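/- **Model.** All running times refer to one model, a real random access machine: a program with registers and arrays for natural numbers (operations $+$, truncated $-$, $\cdot$, integer division, comparison and indirect addressing, charged by the bit lengths of the numbers involved) and registers and arrays for real numbers (operations $+,-,\cdot,/,\exp$ and comparison at unit cost, no rounding of reals to integers, no real constants). **SETH.** For every $\epsilon>0$ there is a $k$ such that no program decides $k$-SAT on $N$ variables in time $2^{(1-\epsilon)N}$ times a polynomial in the size of the formula. **Problem.** For $Q\in\mathbb R^{n\times d_q}$ with rows $Q_1,\dots,Q_n$, for $V\in\mathbb R^{n\times d_v}$ and a window size $w$, let $S\in\mathbb R^{n\times n}$ be given by $S_{ij}=e^{Q_i^TQ_j}$ if $|i-j|\le w/2$ and $S_{ij}=0$ otherwise, and let $Y=S\,V\in\mathbb R^{n\times d_v}$ (sliding-window exponential dot-product self-attention without normalization). **Theorem.** Assume SETH. Let $w=w(n)\le n$, $d_q=d_q(n)$ and $d_v=d_v(n)\ge 1$ (the two inequalities for all large $n$) be functions of $n$ that can be computed in time polynomial in $n$, with $d_q=\omega(\log w)$ and $w=\omega(d_q)$ as $n\to\infty$. Then for every $\epsilon>0$, there is no program that, given $n,w,d_q,d_v,Q,V$,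 computes in time $O\big((nw)^{1-\epsilon}\big)$, for all sufficiently large $n$ and all $Q\in\mathbb R^{n\times d_q}$, $V\in\mathbb R^{n\times d_v}$, a matrix $\hat Y\in\mathbb R^{n\times d_v}$ with any one of the following guarantees: 1. $\hat Y=Y$ (exact computation); 2. $|\hat Y_{ij}-Y_{ij}|\le\mu|Y_{ij}|$ for all $i,j$, for a fixed $\mu$ with $0\le\mu<1$ (multiplicative approximation); 3. $|\hat Y_{ij}-Y_{ij}|\le\mu$ for all $i,j$, for a fixed $\mu\ge 0$ (additive approximation). -/

import Mathlib

open Filter Asymptotics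

noncomputable section

/-! ## The machine model

A random access machine with a store for natural numbers and a store for real numbers (a real RAM).
Each store consists of registers, which are named in the program, and of arrays, whose cells are
reached through an index held in a natural-number register. Operations on reals (`+`, `-`, `*`, `/`,
`exp`, comparison) have unit cost; operations on natural numbers have logarithmic cost, that is,
they are charged for the bit lengths of the numbers and addresses involved. There is no operation
that turns a real into a natural number (no rounding), and a program holds no real constants. -/

namespace RealRAM

/-- The contents of the registers and of the arrays; `natMem a i` is cell `i` of array `a`. -/
@[ext]
structure State where
  natReg : ℕ → ℕ
  natMem : ℕ → ℕ → ℕ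
  realReg : ℕ → ℝ
  realMem : ℕ → ℕ → ℝ

/-- All registers and cells are zero. -/
def State.blank : State where
  natReg := fun _ => 0
  natMem := fun _ _ => 0
  realReg := fun _ => 0
  realMem := fun _ _ => 0

/-- Binary operations on natural numbers (truncated subtraction, integer division). -/
inductive NatOp
  | add | sub | mul | div

def NatOp.eval : NatOp → ℕ → ℕ → ℕ
  | .add, x, y => x + y
  | .sub, x, y => x - y
  | .mul, x, y => x * y
  | .div, x, y => x / y

/-- Binary operations on real numbers. -/
inductive RealOp
  | add | sub | mul | div

def RealOp.eval : RealOp → ℝ → ℝ → ℝ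
  | .add, x, y => x + y
  | .sub, x, y => x - y
  | .mul, x, y => x * y
  | .div, x, y => x / y

/-- Elementary instructions. Registers and arrays are given by their numbers; `dst` is the target
register, `idx` the natural-number register that holds the index of an array cell. -/
inductive Instr
  | natConst (dst c : ℕ)
  | natOp (o : NatOp) (dst a b : ℕ)
  | natLoad (dst arr idx : ℕ)
  | natStore (arr idx src : ℕ)
  | realCast (dst a : ℕ)
  | realOp (o : RealOp) (dst a b : ℕ)
  | realExp (dst a : ℕ)
  | realLoad (dst arr idx : ℕ)
  | realStore (arr idx src : ℕ)

/-- Put the value `x` into cell `i` of array `a`. -/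
def write {α : Type} (m : ℕ → ℕ → α) (a i : ℕ) (x : α) : ℕ → ℕ → α :=
  Function.update m a (Function.update (m a) i x)

/-- The effect of an instruction. -/
def Instr.apply : Instr → State → State
  | .natConst dst c, s => { s with natReg := Function.update s.natReg dst c }
  | .natOp o dst a b, s =>
      { s with natReg := Function.update s.natReg dst (o.eval (s.natReg a) (s.natReg b)) }
  | .natLoad dst arr idx, s =>
      { s with natReg := Function.update s.natReg dst (s.natMem arr (s.natReg idx)) }
  | .natStore arr idx src, s =>
      { s with natMem := write s.natMem arr (s.natReg idx) (s.natReg src) }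
  | .realCast dst a, s =>
      { s with realReg := Function.update s.realReg dst (s.natReg a : ℝ) }
  | .realOp o dst a b, s =>
      { s with realReg := Function.update s.realReg dst (o.eval (s.realReg a) (s.realReg b)) }
  | .realExp dst a, s =>
      { s with realReg := Function.update s.realReg dst (Real.exp (s.realReg a)) }
  | .realLoad dst arr idx, s =>
      { s with realReg := Function.update s.realReg dst (s.realMem arr (s.natReg idx)) }
  | .realStore arr idx src, s =>
      { s with realMem := write s.realMem arr (s.natReg idx) (s.realReg src) }

/-- The cost of an instruction; `Nat.size` is the number of binary digits. -/
def Instr.cost : Instr → State → ℕ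
  | .natConst _ c, _ => 1 + c.size
  | .natOp _ _ a b, s => 1 + (s.natReg a).size + (s.natReg b).size
  | .natLoad _ arr idx, s => 1 + (s.natReg idx).size + (s.natMem arr (s.natReg idx)).size
  | .natStore _ idx src, s => 1 + (s.natReg idx).size + (s.natReg src).size
  | .realCast _ a, s => 1 + (s.natReg a).size
  | .realOp _ _ _ _, _ => 1
  | .realExp _ _, _ => 1
  | .realLoad _ _ idx, s => 1 + (s.natReg idx).size
  | .realStore _ idx _, s => 1 + (s.natReg idx).size

/-- Conditions for branching: comparison of two registers. -/
inductive Test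
  | natLt (a b : ℕ)
  | realLt (a b : ℕ)

def Test.holds : Test → State → Prop
  | .natLt a b, s => s.natReg a < s.natReg b
  | .realLt a b, s => s.realReg a < s.realReg b

def Test.cost : Test → State → ℕ
  | .natLt a b, s => 1 + (s.natReg a).size + (s.natReg b).size
  | .realLt _ _, _ => 1

/-- Programs. -/
inductive Program
  | instr (i : Instr)
  | seq (p q : Program)
  | branch (b : Test) (p q : Program)
  | loop (b : Test) (p : Program)

/-- `Exec p s t s'`: started in the state `s`, the program `p` halts in the state `s'`, with total
cost (running time) `t`. -/
inductive Exec : Program → State → ℕ → State → Prop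
  | instr (i : Instr) (s : State) : Exec (.instr i) s (i.cost s) (i.apply s)
  | seq {p q : Program} {s s₁ s₂ : State} {t₁ t₂ : ℕ} :
      Exec p s t₁ s₁ → Exec q s₁ t₂ s₂ → Exec (.seq p q) s (t₁ + t₂) s₂
  | branchTrue {b : Test} {p q : Program} {s s' : State} {t : ℕ} :
      b.holds s → Exec p s t s' → Exec (.branch b p q) s (b.cost s + t) s'
  | branchFalse {b : Test} {p q : Program} {s s' : State} {t : ℕ} :
      ¬ b.holds s → Exec q s t s' → Exec (.branch b p q) s (b.cost s + t) s'
  | loopTrue {b : Test} {p : Program} {s s₁ s₂ : State} {t₁ t₂ : ℕ} :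
      b.holds s → Exec p s t₁ s₁ → Exec (.loop b p) s₁ t₂ s₂ →
      Exec (.loop b p) s (b.cost s + t₁ + t₂) s₂
  | loopFalse {b : Test} {p : Program} {s : State} :
      ¬ b.holds s → Exec (.loop b p) s (b.cost s) s

/-- `f : ℕ → ℕ` can be computed from `n` in time polynomial in `n` (in `n` itself, not only in its
bit length). -/
def PolyTimeComputable (f : ℕ → ℕ) : Prop :=
  ∃ (P : Program) (C c : ℕ), ∀ n : ℕ, ∃ (t : ℕ) (s : State),
    Exec P { State.blank with natReg := fun r => if r = 0 then n else 0 } t s ∧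
    s.natReg 0 = f n ∧ t ≤ C * (n + 1) ^ c

end RealRAM

/-! ## Satisfiability and the Strong Exponential Time Hypothesis -/

namespace SAT

/-- A literal over `N` variables: `(v, true)` is `v`, `(v, false)` is the negation of `v`. -/
abbrev Literal (N : ℕ) := Fin N × Bool

/-- A formula in conjunctive normal form: a list of clauses, each a list of literals. -/
abbrev CNF (N : ℕ) := List (List (Literal N))

def Satisfiable {N : ℕ} (φ : CNF N) : Prop :=
  ∃ σ : Fin N → Bool, ∀ c ∈ φ, ∃ l ∈ c, σ l.1 = l.2

/-- Every clause has at most `k` literals. -/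
def WidthLE {N : ℕ} (k : ℕ) (φ : CNF N) : Prop := ∀ c ∈ φ, c.length ≤ k

/-- The clauses one after the other, each as its length followed by its literals,
where `v` is written `2 * v + 1` and the negation of `v` is written `2 * v`. -/
def encode {N : ℕ} (φ : CNF N) : List ℕ :=
  φ.flatMap fun c => c.length :: c.map fun l => 2 * (l.1 : ℕ) + l.2.toNat

/-- The size of a formula: the number of variables plus the length of the encoding. -/
def size {N : ℕ} (φ : CNF N) : ℕ := N + (encode φ).length

/-- The initial state for a formula: register 0 holds the number of variables, register 1 the number
of clauses, array 0 the encoding. -/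
def input {N : ℕ} (φ : CNF N) : RealRAM.State :=
  { RealRAM.State.blank with
    natReg := fun r => if r = 0 then N else if r = 1 then φ.length else 0
    natMem := fun a i => if a = 0 then (encode φ).getD i 0 else 0 }

/-- `k`-SAT on `N` variables can be decided in time `2 ^ ((1 - ε) N)` times a polynomial in the size
of the formula. The answer is left in register 0. -/
def SolvableInTime (k : ℕ) (ε : ℝ) : Prop :=
  ∃ (P : RealRAM.Program) (C : ℝ) (c : ℕ), ∀ (N : ℕ) (φ : CNF N), WidthLE k φ →
    ∃ (t : ℕ) (s : RealRAM.State), RealRAM.Exec P (input φ) t s ∧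
      (s.natReg 0 = 1 ↔ Satisfiable φ) ∧
      (t : ℝ) ≤ C * (size φ + 1 : ℝ) ^ c * (2 : ℝ) ^ ((1 - ε) * (N : ℝ))

end SAT

/-- The Strong Exponential Time Hypothesis: for every `ε > 0` there is a `k` such that `k`-SAT on `N`
variables cannot be decided in time `2 ^ ((1 - ε) N)`, up to polynomial factors. -/
def SETH : Prop := ∀ ε : ℝ, 0 < ε → ∃ k : ℕ, ¬ SAT.SolvableInTime k ε

/-! ## Sliding-window exponential dot-product self-attention -/

namespace SlidingWindow

/-- The score matrix: `exp (Q_i · Q_j)` inside the window `|i - j| ≤ w / 2`, zero outside. -/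
def score {n d : ℕ} (w : ℕ) (Q : Matrix (Fin n) (Fin d) ℝ) : Matrix (Fin n) (Fin n) ℝ :=
  Matrix.of fun i j =>
    if |((i : ℕ) : ℝ) - ((j : ℕ) : ℝ)| ≤ (w : ℝ) / 2 then Real.exp (Q i ⬝ᵥ Q j) else 0

/-- Self-attention without normalization: the product of the score matrix and the value matrix. -/
def attention {n d m : ℕ} (w : ℕ) (Q : Matrix (Fin n) (Fin d) ℝ) (V : Matrix (Fin n) (Fin m) ℝ) :
    Matrix (Fin n) (Fin m) ℝ :=
  score w Q * V

/-- The initial state: registers 0, 1, 2, 3 hold `n`, `w`, `d`, `m`; the real arrays 0 and 1 hold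
`Q` and `V`, row by row. -/
def input {n d m : ℕ} (w : ℕ) (Q : Matrix (Fin n) (Fin d) ℝ) (V : Matrix (Fin n) (Fin m) ℝ) :
    RealRAM.State :=
  { RealRAM.State.blank with
    natReg := fun r =>
      if r = 0 then n else if r = 1 then w else if r = 2 then d else if r = 3 then m else 0
    realMem := fun a p =>
      if a = 0 then
        if h : p / d < n ∧ p % d < d then Q ⟨p / d, h.1⟩ ⟨p % d, h.2⟩ else 0
      else if a = 1 then
        if h : p / m < n ∧ p % m < m then V ⟨p / m, h.1⟩ ⟨p % m, h.2⟩ else 0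
      else 0 }

/-- The `n × m` matrix that is stored, row by row, in the real array 2. -/
def output (n m : ℕ) (s : RealRAM.State) : Matrix (Fin n) (Fin m) ℝ :=
  Matrix.of fun i j => s.realMem 2 ((i : ℕ) * m + (j : ℕ))

/-- A requirement `A Y Y'` on the computed matrix `Y'` in terms of the true one `Y`. -/
abbrev Accuracy := ∀ n m : ℕ, Matrix (Fin n) (Fin m) ℝ → Matrix (Fin n) (Fin m) ℝ → Prop

def exact : Accuracy := fun _ _ Y Y' => Y' = Y

def multiplicative (μ : ℝ) : Accuracy := fun _ _ Y Y' => ∀ i j, |Y' i j - Y i j| ≤ μ * |Y i j|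

def additive (μ : ℝ) : Accuracy := fun _ _ Y Y' => ∀ i j, |Y' i j - Y i j| ≤ μ

/-- Some program, given matrices `Q` of size `n × dq n` and `V` of size `n × dv n`, computes their
self-attention with window `w n` to the accuracy `A`, in time `O(T n)`, for all large `n`. -/
def ComputableInTime (w dq dv : ℕ → ℕ) (A : Accuracy) (T : ℕ → ℝ) : Prop :=
  ∃ (P : RealRAM.Program) (C : ℝ), ∀ᶠ n in atTop,
    ∀ (Q : Matrix (Fin n) (Fin (dq n)) ℝ) (V : Matrix (Fin n) (Fin (dv n)) ℝ),
      ∃ (t : ℕ) (s : RealRAM.State), RealRAM.Exec P (input (w n) Q V) t s ∧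
        A n (dv n) (attention (w n) Q V) (output n (dv n) s) ∧
        (t : ℝ) ≤ C * T n

end SlidingWindow

end

/-! Suppose that some program computes the attention matrix up to an error `μ |Y| + ν` with `μ < 1`
in time `C (n w)^(1-ε)`; the exact, the multiplicative and the additive guarantee are all of this
form. It is turned into an algorithm for `k`-SAT whose saving in the exponent does not depend on
`k`, against SETH.

Orthogonal pairs show as large entries. Let some rows carry 0-1 vectors and the value 0, and let the
other rows carry 0-1 vectors times `-n` and the value `n` in the first column. The score of a row of
the first kind with a row of the second kind in its window is 1 if the vectors are orthogonal and at
most `exp (-n)` otherwise. Hence the first entry of a row of the first kind is at least `n` if an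
orthogonal partner lies in its window, and at most `n^2 exp (-n) ≤ 2` if there is no orthogonal
partner at all. For large `n` a fixed threshold survives the approximation (`lt_approx`,
`exists_of_lt_approx`).

Satisfiability becomes orthogonality. For `N` variables take `n = 2^e` rows with `e = N / a` for a
constant `a`, and `2^q` about `w / 4`. Bit `q` of the row number is the kind of the row. The other
bits of a row of the first kind assign `e - 1` variables, the low `q` bits of a row of the second
kind assign `q` further ones. The block of `2^q` rows that follows the block of a row of the first
kind contains all patterns of low bits and lies in the window, so no combination is missed
(`exists_rows`). The coordinates are the clauses; a coordinate is 1 if the row makes no literal of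
the clause true, so two rows are orthogonal iff together they satisfy all clauses
(`coordFalse_iff`). The remaining variables are guessed in an outer loop: `2^(N-e-q+1)` calls of
cost about `2^((e+q)(1-ε))` save a factor `2^(εe)`, which is exponential in `N`.

The number of clauses has to be at most `d_q`. On one side, `d_q = ω(log w)` gives `d_q = ω(log n)`:
the program must write about `n d_v` nonzero cells, so `n ≤ C (n w)^(1-ε)` and `w` is at least a
power of `n` (`card_output_le`, `exists_log_le`). On the other side, the formula is sparsified to
`O(N)` clauses. If many minimal clauses of one size share a heart `H`, either `H` holds and is added
as a clause, or the petals, that is the clauses without `H`, all hold and are added. With the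
thresholds of `thresh` the number of steps is linear in `N` and the number of petal steps is a small
fraction of `N` (`Inv.steps_le`, `Inv.petals_le`). The decisions are therefore encoded by few bits,
as lengths of runs of heart steps (`exists_advice`, `exists_params`), and these bits are guessed in
the outer loop too, at the cost of half the saving.

The rest is an implementation on the real RAM. Polynomial-time bookkeeping is written as expressions
with bounded sums and compiled once and for all (`compile_runs`). The attention program is called in
relocated form, each time in another residue class of the cells, so that it always finds empty
memory (`Exec.reloc`). The parameters are evaluated at `n`, and `a` is so large that a time
polynomial in `n` is `O(2^(N/2))`. The running time is added up in `search_time_le` and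
`solvableInTime`. -/

namespace RealRAM

/-! ### Running times of programs, and relocation of programs in memory -/

/-- `P`, started in `s`, halts within time `T` in a state satisfying `Post`. -/
def Runs (P : Program) (s : State) (T : ℕ) (Post : State → Prop) : Prop :=
  ∃ t s', Exec P s t s' ∧ t ≤ T ∧ Post s'

namespace Runs

theorem mono {P : Program} {s : State} {T T' : ℕ} {Q Q' : State → Prop} (h : Runs P s T Q)
    (hT : T ≤ T') (hQ : ∀ s', Q s' → Q' s') : Runs P s T' Q' := by
  obtain ⟨t, s', he, ht, hq⟩ := h
  exact ⟨t, s', he, ht.trans hT, hQ _ hq⟩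

theorem instr (i : Instr) (s : State) {Q : State → Prop} {T : ℕ} (hT : i.cost s ≤ T)
    (hQ : Q (i.apply s)) : Runs (.instr i) s T Q :=
  ⟨_, _, Exec.instr i s, hT, hQ⟩

theorem seq {p q : Program} {s : State} {T₁ T₂ T : ℕ} {M Q : State → Prop} (h₁ : Runs p s T₁ M)
    (h₂ : ∀ s', M s' → Runs q s' T₂ Q) (hT : T₁ + T₂ ≤ T) : Runs (.seq p q) s T Q := by
  obtain ⟨t, s', he, ht, hm⟩ := h₁
  obtain ⟨t', s'', he', ht', hq⟩ := h₂ s' hm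
  exact ⟨_, _, Exec.seq he he', (Nat.add_le_add ht ht').trans hT, hq⟩

theorem branchTrue {b : Test} {p q : Program} {s : State} {T c : ℕ} {Q : State → Prop}
    (hb : b.holds s) (hc : b.cost s ≤ c) (h : Runs p s T Q) :
    Runs (.branch b p q) s (c + T) Q := by
  obtain ⟨t, s', he, ht, hq⟩ := h
  exact ⟨_, _, Exec.branchTrue hb he, Nat.add_le_add hc ht, hq⟩

theorem branchFalse {b : Test} {p q : Program} {s : State} {T c : ℕ} {Q : State → Prop}
    (hb : ¬ b.holds s) (hc : b.cost s ≤ c) (h : Runs q s T Q) :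
    Runs (.branch b p q) s (c + T) Q := by
  obtain ⟨t, s', he, ht, hq⟩ := h
  exact ⟨_, _, Exec.branchFalse hb he, Nat.add_le_add hc ht, hq⟩

/-- A loop that makes exactly `n` rounds, with an invariant indexed by the number of rounds done. -/
theorem loop {b : Test} {p : Program} (Inv : ℕ → State → Prop) {c T n : ℕ}
    (hcost : ∀ i s, i ≤ n → Inv i s → b.cost s ≤ c)
    (hstep : ∀ i s, i < n → Inv i s → b.holds s ∧ Runs p s T (Inv (i + 1)))
    (hend : ∀ s, Inv n s → ¬ b.holds s) {s : State} (h0 : Inv 0 s) {T' : ℕ}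
    (hT' : n * (c + T) + c ≤ T') :
    Runs (.loop b p) s T' (Inv n) := by
  refine mono ?_ hT' fun _ h => h
  have key : ∀ k i s, i + k = n → Inv i s → Runs (.loop b p) s (k * (c + T) + c) (Inv n) := by
    intro k
    induction k with
    | zero =>
      intro i s hi hs
      obtain rfl : i = n := by omega
      exact ⟨_, _, Exec.loopFalse (hend s hs), by simpa using hcost i s le_rfl hs, hs⟩
    | succ k ih =>
      intro i s hi hs
      obtain ⟨hb, t, s', he, ht, hs'⟩ := hstep i s (by omega) hs
      obtain ⟨t', s'', he', ht', hq⟩ := ih (i + 1) s' (by omega) hs'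
      refine ⟨_, _, Exec.loopTrue hb he he', ?_, hq⟩
      have := hcost i s (by omega) hs
      have e : (k + 1) * (c + T) + c = (c + T) + (k * (c + T) + c) := by ring
      rw [e]; omega
  exact key n 0 s (by omega) h0

end Runs

/-! ### Straight-line code -/

/-- The instructions of a nonempty list one after the other. -/
def block : List Instr → Program
  -- There is no empty program; this default is never executed, since `Runs.block` excludes the
  -- empty list.
  | [] => .instr (.natConst 19 0)
  | [i] => .instr i
  | i :: j :: l => .seq (.instr i) (block (j :: l))

theorem Runs.cons {i j : Instr} {l : List Instr} {s : State} {c T : ℕ} {Q : State → Prop}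
    (hc : i.cost s ≤ c) (h : Runs (block (j :: l)) (i.apply s) T Q) :
    Runs (block (i :: j :: l)) s (c + T) Q :=
  Runs.seq (M := fun s' => s' = i.apply s) (Runs.instr i s hc rfl) (by rintro _ rfl; exact h) le_rfl

/-! ### Bit lengths -/

theorem size_mul_le (x y : ℕ) : (x * y).size ≤ x.size + y.size := by
  rw [Nat.size_le, pow_add]
  exact Nat.mul_lt_mul'' (Nat.lt_size_self x) (Nat.lt_size_self y)

theorem size_mul_add_le {x R r : ℕ} (h : r < R) : (x * R + r).size ≤ x.size + R.size := by
  rw [Nat.size_le, pow_add]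
  calc x * R + r < (x + 1) * R := by rw [add_mul]; omega
    _ ≤ 2 ^ x.size * 2 ^ R.size :=
      Nat.mul_le_mul (Nat.lt_size_self x) (Nat.lt_size_self R).le

theorem size_le_self (x : ℕ) : x.size ≤ x := by
  rw [Nat.size_le]; exact Nat.lt_two_pow_self

/-! ### Relocation

`reloc j P` is `P` with registers `r` moved to `8 r + j`, arrays `a` moved to `8 a + j` and cells `i`
moved to `i R + r₀`, where `R` and `r₀` are held in the registers `3` and `11`. -/

/-- The address goes to register 19, which is 3 modulo 8 and hence belongs to none of the classes `8
r + j` with `3 < j < 8`. -/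
def relocAddr (j idx : ℕ) : Program :=
  .seq (.instr (.natOp .mul 19 (8 * idx + j) 3)) (.instr (.natOp .add 19 19 11))

def relocInstr (j : ℕ) : Instr → Program
  | .natConst dst c => .instr (.natConst (8 * dst + j) c)
  | .natOp o dst a b => .instr (.natOp o (8 * dst + j) (8 * a + j) (8 * b + j))
  | .natLoad dst arr idx => .seq (relocAddr j idx) (.instr (.natLoad (8 * dst + j) (8 * arr + j) 19))
  | .natStore arr idx src => .seq (relocAddr j idx) (.instr (.natStore (8 * arr + j) 19 (8 * src + j)))
  | .realCast dst a => .instr (.realCast (8 * dst + j) (8 * a + j))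
  | .realOp o dst a b => .instr (.realOp o (8 * dst + j) (8 * a + j) (8 * b + j))
  | .realExp dst a => .instr (.realExp (8 * dst + j) (8 * a + j))
  | .realLoad dst arr idx =>
      .seq (relocAddr j idx) (.instr (.realLoad (8 * dst + j) (8 * arr + j) 19))
  | .realStore arr idx src =>
      .seq (relocAddr j idx) (.instr (.realStore (8 * arr + j) 19 (8 * src + j)))

def relocTest (j : ℕ) : Test → Test
  | .natLt a b => .natLt (8 * a + j) (8 * b + j)
  | .realLt a b => .realLt (8 * a + j) (8 * b + j)

def reloc (j : ℕ) : Program → Program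
  | .instr i => relocInstr j i
  | .seq p q => .seq (reloc j p) (reloc j q)
  | .branch b p q => .branch (relocTest j b) (reloc j p) (reloc j q)
  | .loop b p => .loop (relocTest j b) (reloc j p)

/-- A bound for the registers that are written by an instruction. -/
def Instr.bound : Instr → ℕ
  | .natConst dst _ => dst + 1
  | .natOp _ dst _ _ => dst + 1
  | .natLoad dst _ _ => dst + 1
  | .natStore _ _ _ => 0
  | .realCast dst _ => dst + 1
  | .realOp _ dst _ _ => dst + 1
  | .realExp dst _ => dst + 1
  | .realLoad dst _ _ => dst + 1
  | .realStore _ _ _ => 0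

/-- A bound for the registers that are written by a program. -/
def Program.bound : Program → ℕ
  | .instr i => i.bound
  | .seq p q => max p.bound q.bound
  | .branch _ p q => max p.bound q.bound
  | .loop _ p => p.bound

/-- The part of a state that a relocated program sees. -/
def view (j R r₀ : ℕ) (s : State) : State where
  natReg r := s.natReg (8 * r + j)
  natMem a i := s.natMem (8 * a + j) (i * R + r₀)
  realReg r := s.realReg (8 * r + j)
  realMem a i := s.realMem (8 * a + j) (i * R + r₀)

/-- `s'` differs from `s` only where a program relocated by `reloc j` may write. -/
structure RelocFrame (j K R r₀ : ℕ) (s s' : State) : Prop where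
  natReg : ∀ x, x ≠ 19 → (x % 8 = j → 8 * K ≤ x) → s'.natReg x = s.natReg x
  realReg : ∀ x, (x % 8 = j → 8 * K ≤ x) → s'.realReg x = s.realReg x
  natMem : ∀ a x, (a % 8 = j → x % R ≠ r₀) → s'.natMem a x = s.natMem a x
  realMem : ∀ a x, (a % 8 = j → x % R ≠ r₀) → s'.realMem a x = s.realMem a x

theorem RelocFrame.trans {j K R r₀ : ℕ} {s s' s'' : State} (h : RelocFrame j K R r₀ s s')
    (h' : RelocFrame j K R r₀ s' s'') : RelocFrame j K R r₀ s s'' where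
  natReg x hx hx' := (h'.natReg x hx hx').trans (h.natReg x hx hx')
  realReg x hx := (h'.realReg x hx).trans (h.realReg x hx)
  natMem a x hx := (h'.natMem a x hx).trans (h.natMem a x hx)
  realMem a x hx := (h'.realMem a x hx).trans (h.realMem a x hx)

theorem RelocFrame.refl (j K R r₀ : ℕ) (s : State) : RelocFrame j K R r₀ s s where
  natReg _ _ _ := rfl
  realReg _ _ := rfl
  natMem _ _ _ := rfl
  realMem _ _ _ := rfl

theorem write_apply {α : Type} (m : ℕ → ℕ → α) (a i : ℕ) (x : α) (b k : ℕ) :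
    write m a i x b k = if b = a ∧ k = i then x else m b k := by
  unfold write
  by_cases hb : b = a
  · subst hb; by_cases hk : k = i <;> simp [hk]
  · simp [hb]

theorem relocAddr_runs {j idx R r₀ : ℕ} {s : State}
    (hR : s.natReg 3 = R) (hr : s.natReg 11 = r₀) (hlt : r₀ < R) :
    Runs (relocAddr j idx) s (2 + 2 * (s.natReg (8 * idx + j)).size + 3 * R.size)
      (fun s' => s' = State.mk (Function.update s.natReg 19 (s.natReg (8 * idx + j) * R + r₀))
        s.natMem s.realReg s.realMem) := by
  have h0 := size_mul_le (s.natReg (8 * idx + j)) R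
  have h1 : r₀.size ≤ R.size := Nat.size_le_size hlt.le
  refine Runs.seq (T₁ := 1 + (s.natReg (8 * idx + j)).size + R.size)
    (T₂ := 1 + (s.natReg (8 * idx + j)).size + 2 * R.size) (Runs.instr _ _ ?_ rfl) ?_ (by omega)
  · simp [Instr.cost, hR]
  · rintro _ rfl
    refine Runs.instr _ _ ?_ ?_
    · simp [Instr.cost, Instr.apply, hR, hr, NatOp.eval]; omega
    · simp [Instr.apply, hR, hr, NatOp.eval]

theorem Instr.reloc_runs {j K R r₀ : ℕ} (hj : j < 8) (hj3 : 3 < j) (i : Instr) (hK : i.bound ≤ K)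
    {s : State} (hR : s.natReg 3 = R) (hr : s.natReg 11 = r₀) (hlt : r₀ < R) :
    Runs (relocInstr j i) s (i.cost (view j R r₀ s) * (8 * (R.size + 1)))
      (fun s' => view j R r₀ s' = i.apply (view j R r₀ s) ∧ RelocFrame j K R r₀ s s') := by
  have hmod : ∀ a, (8 * a + j) % 8 = j := fun a => by omega
  have h19 : ∀ a, 8 * a + j ≠ 19 := fun a => by omega
  -- All cells that are touched lie in the residue class of `r₀` modulo `R`; this is what the frame
  -- records.
  have hRm : ∀ x, (x * R + r₀) % R = r₀ := fun x => by
    rw [add_comm, mul_comm, Nat.add_mul_mod_self_left, Nat.mod_eq_of_lt hlt]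
  have hpos : ∀ c, c ≤ c * (8 * (R.size + 1)) := fun c => by nlinarith [R.size.zero_le]
  have nreg : ∀ (dst v : ℕ) (s : State), dst + 1 ≤ K → RelocFrame j K R r₀ s
      { s with natReg := Function.update s.natReg (8 * dst + j) v } := by
    intro dst v s hd
    refine ⟨fun x hx hx' => ?_, fun _ _ => rfl, fun _ _ _ => rfl, fun _ _ _ => rfl⟩
    have : x ≠ 8 * dst + j := by rintro rfl; have := hx' (hmod _); omega
    simp [Function.update_of_ne this]
  have rreg : ∀ (dst : ℕ) (v : ℝ) (s : State), dst + 1 ≤ K → RelocFrame j K R r₀ s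
      { s with realReg := Function.update s.realReg (8 * dst + j) v } := by
    intro dst v s hd
    refine ⟨fun _ _ _ => rfl, fun x hx' => ?_, fun _ _ _ => rfl, fun _ _ _ => rfl⟩
    have : x ≠ 8 * dst + j := by rintro rfl; have := hx' (hmod _); omega
    simp [Function.update_of_ne this]
  have addr : ∀ (v : ℕ) (s : State), RelocFrame j K R r₀ s
      { s with natReg := Function.update s.natReg 19 v } := by
    intro v s
    refine ⟨fun x hx hx' => ?_, fun _ _ => rfl, fun _ _ _ => rfl, fun _ _ _ => rfl⟩
    simp [Function.update_of_ne hx]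
  have viewn : ∀ (dst v : ℕ) (s : State), view j R r₀ { s with
      natReg := Function.update s.natReg (8 * dst + j) v } =
      { view j R r₀ s with natReg := Function.update (view j R r₀ s).natReg dst v } := by
    intro dst v s
    ext x <;> simp [view, Function.update_apply]
  have viewr : ∀ (dst : ℕ) (v : ℝ) (s : State), view j R r₀ { s with
      realReg := Function.update s.realReg (8 * dst + j) v } =
      { view j R r₀ s with realReg := Function.update (view j R r₀ s).realReg dst v } := by
    intro dst v s
    ext x <;> simp [view, Function.update_apply]
  have viewa : ∀ (v : ℕ) (s : State), view j R r₀ { s with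
      natReg := Function.update s.natReg 19 v } = view j R r₀ s := by
    intro v s
    ext x <;> simp [view, h19]
  have hR0 : R ≠ 0 := by omega
  have hb : ∀ x, (x * R + r₀).size ≤ x.size + R.size := fun x => size_mul_add_le hlt
  cases i with
  | natConst dst c =>
    exact Runs.instr _ _ (hpos _) ⟨viewn _ _ _, nreg _ _ _ hK⟩
  | natOp o dst a b =>
    exact Runs.instr _ _ (hpos _) ⟨viewn _ _ _, nreg _ _ _ hK⟩
  | realCast dst a =>
    exact Runs.instr _ _ (hpos _) ⟨viewr _ _ _, rreg _ _ _ hK⟩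
  | realOp o dst a b =>
    exact Runs.instr _ _ (hpos _) ⟨viewr _ _ _, rreg _ _ _ hK⟩
  | realExp dst a =>
    exact Runs.instr _ _ (hpos _) ⟨viewr _ _ _, rreg _ _ _ hK⟩
  | natLoad dst arr idx =>
    refine Runs.seq (T₂ := 1 + ((s.natReg (8 * idx + j)).size + R.size) +
      (s.natMem (8 * arr + j) (s.natReg (8 * idx + j) * R + r₀)).size)
      (relocAddr_runs hR hr hlt) ?_ ?_
    · rintro _ rfl
      refine Runs.instr _ _ ?_ ⟨?_, (addr (s.natReg (8 * idx + j) * R + r₀) s).trans ?_⟩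
      · simp [Instr.cost]; exact hb _
      · ext x y <;> simp [view, Instr.apply, Function.update_apply, h19]
      · exact nreg _ _ _ hK
    · simp only [Instr.cost, view]
      ring_nf; nlinarith [Nat.zero_le (R.size * (s.natReg (idx * 8 + j)).size), Nat.zero_le (R.size * (s.natMem (arr * 8 + j) (s.natReg (idx * 8 + j) * R + r₀)).size)]
  | realLoad dst arr idx =>
    refine Runs.seq (T₂ := 1 + ((s.natReg (8 * idx + j)).size + R.size))
      (relocAddr_runs hR hr hlt) ?_ ?_
    · rintro _ rfl
      refine Runs.instr _ _ ?_ ⟨?_, (addr (s.natReg (8 * idx + j) * R + r₀) s).trans ?_⟩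
      · simp [Instr.cost]; exact hb _
      · ext x y <;> simp [view, Instr.apply, Function.update_apply, h19]
      · exact rreg _ _ _ hK
    · simp only [Instr.cost, view]
      ring_nf; nlinarith [Nat.zero_le (R.size * (s.natReg (idx * 8 + j)).size)]
  | natStore arr idx src =>
    refine Runs.seq (T₂ := 1 + ((s.natReg (8 * idx + j)).size + R.size) +
      (s.natReg (8 * src + j)).size)
      (relocAddr_runs hR hr hlt) ?_ ?_
    · rintro _ rfl
      refine Runs.instr _ _ ?_ ⟨?_, (addr (s.natReg (8 * idx + j) * R + r₀) s).trans ?_⟩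
      · simp [Instr.cost, h19]; exact hb _
      · ext x y <;> simp [view, Instr.apply, h19, write_apply, hR0]
      · refine ⟨fun _ _ _ => rfl, fun _ _ => rfl, fun a x h => ?_, fun _ _ _ => rfl⟩
        simp only [Instr.apply, write_apply, Function.update_self]
        rw [if_neg]
        rintro ⟨rfl, rfl⟩
        exact h (hmod _) (hRm _)
    · simp only [Instr.cost, view]
      ring_nf; nlinarith [Nat.zero_le (R.size * (s.natReg (idx * 8 + j)).size), Nat.zero_le (R.size * (s.natReg (src * 8 + j)).size)]
  | realStore arr idx src =>
    refine Runs.seq (T₂ := 1 + ((s.natReg (8 * idx + j)).size + R.size))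
      (relocAddr_runs hR hr hlt) ?_ ?_
    · rintro _ rfl
      refine Runs.instr _ _ ?_ ⟨?_, (addr (s.natReg (8 * idx + j) * R + r₀) s).trans ?_⟩
      · simp [Instr.cost]; exact hb _
      · ext x y <;> simp [view, Instr.apply, h19, write_apply, hR0]
      · refine ⟨fun _ _ _ => rfl, fun _ _ => rfl, fun _ _ _ => rfl, fun a x h => ?_⟩
        simp only [Instr.apply, write_apply, Function.update_self]
        rw [if_neg]
        rintro ⟨rfl, rfl⟩
        exact h (hmod _) (hRm _)
    · simp only [Instr.cost, view]
      ring_nf; nlinarith [Nat.zero_le (R.size * (s.natReg (idx * 8 + j)).size)]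

/-- An array access becomes three instructions on numbers that are longer by about `R.size` bits,
which explains the factor. The frame is the point: runs with different `r₀` do not touch each
other's cells, so exponentially many calls can each start with empty arrays although nobody knows
which cells the previous calls have written. -/
theorem Exec.reloc {j K R r₀ : ℕ} (hj : j < 8) (hj3 : 3 < j) (hlt : r₀ < R) {P : Program}
    {u u' : State} {t : ℕ} (h : Exec P u t u') : P.bound ≤ K → ∀ s, view j R r₀ s = u →
    s.natReg 3 = R → s.natReg 11 = r₀ →
    Runs (reloc j P) s (t * (8 * (R.size + 1)))
      (fun s' => view j R r₀ s' = u' ∧ RelocFrame j K R r₀ s s') := by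
  have hpos : ∀ c, c ≤ c * (8 * (R.size + 1)) := fun c => by nlinarith [R.size.zero_le]
  have keep : ∀ {s s' : State}, RelocFrame j K R r₀ s s' → s.natReg 3 = R → s.natReg 11 = r₀ →
      s'.natReg 3 = R ∧ s'.natReg 11 = r₀ := fun {s s'} hf h3 h11 =>
    ⟨(hf.natReg 3 (by omega) (by omega)).trans h3, (hf.natReg 11 (by omega) (by omega)).trans h11⟩
  have htest : ∀ (b : Test) (s : State), ((relocTest j b).holds s ↔ b.holds (view j R r₀ s)) ∧
      (relocTest j b).cost s = b.cost (view j R r₀ s) := by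
    intro b s; cases b <;> exact ⟨Iff.rfl, rfl⟩
  induction h with
  | instr i u =>
    rintro hK s rfl h3 h11
    exact Instr.reloc_runs hj hj3 i hK h3 h11 hlt
  | seq _ _ ih₁ ih₂ =>
    intro hK s hs h3 h11
    refine Runs.seq (ih₁ (le_trans (le_max_left _ _) hK) s hs h3 h11) ?_ (by rw [← add_mul])
    rintro s' ⟨hv, hf⟩
    obtain ⟨h3', h11'⟩ := keep hf h3 h11
    exact (ih₂ (le_trans (le_max_right _ _) hK) s' hv h3' h11').mono le_rfl
      fun s'' h => ⟨h.1, hf.trans h.2⟩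
  | @branchTrue b p q u u' t hb _ ih =>
    rintro hK s rfl h3 h11
    refine (Runs.branchTrue ((htest b s).1.2 hb) le_rfl
      (ih (le_trans (le_max_left _ _) hK) s rfl h3 h11)).mono ?_ fun _ h => h
    rw [(htest b s).2, add_mul]; exact Nat.add_le_add_right (hpos _) _
  | @branchFalse b p q u u' t hb _ ih =>
    rintro hK s rfl h3 h11
    refine (Runs.branchFalse (fun h => hb ((htest b s).1.1 h)) le_rfl
      (ih (le_trans (le_max_right _ _) hK) s rfl h3 h11)).mono ?_ fun _ h => h
    rw [(htest b s).2, add_mul]; exact Nat.add_le_add_right (hpos _) _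
  | @loopTrue b p u u₁ u₂ t₁ t₂ hb _ _ ih₁ ih₂ =>
    rintro hK s rfl h3 h11
    obtain ⟨t, s₁, he, ht, hv, hf⟩ := ih₁ hK s rfl h3 h11
    obtain ⟨h3', h11'⟩ := keep hf h3 h11
    obtain ⟨t', s₂, he', ht', hv', hf'⟩ := ih₂ hK s₁ hv h3' h11'
    refine ⟨_, _, Exec.loopTrue ((htest b s).1.2 hb) he he', ?_, hv', hf.trans hf'⟩
    rw [(htest b s).2, add_mul, add_mul]
    have := hpos (b.cost (view j R r₀ s))
    omega
  | @loopFalse b p u hb =>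
    rintro hK s rfl h3 h11
    refine ⟨_, _, Exec.loopFalse (fun h => hb ((htest b s).1.1 h)), ?_, rfl, RelocFrame.refl ..⟩
    rw [(htest b s).2]; exact hpos _

end RealRAM

/-! ### Expressions with bounded sums, their compilation and their polynomial bounds -/

namespace RealRAM

/-! ### Expressions

Expressions range over the small variables (registers `8 v`), the small arrays (`8 a`) and local
variables (registers `8 i + 2`). They are evaluated with the help of the registers `8 t + 1`. -/

/-- The values of the small variables and the small arrays. -/
structure Env where
  var : ℕ → ℕ
  mem : ℕ → ℕ → ℕ

def State.env (s : State) : Env := ⟨fun v => s.natReg (8 * v), fun a => s.natMem (8 * a)⟩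

def State.loc (s : State) : ℕ → ℕ := fun i => s.natReg (8 * i + 2)

/-- All small variables and all cells of small arrays are at most `V`. -/
def Env.Bdd (V : ℕ) (m : Env) : Prop := (∀ v, m.var v ≤ V) ∧ ∀ a i, m.mem a i ≤ V

theorem Env.Bdd.mono {V W : ℕ} {m : Env} (h : m.Bdd V) (hVW : V ≤ W) : m.Bdd W :=
  ⟨fun v => (h.1 v).trans hVW, fun a i => (h.2 a i).trans hVW⟩

/-- Bounded sums provide bounded quantifiers, counting and bounded search, which is all that the
bookkeeping of the reduction needs. -/
inductive Expr
  | const (c : ℕ)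
  | var (v : ℕ)
  | loc (i : ℕ)
  | load (a : ℕ) (e : Expr)
  | op (o : NatOp) (e f : Expr)
  | lt (e f : Expr)
  | sum (d : ℕ) (b e : Expr)

namespace Expr

def eval : Expr → Env → (ℕ → ℕ) → ℕ
  | const c, _, _ => c
  | var v, m, _ => m.var v
  | loc i, _, ρ => ρ i
  | load a e, m, ρ => m.mem a (e.eval m ρ)
  | op o e f, m, ρ => o.eval (e.eval m ρ) (f.eval m ρ)
  | lt e f, m, ρ => if e.eval m ρ < f.eval m ρ then 1 else 0
  | sum d b e, m, ρ => ∑ i ∈ Finset.range (b.eval m ρ), e.eval m (Function.update ρ d i)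

/-- A bound for the value in terms of a bound for the variables and cells. -/
def bd : Expr → ℕ → ℕ
  | const c, _ => c
  | var _, V => V
  | loc _, V => V
  | load _ _, V => V
  | op _ e f, V => e.bd V + f.bd V + e.bd V * f.bd V
  | lt _ _, _ => 1
  | sum _ b e, V => b.bd V * e.bd (V + b.bd V)

/-- A bound for the evaluation time in terms of a bound for the variables and cells. -/
def timeBd : Expr → ℕ → ℕ
  | const c, _ => 1 + c
  | var _, V => 2 + V
  | loc _, V => 2 + V
  | load _ e, V => e.timeBd V + (1 + e.bd V + V)
  | op _ e f, V => e.timeBd V + f.timeBd V + (1 + e.bd V + f.bd V)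
  | lt e f, V => e.timeBd V + f.timeBd V + (3 + e.bd V + f.bd V)
  | sum d b e, V => b.timeBd V + 20 + 2 * V + (sum d b e).bd V + (b.bd V + 1) *
      (20 + 4 * b.bd V + e.timeBd (V + b.bd V) + e.bd (V + b.bd V) + (sum d b e).bd V)

def copyReg (dst src : ℕ) : Program :=
  .seq (.instr (.natConst dst 0)) (.instr (.natOp .add dst dst src))

/-- The program that leaves the value of an expression in the register `8 t + 1`. -/
def compile : Expr → ℕ → Program
  | const c, t => .instr (.natConst (8 * t + 1) c)
  | var v, t => copyReg (8 * t + 1) (8 * v)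
  | loc i, t => copyReg (8 * t + 1) (8 * i + 2)
  | load a e, t => .seq (e.compile t) (.instr (.natLoad (8 * t + 1) (8 * a) (8 * t + 1)))
  | op o e f, t => .seq (.seq (e.compile t) (f.compile (t + 1)))
      (.instr (.natOp o (8 * t + 1) (8 * t + 1) (8 * (t + 1) + 1)))
  | lt e f, t => .seq (.seq (e.compile t) (f.compile (t + 1)))
      (.branch (.natLt (8 * t + 1) (8 * (t + 1) + 1)) (.instr (.natConst (8 * t + 1) 1))
        (.instr (.natConst (8 * t + 1) 0)))
  -- The temporaries `t`, `t + 1`, `t + 2` hold the number of rounds, the old value of the local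
  -- variable `d` and the partial sum; the body uses those from `t + 3` on. The local variable is
  -- restored at the end, so that only temporaries change.
  | sum d b e, t => .seq (b.compile t) (.seq (copyReg (8 * (t + 1) + 1) (8 * d + 2))
      (.seq (block [.natConst (8 * (t + 2) + 1) 0, .natConst (8 * d + 2) 0])
      (.seq (.loop (.natLt (8 * d + 2) (8 * t + 1)) (.seq (e.compile (t + 3))
        (block [.natOp .add (8 * (t + 2) + 1) (8 * (t + 2) + 1) (8 * (t + 3) + 1),
          .natConst (8 * (t + 3) + 1) 1, .natOp .add (8 * d + 2) (8 * d + 2) (8 * (t + 3) + 1)])))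
      (.seq (copyReg (8 * d + 2) (8 * (t + 1) + 1)) (copyReg (8 * t + 1) (8 * (t + 2) + 1))))))

/-- The bound `W` for the local variables is kept apart from the bound `V` for the memory, because
only the former grows when a sum is entered. -/
theorem eval_le {m : Env} {V : ℕ} (hm : m.Bdd V) (e : Expr) :
    ∀ {W : ℕ} {ρ : ℕ → ℕ}, V ≤ W → (∀ i, ρ i ≤ W) → e.eval m ρ ≤ e.bd W := by
  induction e with
  | const c => intros; exact le_rfl
  | var v => intro W ρ h _; exact (hm.1 v).trans h
  | loc i => intro W ρ _ h; exact h i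
  | load a e _ => intro W ρ h _; exact (hm.2 _ _).trans h
  | op o e f he hf =>
    intro W ρ h h'
    have h1 := he h h'
    have h2 := hf h h'
    have h3 := Nat.mul_le_mul h1 h2
    cases o <;> simp only [eval, bd, NatOp.eval]
    · omega
    · omega
    · omega
    · have := Nat.div_le_self (e.eval m ρ) (f.eval m ρ); omega
  | lt e f _ _ => intro W ρ _ _; simp only [eval, bd]; split <;> omega
  | sum d b e hb he =>
    intro W ρ h h'
    simp only [eval, bd]
    refine (Finset.sum_le_card_nsmul _ _ (e.bd (W + b.bd W)) fun i hi => ?_).trans ?_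
    · refine he (by omega) fun j => ?_
      have := hb h h'
      rw [Finset.mem_range] at hi
      rw [Function.update_apply]
      have := h' j
      split <;> omega
    · simpa using Nat.mul_le_mul_right _ (hb h h')

/-- `s'` differs from `s` only in the registers `8 u + 1` with `u ≥ t`. -/
structure TempFrame (t : ℕ) (s s' : State) : Prop where
  natReg : ∀ x, (x % 8 = 1 → x < 8 * t + 1) → s'.natReg x = s.natReg x
  natMem : s'.natMem = s.natMem
  realReg : s'.realReg = s.realReg
  realMem : s'.realMem = s.realMem

theorem TempFrame.trans {t u : ℕ} {s s' s'' : State} (h : TempFrame t s s')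
    (h' : TempFrame u s' s'') (htu : t ≤ u) : TempFrame t s s'' where
  natReg x hx := (h'.natReg x fun h8 => by have := hx h8; omega).trans (h.natReg x hx)
  natMem := h'.natMem.trans h.natMem
  realReg := h'.realReg.trans h.realReg
  realMem := h'.realMem.trans h.realMem

theorem TempFrame.env {t : ℕ} {s s' : State} (h : TempFrame t s s') : s'.env = s.env := by
  simp only [State.env, h.natMem]
  congr 1; funext v; exact h.natReg _ (by omega)

theorem TempFrame.loc {t : ℕ} {s s' : State} (h : TempFrame t s s') : s'.loc = s.loc := by
  funext v; exact h.natReg _ (by omega)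

theorem tempFrame_update (t u v : ℕ) (s : State) (h : t ≤ u) : TempFrame t s
    { s with natReg := Function.update s.natReg (8 * u + 1) v } where
  natReg x hx := Function.update_of_ne (by rintro rfl; have := hx (by omega); omega) _ _
  natMem := rfl
  realReg := rfl
  realMem := rfl

theorem copyReg_runs {dst src : ℕ} (h : src ≠ dst) (s : State) :
    Runs (copyReg dst src) s (2 + s.natReg src)
      (fun s' => s' = { s with natReg := Function.update s.natReg dst (s.natReg src) }) := by
  refine Runs.seq (T₁ := 1) (T₂ := 1 + s.natReg src) (Runs.instr _ _ ?_ rfl) ?_ (by omega)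
  · simp [Instr.cost]
  · rintro _ rfl
    refine Runs.instr _ _ ?_ ?_
    · simp [Instr.cost, Instr.apply, Function.update_of_ne h, size_le_self]
    · simp [Instr.apply, NatOp.eval, Function.update_of_ne h]

theorem compile_runs (e : Expr) : ∀ (t : ℕ) {s : State} {V W : ℕ}, s.env.Bdd V → V ≤ W →
    (∀ i, s.loc i ≤ W) → Runs (e.compile t) s (e.timeBd W)
      (fun s' => s'.natReg (8 * t + 1) = e.eval s.env s.loc ∧ TempFrame t s s') := by
  induction e with
  | const c =>
    intro t s V W hm hV hl
    exact Runs.instr _ _ (by simpa [Instr.cost, timeBd] using size_le_self c)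
      ⟨by simp [Instr.apply, eval], tempFrame_update _ _ _ _ le_rfl⟩
  | var v =>
    intro t s V W hm hV hl
    refine (copyReg_runs (by omega) s).mono ?_ ?_
    · have : s.natReg (8 * v) ≤ V := hm.1 v
      simp only [timeBd]; omega
    · rintro _ rfl; exact ⟨by simp [eval, State.env], tempFrame_update _ _ _ _ le_rfl⟩
  | loc v =>
    intro t s V W hm hV hl
    refine (copyReg_runs (by omega) s).mono ?_ ?_
    · have : s.natReg (8 * v + 2) ≤ W := hl v
      simp only [timeBd]; omega
    · rintro _ rfl; exact ⟨by simp [eval, State.loc], tempFrame_update _ _ _ _ le_rfl⟩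
  | load a e he =>
    intro t s V W hm hV hl
    refine Runs.seq (he t hm hV hl) (T₂ := 1 + e.bd W + W) ?_ le_rfl
    rintro s' ⟨h1, h2⟩
    have h3 := eval_le hm e hV hl
    have h4 : s.natMem (8 * a) (e.eval s.env s.loc) ≤ V := hm.2 a _
    refine Runs.instr _ _ ?_ ⟨?_, h2.trans (tempFrame_update _ _ _ _ le_rfl) le_rfl⟩
    · simp only [Instr.cost, h1, h2.natMem]
      have := size_le_self (e.eval s.env s.loc)
      have := size_le_self (s.natMem (8 * a) (e.eval s.env s.loc))
      omega
    · simp [Instr.apply, h1, h2.natMem, eval, State.env]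
  | op o e f he hf =>
    intro t s V W hm hV hl
    have h3 := eval_le hm e hV hl
    have h4 := eval_le hm f hV hl
    refine Runs.seq (Runs.seq (he t hm hV hl) (T₂ := f.timeBd W) (Q := fun s' =>
      s'.natReg (8 * t + 1) = e.eval s.env s.loc ∧ s'.natReg (8 * (t + 1) + 1) =
        f.eval s.env s.loc ∧ TempFrame t s s') ?_ le_rfl) (T₂ := 1 + e.bd W + f.bd W) ?_ le_rfl
    · rintro s' ⟨h1, h2⟩
      refine (hf (t + 1) (h2.env ▸ hm) hV (h2.loc ▸ hl)).mono le_rfl ?_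
      rintro s'' ⟨h5, h6⟩
      exact ⟨(h6.natReg _ (by omega)).trans h1, by rw [h5, h2.env, h2.loc],
        h2.trans h6 (by omega)⟩
    · rintro s' ⟨h1, h2, h5⟩
      refine Runs.instr _ _ ?_ ⟨?_, h5.trans (tempFrame_update _ _ _ _ le_rfl) le_rfl⟩
      · simp only [Instr.cost, h1, h2]
        have := size_le_self (e.eval s.env s.loc)
        have := size_le_self (f.eval s.env s.loc)
        omega
      · simp [Instr.apply, h1, h2, eval]
  | lt e f he hf =>
    intro t s V W hm hV hl
    have h3 := eval_le hm e hV hl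
    have h4 := eval_le hm f hV hl
    refine Runs.seq (Runs.seq (he t hm hV hl) (T₂ := f.timeBd W) (Q := fun s' =>
      s'.natReg (8 * t + 1) = e.eval s.env s.loc ∧ s'.natReg (8 * (t + 1) + 1) =
        f.eval s.env s.loc ∧ TempFrame t s s') ?_ le_rfl)
        (T₂ := 1 + e.bd W + f.bd W + 2) ?_ (by simp only [timeBd]; omega)
    · rintro s' ⟨h1, h2⟩
      refine (hf (t + 1) (h2.env ▸ hm) hV (h2.loc ▸ hl)).mono le_rfl ?_
      rintro s'' ⟨h5, h6⟩
      exact ⟨(h6.natReg _ (by omega)).trans h1, by rw [h5, h2.env, h2.loc],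
        h2.trans h6 (by omega)⟩
    · rintro s' ⟨h1, h2, h5⟩
      have hc : (Test.natLt (8 * t + 1) (8 * (t + 1) + 1)).cost s' ≤ 1 + e.bd W + f.bd W := by
        simp only [Test.cost, h1, h2]
        have := size_le_self (e.eval s.env s.loc)
        have := size_le_self (f.eval s.env s.loc)
        omega
      by_cases hlt : e.eval s.env s.loc < f.eval s.env s.loc
      · refine Runs.branchTrue (by simpa [Test.holds, h1, h2]) hc (Runs.instr _ _ ?_
          ⟨?_, h5.trans (tempFrame_update _ _ _ _ le_rfl) le_rfl⟩)
        · simp [Instr.cost]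
        · simp [Instr.apply, eval, hlt]
      · refine Runs.branchFalse (by simpa [Test.holds, h1, h2] using hlt) hc (Runs.instr _ _ ?_
          ⟨?_, h5.trans (tempFrame_update _ _ _ _ le_rfl) le_rfl⟩)
        · simp [Instr.cost]
        · simp [Instr.apply, eval, hlt]
  | sum d b e hb he =>
    intro t s V W hm hV hl
    have hn := eval_le hm b hV hl
    have hS := eval_le hm (sum d b e) hV hl
    set n := b.eval s.env s.loc with hn_def
    set N := b.bd W
    -- Partial sums are at most the full sum, so the bound for the latter controls the accumulator
    -- in every round.
    have hpart : ∀ i ≤ n, ∑ j ∈ Finset.range i, e.eval s.env (Function.update s.loc d j) ≤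
        (sum d b e).bd W := fun i hi => le_trans
      (Finset.sum_le_sum_of_subset (Finset.range_subset_range.2 hi)) hS
    have hloc : s.natReg (8 * d + 2) ≤ W := hl d
    simp only [compile]
    refine Runs.seq (hb t hm hV hl) (T₂ := 20 + 2 * W + (sum d b e).bd W + (N + 1) *
      (20 + 4 * N + e.timeBd (W + N) + e.bd (W + N) + (sum d b e).bd W)) ?_
      (by simp only [timeBd, N]; omega)
    rintro s₁ ⟨h1, f1⟩
    refine Runs.seq (copyReg_runs (by omega) s₁) (T₂ := 18 + W + (sum d b e).bd W + (N + 1) *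
      (20 + 4 * N + e.timeBd (W + N) + e.bd (W + N) + (sum d b e).bd W)) ?_ (by
        rw [f1.natReg _ (by omega)]; omega)
    rintro _ rfl
    rw [f1.natReg (8 * d + 2) (by omega)]
    let Inv : ℕ → State → Prop := fun i s' => s'.natReg (8 * t + 1) = n ∧
      s'.natReg (8 * (t + 1) + 1) = s.natReg (8 * d + 2) ∧ s'.natReg (8 * (t + 2) + 1) =
        ∑ j ∈ Finset.range i, e.eval s.env (Function.update s.loc d j) ∧
      s'.natReg (8 * d + 2) = i ∧ (∀ x, x ≠ 8 * d + 2 → (x % 8 = 1 → x < 8 * t + 1) →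
        s'.natReg x = s.natReg x) ∧
      s'.natMem = s.natMem ∧ s'.realReg = s.realReg ∧ s'.realMem = s.realMem
    have hInv0 : ∀ i s', Inv i s' → s'.env = s.env ∧ s'.loc = Function.update s.loc d i := by
      rintro i s' ⟨-, -, -, h4, h5, h6, -, -⟩
      constructor
      · simp only [State.env, h6]
        congr 1; funext v; exact h5 _ (by omega) (by omega)
      · funext v
        by_cases hv : v = d
        · subst hv; simpa [State.loc] using h4
        · rw [Function.update_of_ne hv]; exact h5 _ (by omega) (by omega)
    refine Runs.seq (M := Inv 0) (T₁ := 2) (T₂ := 16 + W + (sum d b e).bd W + (N + 1) *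
      (20 + 4 * N + e.timeBd (W + N) + e.bd (W + N) + (sum d b e).bd W)) ?_ ?_ (by omega)
    · refine Runs.cons (c := 1) (T := 1) (by simp [Instr.cost]) (Runs.instr _ _
        (by simp [Instr.cost]) ?_)
      refine ⟨?_, ?_, ?_, ?_, ?_, f1.natMem, f1.realReg, f1.realMem⟩
      · simp (disch := omega) [Instr.apply, Function.update_of_ne, h1, hn_def]
      · simp (disch := omega) [Instr.apply, Function.update_of_ne]
      · simp (disch := omega) [Instr.apply, Function.update_of_ne]
      · simp [Instr.apply]
      · intro x hx hx'
        simp only [Instr.apply]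
        rw [Function.update_of_ne (by omega), Function.update_of_ne (by omega),
          Function.update_of_ne (by omega), f1.natReg x hx']
    intro s₂ hs₂
    refine Runs.seq (M := Inv n) (T₂ := 4 + W + (sum d b e).bd W) (Runs.loop Inv (c := 1 + 2 * N)
      (T := e.timeBd (W + N) + (10 + e.bd (W + N) + (sum d b e).bd W + N)) ?_ ?_ ?_ hs₂ le_rfl) ?_ ?_
    · rintro i s' hi ⟨h1, -, -, h4, -⟩
      simp only [Test.cost, h1, h4]
      have := size_le_self n
      have := size_le_self i
      omega
    · rintro i s' hi hI
      obtain ⟨henv, hloc'⟩ := hInv0 i s' hI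
      have hle : ∀ j, s'.loc j ≤ W + N := by
        intro j; rw [hloc', Function.update_apply]
        have := hl j
        split <;> omega
      refine ⟨by simpa [Test.holds, hI.1, hI.2.2.2.1] using hi, ?_⟩
      refine Runs.seq (he (t + 3) (henv ▸ hm) (by omega) hle) ?_ le_rfl
      rintro s'' ⟨g1, g2⟩
      obtain ⟨h1, h2, h3, h4, h5, h6, h7, h8⟩ := hI
      have hp := hpart i (by omega)
      have hev : e.eval s'.env s'.loc ≤ e.bd (W + N) := eval_le (henv ▸ hm) e (by omega) hle
      rw [henv, hloc'] at g1 hev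
      rw [show 10 + e.bd (W + N) + (sum d b e).bd W + N = (1 + (sum d b e).bd W + e.bd (W + N)) +
        (2 + (7 + N)) by omega]
      refine Runs.cons ?_ (Runs.cons ?_ (Runs.instr _ _ ?_ ⟨?_, ?_, ?_, ?_, ?_, ?_, ?_, ?_⟩))
      · simp only [Instr.cost, g1, g2.natReg (8 * (t + 2) + 1) (by omega), h3]
        have := size_le_self (∑ j ∈ Finset.range i, e.eval s.env (Function.update s.loc d j))
        have := size_le_self (e.eval s.env (Function.update s.loc d i))
        omega
      · simp [Instr.cost]
      · simp (disch := omega) [Instr.cost, Instr.apply, Function.update_of_ne, g2.natReg, h4]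
        have := size_le_self i
        omega
      · simp (disch := omega) [Instr.apply, Function.update_of_ne, g2.natReg, h1]
      · simp (disch := omega) [Instr.apply, Function.update_of_ne, g2.natReg, h2]
      · simp (disch := omega) [Instr.apply, Function.update_of_ne, g2.natReg, h3, g1, NatOp.eval,
          Finset.sum_range_succ]
      · simp (disch := omega) [Instr.apply, Function.update_of_ne, g2.natReg, h4, NatOp.eval]
      · intro x hx hx'
        simp only [Instr.apply]
        rw [Function.update_of_ne (by omega), Function.update_of_ne (by omega),
          Function.update_of_ne (by omega), g2.natReg x (by omega), h5 x hx hx']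
      · exact g2.natMem.trans h6
      · exact g2.realReg.trans h7
      · exact g2.realMem.trans h8
    · rintro s' ⟨h1, -, -, h4, -⟩
      simp [Test.holds, h1, h4]
    · rintro s₃ ⟨h1, h2, h3, h4, h5, h6, h7, h8⟩
      refine Runs.seq (copyReg_runs (by omega) s₃) (T₂ := 2 + (sum d b e).bd W) ?_ (by omega)
      rintro _ rfl
      refine (copyReg_runs (by omega) _).mono ?_ ?_
      · simp (disch := omega) only [Function.update_of_ne]
        rw [h3]
        have := hpart n le_rfl
        omega
      · rintro _ rfl
        refine ⟨?_, ?_, h6, h7, h8⟩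
        · simp (disch := omega) [Function.update_of_ne, h3, eval]
          rw [hn_def]
        · intro x hx
          simp only
          rw [Function.update_of_ne (by omega)]
          by_cases hxd : x = 8 * d + 2
          · subst hxd; simp [h2]
          · rw [Function.update_of_ne hxd, h5 x hxd hx]
    · have : n * (1 + 2 * N + (e.timeBd (W + N) + (10 + e.bd (W + N) + (sum d b e).bd W + N))) +
        (1 + 2 * N) ≤ (N + 1) * (20 + 4 * N + e.timeBd (W + N) + e.bd (W + N) +
          (sum d b e).bd W) := by
        rw [add_mul N 1]
        refine Nat.add_le_add (Nat.mul_le_mul hn (by omega)) (by omega)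
      omega

/-! ### Polynomial bounds -/

/-- `f` is bounded by a polynomial. -/
def PolyBd (f : ℕ → ℕ) : Prop := ∃ c, ∀ V, f V ≤ (V + 2) ^ c

theorem one_le_pow (V c : ℕ) : 1 ≤ (V + 2) ^ c := Nat.one_le_pow _ _ (by omega)

theorem PolyBd.const (c : ℕ) : PolyBd fun _ => c :=
  ⟨c, fun V => (Nat.lt_two_pow_self (n := c)).le.trans (Nat.pow_le_pow_left (by omega) c)⟩

theorem PolyBd.id : PolyBd fun V => V := ⟨1, fun V => by simp⟩

theorem PolyBd.add {f g : ℕ → ℕ} (hf : PolyBd f) (hg : PolyBd g) : PolyBd fun V => f V + g V := by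
  obtain ⟨c, hc⟩ := hf
  obtain ⟨d, hd⟩ := hg
  refine ⟨c + d + 1, fun V => ?_⟩
  have h1 : (V + 2) ^ c ≤ (V + 2) ^ (c + d) := Nat.pow_le_pow_right (by omega) (by omega)
  have h2 : (V + 2) ^ d ≤ (V + 2) ^ (c + d) := Nat.pow_le_pow_right (by omega) (by omega)
  have := hc V
  have := hd V
  rw [pow_succ]
  nlinarith

theorem PolyBd.mul {f g : ℕ → ℕ} (hf : PolyBd f) (hg : PolyBd g) : PolyBd fun V => f V * g V := by
  obtain ⟨c, hc⟩ := hf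
  obtain ⟨d, hd⟩ := hg
  exact ⟨c + d, fun V => by rw [pow_add]; exact Nat.mul_le_mul (hc V) (hd V)⟩

/-- The normal form `(V + 2) ^ c` is stable under composition because `(V + 2) ^ d + 2 ≤ (V + 2) ^
(d + 2)`. -/
theorem PolyBd.comp {f g : ℕ → ℕ} (hf : PolyBd f) (hg : PolyBd g) : PolyBd fun V => f (g V) := by
  obtain ⟨c, hc⟩ := hf
  obtain ⟨d, hd⟩ := hg
  refine ⟨(d + 2) * c, fun V => (hc _).trans ?_⟩
  rw [pow_mul]
  refine Nat.pow_le_pow_left ?_ c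
  have := hd V
  have := one_le_pow V d
  rw [pow_add]
  nlinarith [Nat.zero_le ((V + 2) ^ d * V)]

theorem PolyBd.mono {f g : ℕ → ℕ} (hg : PolyBd g) (h : ∀ V, f V ≤ g V) : PolyBd f := by
  obtain ⟨c, hc⟩ := hg
  exact ⟨c, fun V => (h V).trans (hc V)⟩

theorem bd_polyBd (e : Expr) : PolyBd e.bd := by
  induction e with
  | const c => exact .const c
  | var _ => exact .id
  | loc _ => exact .id
  | load _ _ _ => exact .id
  | op o e f he hf => exact (he.add hf).add (he.mul hf)
  | lt _ _ _ _ => exact .const 1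
  | sum d b e hb he => exact hb.mul (he.comp (PolyBd.id.add hb))

theorem timeBd_polyBd (e : Expr) : PolyBd e.timeBd := by
  induction e with
  | const c => exact (PolyBd.const 1).add (.const c)
  | var _ => exact (PolyBd.const 2).add .id
  | loc _ => exact (PolyBd.const 2).add .id
  | load _ e he => exact he.add (((PolyBd.const 1).add e.bd_polyBd).add .id)
  | op o e f he hf =>
    exact (he.add hf).add (((PolyBd.const 1).add e.bd_polyBd).add f.bd_polyBd)
  | lt e f he hf =>
    exact (he.add hf).add (((PolyBd.const 3).add e.bd_polyBd).add f.bd_polyBd)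
  | sum d b e hb he =>
    have h2 := PolyBd.id.add b.bd_polyBd
    refine (((hb.add (.const 20)).add ((PolyBd.const 2).mul .id)).add (bd_polyBd _)).add
      ((b.bd_polyBd.add (.const 1)).mul (((((PolyBd.const 20).add
        ((PolyBd.const 4).mul b.bd_polyBd)).add (he.comp h2)).add
        (e.bd_polyBd.comp h2)).add (bd_polyBd _)))

end Expr

end RealRAM

/-! ### Computable functions and predicates, and programs acting on the small memory -/

namespace RealRAM

/-! ### Computable functions of the small variables and arrays -/

/-- The types of contexts in which expressions are evaluated: the small variables and arrays
together with the values of some local variables. -/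
class Ctx (Γ : Type) where
  depth : ℕ
  env : Γ → Env
  loc : Γ → ℕ → ℕ

instance : Ctx Env where
  depth := 0
  env m := m
  loc _ _ := 0

/-- Local variables are numbered by levels: a new one gets the number `depth Γ`, and the earlier
ones keep theirs. -/
instance {Γ : Type} [Ctx Γ] : Ctx (Γ × ℕ) where
  depth := Ctx.depth Γ + 1
  env γ := Ctx.env γ.1
  loc γ i := if i = Ctx.depth Γ then γ.2 else Ctx.loc γ.1 i

/-- `f` is given by an expression. -/
def Comp {Γ : Type} [Ctx Γ] (f : Γ → ℕ) : Prop :=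
  ∃ e : Expr, ∀ (γ : Γ) (ρ : ℕ → ℕ), (∀ i < Ctx.depth Γ, ρ i = Ctx.loc γ i) →
    e.eval (Ctx.env γ) ρ = f γ

/-- `p` is decided by an expression. -/
def CompP {Γ : Type} [Ctx Γ] (p : Γ → Prop) : Prop :=
  ∃ f : Γ → ℕ, Comp f ∧ ∀ γ, f γ ≠ 0 ↔ p γ

section
variable {Γ : Type} [Ctx Γ]

namespace Comp

theorem congr {f g : Γ → ℕ} (hf : Comp f) (h : ∀ γ, f γ = g γ) : Comp g := by
  rwa [← funext h]

theorem const (c : ℕ) : Comp fun _ : Γ => c := ⟨.const c, fun _ _ _ => rfl⟩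

theorem var (v : ℕ) : Comp fun γ : Γ => (Ctx.env γ).var v := ⟨.var v, fun _ _ _ => rfl⟩

theorem load (a : ℕ) {f : Γ → ℕ} (hf : Comp f) : Comp fun γ : Γ => (Ctx.env γ).mem a (f γ) := by
  obtain ⟨e, he⟩ := hf
  exact ⟨.load a e, fun γ ρ h => by simp only [Expr.eval, he γ ρ h]⟩

theorem snd : Comp fun γ : Γ × ℕ => γ.2 :=
  ⟨.loc (Ctx.depth Γ), fun γ ρ h => by
    simp only [Expr.eval]
    rw [h _ (Nat.lt_succ_self _)]
    simp [Ctx.loc]⟩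

theorem fst {f : Γ → ℕ} (hf : Comp f) : Comp fun γ : Γ × ℕ => f γ.1 := by
  obtain ⟨e, he⟩ := hf
  refine ⟨e, fun γ ρ h => he γ.1 ρ fun i hi => ?_⟩
  rw [h i (Nat.lt_succ_of_lt hi)]
  simp [Ctx.loc, hi.ne]

theorem op (o : NatOp) {f g : Γ → ℕ} (hf : Comp f) (hg : Comp g) :
    Comp fun γ => o.eval (f γ) (g γ) := by
  obtain ⟨e, he⟩ := hf
  obtain ⟨e', he'⟩ := hg
  exact ⟨.op o e e', fun γ ρ h => by simp only [Expr.eval, he γ ρ h, he' γ ρ h]⟩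

theorem add {f g : Γ → ℕ} (hf : Comp f) (hg : Comp g) : Comp fun γ => f γ + g γ := op .add hf hg
theorem sub {f g : Γ → ℕ} (hf : Comp f) (hg : Comp g) : Comp fun γ => f γ - g γ := op .sub hf hg
theorem mul {f g : Γ → ℕ} (hf : Comp f) (hg : Comp g) : Comp fun γ => f γ * g γ := op .mul hf hg
theorem div {f g : Γ → ℕ} (hf : Comp f) (hg : Comp g) : Comp fun γ => f γ / g γ := op .div hf hg

theorem mod {f g : Γ → ℕ} (hf : Comp f) (hg : Comp g) : Comp fun γ => f γ % g γ :=
  (hf.sub (hg.mul (hf.div hg))).congr fun γ => by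
    have := Nat.div_add_mod (f γ) (g γ); omega

theorem pow {f : Γ → ℕ} (hf : Comp f) (k : ℕ) : Comp fun γ => f γ ^ k := by
  induction k with
  | zero => exact const 1
  | succ k ih => exact ih.mul hf

theorem sum {f : Γ → ℕ} {g : Γ → ℕ → ℕ} (hf : Comp f) (hg : Comp fun q : Γ × ℕ => g q.1 q.2) :
    Comp fun γ => ∑ i ∈ Finset.range (f γ), g γ i := by
  obtain ⟨e, he⟩ := hf
  obtain ⟨e', he'⟩ := hg
  refine ⟨.sum (Ctx.depth Γ) e e', fun γ ρ h => ?_⟩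
  simp only [Expr.eval, he γ ρ h]
  refine Finset.sum_congr rfl fun i _ => he' (γ, i) _ fun j hj => ?_
  by_cases hjd : j = Ctx.depth Γ
  · simp [Ctx.loc, hjd]
  · rw [Function.update_of_ne hjd, h j (lt_of_le_of_ne (Nat.lt_succ_iff.1 hj) hjd)]
    simp [Ctx.loc, hjd]

/-- The range is constant and the sum is written out, so the summands may depend on `l` in any way,
for instance through an exponent or a table of constants. -/
theorem constSum (k : ℕ) {g : Γ → ℕ → ℕ} (hg : ∀ l, Comp fun γ => g γ l) :
    Comp fun γ => ∑ l ∈ Finset.range k, g γ l := by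
  induction k with
  | zero => exact (const 0).congr fun γ => by simp
  | succ k ih => exact (ih.add (hg k)).congr fun γ => by rw [Finset.sum_range_succ]

theorem lt_ind {f g : Γ → ℕ} (hf : Comp f) (hg : Comp g) :
    Comp fun γ => if f γ < g γ then 1 else 0 := by
  obtain ⟨e, he⟩ := hf
  obtain ⟨e', he'⟩ := hg
  exact ⟨.lt e e', fun γ ρ h => by simp only [Expr.eval, he γ ρ h, he' γ ρ h]⟩

/-- Forget the last but one local variable. -/
theorem forget {f : Γ × ℕ → ℕ} (hf : Comp f) : Comp fun q : (Γ × ℕ) × ℕ => f (q.1.1, q.2) := by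
  obtain ⟨e, he⟩ := hf
  let d := Ctx.depth Γ
  -- The value of the variable of level `d + 1` must be moved to level `d`. The sum binds level `d`,
  -- and the factor `1 - [i < value]` kills all terms except the last one, where `i` is the wanted
  -- value.
  refine ⟨.sum d (.op .add (.loc (d + 1)) (.const 1)) (.op .mul (.op .sub (.const 1)
    (.lt (.loc d) (.loc (d + 1)))) e), fun q ρ h => ?_⟩
  have h1 : ρ (d + 1) = q.2 := by
    rw [h (d + 1) (by show d + 1 < d + 1 + 1; omega)]; simp [Ctx.loc, Ctx.depth, d]
  have h3 : ∀ i, Function.update ρ d i (d + 1) = q.2 := fun i => by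
    rw [Function.update_of_ne (by omega), h1]
  have h2 : ∀ i, e.eval (Ctx.env q) (Function.update ρ d i) = f (q.1.1, i) := by
    refine fun i => he (q.1.1, i) _ fun j hj => ?_
    by_cases hjd : j = d
    · subst hjd; simp [Ctx.loc, d]
    · have hj' : j < d := lt_of_le_of_ne (Nat.lt_succ_iff.1 hj) hjd
      rw [Function.update_of_ne hjd, h j (by show j < d + 1 + 1; omega)]
      have h4 : j ≠ d + 1 := by omega
      simp only [Ctx.loc, Ctx.depth]
      rw [if_neg h4, if_neg hjd, if_neg hjd]
  simp only [Expr.eval, NatOp.eval, h1, h2, h3, Function.update_self]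
  rw [Finset.sum_range_succ, Finset.sum_eq_zero]
  · simp
  · intro i hi
    rw [Finset.mem_range] at hi
    simp [hi]

end Comp

namespace CompP

theorem congr {p q : Γ → Prop} (hp : CompP p) (h : ∀ γ, p γ ↔ q γ) : CompP q := by
  rwa [← funext fun γ => propext (h γ)]

theorem lt {f g : Γ → ℕ} (hf : Comp f) (hg : Comp g) : CompP fun γ => f γ < g γ :=
  ⟨_, hf.lt_ind hg, fun γ => by simp⟩

theorem ind {p : Γ → Prop} [DecidablePred p] (hp : CompP p) :
    Comp fun γ => if p γ then 1 else 0 := by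
  obtain ⟨f, hf, h⟩ := hp
  refine ((Comp.const 0).lt_ind hf).congr fun γ => ?_
  simp [← h γ, Nat.pos_iff_ne_zero]

theorem ite {p : Γ → Prop} [DecidablePred p] {f g : Γ → ℕ} (hp : CompP p) (hf : Comp f)
    (hg : Comp g) : Comp fun γ => if p γ then f γ else g γ :=
  ((hp.ind.mul hf).add (((Comp.const 1).sub hp.ind).mul hg)).congr fun γ => by
    split <;> simp

theorem not {p : Γ → Prop} (hp : CompP p) : CompP fun γ => ¬ p γ := by
  obtain ⟨f, hf, h⟩ := hp
  exact ⟨_, (Comp.const 1).sub hf, fun γ => by beta_reduce; rw [← h γ]; omega⟩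

theorem and {p q : Γ → Prop} (hp : CompP p) (hq : CompP q) : CompP fun γ => p γ ∧ q γ := by
  obtain ⟨f, hf, h⟩ := hp
  obtain ⟨g, hg, h'⟩ := hq
  exact ⟨_, hf.mul hg, fun γ => by beta_reduce; rw [← h γ, ← h' γ, mul_ne_zero_iff]⟩

theorem or {p q : Γ → Prop} (hp : CompP p) (hq : CompP q) : CompP fun γ => p γ ∨ q γ := by
  obtain ⟨f, hf, h⟩ := hp
  obtain ⟨g, hg, h'⟩ := hq
  exact ⟨_, hf.add hg, fun γ => by beta_reduce; rw [← h γ, ← h' γ]; omega⟩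

theorem imp {p q : Γ → Prop} (hp : CompP p) (hq : CompP q) : CompP fun γ => p γ → q γ :=
  (hp.not.or hq).congr fun _ => by tauto

theorem iff {p q : Γ → Prop} (hp : CompP p) (hq : CompP q) : CompP fun γ => p γ ↔ q γ :=
  ((hp.imp hq).and (hq.imp hp)).congr fun _ => by tauto

theorem le {f g : Γ → ℕ} (hf : Comp f) (hg : Comp g) : CompP fun γ => f γ ≤ g γ :=
  (lt hg hf).not.congr fun _ => by omega

theorem eq {f g : Γ → ℕ} (hf : Comp f) (hg : Comp g) : CompP fun γ => f γ = g γ :=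
  ((le hf hg).and (le hg hf)).congr fun _ => by omega

theorem ex {f : Γ → ℕ} {p : Γ → ℕ → Prop} (hf : Comp f)
    (hp : CompP fun q : Γ × ℕ => p q.1 q.2) : CompP fun γ => ∃ i < f γ, p γ i := by
  obtain ⟨g, hg, h⟩ := hp
  refine ⟨fun γ => ∑ i ∈ Finset.range (f γ), g (γ, i), Comp.sum hf hg, fun γ => ?_⟩
  rw [ne_eq, Finset.sum_eq_zero_iff]
  push Not
  simp only [Finset.mem_range]
  exact exists_congr fun i => and_congr_right fun _ => h (γ, i)

theorem all {f : Γ → ℕ} {p : Γ → ℕ → Prop} (hf : Comp f)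
    (hp : CompP fun q : Γ × ℕ => p q.1 q.2) : CompP fun γ => ∀ i < f γ, p γ i :=
  (ex hf (p := fun γ i => ¬ p γ i) hp.not).not.congr fun γ => by push Not; rfl

theorem constEx (k : ℕ) {p : Γ → ℕ → Prop} (hp : ∀ l, CompP fun γ => p γ l) :
    CompP fun γ => ∃ l < k, p γ l := by
  choose g hg h using hp
  refine ⟨fun γ => ∑ l ∈ Finset.range k, g l γ, Comp.constSum k hg, fun γ => ?_⟩
  simp [Finset.sum_eq_zero_iff, ← h]

theorem card {f : Γ → ℕ} {p : Γ → ℕ → Prop} [∀ γ, DecidablePred (p γ)] (hf : Comp f)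
    (hp : CompP fun q : Γ × ℕ => p q.1 q.2) :
    Comp fun γ => ((Finset.range (f γ)).filter fun i => p γ i).card := by
  refine (Comp.sum hf (g := fun γ i => if p γ i then 1 else 0) hp.ind).congr fun γ => ?_
  rw [Finset.card_filter]

theorem forget {p : Γ × ℕ → Prop} (hp : CompP p) :
    CompP fun q : (Γ × ℕ) × ℕ => p (q.1.1, q.2) := by
  obtain ⟨f, hf, h⟩ := hp
  exact ⟨_, hf.forget, fun q => h (q.1.1, q.2)⟩

end CompP

end

/-! ### Programs that act on the small variables and arrays -/

def Env.setVar (m : Env) (v x : ℕ) : Env := ⟨Function.update m.var v x, m.mem⟩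

/-- Replace the first `b` cells of the array `a` by the values of `f`. -/
def Env.setArr (m : Env) (a b : ℕ) (f : ℕ → ℕ) : Env :=
  ⟨m.var, Function.update m.mem a fun i => if i < b then f i else m.mem a i⟩

/-- `s'` differs from `s` only in small variables, small arrays and temporaries. -/
structure SmallFrame (s s' : State) : Prop where
  natReg : ∀ x, x % 8 ≠ 0 → x % 8 ≠ 1 → s'.natReg x = s.natReg x
  natMem : ∀ a, a % 8 ≠ 0 → a % 8 ≠ 1 → s'.natMem a = s.natMem a
  realReg : s'.realReg = s.realReg
  realMem : s'.realMem = s.realMem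

theorem SmallFrame.refl (s : State) : SmallFrame s s :=
  ⟨fun _ _ _ => rfl, fun _ _ _ => rfl, rfl, rfl⟩

theorem SmallFrame.trans {s s' s'' : State} (h : SmallFrame s s') (h' : SmallFrame s' s'') :
    SmallFrame s s'' :=
  ⟨fun x hx hx' => (h'.natReg x hx hx').trans (h.natReg x hx hx'),
    fun x hx hx' => (h'.natMem x hx hx').trans (h.natMem x hx hx'),
    h'.realReg.trans h.realReg, h'.realMem.trans h.realMem⟩

theorem SmallFrame.loc {s s' : State} (h : SmallFrame s s') : s'.loc = s.loc := by
  funext i; exact h.natReg _ (by omega) (by omega)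

/-- The function `F` of the small variables and arrays is computed in polynomial time by `P`. -/
def Program.Acts (P : Program) (F : Env → Env) : Prop :=
  (∃ c, ∀ (s : State) (V : ℕ), s.env.Bdd V → (∀ i, s.loc i = 0) →
    Runs P s ((V + 2) ^ c) fun s' => s'.env = F s.env ∧ SmallFrame s s') ∧
  ∃ c, ∀ (m : Env) (V : ℕ), m.Bdd V → (F m).Bdd ((V + 2) ^ c)

/-- The time of the second program is measured at the bound for the memory that the first one
leaves; this is why polynomial growth of the memory is part of `Acts`. -/
theorem Program.Acts.seq {P Q : Program} {F G : Env → Env} (hP : P.Acts F) (hQ : Q.Acts G) :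
    (Program.seq P Q).Acts (G ∘ F) := by
  obtain ⟨⟨c, hc⟩, ⟨d, hd⟩⟩ := hP
  obtain ⟨⟨c', hc'⟩, ⟨d', hd'⟩⟩ := hQ
  have h1 : ∀ e : ℕ, Expr.PolyBd fun V => (V + 2) ^ e := fun e => ⟨e, fun _ => le_rfl⟩
  obtain ⟨k, hk⟩ := (h1 c).add ((h1 c').comp (h1 d))
  obtain ⟨k', hk'⟩ := (h1 d').comp (h1 d)
  refine ⟨⟨k, fun s V hs hl => ?_⟩, ⟨k', fun m V hm => (hd' _ _ (hd m V hm)).mono (hk' V)⟩⟩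
  refine Runs.seq (hc s V hs hl) ?_ (hk V)
  rintro s' ⟨he, hf⟩
  refine (hc' s' _ (he ▸ hd _ V hs) (by rw [hf.loc]; exact hl)).mono le_rfl ?_
  rintro s'' ⟨he', hf'⟩
  exact ⟨by rw [he', he]; rfl, hf.trans hf'⟩

theorem Program.Acts.congr {P : Program} {F G : Env → Env} (hP : P.Acts F) (h : ∀ m, F m = G m) :
    P.Acts G := by
  rwa [← funext h]

theorem exists_acts_setVar (v : ℕ) {f : Env → ℕ} (hf : Comp f) :
    ∃ P : Program, P.Acts fun m => m.setVar v (f m) := by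
  obtain ⟨e, he⟩ := hf
  replace he : ∀ (m : Env) (ρ : ℕ → ℕ), e.eval m ρ = f m := fun m ρ => he m ρ (by simp [Ctx.depth])
  refine ⟨.seq (e.compile 0) (Expr.copyReg (8 * v) (8 * 0 + 1)), ?_, ?_⟩
  · obtain ⟨c, hc⟩ := e.timeBd_polyBd.add ((Expr.PolyBd.const 2).add e.bd_polyBd)
    refine ⟨c, fun s V hs hl => ?_⟩
    refine Runs.seq (e.compile_runs 0 hs le_rfl (by simp [hl])) (T₂ := 2 + e.bd V) ?_ (hc V)
    rintro s' ⟨h1, h2⟩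
    rw [he] at h1
    refine (Expr.copyReg_runs (by omega) s').mono ?_ ?_
    · rw [h1, ← he _ fun _ => 0]
      exact Nat.add_le_add_left (e.eval_le hs le_rfl (by simp)) _
    · rintro _ rfl
      refine ⟨?_, ?_, ?_, h2.realReg, h2.realMem⟩
      · simp only [State.env, Env.setVar, h2.natMem]
        congr 1
        funext x
        by_cases hx : x = v
        · subst hx; simp only [Function.update_self]; exact h1
        · rw [Function.update_of_ne (by omega), Function.update_of_ne hx, h2.natReg _ (by omega)]
      · intro x h0 h8
        simp only
        rw [Function.update_of_ne (by omega), h2.natReg _ (by omega)]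
      · intro a _ _
        rw [h2.natMem]
  · obtain ⟨c, hc⟩ := e.bd_polyBd.add .id
    refine ⟨c, fun m V hm => ?_⟩
    refine Env.Bdd.mono (V := e.bd V + V) ⟨fun x => ?_, fun a i => (hm.2 a i).trans (by omega)⟩ (hc V)
    have h1 : f m ≤ e.bd V := by
      rw [← he m fun _ => 0]; exact e.eval_le hm le_rfl (by simp)
    have := hm.1 x
    simp only [Env.setVar, Function.update_apply]
    split <;> omega

/-- Since `f` may read the array that is being replaced, the new values are first collected in the
temporary array 1 and copied afterwards. The counter is register 2, which is the local variable 0 as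
seen by the compiled expression; it is set back to zero at the end. -/
theorem exists_acts_setArr (a : ℕ) {b : Env → ℕ} {f : Env → ℕ → ℕ} (hb : Comp b)
    (hf : Comp fun q : Env × ℕ => f q.1 q.2) :
    ∃ P : Program, P.Acts fun m => m.setArr a (b m) (f m) := by
  obtain ⟨e, he⟩ := hf
  obtain ⟨e', he'⟩ := hb
  replace he' : ∀ (m : Env) (ρ : ℕ → ℕ), e'.eval m ρ = b m :=
    fun m ρ => he' m ρ (by simp [Ctx.depth])
  replace he : ∀ (m : Env) (ρ : ℕ → ℕ), e.eval m ρ = f m (ρ 0) := fun m ρ =>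
    he (m, ρ 0) ρ (by simp [Ctx.depth, Ctx.loc])
  have hbb : ∀ {m : Env} {V : ℕ}, m.Bdd V → b m ≤ e'.bd V := fun {m V} hm => by
    rw [← he' m fun _ => 0]; exact e'.eval_le hm le_rfl (by simp)
  have hff : ∀ {m : Env} {V i W : ℕ}, m.Bdd V → i ≤ W → f m i ≤ e.bd (V + W) :=
    fun {m V i W} hm hi => by
      rw [show f m i = e.eval m fun _ => i from (he m fun _ => i).symm]
      exact e.eval_le hm (by omega) (by simp; omega)
  refine ⟨.seq (e'.compile 0) (.seq (.instr (.natConst 2 0)) (.seq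
      (.loop (.natLt 2 (8 * 0 + 1)) (.seq (e.compile 1) (block
        [.natStore 1 2 (8 * 1 + 1), .natConst (8 * 1 + 1) 1, .natOp .add 2 2 (8 * 1 + 1)])))
      (.seq (.instr (.natConst 2 0)) (.seq (.loop (.natLt 2 (8 * 0 + 1)) (block
        [.natLoad (8 * 1 + 1) 1 2, .natStore (8 * a) 2 (8 * 1 + 1), .natConst (8 * 1 + 1) 1,
          .natOp .add 2 2 (8 * 1 + 1)]))
      (.instr (.natConst 2 0)))))), ?_, ?_⟩
  · have hpN := e'.bd_polyBd
    have hpW := Expr.PolyBd.id.add hpN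
    have hpE := e.bd_polyBd.comp hpW
    have hpT := e.timeBd_polyBd.comp hpW
    have hpc := ((Expr.PolyBd.const 2).mul hpN).add (.const 1)
    have hp1 := (hpN.mul (hpc.add (hpT.add ((hpN.add hpE).add (hpN.add (.const 10)))))).add hpc
    have hp2 := (hpN.mul (hpc.add ((((Expr.PolyBd.const 2).mul hpN).add
      ((Expr.PolyBd.const 2).mul hpE)).add (hpN.add (.const 10))))).add hpc
    obtain ⟨c, hc⟩ := (e'.timeBd_polyBd.add (.const 10)).add (hp1.add hp2)
    refine ⟨c, fun s V hs hl => ?_⟩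
    refine Runs.mono ?_ (hc V) fun _ h => h
    set N := e'.bd V
    set E := e.bd (V + N)
    set n := b s.env with hn
    have hnN : n ≤ N := hbb hs
    have hfE : ∀ i ≤ n, f s.env i ≤ E := fun i hi => hff hs (hi.trans hnN)
    let I1 : ℕ → State → Prop := fun i s' => s'.natReg 1 = n ∧ s'.natReg 2 = i ∧
      (∀ j < i, s'.natMem 1 j = f s.env j) ∧ (∀ x, x % 8 ≠ 1 → x ≠ 2 → s'.natReg x = s.natReg x) ∧
      (∀ x, x ≠ 1 → s'.natMem x = s.natMem x) ∧ s'.realReg = s.realReg ∧ s'.realMem = s.realMem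
    let I2 : ℕ → State → Prop := fun i s' => s'.natReg 1 = n ∧ s'.natReg 2 = i ∧
      (∀ j < n, s'.natMem 1 j = f s.env j) ∧ (∀ x, x % 8 ≠ 1 → x ≠ 2 → s'.natReg x = s.natReg x) ∧
      (∀ x, x ≠ 1 → x ≠ 8 * a → s'.natMem x = s.natMem x) ∧
      (∀ j, s'.natMem (8 * a) j = if j < i then f s.env j else s.natMem (8 * a) j) ∧
      s'.realReg = s.realReg ∧ s'.realMem = s.realMem
    refine Runs.seq (e'.compile_runs 0 hs le_rfl (by simp [hl])) (T₂ := 10 +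
      (N * (2 * N + 1 + (e.timeBd (V + N) + (N + E + (N + 10)))) + (2 * N + 1) +
      (N * (2 * N + 1 + (2 * N + 2 * E + (N + 10))) + (2 * N + 1)))) ?_
      (by simp only [N, E]; omega)
    rintro s₁ ⟨h1, f1⟩
    rw [he'] at h1
    refine Runs.seq (M := I1 0) (T₁ := 1) (T₂ := 9 +
      (N * (2 * N + 1 + (e.timeBd (V + N) + (N + E + (N + 10)))) + (2 * N + 1) +
      (N * (2 * N + 1 + (2 * N + 2 * E + (N + 10))) + (2 * N + 1)))) ?_ ?_ (by omega)
    · refine Runs.instr _ _ (by simp [Instr.cost]) ⟨?_, ?_, ?_, ?_, ?_, f1.realReg, f1.realMem⟩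
      · simpa [Instr.apply] using h1
      · simp [Instr.apply]
      · simp
      · intro x hx hx'
        simp only [Instr.apply]
        rw [Function.update_of_ne hx', f1.natReg _ (by omega)]
      · intro x hx
        simp only [Instr.apply, f1.natMem]
    intro s₂ h₂
    have hstep1 : ∀ i s', i < n → I1 i s' → (Test.natLt 2 (8 * 0 + 1)).holds s' ∧
        Runs (.seq (e.compile 1) (block [.natStore 1 2 (8 * 1 + 1), .natConst (8 * 1 + 1) 1,
          .natOp .add 2 2 (8 * 1 + 1)])) s' (e.timeBd (V + N) + (N + E + (N + 10)))
          (I1 (i + 1)) := by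
      rintro i s' hi ⟨g1, g2, g3, g4, g5, g6, g7⟩
      refine ⟨by simp [Test.holds, g1, g2, hi], ?_⟩
      have henv : s'.env = s.env := by
        simp only [State.env]
        congr 1
        · funext v; exact g4 _ (by omega) (by omega)
        · funext v; exact g5 _ (by omega)
      have hloc : s'.loc 0 = i := g2
      have hlocs : ∀ j, s'.loc j ≤ V + N := by
        intro j
        by_cases hj : j = 0
        · rw [hj, hloc]; omega
        · have h1 : s'.natReg (8 * j + 2) = s.natReg (8 * j + 2) := g4 _ (by omega) (by omega)
          have h2 : s.natReg (8 * j + 2) = 0 := hl j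
          simp only [State.loc]; omega
      refine Runs.seq (e.compile_runs 1 (henv ▸ hs) (by omega) hlocs) ?_ le_rfl
      rintro s'' ⟨k1, k2⟩
      rw [he, henv, hloc] at k1
      have k3 : s''.natReg 2 = i := (k2.natReg 2 (by omega)).trans g2
      have k4 : s''.natReg 1 = n := (k2.natReg 1 (by omega)).trans g1
      have hE := hfE i hi.le
      have z1 := size_le_self i
      have z2 := size_le_self (f s.env i)
      rw [show N + E + (N + 10) = (1 + N + E) + (2 + (N + 7)) by omega]
      refine Runs.cons ?_ (Runs.cons ?_ (Runs.instr _ _ ?_ ⟨?_, ?_, ?_, ?_, ?_, ?_, ?_⟩))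
      · simp only [Instr.cost, k1, k3]; omega
      · simp [Instr.cost]
      · simp [Instr.cost, Instr.apply, k3]; omega
      · simpa [Instr.apply] using k4
      · simp [Instr.apply, k3, NatOp.eval]
      · intro j hj
        simp only [Instr.apply, write_apply, k3, k1]
        by_cases hji : j = i
        · simp [hji]
        · simp only [hji, and_false, if_false, k2.natMem]
          exact g3 j (by omega)
      · intro x hx hx'
        simp only [Instr.apply]
        rw [Function.update_of_ne (by omega), Function.update_of_ne (by omega),
          k2.natReg _ (by omega), g4 x hx hx']
      · intro x hx
        simp only [Instr.apply, write, Function.update_of_ne hx, k2.natMem]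
        exact g5 x hx
      · exact k2.realReg.trans g6
      · exact k2.realMem.trans g7
    refine Runs.seq (M := I1 n) (T₂ := 9 + (N * (2 * N + 1 + (2 * N + 2 * E + (N + 10))) + (2 * N + 1)))
      (Runs.loop I1 (c := 2 * N + 1) (fun i s' hi h => ?_) hstep1 (fun s' h => ?_) h₂
        (Nat.add_le_add_right (Nat.mul_le_mul_right _ hnN) _)) ?_ (by omega)
    · simp only [Test.cost, h.1, h.2.1]
      have z1 := size_le_self i
      have z2 := size_le_self n
      omega
    · simp [Test.holds, h.1, h.2.1]
    rintro s₃ ⟨g1, g2, g3, g4, g5, g6, g7⟩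
    refine Runs.seq (M := I2 0) (T₁ := 1)
      (T₂ := 8 + (N * (2 * N + 1 + (2 * N + 2 * E + (N + 10))) + (2 * N + 1))) ?_ ?_ (by omega)
    · refine Runs.instr _ _ (by simp [Instr.cost]) ⟨?_, ?_, ?_, ?_, ?_, ?_, g6, g7⟩
      · simpa [Instr.apply] using g1
      · simp [Instr.apply]
      · exact g3
      · intro x hx hx'
        simp only [Instr.apply]
        rw [Function.update_of_ne hx', g4 _ hx hx']
      · intro x hx _
        exact g5 x hx
      · intro j
        simp only [Instr.apply, g5 (8 * a) (by omega)]
        simp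
    intro s₄ h₄
    have hstep2 : ∀ i s', i < n → I2 i s' → (Test.natLt 2 (8 * 0 + 1)).holds s' ∧
        Runs (block [.natLoad (8 * 1 + 1) 1 2, .natStore (8 * a) 2 (8 * 1 + 1),
          .natConst (8 * 1 + 1) 1, .natOp .add 2 2 (8 * 1 + 1)]) s'
          (2 * N + 2 * E + (N + 10)) (I2 (i + 1)) := by
      rintro i s' hi ⟨g1, g2, g3, g4, g5, g6, g7, g8⟩
      refine ⟨by simp [Test.holds, g1, g2, hi], ?_⟩
      have hE := hfE i hi.le
      have z1 := size_le_self i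
      have z2 := size_le_self (f s.env i)
      have gi := g3 i hi
      rw [show 2 * N + 2 * E + (N + 10) = (1 + N + E) + ((1 + N + E) + (2 + (N + 6))) by omega]
      refine Runs.cons ?_ (Runs.cons ?_ (Runs.cons ?_ (Runs.instr _ _ ?_
        ⟨?_, ?_, ?_, ?_, ?_, ?_, g7, g8⟩)))
      · simp only [Instr.cost, g2, gi]; omega
      · simp [Instr.cost, Instr.apply, g2, gi]; omega
      · simp [Instr.cost]
      · simp [Instr.cost, Instr.apply, g2]; omega
      · simpa [Instr.apply] using g1
      · simp [Instr.apply, g2, NatOp.eval]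
      · intro j hj
        simp only [Instr.apply, write_apply]
        rw [if_neg (by omega)]
        exact g3 j hj
      · intro x hx hx'
        simp only [Instr.apply]
        rw [Function.update_of_ne (by omega), Function.update_of_ne (by omega),
          Function.update_of_ne (by omega), g4 x hx hx']
      · intro x hx hx'
        simp only [Instr.apply, write, Function.update_of_ne hx']
        exact g5 x hx hx'
      · intro j
        simp only [Instr.apply, write_apply]
        have e1 : Function.update s'.natReg (8 * 1 + 1) (s'.natMem 1 (s'.natReg 2)) 2 = i := by
          rw [Function.update_of_ne (by omega), g2]
        rw [e1, Function.update_self, g2, gi, g6 j]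
        by_cases hji : j = i
        · simp [hji]
        · simp only [hji, and_false, if_false]
          by_cases hji' : j < i
          · rw [if_pos hji', if_pos (by omega)]
          · rw [if_neg hji', if_neg (by omega)]
    refine Runs.seq (M := I2 n) (T₂ := 8) (Runs.loop I2 (c := 2 * N + 1) (fun i s' hi h => ?_)
      hstep2 (fun s' h => ?_) h₄ (Nat.add_le_add_right (Nat.mul_le_mul_right _ hnN) _)) ?_
      (by omega)
    · simp only [Test.cost, h.1, h.2.1]
      have z1 := size_le_self i
      have z2 := size_le_self n
      omega
    · simp [Test.holds, h.1, h.2.1]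
    rintro s₅ ⟨g1, g2, g3, g4, g5, g6, g7, g8⟩
    refine Runs.instr _ _ (by simp [Instr.cost]) ⟨?_, ?_, ?_, g7, g8⟩
    · simp only [State.env, Env.setArr, Instr.apply]
      congr 1
      · funext v
        rw [Function.update_of_ne (by omega), g4 _ (by omega) (by omega)]
      · funext x
        by_cases hx : x = a
        · subst hx; funext j; rw [g6 j, Function.update_self]; rfl
        · rw [Function.update_of_ne hx, g5 _ (by omega) (by omega)]
    · intro x hx hx'
      simp only [Instr.apply]
      by_cases h2 : x = 2
      · subst h2; rw [Function.update_self]; exact (hl 0).symm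
      · rw [Function.update_of_ne h2, g4 _ hx' h2]
    · intro x hx hx'
      exact g5 x (by omega) (by omega)
  · obtain ⟨c, hc⟩ := (e.bd_polyBd.comp (Expr.PolyBd.id.add e'.bd_polyBd)).add .id
    refine ⟨c, fun m V hm => ?_⟩
    refine Env.Bdd.mono (V := e.bd (V + e'.bd V) + V) ⟨fun x => (hm.1 x).trans (by omega), fun x i => ?_⟩ (hc V)
    simp only [Env.setArr, Function.update_apply]
    have := hm.2 x i
    have h2 := hbb hm
    split
    · rename_i hx
      subst hx
      dsimp only
      split
      · have := hff hm (i := i) (W := e'.bd V) (by omega)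
        omega
      · omega
    · omega

/-- The loop `while v < u do P` for small variables `v`, `u`, if it makes `n` rounds. -/
theorem Program.Acts.loop_runs {P : Program} {F : Env → Env} (hP : P.Acts F) (v u : ℕ) :
    ∃ c, ∀ (s : State) (V n : ℕ), (∀ i, s.loc i = 0) → (∀ i ≤ n, (F^[i] s.env).Bdd V) →
      (∀ i < n, (F^[i] s.env).var v < (F^[i] s.env).var u) →
      ¬ (F^[n] s.env).var v < (F^[n] s.env).var u →
      Runs (.loop (.natLt (8 * v) (8 * u)) P) s ((n + 1) * (V + 2) ^ c)
        fun s' => s'.env = F^[n] s.env ∧ SmallFrame s s' := by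
  -- The growth bound for a single application of `F` is dropped, as iterating it would not remain
  -- polynomial; instead a common bound `V` for all iterates is assumed.
  obtain ⟨⟨c, hc⟩, -⟩ := hP
  obtain ⟨k, hk⟩ := (((Expr.PolyBd.const 2).mul .id).add (.const 1)).add
    (show Expr.PolyBd fun V => (V + 2) ^ c from ⟨c, fun _ => le_rfl⟩)
  refine ⟨k, fun s V n hl hB hlt hge => ?_⟩
  refine (Runs.loop (fun i s' => s'.env = F^[i] s.env ∧ SmallFrame s s') (c := 2 * V + 1)
    (T := (V + 2) ^ c) ?_ ?_ ?_ (n := n) (s := s) ⟨rfl, .refl s⟩ le_rfl).mono ?_ fun _ h => h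
  · rintro i s' hi ⟨h1, -⟩
    have e1 : s'.natReg (8 * v) ≤ V := by
      rw [show s'.natReg (8 * v) = s'.env.var v from rfl, h1]; exact (hB i hi).1 v
    have e2 : s'.natReg (8 * u) ≤ V := by
      rw [show s'.natReg (8 * u) = s'.env.var u from rfl, h1]; exact (hB i hi).1 u
    simp only [Test.cost]
    have z1 := size_le_self (s'.natReg (8 * v))
    have z2 := size_le_self (s'.natReg (8 * u))
    omega
  · rintro i s' hi ⟨h1, h2⟩
    refine ⟨?_, ?_⟩
    · change s'.env.var v < s'.env.var u
      rw [h1]; exact hlt i hi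
    · refine (hc s' V (h1 ▸ hB i hi.le) (by rw [h2.loc]; exact hl)).mono le_rfl ?_
      rintro s'' ⟨h3, h4⟩
      exact ⟨by rw [h3, h1, Function.iterate_succ_apply'], h2.trans h4⟩
  · rintro s' ⟨h1, -⟩
    change ¬ s'.env.var v < s'.env.var u
    rwa [h1]
  · rw [add_mul, one_mul]
    have h1 : 2 * V + 1 + (V + 2) ^ c ≤ (V + 2) ^ k := hk V
    exact Nat.add_le_add (Nat.mul_le_mul_left n h1) (by omega)

end RealRAM

/-! ## Sparsification

Clauses are finite sets of natural numbers, which stand for literals. -/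

/-! ### Sparsification: hearts, petals and the invariant that bounds the branching -/

namespace Sparsify

abbrev Clauses := Finset (Finset ℕ)

/-- The clauses that contain no other clause. -/
def minimal (S : Clauses) : Clauses := S.filter fun C => ∀ E ∈ S, E ⊆ C → E = C

/-- The minimal clauses of size `c` that contain `H`. -/
def fam (S : Clauses) (c : ℕ) (H : Finset ℕ) : Clauses :=
  (minimal S).filter fun C => C.card = c ∧ H ⊆ C

/-- The set `H` is contained in too many minimal clauses of size `c`. -/
def Viol (θ : ℕ → ℕ) (k : ℕ) (S : Clauses) (c : ℕ) (H : Finset ℕ) : Prop :=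
  c ≤ k ∧ 1 ≤ H.card ∧ H.card < c ∧ θ (c - H.card) ≤ (fam S c H).card

/-- A violation with the least `c` and, among those, the largest `H`. -/
def Choice (θ : ℕ → ℕ) (k : ℕ) (S : Clauses) (c : ℕ) (H : Finset ℕ) : Prop :=
  Viol θ k S c H ∧ ∀ c' H', Viol θ k S c' H' → c < c' ∨ c = c' ∧ c - H.card ≤ c' - H'.card

/-- If no literal of `H` is true, the clauses that contain `H` stay true after `H` is removed from
them. So every assignment that satisfies `S` satisfies `S ∪ {H}` or `S ∪ petals S c H`. -/
def petals (S : Clauses) (c : ℕ) (H : Finset ℕ) : Clauses := (fam S c H).image fun C => C \ H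

def Sat (σ : ℕ → Prop) (S : Clauses) : Prop := ∀ C ∈ S, ∃ y ∈ C, σ y

/-- Clauses of at most `k` of the literals `0, …, L - 1`. -/
def WF (k L : ℕ) (S : Clauses) : Prop := ∀ C ∈ S, C ⊆ Finset.range L ∧ C.card ≤ k

/-- The number of clauses of size `i` in `S` but not in `S₀`. -/
def added (S₀ S : Clauses) (i : ℕ) : Clauses := (S \ S₀).filter fun C => C.card = i

def addedLt (S₀ S : Clauses) (i : ℕ) : Clauses := (S \ S₀).filter fun C => C.card < i

/-- Here `S` has come from `S₀` by `h` heart steps and `p` petal steps. The fields `deg` and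
`nonmin` serve to bound the number of added clauses of each size by a multiple of `L`, by induction
on the size. The field `pet` charges a petal step with petals of size `i` to the clauses of size `i`
that it adds, of which there are at least `θ i`. -/
structure Inv (θ : ℕ → ℕ) (k L : ℕ) (S₀ S : Clauses) (h p : ℕ) : Prop where
  sub : S₀ ⊆ S
  wf : WF k L S
  pos : ∀ C ∈ S \ S₀, 1 ≤ C.card ∧ C.card < k
  deg : ∀ i, (added S₀ S i).Nonempty → ∀ x, (fam S i {x}).card ≤ 2 * θ (i - 1)
  nonmin : ∀ i, ((added S₀ S i).filter fun C => C ∉ minimal S).card ≤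
    2 * θ (i - 1) * (addedLt S₀ S i).card
  steps : h + p ≤ (S \ S₀).card
  pet : (p : ℚ) ≤ ∑ i ∈ Finset.Ico 1 k, ((added S₀ S i).card : ℚ) / θ i

theorem mem_minimal {S : Clauses} {C : Finset ℕ} :
    C ∈ minimal S ↔ C ∈ S ∧ ∀ E ∈ S, E ⊆ C → E = C := by
  simp [minimal]

theorem mem_fam {S : Clauses} {c : ℕ} {H C : Finset ℕ} :
    C ∈ fam S c H ↔ C ∈ minimal S ∧ C.card = c ∧ H ⊆ C := by
  simp [fam]

theorem fam_card_le_one {S : Clauses} {c : ℕ} {H : Finset ℕ} (h : c ≤ H.card) :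
    (fam S c H).card ≤ 1 := by
  refine Finset.card_le_one.2 fun A hA B hB => ?_
  rw [mem_fam] at hA hB
  rw [← Finset.eq_of_subset_of_card_le hA.2.2 (by omega),
    ← Finset.eq_of_subset_of_card_le hB.2.2 (by omega)]

section step

variable {θ : ℕ → ℕ} {k L : ℕ} {S₀ S New : Clauses} {h p j : ℕ}

theorem minimal_union_subset : minimal (S ∪ New) ⊆ minimal S ∪ New := by
  intro C hC
  rw [mem_minimal] at hC
  rw [Finset.mem_union, mem_minimal]
  rcases Finset.mem_union.1 hC.1 with h | h
  · exact Or.inl ⟨h, fun E hE => hC.2 E (Finset.mem_union_left _ hE)⟩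
  · exact Or.inr h

theorem added_union_eq (hsub : S₀ ⊆ S) (hfresh : ∀ E ∈ New, E ∉ S) (hcard : ∀ E ∈ New, E.card = j)
    (i : ℕ) : (added S₀ (S ∪ New) i).card = (added S₀ S i).card + if i = j then New.card else 0 := by
  have : added S₀ (S ∪ New) i = added S₀ S i ∪ if i = j then New else ∅ := by
    ext C
    simp only [added, Finset.mem_filter, Finset.mem_sdiff, Finset.mem_union]
    constructor
    · rintro ⟨⟨h1 | h1, h2⟩, h3⟩
      · exact Or.inl ⟨⟨h1, h2⟩, h3⟩
      · right; rw [← h3, if_pos (hcard C h1)]; exact h1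
    · rintro (⟨⟨h1, h2⟩, h3⟩ | h1)
      · exact ⟨⟨Or.inl h1, h2⟩, h3⟩
      · split at h1
        · rename_i hij
          exact ⟨⟨Or.inr h1, fun h2 => hfresh C h1 (hsub h2)⟩, by rw [hcard C h1, hij]⟩
        · simp at h1
  rw [this, Finset.card_union_of_disjoint]
  · split <;> simp
  · split
    · refine Finset.disjoint_left.2 fun C hC hC' => hfresh C hC' ?_
      simp only [added, Finset.mem_filter, Finset.mem_sdiff] at hC
      exact hC.1.1
    · simp

theorem addedLt_union_eq (hsub : S₀ ⊆ S) (hfresh : ∀ E ∈ New, E ∉ S)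
    (hcard : ∀ E ∈ New, E.card = j) (i : ℕ) :
    (addedLt S₀ (S ∪ New) i).card = (addedLt S₀ S i).card + if j < i then New.card else 0 := by
  have : addedLt S₀ (S ∪ New) i = addedLt S₀ S i ∪ if j < i then New else ∅ := by
    ext C
    simp only [addedLt, Finset.mem_filter, Finset.mem_sdiff, Finset.mem_union]
    constructor
    · rintro ⟨⟨h1 | h1, h2⟩, h3⟩
      · exact Or.inl ⟨⟨h1, h2⟩, h3⟩
      · right; rw [if_pos (by rw [← hcard C h1]; exact h3)]; exact h1
    · rintro (⟨⟨h1, h2⟩, h3⟩ | h1)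
      · exact ⟨⟨Or.inl h1, h2⟩, h3⟩
      · split at h1
        · rename_i hij
          exact ⟨⟨Or.inr h1, fun h2 => hfresh C h1 (hsub h2)⟩, by rw [hcard C h1]; exact hij⟩
        · simp at h1
  rw [this, Finset.card_union_of_disjoint]
  · split <;> simp
  · split
    · refine Finset.disjoint_left.2 fun C hC hC' => hfresh C hC' ?_
      simp only [addedLt, Finset.mem_filter, Finset.mem_sdiff] at hC
      exact hC.1.1
    · simp

/-- The common part of both kinds of steps. At the moment when clauses of size `j` are added, a
literal is in at most `θ (j - 1)` old minimal clauses of size `j` and in at most as many new ones;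
this gives the factor 2 in `deg`. A minimal clause of size `i` can lose minimality only to a new
clause `E` of smaller size; such clauses contain any fixed literal of `E`, so by `deg` each `E` is
responsible for at most `2 θ (i - 1)` of them. -/
theorem Inv.union (hI : Inv θ k L S₀ S h p) (hθ : ∀ i, 1 ≤ θ i) (hj : 1 ≤ j) (hjk : j < k)
    (hcard : ∀ E ∈ New, E.card = j) (hne : New.Nonempty) (hL : ∀ E ∈ New, E ⊆ Finset.range L)
    (hmin : ∀ E ∈ New, ∀ E' ∈ S, ¬ E' ⊆ E)
    (hdegNew : ∀ x, (New.filter fun E => x ∈ E).card ≤ θ (j - 1))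
    (hdegOld : ∀ x, (fam S j {x}).card ≤ θ (j - 1)) {h' p' : ℕ}
    (hh : h' + p' ≤ h + p + 1) (hp : p' = p ∨ p' = p + 1 ∧ θ j ≤ New.card) :
    Inv θ k L S₀ (S ∪ New) h' p' := by
  have hfresh : ∀ E ∈ New, E ∉ S := fun E hE hE' => hmin E hE E hE' subset_rfl
  refine ⟨hI.sub.trans Finset.subset_union_left, ?_, ?_, ?_, ?_, ?_, ?_⟩
  · intro C hC
    rcases Finset.mem_union.1 hC with h | h
    · exact hI.wf C h
    · exact ⟨hL C h, by rw [hcard C h]; omega⟩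
  · intro C hC
    rw [Finset.mem_sdiff, Finset.mem_union] at hC
    rcases hC.1 with h | h
    · exact hI.pos C (Finset.mem_sdiff.2 ⟨h, hC.2⟩)
    · rw [hcard C h]; omega
  · intro i hi x
    by_cases hij : i = j
    · subst hij
      have hsub : fam (S ∪ New) i {x} ⊆ fam S i {x} ∪ New.filter fun E => x ∈ E := by
        intro C hC
        rw [mem_fam] at hC
        rw [Finset.mem_union, mem_fam, Finset.mem_filter]
        rcases Finset.mem_union.1 (minimal_union_subset hC.1) with h | h
        · exact Or.inl ⟨h, hC.2⟩
        · exact Or.inr ⟨h, Finset.singleton_subset_iff.1 hC.2.2⟩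
      calc _ ≤ _ := Finset.card_le_card hsub
        _ ≤ _ := Finset.card_union_le _ _
        _ ≤ 2 * θ (i - 1) := by have := hdegNew x; have := hdegOld x; omega
    · have hsub : fam (S ∪ New) i {x} ⊆ fam S i {x} := by
        intro C hC
        rw [mem_fam] at hC
        rw [mem_fam]
        rcases Finset.mem_union.1 (minimal_union_subset hC.1) with h | h
        · exact ⟨h, hC.2⟩
        · exact absurd ((hC.2.1).symm.trans (hcard C h)) hij
      refine (Finset.card_le_card hsub).trans (hI.deg i ?_ x)
      rw [← Finset.card_pos] at hi ⊢
      rw [added_union_eq hI.sub hfresh hcard, if_neg hij] at hi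
      exact hi
  · intro i
    rw [addedLt_union_eq hI.sub hfresh hcard]
    have hsub : ((added S₀ (S ∪ New) i).filter fun C => C ∉ minimal (S ∪ New)) ⊆
        ((added S₀ S i).filter fun C => C ∉ minimal S) ∪
          if j < i then New.biUnion fun E => (added S₀ S i).filter fun C => C ∈ fam S i E else ∅ := by
      intro C hC
      simp only [added, Finset.mem_filter, Finset.mem_sdiff, Finset.mem_union] at hC
      obtain ⟨⟨⟨h1, h2⟩, h3⟩, h4⟩ := hC
      rw [mem_minimal] at h4
      push Not at h4
      obtain ⟨E, hE, hEC, hne⟩ := h4 (Finset.mem_union.2 h1)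
      have hlt : E.card < C.card := Finset.card_lt_card (hEC.ssubset_of_ne hne)
      have hCS : C ∈ S := by
        rcases h1 with h1 | h1
        · exact h1
        · rcases Finset.mem_union.1 hE with hE | hE
          · exact absurd hEC (hmin C h1 E hE)
          · rw [hcard C h1, hcard E hE] at hlt; omega
      have hadd : C ∈ added S₀ S i := by
        simp only [added, Finset.mem_filter, Finset.mem_sdiff]
        exact ⟨⟨hCS, h2⟩, h3⟩
      rw [Finset.mem_union]
      by_cases hCm : C ∈ minimal S
      · right
        rcases Finset.mem_union.1 hE with hE | hE
        · exact absurd ((mem_minimal.1 hCm).2 E hE hEC) hne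
        · rw [if_pos (by rw [← h3, ← hcard E hE]; exact hlt), Finset.mem_biUnion]
          exact ⟨E, hE, Finset.mem_filter.2 ⟨hadd, mem_fam.2 ⟨hCm, h3, hEC⟩⟩⟩
      · exact Or.inl (Finset.mem_filter.2 ⟨hadd, hCm⟩)
    refine (Finset.card_le_card hsub).trans ((Finset.card_union_le _ _).trans ?_)
    rw [mul_add]
    refine Nat.add_le_add (hI.nonmin i) ?_
    split
    · refine (Finset.card_biUnion_le_card_mul _ _ (2 * θ (i - 1)) fun E hE => ?_).trans
        (by rw [mul_comm])
      by_cases hA : (added S₀ S i).Nonempty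
      · have hEne : E.Nonempty := Finset.card_pos.1 (by rw [hcard E hE]; omega)
        obtain ⟨x, hx⟩ := hEne
        refine (Finset.card_le_card fun C hC => ?_).trans (hI.deg i hA x)
        have h5 := mem_fam.1 (Finset.mem_filter.1 hC).2
        exact mem_fam.2 ⟨h5.1, h5.2.1, Finset.singleton_subset_iff.2 (h5.2.2 hx)⟩
      · rw [Finset.not_nonempty_iff_eq_empty.1 hA]; simp
    · simp
  · have : ((S ∪ New) \ S₀).card = (S \ S₀).card + New.card := by
      rw [Finset.union_sdiff_distrib, Finset.sdiff_eq_self_of_disjoint (s := New),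
        Finset.card_union_of_disjoint]
      · exact Finset.disjoint_left.2 fun C hC hC' => hfresh C hC' (Finset.mem_sdiff.1 hC).1
      · exact Finset.disjoint_left.2 fun C hC hC' => hfresh C hC (hI.sub hC')
    have h1 := hI.steps
    have h2 := hne.card_pos
    omega
  · have hadd := fun i => added_union_eq hI.sub hfresh hcard i
    have hmono : ∀ i, (added S₀ S i).card ≤ (added S₀ (S ∪ New) i).card := fun i => by
      rw [hadd]; omega
    rcases hp with rfl | ⟨rfl, hp⟩
    · refine hI.pet.trans (Finset.sum_le_sum fun i _ => ?_)
      exact div_le_div_of_nonneg_right (by exact_mod_cast hmono i) (Nat.cast_nonneg _)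
    -- A petal step adds at least `θ j` clauses of size `j`, so the summand of `j` grows by at least
    -- 1.
    · have hjm : j ∈ Finset.Ico 1 k := Finset.mem_Ico.2 ⟨hj, hjk⟩
      have hpet := hI.pet
      rw [← Finset.add_sum_erase _ _ hjm] at hpet ⊢
      have h1 : ∑ i ∈ (Finset.Ico 1 k).erase j, ((added S₀ S i).card : ℚ) / θ i ≤
          ∑ i ∈ (Finset.Ico 1 k).erase j, ((added S₀ (S ∪ New) i).card : ℚ) / θ i :=
        Finset.sum_le_sum fun i _ =>
          div_le_div_of_nonneg_right (by exact_mod_cast hmono i) (Nat.cast_nonneg _)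
      have h2 : ((added S₀ (S ∪ New) j).card : ℚ) / θ j ≥ ((added S₀ S j).card : ℚ) / θ j + 1 := by
        have hpos : (0 : ℚ) < θ j := by exact_mod_cast hθ j
        rw [hadd, if_pos rfl, Nat.cast_add, add_div]
        have : (1 : ℚ) ≤ (New.card : ℚ) / θ j := by
          rw [le_div_iff₀ hpos, one_mul]; exact_mod_cast hp
        linarith
      push_cast
      linarith

theorem Choice.fam_nonempty (hθ : ∀ i, 1 ≤ θ i) {c : ℕ} {H : Finset ℕ} (hc : Choice θ k S c H) :
    (fam S c H).Nonempty :=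
  Finset.card_pos.1 ((hθ _).trans hc.1.2.2.2)

/-- No size below `c` has a violation. Size 1 is treated apart because a heart must be smaller than
the clauses. -/
theorem Choice.fam_le (hθ : ∀ i, 1 ≤ θ i) {c : ℕ} {H : Finset ℕ} (hc : Choice θ k S c H)
    (hj : 1 ≤ j) (hjc : j < c) (x : ℕ) : (fam S j {x}).card ≤ θ (j - 1) := by
  by_cases hj1 : j = 1
  · exact (fam_card_le_one (by simp [hj1])).trans (hθ _)
  · by_contra hcon
    have := hc.2 j {x} ⟨hjc.le.trans hc.1.1, by simp, by simp; omega, by simp; omega⟩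
    omega

theorem Inv.heart (hI : Inv θ k L S₀ S h p) (hθ : ∀ i, 1 ≤ θ i) {c : ℕ} {H : Finset ℕ}
    (hc : Choice θ k S c H) : Inv θ k L S₀ (S ∪ {H}) (h + 1) p := by
  obtain ⟨C, hC⟩ := hc.fam_nonempty hθ
  rw [mem_fam, mem_minimal] at hC
  obtain ⟨hck, h1, hlt, -⟩ := hc.1
  refine hI.union (j := H.card) hθ h1 (by omega) (by simp) (by simp) ?_ ?_ ?_ ?_ (by omega)
    (Or.inl rfl)
  · simpa using hC.2.2.trans (hI.wf C hC.1.1).1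
  · simp only [Finset.mem_singleton, forall_eq]
    intro E hE hEH
    have := hC.1.2 E hE (hEH.trans hC.2.2)
    have h2 := Finset.card_le_card hEH
    rw [this, hC.2.1] at h2
    omega
  · intro x
    refine (Finset.card_filter_le _ _).trans ?_
    simpa using hθ _
  · exact fun x => hc.fam_le hθ h1 hlt x

/-- The heart `H` is a largest one. For `x ∉ H` the petals through `x` come from clauses that
contain `insert x H`, and more than `θ (j - 1)` of these would make `insert x H` a violation of the
same size with a larger heart. -/
theorem Inv.petals (hI : Inv θ k L S₀ S h p) (hθ : ∀ i, 1 ≤ θ i) {c : ℕ} {H : Finset ℕ}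
    (hc : Choice θ k S c H) : Inv θ k L S₀ (S ∪ petals S c H) h (p + 1) := by
  have hne := hc.fam_nonempty hθ
  obtain ⟨hck, h1, hlt, hv⟩ := hc.1
  obtain ⟨y, hy⟩ := Finset.card_pos.1 h1
  have hmem : ∀ E ∈ Sparsify.petals S c H, ∃ C ∈ fam S c H, C \ H = E := by
    intro E hE; simpa [Sparsify.petals] using hE
  have hinj : Set.InjOn (fun C => C \ H) (fam S c H : Set (Finset ℕ)) := by
    intro A hA B hB hAB
    have hA' := (mem_fam.1 hA).2.2
    have hB' := (mem_fam.1 hB).2.2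
    simp only at hAB
    rw [← Finset.sdiff_union_of_subset hA', hAB, Finset.sdiff_union_of_subset hB']
  refine hI.union (j := c - H.card) hθ (by omega) (by omega) ?_ (hne.image _) ?_ ?_ ?_ ?_ (by omega)
    (Or.inr ⟨rfl, ?_⟩)
  · intro E hE
    obtain ⟨C, hC, rfl⟩ := hmem E hE
    rw [mem_fam] at hC
    rw [Finset.card_sdiff_of_subset hC.2.2, hC.2.1]
  · intro E hE
    obtain ⟨C, hC, rfl⟩ := hmem E hE
    rw [mem_fam, mem_minimal] at hC
    exact Finset.sdiff_subset.trans (hI.wf C hC.1.1).1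
  · intro E hE E' hE' hsub
    obtain ⟨C, hC, rfl⟩ := hmem E hE
    rw [mem_fam, mem_minimal] at hC
    -- A clause inside the petal lies inside the minimal clause `C` and is therefore equal to `C`;
    -- but `C` contains `y ∈ H`, and the petal does not.
    have h2 := hC.1.2 E' hE' (hsub.trans Finset.sdiff_subset)
    rw [h2] at hsub
    exact (Finset.mem_sdiff.1 (hsub (hC.2.2 hy))).2 hy
  · intro x
    by_cases hx : x ∈ H
    · rw [Finset.filter_false_of_mem]
      · simp
      · intro E hE hxE
        obtain ⟨C, hC, rfl⟩ := hmem E hE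
        exact (Finset.mem_sdiff.1 hxE).2 hx
    have h2 : ((Sparsify.petals S c H).filter fun E => x ∈ E).card ≤ (fam S c (insert x H)).card := by
      refine (Finset.card_le_card (t := (fam S c (insert x H)).image fun C => C \ H) ?_).trans
        Finset.card_image_le
      intro E hE
      rw [Finset.mem_filter] at hE
      obtain ⟨C, hC, rfl⟩ := hmem E hE.1
      refine Finset.mem_image.2 ⟨C, ?_, rfl⟩
      rw [mem_fam] at hC ⊢
      exact ⟨hC.1, hC.2.1, Finset.insert_subset (Finset.mem_sdiff.1 hE.2).1 hC.2.2⟩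
    have h3 : (insert x H).card = H.card + 1 := Finset.card_insert_of_notMem hx
    refine h2.trans ?_
    by_cases hlt' : H.card + 1 < c
    · by_contra hcon
      have h4 := hc.2 c (insert x H) ⟨hck, by omega, by omega, by
        rw [h3, show c - (H.card + 1) = c - H.card - 1 by omega]; omega⟩
      omega
    · exact (fam_card_le_one (by omega)).trans (hθ _)
  · exact fun x => hc.fam_le hθ (by omega) (by omega) x
  · exact hv.trans_eq (Finset.card_image_of_injOn hinj).symm

end step

/-! ### The thresholds -/

/-- The thresholds `θ i` together with bounds for the number of added clauses. -/
def thresh (α : ℕ) : ℕ → ℕ × ℕ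
  | 0 => (1, 0)
  -- If at most `B L` clauses of size at most `i` are added, then at most `2 θ (1 + B) L` of size `i
  -- + 1` are, where `θ` is the threshold of `i`. The next threshold is `α` times this coefficient,
  -- plus 1 to be positive.
  | i + 1 => (2 * α * (thresh α i).1 * (1 + (thresh α i).2) + 1,
      (thresh α i).2 + 2 * (thresh α i).1 * (1 + (thresh α i).2))

def theta (α i : ℕ) : ℕ := (thresh α i).1

theorem one_le_theta (α i : ℕ) : 1 ≤ theta α i := by
  cases i <;> simp [theta, thresh]

section count

variable {α k L : ℕ} {S₀ S : Clauses} {h p : ℕ}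

theorem card_minimal_filter_le {m : ℕ} (hwf : WF k L S) (c : ℕ) (hc : 1 ≤ c)
    (hm : ∀ x, (fam S c {x}).card ≤ m) :
    ((minimal S).filter fun C => C.card = c).card ≤ L * m := by
  have hsub : ((minimal S).filter fun C => C.card = c) ⊆
      (Finset.range L).biUnion fun x => fam S c {x} := by
    intro C hC
    rw [Finset.mem_filter] at hC
    obtain ⟨x, hx⟩ := Finset.card_pos.1 (hC.2 ▸ hc)
    refine Finset.mem_biUnion.2 ⟨x, (hwf C (mem_minimal.1 hC.1).1).1 hx, mem_fam.2 ⟨hC.1, hC.2, ?_⟩⟩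
    simpa using hx
  refine (Finset.card_le_card hsub).trans ?_
  simpa using Finset.card_biUnion_le_card_mul (Finset.range L) (fun x => fam S c {x}) m
    fun x _ => hm x

/-- The added clauses of size `i` that are minimal number at most `2 θ (i - 1)` per literal; those
that are not minimal number at most `2 θ (i - 1)` per smaller added clause. -/
theorem Inv.card_added_le (hI : Inv (theta α) k L S₀ S h p) {i B : ℕ} (hi : 1 ≤ i)
    (hB : (addedLt S₀ S i).card ≤ B * L) :
    (added S₀ S i).card ≤ 2 * theta α (i - 1) * (1 + B) * L := by
  by_cases hA : (added S₀ S i).Nonempty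
  · have h1 : ((added S₀ S i).filter fun C => C ∈ minimal S).card ≤ L * (2 * theta α (i - 1)) := by
      refine (Finset.card_le_card fun C hC => ?_).trans
        (card_minimal_filter_le hI.wf i hi (hI.deg i hA))
      simp only [added, Finset.mem_filter] at hC ⊢
      exact ⟨hC.2, hC.1.2⟩
    have h2 := hI.nonmin i
    have h3 := Finset.card_filter_add_card_filter_not (s := added S₀ S i) (fun C => C ∈ minimal S)
    have h4 : 2 * theta α (i - 1) * (addedLt S₀ S i).card ≤ 2 * theta α (i - 1) * (B * L) :=
      Nat.mul_le_mul_left _ hB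
    rw [← h3]
    calc _ ≤ L * (2 * theta α (i - 1)) + 2 * theta α (i - 1) * (B * L) :=
          Nat.add_le_add h1 (h2.trans h4)
      _ = _ := by ring
  · rw [Finset.not_nonempty_iff_eq_empty.1 hA]; simp

theorem Inv.card_addedLt_le (hI : Inv (theta α) k L S₀ S h p) (i : ℕ) :
    (addedLt S₀ S (i + 1)).card ≤ (thresh α i).2 * L := by
  induction i with
  | zero =>
    have : addedLt S₀ S (0 + 1) = ∅ := by
      refine Finset.filter_false_of_mem fun C hC => ?_
      have := (hI.pos C hC).1
      omega
    rw [this]; simp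
  | succ i ih =>
    have h1 : addedLt S₀ S (i + 1 + 1) ⊆ addedLt S₀ S (i + 1) ∪ added S₀ S (i + 1) := by
      intro C hC
      simp only [addedLt, added, Finset.mem_union, Finset.mem_filter] at hC ⊢
      by_cases h : C.card < i + 1
      · exact Or.inl ⟨hC.1, h⟩
      · exact Or.inr ⟨hC.1, by omega⟩
    have h2 := hI.card_added_le (by omega) ih
    refine (Finset.card_le_card h1).trans ((Finset.card_union_le _ _).trans ?_)
    simp only [thresh, add_tsub_cancel_right, theta] at h2 ⊢
    calc _ ≤ (thresh α i).2 * L + 2 * (thresh α i).1 * (1 + (thresh α i).2) * L :=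
          Nat.add_le_add ih h2
      _ = _ := by ring

theorem Inv.steps_le (hI : Inv (theta α) k L S₀ S h p) : h + p ≤ (thresh α k).2 * L := by
  refine hI.steps.trans ((Finset.card_le_card fun C hC => ?_).trans (hI.card_addedLt_le k))
  simp only [addedLt, Finset.mem_filter]
  exact ⟨hC, by have := (hI.pos C hC).2; omega⟩

/-- By the choice of the thresholds, `α` times the number of added clauses of size `i` is at most `L
θ i`. Each of the fewer than `k` sizes thus contributes at most `L / α` to the sum in `Inv.pet`. -/
theorem Inv.petals_le (hI : Inv (theta α) k L S₀ S h p) : p * α ≤ k * L := by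
  have h1 : ∀ i ∈ Finset.Ico 1 k, ((added S₀ S i).card : ℚ) / theta α i * α ≤ L := by
    intro i hi
    rw [Finset.mem_Ico] at hi
    obtain ⟨j, rfl⟩ : ∃ j, i = j + 1 := ⟨i - 1, by omega⟩
    have h2 := hI.card_added_le (i := j + 1) (by omega) (hI.card_addedLt_le j)
    have hpos : (0 : ℚ) < theta α (j + 1) := by exact_mod_cast one_le_theta _ _
    rw [div_mul_eq_mul_div, div_le_iff₀ hpos]
    have h3 : (added S₀ S (j + 1)).card * α ≤ L * theta α (j + 1) := by
      simp only [add_tsub_cancel_right, theta, thresh] at h2 ⊢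
      calc _ ≤ 2 * (thresh α j).1 * (1 + (thresh α j).2) * L * α := Nat.mul_le_mul_right _ h2
        _ ≤ _ := by nlinarith [Nat.zero_le L]
    exact_mod_cast h3
  have h2 : (p : ℚ) * α ≤ ∑ i ∈ Finset.Ico 1 k, (L : ℚ) := by
    refine (mul_le_mul_of_nonneg_right hI.pet (by positivity)).trans ?_
    rw [Finset.sum_mul]
    exact Finset.sum_le_sum h1
  have h3 : (p : ℚ) * α ≤ k * L := by
    refine h2.trans ?_
    simp only [Finset.sum_const, Nat.card_Ico, nsmul_eq_mul]
    gcongr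
    exact Nat.sub_le _ _
  exact_mod_cast h3

/-- A bound for the number of minimal clauses, per literal, when there is no violation. -/
def sparseBound (α k : ℕ) : ℕ := ∑ c ∈ Finset.range k, theta α c

/-- Applied to one-element hearts, the absence of violations bounds the number of minimal clauses of
each size through each literal. The summand 1 is for the empty clause. -/
theorem card_minimal_le (hwf : WF k L S) (hno : ∀ c H, ¬ Viol (theta α) k S c H) :
    (minimal S).card ≤ 1 + L * sparseBound α k := by
  have h1 : minimal S ⊆ {∅} ∪ (Finset.range k).biUnion fun c =>
      (minimal S).filter fun C => C.card = c + 1 := by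
    intro C hC
    by_cases h : C = ∅
    · exact Finset.mem_union_left _ (by simp [h])
    · have h2 : 0 < C.card := Finset.card_pos.2 (Finset.nonempty_iff_ne_empty.2 h)
      have h3 := (hwf C (mem_minimal.1 hC).1).2
      refine Finset.mem_union_right _ (Finset.mem_biUnion.2 ⟨C.card - 1, ?_, ?_⟩)
      · rw [Finset.mem_range]; omega
      · rw [Finset.mem_filter]; exact ⟨hC, by omega⟩
  refine (Finset.card_le_card h1).trans ((Finset.card_union_le _ _).trans ?_)
  rw [Finset.card_singleton, sparseBound, Finset.mul_sum]
  refine Nat.add_le_add_left (Finset.card_biUnion_le.trans (Finset.sum_le_sum fun c hc => ?_)) 1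
  rw [Finset.mem_range] at hc
  refine card_minimal_filter_le hwf (c + 1) (by omega) fun x => ?_
  by_cases hc0 : c = 0
  · exact (fam_card_le_one (by simp [hc0])).trans (one_le_theta _ _)
  · by_contra hcon
    exact hno (c + 1) {x} ⟨by omega, by simp, by simp; omega, by simp; omega⟩

/-- For fixed `k` the growth in `α` is polynomial; in `exists_params` the parameter `α` is linear in
`s`, so that `2 ^ s` wins. -/
theorem thresh_le (k : ℕ) : ∃ c g : ℕ, ∀ α, 1 ≤ α →
    (thresh α k).1 ≤ c * α ^ g ∧ (thresh α k).2 ≤ c * α ^ g := by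
  induction k with
  | zero => exact ⟨1, 0, fun α _ => by simp [thresh]⟩
  | succ k ih =>
    obtain ⟨c, g, h⟩ := ih
    refine ⟨2 * c * (1 + c) + c + 1, g + g + 1, fun α hα => ?_⟩
    obtain ⟨h1, h2⟩ := h α hα
    have hA : 1 ≤ α ^ g := Nat.one_le_pow _ _ hα
    set A := α ^ g
    have e : α ^ (g + g + 1) = A * A * α := by rw [pow_succ, pow_add]
    have h3 : (thresh α k).1 * (1 + (thresh α k).2) ≤ c * A * (A + c * A) :=
      Nat.mul_le_mul h1 (Nat.add_le_add hA h2)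
    have h4 : 1 ≤ A * A * α := Nat.mul_pos (Nat.mul_pos hA hA) hα
    have h5 : A ≤ A * A * α := by
      calc A = A * 1 * 1 := by ring
        _ ≤ A * A * α := Nat.mul_le_mul (Nat.mul_le_mul_left _ hA) hα
    have h6 : A * A ≤ A * A * α := Nat.le_mul_of_pos_right _ hα
    rw [e]
    simp only [thresh]
    constructor
    · calc 2 * α * (thresh α k).1 * (1 + (thresh α k).2) + 1
          = 2 * α * ((thresh α k).1 * (1 + (thresh α k).2)) + 1 := by ring
        _ ≤ 2 * α * (c * A * (A + c * A)) + A * A * α :=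
          Nat.add_le_add (Nat.mul_le_mul_left _ h3) h4
        _ ≤ _ := by
          have : c * (A * A * α) ≥ 0 := Nat.zero_le _
          nlinarith
    · calc (thresh α k).2 + 2 * (thresh α k).1 * (1 + (thresh α k).2)
          = (thresh α k).2 + 2 * ((thresh α k).1 * (1 + (thresh α k).2)) := by ring
        _ ≤ c * A + 2 * (c * A * (A + c * A)) :=
          Nat.add_le_add h2 (Nat.mul_le_mul_left _ h3)
        _ = c * A + (2 * c * (1 + c)) * (A * A) := by ring
        _ ≤ c * (A * A * α) + (2 * c * (1 + c)) * (A * A * α) :=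
          Nat.add_le_add (Nat.mul_le_mul_left _ h5) (Nat.mul_le_mul_left _ h6)
        _ ≤ _ := by nlinarith

end count

/-! ### Runs with advice -/

section run

variable (ch : Clauses → Option (ℕ × Finset ℕ))

/-- One step: add the heart (`mode = 1`), add the petals (`mode = 2`), or do nothing. -/
def step (mode : ℕ) (S : Clauses) : Clauses :=
  match ch S with
  | none => S
  | some (c, H) => if mode = 1 then S ∪ {H} else if mode = 2 then S ∪ petals S c H else S

def run (m : ℕ → ℕ) : ℕ → Clauses → Clauses
  | 0, S => S
  | n + 1, S => step ch (m n) (run m n S)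

/-- Within a chunk of length `D`: `v` hearts, then petals if there is room. -/
def chunkMode (D v u : ℕ) : ℕ := if u < v then 1 else if u = v ∧ u + 1 < D then 2 else 0

def adviceMode (D : ℕ) (z : ℕ → ℕ) (τ : ℕ) : ℕ := chunkMode D (z (τ / D)) (τ % D)

variable {ch}

theorem run_add (m : ℕ → ℕ) (a b : ℕ) (S : Clauses) :
    run ch m (a + b) S = run ch (fun i => m (a + i)) b (run ch m a S) := by
  induction b with
  | zero => rfl
  | succ b ih => rw [← add_assoc, run, run, ih]

theorem run_congr {m m' : ℕ → ℕ} {n : ℕ} (h : ∀ i < n, m i = m' i) (S : Clauses) :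
    run ch m n S = run ch m' n S := by
  induction n with
  | zero => rfl
  | succ n ih => rw [run, run, ih fun i hi => h i (by omega), h n (by omega)]

theorem subset_step (mode : ℕ) (S : Clauses) : S ⊆ step ch mode S := by
  unfold step
  split
  · exact subset_rfl
  · split_ifs
    · exact Finset.subset_union_left
    · exact Finset.subset_union_left
    · exact subset_rfl

theorem subset_run (m : ℕ → ℕ) (n : ℕ) (S : Clauses) : S ⊆ run ch m n S := by
  induction n with
  | zero => exact subset_rfl
  | succ n ih => exact ih.trans (subset_step _ _)

theorem step_zero (S : Clauses) : step ch 0 S = S := by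
  unfold step; split <;> simp

theorem step_none {S : Clauses} (h : ch S = none) (mode : ℕ) : step ch mode S = S := by
  unfold step; rw [h]

variable {θ : ℕ → ℕ} {k L D : ℕ} {S₀ : Clauses} {σ : ℕ → Prop}

/-- Take for `v` the number of consecutive chosen hearts that `σ` makes true, cut off at `D - 1`. If
`v < D - 1`, the next heart is false, and the petals are added. If `v = D - 1`, the chunk consists
of `D - 1` heart steps, and its last place is idle. In both cases the potential `p (D - 1) + h`
grows by at least `D - 1`, unless no choice is left. -/
theorem exists_chunk (hch : ∀ S c H, WF k L S → ch S = some (c, H) → Choice θ k S c H) (hθ : ∀ i, 1 ≤ θ i)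
    (hD : 2 ≤ D) {S : Clauses} {h p : ℕ} (hI : Inv θ k L S₀ S h p) (hσ : Sat σ S) :
    ∃ v < D, ∃ h' p', Inv θ k L S₀ (run ch (chunkMode D v) D S) h' p' ∧
      Sat σ (run ch (chunkMode D v) D S) ∧ (ch (run ch (chunkMode D v) D S) = none ∨
        p * (D - 1) + h + (D - 1) ≤ p' * (D - 1) + h') := by
  classical
  set A : ℕ → Clauses := fun u => run ch (fun _ => 1) u S with hA
  have hAs : ∀ u, A (u + 1) = step ch 1 (A u) := fun u => rfl
  have key : ∀ u, (∀ u' < u, ∀ c H, ch (A u') = some (c, H) → ∃ y ∈ H, σ y) →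
      Sat σ (A u) ∧ ∃ h', Inv θ k L S₀ (A u) h' p ∧ (ch (A u) = none ∨ h' = h + u) := by
    intro u
    induction u with
    | zero => intro _; exact ⟨hσ, h, hI, Or.inr rfl⟩
    | succ u ih =>
      intro hu
      obtain ⟨h1, h', h2, h3⟩ := ih fun u' hu' => hu u' (by omega)
      rw [hAs]
      rcases hcu : ch (A u) with _ | ⟨c, H⟩
      · rw [step_none hcu]
        exact ⟨h1, h', h2, Or.inl hcu⟩
      · have e : step ch 1 (A u) = A u ∪ {H} := by simp [step, hcu]
        rw [e]
        refine ⟨?_, h' + 1, h2.heart hθ (hch _ _ _ h2.wf hcu), ?_⟩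
        · intro C hC
          rcases Finset.mem_union.1 hC with hC | hC
          · exact h1 C hC
          · rw [Finset.mem_singleton.1 hC]; exact hu u (by omega) c H hcu
        · right
          rcases h3 with h3 | h3
          · rw [h3] at hcu; simp at hcu
          · omega
  have hrun : ∀ v u, u ≤ v → run ch (chunkMode D v) u S = A u := fun v u huv =>
    run_congr (fun i hi => by simp [chunkMode, show i < v by omega]) S
  have hrest : ∀ v b, run ch (chunkMode D v) (v + 1 + b) S = run ch (chunkMode D v) (v + 1) S := by
    intro v b
    rw [run_add, run_congr (m' := fun _ => 0)]
    · induction b with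
      | zero => rfl
      | succ b ih => rw [run, step_zero, ih]
    · intro i _
      simp only [chunkMode]
      rw [if_neg (by omega), if_neg (by omega)]
  by_cases hex : ∃ v < D - 1, ∃ c H, ch (A v) = some (c, H) ∧ ¬ ∃ y ∈ H, σ y
  · obtain ⟨hv1, c, H, hcv, hnot⟩ := Nat.find_spec hex
    set v := Nat.find hex
    obtain ⟨h1, h', h2, h3⟩ := key v fun u' hu' c H hc => by
      by_contra hcon
      exact Nat.find_min hex hu' ⟨by omega, c, H, hc, hcon⟩
    have e : run ch (chunkMode D v) D S = A v ∪ petals (A v) c H := by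
      obtain ⟨b, hb⟩ : ∃ b, D = v + 1 + b := ⟨D - (v + 1), by omega⟩
      have : run ch (chunkMode D v) (v + 1) S = A v ∪ petals (A v) c H := by
        rw [run, hrun v v le_rfl]
        have : chunkMode D v v = 2 := by simp [chunkMode]; omega
        simp [step, hcv, this]
      rw [← this]
      conv_lhs => rw [show run ch (chunkMode D v) D S = run ch (chunkMode D v) (v + 1 + b) S by
        rw [← hb]]
      exact hrest v b
    refine ⟨v, by omega, ?_⟩
    rw [e]
    refine ⟨h', p + 1, h2.petals hθ (hch _ _ _ h2.wf hcv), ?_, Or.inr ?_⟩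
    · intro C hC
      rcases Finset.mem_union.1 hC with hC | hC
      · exact h1 C hC
      · obtain ⟨C', hC', rfl⟩ := Finset.mem_image.1 hC
        obtain ⟨y, hy, hy'⟩ := h1 C' (mem_minimal.1 (mem_fam.1 hC').1).1
        exact ⟨y, Finset.mem_sdiff.2 ⟨hy, fun hyH => hnot ⟨y, hyH, hy'⟩⟩, hy'⟩
    · rcases h3 with h3 | h3
      · rw [h3] at hcv; simp at hcv
      · rw [h3, add_mul, one_mul]; omega
  · push Not at hex
    obtain ⟨h1, h', h2, h3⟩ := key (D - 1) fun u' hu' c H hc => hex u' hu' c H hc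
    have e : run ch (chunkMode D (D - 1)) D S = A (D - 1) := by
      obtain ⟨b, hb⟩ : ∃ b, D = b + 1 := ⟨D - 1, by omega⟩
      subst hb
      rw [run, Nat.add_sub_cancel, hrun b b le_rfl]
      have : chunkMode (b + 1) b b = 0 := by simp [chunkMode]
      rw [this, step_zero]
    refine ⟨D - 1, by omega, ?_⟩
    rw [e]
    refine ⟨h', p, ?_⟩
    refine ⟨h2, h1, h3.imp_right fun h3 => by omega⟩

/-- The bounds for `h` and `p` keep the potential below `T (D - 1)`, so within `T` chunks the
choices must come to an end. The whole path of decisions is thus described by `T` digits below `D`.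
-/
theorem exists_advice {α : ℕ} (hch : ∀ S c H, WF k L S → ch S = some (c, H) → Choice (theta α) k S c H)
    (hD : 2 ≤ D) (hwf : WF k L S₀) (hσ : Sat σ S₀) {T : ℕ}
    (hT : ∀ h p, h + p ≤ (thresh α k).2 * L → p * α ≤ k * L → p * (D - 1) + h < T * (D - 1)) :
    ∃ z : ℕ → ℕ, (∀ t, z t < D) ∧ WF k L (run ch (adviceMode D z) (T * D) S₀) ∧
      Sat σ (run ch (adviceMode D z) (T * D) S₀) ∧
      ch (run ch (adviceMode D z) (T * D) S₀) = none := by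
  have hθ := one_le_theta α
  have key : ∀ t, ∃ z : ℕ → ℕ, (∀ i, z i < D) ∧ ∃ h p,
      Inv (theta α) k L S₀ (run ch (adviceMode D z) (t * D) S₀) h p ∧
      Sat σ (run ch (adviceMode D z) (t * D) S₀) ∧
      (ch (run ch (adviceMode D z) (t * D) S₀) = none ∨ t * (D - 1) ≤ p * (D - 1) + h) := by
    intro t
    induction t with
    | zero =>
      refine ⟨fun _ => 0, fun _ => by show 0 < D; omega, 0, 0, ?_, by simpa [run] using hσ, Or.inr (by simp)⟩
      simp only [zero_mul, run]
      refine ⟨subset_rfl, hwf, by simp, by simp [added], by simp [added], by simp, ?_⟩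
      push_cast
      exact Finset.sum_nonneg fun i _ => by positivity
    | succ t ih =>
      obtain ⟨z, hz, h, p, hI, hs, hnone⟩ := ih
      set S := run ch (adviceMode D z) (t * D) S₀ with hS
      have hnext : ∀ v < D, ∀ i, Function.update z t v i < D := fun v hv i => by
        rw [Function.update_apply]; split
        · exact hv
        · exact hz i
      have hrun : ∀ v, run ch (adviceMode D (Function.update z t v)) ((t + 1) * D) S₀ =
          run ch (chunkMode D v) D S := by
        intro v
        rw [add_mul, one_mul, run_add, hS]
        have e : run ch (adviceMode D (Function.update z t v)) (t * D) S₀ =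
            run ch (adviceMode D z) (t * D) S₀ := by
          refine run_congr (fun i hi => ?_) S₀
          have : i / D < t := (Nat.div_lt_iff_lt_mul (by omega)).2 hi
          simp [adviceMode, Function.update_of_ne this.ne]
        rw [e]
        refine run_congr (fun i hi => ?_) _
        have h1 : (t * D + i) / D = t := by
          rw [mul_comm, Nat.mul_add_div (by omega), Nat.div_eq_of_lt hi, add_zero]
        have h2 : (t * D + i) % D = i := by
          rw [mul_comm, Nat.mul_add_mod, Nat.mod_eq_of_lt hi]
        simp [adviceMode, h1, h2]
      obtain ⟨v, hv, h', p', h1, h2, h3⟩ := exists_chunk hch hθ hD hI hs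
      refine ⟨Function.update z t v, hnext v hv, h', p', ?_⟩
      rw [hrun]
      refine ⟨h1, h2, ?_⟩
      rcases hnone with hnone | hnone
      · left
        have : ∀ n, run ch (chunkMode D v) n S = S := by
          intro n
          induction n with
          | zero => rfl
          | succ n ih => rw [run, ih, step_none hnone]
        rwa [this]
      · refine h3.imp_right fun h3 => ?_
        rw [add_mul, one_mul]
        omega
  obtain ⟨z, hz, h, p, hI, hs, hnone⟩ := key T
  refine ⟨z, hz, hI.wf, hs, hnone.resolve_right fun hcon => ?_⟩
  have := hT h p hI.steps_le hI.petals_le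
  omega

end run

end Sparsify

/-! ### Sets of clauses as marks on polynomially many codes -/

namespace Sparsify

/-! ### Codes of clauses

The numbers below `(L + 1) ^ k` are codes of sets of at most `k` literals: the digit `y + 1` in base
`L + 1` stands for the literal `y`. -/

def cset (k L x : ℕ) : Finset ℕ :=
  (Finset.range L).filter fun y => ∃ l < k, x / (L + 1) ^ l % (L + 1) = y + 1

theorem mem_cset {k L x y : ℕ} :
    y ∈ cset k L x ↔ y < L ∧ ∃ l < k, x / (L + 1) ^ l % (L + 1) = y + 1 := by
  simp [cset]

theorem cset_subset (k L x : ℕ) : cset k L x ⊆ Finset.range L := Finset.filter_subset _ _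

theorem card_cset_le (k L x : ℕ) : (cset k L x).card ≤ k := by
  have : cset k L x ⊆ (Finset.range k).image fun l => x / (L + 1) ^ l % (L + 1) - 1 := by
    intro y hy
    obtain ⟨-, l, hl, h⟩ := mem_cset.1 hy
    exact Finset.mem_image.2 ⟨l, Finset.mem_range.2 hl, by omega⟩
  exact (Finset.card_le_card this).trans (Finset.card_image_le.trans (by simp))

theorem cset_zero (k L : ℕ) : cset k L 0 = ∅ := by
  ext y; simp [mem_cset]

theorem cset_mul_add {k L x y : ℕ} (hy : y < L) :
    cset (k + 1) L (x * (L + 1) + (y + 1)) = insert y (cset k L x) := by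
  have h0 : (x * (L + 1) + (y + 1)) / (L + 1) = x := by
    rw [mul_comm, Nat.mul_add_div (by omega), Nat.div_eq_of_lt (by omega), add_zero]
  ext y'
  rw [Finset.mem_insert, mem_cset, mem_cset]
  constructor
  · rintro ⟨h1, l, hl, h2⟩
    cases l with
    | zero =>
      left
      rw [pow_zero, Nat.div_one, mul_comm, Nat.mul_add_mod, Nat.mod_eq_of_lt (by omega)] at h2
      omega
    | succ l =>
      right
      rw [pow_succ', ← Nat.div_div_eq_div_mul, h0] at h2
      exact ⟨h1, l, by omega, h2⟩
  · rintro (rfl | ⟨h1, l, hl, h2⟩)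
    · refine ⟨hy, 0, by omega, ?_⟩
      rw [pow_zero, Nat.div_one, mul_comm, Nat.mul_add_mod, Nat.mod_eq_of_lt (by omega)]
    · refine ⟨h1, l + 1, by omega, ?_⟩
      rw [pow_succ', ← Nat.div_div_eq_div_mul, h0, h2]

theorem exists_code {L : ℕ} : ∀ (k : ℕ) (C : Finset ℕ), C ⊆ Finset.range L → C.card ≤ k →
    ∃ x < (L + 1) ^ k, cset k L x = C := by
  intro k
  induction k with
  | zero =>
    intro C _ hC
    exact ⟨0, by simp, by rw [cset_zero, Finset.card_eq_zero.1 (Nat.le_zero.1 hC)]⟩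
  | succ k ih =>
    intro C hL hC
    by_cases hne : C.Nonempty
    · obtain ⟨y, hy⟩ := hne
      have hyL : y < L := Finset.mem_range.1 (hL hy)
      obtain ⟨x, hx, h⟩ := ih (C.erase y) ((Finset.erase_subset _ _).trans hL)
        (by rw [Finset.card_erase_of_mem hy]; omega)
      refine ⟨x * (L + 1) + (y + 1), ?_, by rw [cset_mul_add hyL, h, Finset.insert_erase hy]⟩
      rw [pow_succ]
      calc x * (L + 1) + (y + 1) < (x + 1) * (L + 1) := by rw [add_mul]; omega
        _ ≤ _ := Nat.mul_le_mul_right _ hx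
    · rw [Finset.not_nonempty_iff_eq_empty.1 hne]
      exact ⟨0, by positivity, cset_zero _ _⟩

/-- The set of clauses given by a set of codes (those with `F x ≠ 0`). -/
def clausesOf (k L : ℕ) (F : ℕ → ℕ) : Clauses :=
  ((Finset.range ((L + 1) ^ k)).filter fun x => F x ≠ 0).image (cset k L)

/-- A set has several codes, by the order and the repetition of digits and by zero digits. The marks
are required to depend on the set only. -/
def Closed (k L : ℕ) (F : ℕ → ℕ) : Prop :=
  ∀ x < (L + 1) ^ k, F x ≠ 0 ↔ cset k L x ∈ clausesOf k L F

theorem mem_clausesOf {k L : ℕ} {F : ℕ → ℕ} {C : Finset ℕ} :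
    C ∈ clausesOf k L F ↔ ∃ x < (L + 1) ^ k, F x ≠ 0 ∧ cset k L x = C := by
  simp [clausesOf, and_assoc]

theorem clausesOf_wf (k L : ℕ) (F : ℕ → ℕ) : WF k L (clausesOf k L F) := by
  intro C hC
  obtain ⟨x, -, -, rfl⟩ := mem_clausesOf.1 hC
  exact ⟨cset_subset _ _ _, card_cset_le _ _ _⟩

/-- If `F` marks the codes of the elements of `S`, then it describes `S`. -/
theorem clausesOf_eq {k L : ℕ} {F : ℕ → ℕ} {S : Clauses} (hS : WF k L S)
    (h : ∀ x < (L + 1) ^ k, F x ≠ 0 ↔ cset k L x ∈ S) : clausesOf k L F = S ∧ Closed k L F := by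
  have h1 : clausesOf k L F = S := by
    ext C
    rw [mem_clausesOf]
    constructor
    · rintro ⟨x, hx, hF, rfl⟩
      exact (h x hx).1 hF
    · intro hC
      obtain ⟨x, hx, hxC⟩ := exists_code k C (hS C hC).1 (hS C hC).2
      exact ⟨x, hx, (h x hx).2 (hxC ▸ hC), hxC⟩
  exact ⟨h1, fun x hx => by rw [h1]; exact h x hx⟩

/-- `x` is the least code of a minimal clause. -/
def Good (k L : ℕ) (F : ℕ → ℕ) (x : ℕ) : Prop :=
  F x ≠ 0 ∧ (∀ x' < (L + 1) ^ k, F x' ≠ 0 → cset k L x' ⊆ cset k L x → cset k L x' = cset k L x) ∧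
    ∀ x' < x, cset k L x' ≠ cset k L x

theorem Good.mem_minimal {k L : ℕ} {F : ℕ → ℕ} {x : ℕ} (hx : x < (L + 1) ^ k)
    (h : Good k L F x) : cset k L x ∈ minimal (clausesOf k L F) := by
  refine Sparsify.mem_minimal.2 ⟨mem_clausesOf.2 ⟨x, hx, h.1, rfl⟩, fun E hE hsub => ?_⟩
  obtain ⟨x', hx', hF, rfl⟩ := mem_clausesOf.1 hE
  exact h.2.1 x' hx' hF hsub

theorem Good.inj {k L : ℕ} {F : ℕ → ℕ} {x y : ℕ} (hx : Good k L F x) (hy : Good k L F y)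
    (h : cset k L x = cset k L y) : x = y := by
  rcases lt_trichotomy x y with hlt | rfl | hlt
  · exact absurd h (hy.2.2 x hlt)
  · rfl
  · exact absurd h.symm (hx.2.2 y hlt)

theorem exists_good {k L : ℕ} {F : ℕ → ℕ} (hF : Closed k L F) {C : Finset ℕ}
    (hC : C ∈ minimal (clausesOf k L F)) : ∃ x < (L + 1) ^ k, Good k L F x ∧ cset k L x = C := by
  classical
  rw [Sparsify.mem_minimal] at hC
  have hwf := clausesOf_wf k L F C hC.1
  have hex := exists_code k C hwf.1 hwf.2
  obtain ⟨hx, hxC⟩ := Nat.find_spec hex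
  set x := Nat.find hex
  refine ⟨x, hx, ⟨(hF x hx).2 (hxC ▸ hC.1), fun x' hx' hF' hsub => ?_, fun x' hx' he => ?_⟩, hxC⟩
  · rw [hxC] at hsub ⊢
    exact hC.2 _ (mem_clausesOf.2 ⟨x', hx', hF', rfl⟩) hsub
  · exact Nat.find_min hex hx' ⟨by omega, he.trans hxC⟩

-- Each minimal clause has exactly one good code, its least one, so minimal clauses can be counted
-- by counting marked numbers.
open Classical in
theorem card_good {k L : ℕ} {F : ℕ → ℕ} (hF : Closed k L F) (P : Finset ℕ → Prop) :
    ((Finset.range ((L + 1) ^ k)).filter fun x => Good k L F x ∧ P (cset k L x)).card =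
      ((minimal (clausesOf k L F)).filter P).card := by
  have : (minimal (clausesOf k L F)).filter P = ((Finset.range ((L + 1) ^ k)).filter
      fun x => Good k L F x ∧ P (cset k L x)).image (cset k L) := by
    ext C
    simp only [Finset.mem_filter, Finset.mem_image, Finset.mem_range]
    constructor
    · rintro ⟨h1, h2⟩
      obtain ⟨x, hx, hg, rfl⟩ := exists_good hF h1
      exact ⟨x, ⟨hx, hg, h2⟩, rfl⟩
    · rintro ⟨x, ⟨hx, hg, hP⟩, rfl⟩
      exact ⟨hg.mem_minimal hx, hP⟩
  rw [this, Finset.card_image_of_injOn]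
  intro x hx y hy hxy
  simp only [Finset.coe_filter, Set.mem_ofPred_eq] at hx hy
  exact hx.2.1.inj hy.2.1 hxy

/-- The number `t` encodes a clause size, a petal size and the code of a set that form a
violation. -/
def ViolAt (θ : ℕ → ℕ) (k L : ℕ) (S : Clauses) (t : ℕ) : Prop :=
  Viol θ k S (t / ((k + 1) * (L + 1) ^ k)) (cset k L (t % (L + 1) ^ k)) ∧
    t / ((k + 1) * (L + 1) ^ k) =
      (cset k L (t % (L + 1) ^ k)).card + t / (L + 1) ^ k % (k + 1)

def violBound (k L : ℕ) : ℕ := (k + 1) * ((k + 1) * (L + 1) ^ k)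

open Classical in
/-- The choice of a violation by the least number that encodes one. -/
noncomputable def firstViol (θ : ℕ → ℕ) (k L : ℕ) (S : Clauses) : Option (ℕ × Finset ℕ) :=
  if h : ∃ t, t < violBound k L ∧ ViolAt θ k L S t then
    some (Nat.find h / ((k + 1) * (L + 1) ^ k), cset k L (Nat.find h % (L + 1) ^ k))
  else none

theorem exists_violAt {θ : ℕ → ℕ} {k L : ℕ} {S : Clauses} (hθ : ∀ i, 1 ≤ θ i) (hS : WF k L S)
    {c : ℕ} {H : Finset ℕ} (h : Viol θ k S c H) : ∃ x < (L + 1) ^ k, cset k L x = H ∧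
    ViolAt θ k L S (c * ((k + 1) * (L + 1) ^ k) + ((c - H.card) * (L + 1) ^ k + x)) ∧
    c * ((k + 1) * (L + 1) ^ k) + ((c - H.card) * (L + 1) ^ k + x) < violBound k L := by
  obtain ⟨C, hC⟩ := Finset.card_pos.1 ((hθ _).trans h.2.2.2)
  rw [mem_fam, mem_minimal] at hC
  obtain ⟨h1, h2⟩ := hS C hC.1.1
  obtain ⟨x, hx, hxH⟩ := exists_code k H (hC.2.2.trans h1) ((Finset.card_le_card hC.2.2).trans h2)
  set U := (L + 1) ^ k
  have hck := h.1
  have hlt := h.2.2.1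
  have hr : (c - H.card) * U + x < (k + 1) * U := by
    calc (c - H.card) * U + x < (c - H.card + 1) * U := by rw [add_mul]; omega
      _ ≤ _ := Nat.mul_le_mul_right _ (by omega)
  have e1 : (c * ((k + 1) * U) + ((c - H.card) * U + x)) / ((k + 1) * U) = c := by
    rw [mul_comm c, Nat.mul_add_div (by omega), Nat.div_eq_of_lt hr, add_zero]
  have e2 : (c * ((k + 1) * U) + ((c - H.card) * U + x)) % U = x := by
    rw [show c * ((k + 1) * U) + ((c - H.card) * U + x) = U * (c * (k + 1) + (c - H.card)) + x by
      ring, Nat.mul_add_mod, Nat.mod_eq_of_lt hx]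
  have e3 : (c * ((k + 1) * U) + ((c - H.card) * U + x)) / U % (k + 1) = c - H.card := by
    rw [show c * ((k + 1) * U) + ((c - H.card) * U + x) = U * ((k + 1) * c + (c - H.card)) + x by
      ring, Nat.mul_add_div (by omega), Nat.div_eq_of_lt hx, add_zero, Nat.mul_add_mod,
      Nat.mod_eq_of_lt (by omega)]
  refine ⟨x, hx, hxH, ⟨?_, ?_⟩, ?_⟩
  · rw [e1, e2, hxH]; exact h
  · rw [e1, e2, e3, hxH]; omega
  · calc _ < (c + 1) * ((k + 1) * U) := by rw [add_mul c]; omega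
      _ ≤ _ := Nat.mul_le_mul_right _ (by omega)

/-- The leading digit of the number is `c` and the next one is the petal size, so the least number
belongs to the least `c` and, among those, to the largest heart. -/
theorem firstViol_choice {θ : ℕ → ℕ} {k L : ℕ} (hθ : ∀ i, 1 ≤ θ i) (S : Clauses) (c : ℕ)
    (H : Finset ℕ) (hS : WF k L S) (h : firstViol θ k L S = some (c, H)) : Choice θ k S c H := by
  classical
  unfold firstViol at h
  split at h
  · rename_i hex
    obtain ⟨ht, hv⟩ := Nat.find_spec hex
    simp only [Option.some.injEq, Prod.mk.injEq] at h
    set t := Nat.find hex with ht_def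
    obtain ⟨rfl, rfl⟩ := h
    refine ⟨hv.1, fun c' H' h' => ?_⟩
    obtain ⟨x, hx, hxH, hv', hlt⟩ := exists_violAt hθ hS h'
    have hle : t ≤ _ := Nat.find_min' hex ⟨hlt, hv'⟩
    have hv2 := hv.2
    have hc'k := h'.1
    have hc'H := h'.2.2.1
    set U := (L + 1) ^ k
    have hd := Nat.div_add_mod t ((k + 1) * U)
    have hd2 := Nat.div_add_mod t U
    have hU : 0 < U := by omega
    have hr : (c' - H'.card) * U + x < (k + 1) * U := by
      calc (c' - H'.card) * U + x < (c' - H'.card + 1) * U := by rw [add_mul]; omega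
        _ ≤ _ := Nat.mul_le_mul_right _ (by omega)
    have h1 : t / ((k + 1) * U) ≤ c' := by
      rw [← Nat.lt_add_one_iff, Nat.div_lt_iff_lt_mul (by omega)]
      calc t ≤ _ := hle
        _ < (c' + 1) * ((k + 1) * U) := by rw [add_mul c']; omega
    rcases h1.lt_or_eq with h1 | h1
    · exact Or.inl h1
    · right
      refine ⟨h1, ?_⟩
      have h3 : t / U ≤ c' * (k + 1) + (c' - H'.card) := by
        rw [← Nat.lt_add_one_iff, Nat.div_lt_iff_lt_mul hU]
        calc t ≤ _ := hle
          _ = (c' * (k + 1) + (c' - H'.card)) * U + x := by ring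
          _ < _ := by rw [add_mul _ 1]; omega
      have h4 : t / U = (k + 1) * c' + t / U % (k + 1) := by
        rw [← h1, mul_comm (k + 1) U, ← Nat.div_div_eq_div_mul]
        exact (Nat.div_add_mod _ _).symm
      rw [mul_comm (k + 1)] at h4
      omega
  · simp at h

theorem firstViol_none {θ : ℕ → ℕ} {k L : ℕ} (hθ : ∀ i, 1 ≤ θ i) {S : Clauses} (hS : WF k L S)
    (h : firstViol θ k L S = none) (c : ℕ) (H : Finset ℕ) : ¬ Viol θ k S c H := by
  intro hv
  unfold firstViol at h
  split at h
  · simp at h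
  · rename_i hex
    obtain ⟨x, -, -, h1, h2⟩ := exists_violAt hθ hS hv
    exact hex ⟨_, h2, h1⟩

/-! ### Computing with codes -/

open RealRAM

section

variable {Γ : Type} [Ctx Γ] {k : ℕ} {L x z y : Γ → ℕ}

theorem compP_mem (hL : Comp L) (hx : Comp x) (hy : Comp y) :
    CompP fun γ => y γ ∈ cset k (L γ) (x γ) :=
  ((CompP.lt hy hL).and (CompP.constEx k (p := fun γ l => x γ / (L γ + 1) ^ l % (L γ + 1) = y γ + 1)
    fun l => .eq ((hx.div ((hL.add (.const 1)).pow l)).mod (hL.add (.const 1)))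
      (hy.add (.const 1)))).congr fun _ => mem_cset.symm

theorem compP_subset (hL : Comp L) (hx : Comp x) (hz : Comp z) :
    CompP fun γ => cset k (L γ) (x γ) ⊆ cset k (L γ) (z γ) :=
  (CompP.all (p := fun γ y => y ∈ cset k (L γ) (x γ) → y ∈ cset k (L γ) (z γ)) hL
    ((compP_mem hL.fst hx.fst .snd).imp (compP_mem hL.fst hz.fst .snd))).congr fun γ =>
      ⟨fun h y hy => h y (mem_cset.1 hy).1 hy, fun h _ _ hy => h hy⟩

theorem compP_cset_eq (hL : Comp L) (hx : Comp x) (hz : Comp z) :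
    CompP fun γ => cset k (L γ) (x γ) = cset k (L γ) (z γ) :=
  ((compP_subset hL hx hz).and (compP_subset hL hz hx)).congr fun _ =>
    Finset.Subset.antisymm_iff.symm

theorem comp_card (hL : Comp L) (hx : Comp x) : Comp fun γ => (cset k (L γ) (x γ)).card := by
  classical
  refine (CompP.card (p := fun γ y => y ∈ cset k (L γ) (x γ)) hL
    (compP_mem hL.fst hx.fst .snd)).congr fun _ => ?_
  congr 1
  ext y
  rw [Finset.mem_filter, Finset.mem_range]
  exact ⟨fun h => h.2, fun h => ⟨(mem_cset.1 h).1, h⟩⟩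

theorem comp_codes (hL : Comp L) : Comp fun γ => (L γ + 1) ^ k := (hL.add (.const 1)).pow k

theorem compP_good (a : ℕ) (hL : Comp L) (hx : Comp x) :
    CompP fun γ => Good k (L γ) ((Ctx.env γ).mem a) (x γ) := by
  refine ((CompP.eq (Comp.load a hx) (.const 0)).not).and ((CompP.all (p := fun γ x' =>
    (Ctx.env γ).mem a x' ≠ 0 → cset k (L γ) x' ⊆ cset k (L γ) (x γ) →
      cset k (L γ) x' = cset k (L γ) (x γ)) (comp_codes hL) ?_).and
    (CompP.all (p := fun γ x' => cset k (L γ) x' ≠ cset k (L γ) (x γ)) hx ?_))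
  · exact ((CompP.eq (Comp.load a .snd) (.const 0)).not).imp
      ((compP_subset hL.fst .snd hx.fst).imp (compP_cset_eq hL.fst .snd hx.fst))
  · exact (compP_cset_eq hL.fst .snd hx.fst).not

end

end Sparsify

/-! ### Replaying an advice string by a polynomial-time program -/

namespace Sparsify

open RealRAM

/-! ### Replaying an advice string

Small variables: `0` the number of variables, `2` the step, `3` the violation, `7` the number of
steps, `10` the number of minimal clauses. Small arrays: `2` the codes of the given clauses, `3` the
codes of the current clauses, `4` the good codes, `5` the advice bits. -/

open Classical in
/-- The least `t < B` with `p t`, or `B`. -/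
noncomputable def leastLt (B : ℕ) (p : ℕ → Prop) : ℕ :=
  ((Finset.range B).filter fun t => ∀ t' < t + 1, ¬ p t').card

theorem leastLt_le (B : ℕ) (p : ℕ → Prop) : leastLt B p ≤ B := by
  classical
  exact (Finset.card_filter_le _ _).trans (by simp)

open Classical in
theorem leastLt_eq {B : ℕ} {p : ℕ → Prop} (h : ∃ t, t < B ∧ p t) : leastLt B p = Nat.find h := by
  have : ((Finset.range B).filter fun t => ∀ t' < t + 1, ¬ p t') = Finset.range (Nat.find h) := by
    ext t
    rw [Finset.mem_filter, Finset.mem_range, Finset.mem_range]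
    constructor
    · rintro ⟨-, h2⟩
      by_contra hcon
      exact h2 (Nat.find h) (by omega) (Nat.find_spec h).2
    · intro ht
      have h1 := (Nat.find_spec h).1
      exact ⟨by omega, fun t' ht' hp => Nat.find_min h (m := t') (by omega) ⟨by omega, hp⟩⟩
  rw [leastLt, this, Finset.card_range]

theorem leastLt_eq_bound {B : ℕ} {p : ℕ → Prop} (h : ¬ ∃ t, t < B ∧ p t) : leastLt B p = B := by
  classical
  rw [leastLt, Finset.filter_true_of_mem, Finset.card_range]
  intro t ht t' ht' hp
  rw [Finset.mem_range] at ht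
  exact h ⟨t', by omega, hp⟩

theorem comp_leastLt {Γ : Type} [Ctx Γ] {B : Γ → ℕ} {p : Γ → ℕ → Prop} (hB : Comp B)
    (hp : CompP fun q : Γ × ℕ => p q.1 q.2) : Comp fun γ => leastLt (B γ) (p γ) := by
  classical
  refine CompP.card (p := fun γ t => ∀ t' < t + 1, ¬ p γ t') hB ?_
  exact CompP.all (p := fun (q : Γ × ℕ) t' => ¬ p q.1 t') (Comp.snd.add (.const 1)) hp.forget.not

open Classical in
/-- `ViolAt`, in terms of the good codes. -/
def ViolCode (θ : ℕ → ℕ) (k L : ℕ) (G : ℕ → ℕ) (t : ℕ) : Prop :=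
  let c := t / ((k + 1) * (L + 1) ^ k)
  let i := t / (L + 1) ^ k % (k + 1)
  let x := t % (L + 1) ^ k
  c ≤ k ∧ 1 ≤ (cset k L x).card ∧ (cset k L x).card < c ∧ c = (cset k L x).card + i ∧
    -- The threshold at a computed index is looked up in a table of `k + 1` constants, since `θ`
    -- itself is no expression.
    (∑ l ∈ Finset.range (k + 1), if i = l then θ l else 0) ≤
    ((Finset.range ((L + 1) ^ k)).filter fun x' => G x' ≠ 0 ∧ (cset k L x').card = c ∧
      cset k L x ⊆ cset k L x').card

theorem violCode_iff {θ : ℕ → ℕ} {k L : ℕ} {F G : ℕ → ℕ} (hF : Closed k L F)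
    (hG : ∀ x < (L + 1) ^ k, G x ≠ 0 ↔ Good k L F x) (t : ℕ) :
    ViolCode θ k L G t ↔ ViolAt θ k L (clausesOf k L F) t := by
  classical
  unfold ViolCode ViolAt Viol
  set c := t / ((k + 1) * (L + 1) ^ k)
  set i := t / (L + 1) ^ k % (k + 1) with hi
  set x := t % (L + 1) ^ k
  have e1 : (∑ l ∈ Finset.range (k + 1), if i = l then θ l else 0) = θ i := by
    rw [Finset.sum_ite_eq, if_pos]
    exact Finset.mem_range.2 (Nat.mod_lt _ (by omega))
  have e2 : ((Finset.range ((L + 1) ^ k)).filter fun x' => G x' ≠ 0 ∧ (cset k L x').card = c ∧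
      cset k L x ⊆ cset k L x').card = (fam (clausesOf k L F) c (cset k L x)).card := by
    rw [fam]
    have h := card_good hF fun C => C.card = c ∧ cset k L x ⊆ C
    refine Eq.trans (congrArg _ ?_) (h.trans (congrArg _ ?_))
    · ext x'
      simp only [Finset.mem_filter]
      exact and_congr_right fun hx' => by rw [hG x' (Finset.mem_range.1 hx')]
    · ext C
      simp only [Finset.mem_filter]
  have e3 : c = (cset k L x).card + i → c - (cset k L x).card = i := fun h => by omega
  dsimp only
  rw [e1, e2]
  constructor
  · rintro ⟨h1, h2, h3, h4, h5⟩
    exact ⟨⟨h1, h2, h3, by rw [e3 h4]; exact h5⟩, h4⟩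
  · rintro ⟨⟨h1, h2, h3, h5⟩, h4⟩
    exact ⟨h1, h2, h3, h4, by rw [← e3 h4]; exact h5⟩

/-- The digit of the advice at position `t`, read from the bits in `Y`. -/
def digit (s : ℕ) (Y : ℕ → ℕ) (t : ℕ) : ℕ := ∑ l ∈ Finset.range s, Y (t * s + l) * 2 ^ l

open Classical in
/-- Does the code `x` belong to the set of clauses after the next step? -/
def NextCode (k L s : ℕ) (F G Y : ℕ → ℕ) (τ t x : ℕ) : Prop :=
  let c := t / ((k + 1) * (L + 1) ^ k)
  let h := t % (L + 1) ^ k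
  let v := digit s Y (τ / 2 ^ s)
  let u := τ % 2 ^ s
  F x ≠ 0 ∨ t < violBound k L ∧ (u < v ∧ cset k L x = cset k L h ∨
    ¬ u < v ∧ u = v ∧ u + 1 < 2 ^ s ∧ ∃ z < (L + 1) ^ k, G z ≠ 0 ∧ (cset k L z).card = c ∧
      cset k L h ⊆ cset k L z ∧ ∀ y < L, y ∈ cset k L x ↔ y ∈ cset k L z ∧ y ∉ cset k L h)

/-- One replay step on marks is one `step` on clauses. The new marks depend on a code only through
its set, so they are closed again. If the search for a violation ends at `violBound`, nothing is
added. -/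
theorem clausesOf_next {θ : ℕ → ℕ} {k L s : ℕ} {F F' G Y : ℕ → ℕ} (τ : ℕ) (hF : Closed k L F)
    (hG : ∀ x < (L + 1) ^ k, G x ≠ 0 ↔ Good k L F x)
    (hF' : ∀ x < (L + 1) ^ k, F' x ≠ 0 ↔ NextCode k L s F G Y τ
      (leastLt (violBound k L) (ViolCode θ k L G)) x) :
    clausesOf k L F' = step (firstViol θ k L) (adviceMode (2 ^ s) (digit s Y) τ)
      (clausesOf k L F) ∧ Closed k L F' := by
  classical
  set S := clausesOf k L F with hS
  have hviol : ViolCode θ k L G = ViolAt θ k L S := funext fun t => propext (violCode_iff hF hG t)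
  rw [hviol] at hF'
  by_cases hex : ∃ t, t < violBound k L ∧ ViolAt θ k L S t
  · rw [leastLt_eq hex] at hF'
    have hch : firstViol θ k L S = some (Nat.find hex / ((k + 1) * (L + 1) ^ k),
        cset k L (Nat.find hex % (L + 1) ^ k)) := by
      rw [firstViol, dif_pos hex]
    have htB := (Nat.find_spec hex).1
    set t := Nat.find hex
    set c := t / ((k + 1) * (L + 1) ^ k)
    set H := cset k L (t % (L + 1) ^ k)
    have hpet : ∀ x, (∃ z < (L + 1) ^ k, G z ≠ 0 ∧ (cset k L z).card = c ∧ H ⊆ cset k L z ∧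
        ∀ y < L, y ∈ cset k L x ↔ y ∈ cset k L z ∧ y ∉ H) ↔ cset k L x ∈ petals S c H := by
      intro x
      -- Equality with a set difference is expressed by a bounded quantifier, the form that the
      -- program can evaluate.
      have hset : ∀ z, (∀ y < L, y ∈ cset k L x ↔ y ∈ cset k L z ∧ y ∉ H) ↔
          cset k L z \ H = cset k L x := by
        intro z
        constructor
        · intro h
          ext y
          rw [Finset.mem_sdiff]
          by_cases hy : y < L
          · exact (h y hy).symm
          · exact iff_of_false (fun h' => hy (mem_cset.1 h'.1).1) fun h' => hy (mem_cset.1 h').1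
        · rintro h y -
          rw [← h, Finset.mem_sdiff]
      rw [petals, Finset.mem_image]
      constructor
      · rintro ⟨z, hz, h1, h2, h3, h4⟩
        exact ⟨cset k L z, mem_fam.2 ⟨((hG z hz).1 h1).mem_minimal hz, h2, h3⟩, (hset z).1 h4⟩
      · rintro ⟨C, hC, hC'⟩
        obtain ⟨h1, h2, h3⟩ := mem_fam.1 hC
        obtain ⟨z, hz, hg, rfl⟩ := exists_good hF h1
        exact ⟨z, hz, (hG z hz).2 hg, h2, h3, (hset z).2 hC'⟩
    refine clausesOf_eq ?_ fun x hx => ?_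
    · intro C hC
      unfold step at hC
      rw [hch] at hC
      have hwf := clausesOf_wf k L F
      dsimp only at hC
      split_ifs at hC
      · rcases Finset.mem_union.1 hC with hC | hC
        · exact hwf C hC
        · rw [Finset.mem_singleton.1 hC]; exact ⟨cset_subset _ _ _, card_cset_le _ _ _⟩
      · rcases Finset.mem_union.1 hC with hC | hC
        · exact hwf C hC
        · obtain ⟨C', hC', rfl⟩ := Finset.mem_image.1 hC
          obtain ⟨h1, h2⟩ := hwf C' (mem_minimal.1 (mem_fam.1 hC').1).1
          exact ⟨Finset.sdiff_subset.trans h1,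
            (Finset.card_le_card Finset.sdiff_subset).trans h2⟩
      · exact hwf C hC
    · rw [hF' x hx]
      unfold NextCode step adviceMode chunkMode
      rw [hch]
      dsimp only
      rw [hpet x, hF x hx]
      simp only [htB, true_and]
      by_cases h1 : τ % 2 ^ s < digit s Y (τ / 2 ^ s)
      · simp [h1, H]; tauto
      · by_cases h2 : τ % 2 ^ s = digit s Y (τ / 2 ^ s) ∧ τ % 2 ^ s + 1 < 2 ^ s
        · rw [if_neg h1, if_pos h2]
          have h3 := h2.2
          rw [h2.1] at h3
          simp [h2.1, h3, S]
        · rw [if_neg h1, if_neg h2]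
          have : ∀ p : Prop, ¬ (τ % 2 ^ s = digit s Y (τ / 2 ^ s) ∧ τ % 2 ^ s + 1 < 2 ^ s ∧ p) :=
            fun p hp => h2 ⟨hp.1, hp.2.1⟩
          simp [h1, this, S]
  · rw [leastLt_eq_bound hex] at hF'
    have hch : firstViol θ k L S = none := by rw [firstViol, dif_neg hex]
    rw [step_none hch]
    refine clausesOf_eq (clausesOf_wf k L F) fun x hx => ?_
    rw [hF' x hx, ← hF x hx]
    simp [NextCode]

/-! ### The replay program -/

section

variable (θ : ℕ → ℕ) (k s : ℕ)

def envL (m : Env) : ℕ := 2 * m.var 0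

open Classical in
noncomputable def markGood (m : Env) : Env :=
  m.setArr 4 ((envL m + 1) ^ k) fun x => if Good k (envL m) (m.mem 3) x then 1 else 0

noncomputable def findViol (m : Env) : Env :=
  m.setVar 3 (leastLt (violBound k (envL m)) (ViolCode θ k (envL m) (m.mem 4)))

open Classical in
noncomputable def extend (m : Env) : Env :=
  m.setArr 3 ((envL m + 1) ^ k) fun x =>
    if NextCode k (envL m) s (m.mem 3) (m.mem 4) (m.mem 5) (m.var 2) (m.var 3) x then 1 else 0

noncomputable def replayStep (m : Env) : Env :=
  (extend k s (findViol θ k (markGood k m))).setVar 2 (m.var 2 + 1)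

theorem comp_envL {Γ : Type} [Ctx Γ] : Comp fun γ : Γ => envL (Ctx.env γ) :=
  (Comp.const 2).mul (.var 0)

theorem compP_violCode : CompP fun q : Env × ℕ => ViolCode θ k (envL q.1) (q.1.mem 4) q.2 := by
  classical
  have hU : ∀ {Γ : Type} [Ctx Γ], Comp fun γ : Γ => (envL (Ctx.env γ) + 1) ^ k :=
    comp_codes comp_envL
  have hL : ∀ {Γ : Type} [Ctx Γ], Comp fun γ : Γ => envL (Ctx.env γ) := comp_envL
  have hc : Comp fun q : Env × ℕ => q.2 / ((k + 1) * (envL (Ctx.env q) + 1) ^ k) :=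
    Comp.snd.div ((Comp.const (k + 1)).mul hU)
  have hi : Comp fun q : Env × ℕ => q.2 / (envL (Ctx.env q) + 1) ^ k % (k + 1) :=
    (Comp.snd.div hU).mod (.const (k + 1))
  have hx : Comp fun q : Env × ℕ => q.2 % (envL (Ctx.env q) + 1) ^ k := Comp.snd.mod hU
  have hcard := comp_card (k := k) hL hx
  refine (CompP.le hc (.const k)).and ((CompP.le (.const 1) hcard).and ((CompP.lt hcard hc).and
    ((CompP.eq hc (hcard.add hi)).and (CompP.le ?_ ?_))))
  · exact Comp.constSum (k + 1) (g := fun (q : Env × ℕ) l =>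
      if q.2 / (envL (Ctx.env q) + 1) ^ k % (k + 1) = l then θ l else 0) fun l =>
        CompP.ite (CompP.eq hi (.const l)) (.const _) (.const 0)
  · exact CompP.card (p := fun (q : Env × ℕ) x' => q.1.mem 4 x' ≠ 0 ∧
      (cset k (envL (Ctx.env q)) x').card = q.2 / ((k + 1) * (envL (Ctx.env q) + 1) ^ k) ∧
      cset k (envL (Ctx.env q)) (q.2 % (envL (Ctx.env q) + 1) ^ k) ⊆ cset k (envL (Ctx.env q)) x')
      hU (((CompP.eq (Comp.load 4 .snd) (.const 0)).not).and
        ((CompP.eq (comp_card hL .snd) hc.fst).and (compP_subset hL hx.fst .snd)))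

theorem compP_nextCode : CompP fun q : Env × ℕ => NextCode k (envL q.1) s (q.1.mem 3) (q.1.mem 4)
    (q.1.mem 5) (q.1.var 2) (q.1.var 3) q.2 := by
  classical
  have hU : ∀ {Γ : Type} [Ctx Γ], Comp fun γ : Γ => (envL (Ctx.env γ) + 1) ^ k :=
    comp_codes comp_envL
  have hL : ∀ {Γ : Type} [Ctx Γ], Comp fun γ : Γ => envL (Ctx.env γ) := comp_envL
  have ht : ∀ {Γ : Type} [Ctx Γ], Comp fun γ : Γ => (Ctx.env γ).var 3 := Comp.var 3
  have hc : ∀ {Γ : Type} [Ctx Γ],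
      Comp fun γ : Γ => (Ctx.env γ).var 3 / ((k + 1) * (envL (Ctx.env γ) + 1) ^ k) :=
    ht.div ((Comp.const (k + 1)).mul hU)
  have hh : ∀ {Γ : Type} [Ctx Γ],
      Comp fun γ : Γ => (Ctx.env γ).var 3 % (envL (Ctx.env γ) + 1) ^ k := ht.mod hU
  have hu : Comp fun q : Env × ℕ => q.1.var 2 % 2 ^ s := (Comp.var 2).mod (.const _)
  have hv : Comp fun q : Env × ℕ => digit s (q.1.mem 5) (q.1.var 2 / 2 ^ s) :=
    Comp.constSum s (g := fun (q : Env × ℕ) l => q.1.mem 5 (q.1.var 2 / 2 ^ s * s + l) * 2 ^ l)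
      fun l => (Comp.load 5 ((((Comp.var 2).div (.const _)).mul (.const s)).add (.const l))).mul
        (.const _)
  refine ((CompP.eq (Comp.load 3 .snd) (.const 0)).not).or ((CompP.lt ht ?_).and
    (((CompP.lt hu hv).and (compP_cset_eq hL .snd hh)).or (((CompP.lt hu hv).not).and
    ((CompP.eq hu hv).and ((CompP.lt (hu.add (.const 1)) (.const _)).and ?_)))))
  · exact (Comp.const (k + 1)).mul ((Comp.const (k + 1)).mul hU)
  · exact CompP.ex (p := fun (q : Env × ℕ) z => q.1.mem 4 z ≠ 0 ∧ (cset k (envL q.1) z).card =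
        q.1.var 3 / ((k + 1) * (envL q.1 + 1) ^ k) ∧
        cset k (envL q.1) (q.1.var 3 % (envL q.1 + 1) ^ k) ⊆ cset k (envL q.1) z ∧
        ∀ y < envL q.1, y ∈ cset k (envL q.1) q.2 ↔ y ∈ cset k (envL q.1) z ∧
          y ∉ cset k (envL q.1) (q.1.var 3 % (envL q.1 + 1) ^ k)) hU
      (((CompP.eq (Comp.load 4 .snd) (.const 0)).not).and ((CompP.eq (comp_card hL .snd) hc).and
        ((compP_subset hL hh .snd).and (CompP.all (p := fun (q : (Env × ℕ) × ℕ) y =>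
          y ∈ cset k (envL q.1.1) q.1.2 ↔ y ∈ cset k (envL q.1.1) q.2 ∧
          y ∉ cset k (envL q.1.1) (q.1.1.var 3 % (envL q.1.1 + 1) ^ k)) hL
          ((compP_mem hL (Comp.snd.fst.fst) .snd).iff ((compP_mem hL (Comp.snd.fst) .snd).and
            (compP_mem hL hh .snd).not))))))

theorem exists_acts_markGood : ∃ P : Program, P.Acts (markGood k) := by
  classical
  exact exists_acts_setArr 4 (comp_codes comp_envL)
    (f := fun m x => if Good k (envL m) (m.mem 3) x then 1 else 0)
    (CompP.ind (compP_good 3 comp_envL .snd))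

theorem exists_acts_replayStep : ∃ P : Program, P.Acts (replayStep θ k s) := by
  classical
  obtain ⟨P₁, h₁⟩ := exists_acts_markGood k
  obtain ⟨P₂, h₂⟩ := exists_acts_setVar 3 (f := fun m => leastLt (violBound k (envL m))
    (ViolCode θ k (envL m) (m.mem 4)))
    (comp_leastLt (p := fun m => ViolCode θ k (envL m) (m.mem 4))
      ((Comp.const (k + 1)).mul ((Comp.const (k + 1)).mul (comp_codes comp_envL)))
      (compP_violCode θ k))
  obtain ⟨P₃, h₃⟩ := exists_acts_setArr 3 (comp_codes (k := k) comp_envL)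
    (f := fun m x => if NextCode k (envL m) s (m.mem 3) (m.mem 4) (m.mem 5) (m.var 2) (m.var 3) x
      then 1 else 0) (CompP.ind (compP_nextCode k s))
  obtain ⟨P₄, h₄⟩ := exists_acts_setVar 2 (f := fun m => m.var 2 + 1) ((Comp.var 2).add (.const 1))
  exact ⟨_, (((h₁.seq h₂).seq h₃).seq h₄).congr fun m => rfl⟩

end

end Sparsify

namespace Sparsify

open RealRAM

theorem bdd_setVar {m : Env} {V v x : ℕ} (hm : m.Bdd V) (hx : x ≤ V) : (m.setVar v x).Bdd V := by
  refine ⟨fun u => ?_, hm.2⟩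
  simp only [Env.setVar, Function.update_apply]
  split
  · exact hx
  · exact hm.1 u

theorem bdd_setArr {m : Env} {V a b : ℕ} {f : ℕ → ℕ} (hm : m.Bdd V) (hf : ∀ x < b, f x ≤ V) :
    (m.setArr a b f).Bdd V := by
  refine ⟨hm.1, fun a' i => ?_⟩
  simp only [Env.setArr, Function.update_apply]
  split
  · dsimp only
    split
    · exact hf i (by assumption)
    · exact hm.2 _ _
  · exact hm.2 _ _

theorem setArr_mem_self (m : Env) (a b : ℕ) (f : ℕ → ℕ) {x : ℕ} (hx : x < b) :
    (m.setArr a b f).mem a x = f x := by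
  simp [Env.setArr, hx]

theorem setArr_mem_of_ne (m : Env) {a a' : ℕ} (b : ℕ) (f : ℕ → ℕ) (h : a' ≠ a) :
    (m.setArr a b f).mem a' = m.mem a' := by
  simp [Env.setArr, h]

/-- The state after `i` steps of the replay. -/
structure ReplayInv (θ : ℕ → ℕ) (k s V : ℕ) (m : Env) (i : ℕ) (m' : Env) : Prop where
  bdd : m'.Bdd V
  count : m'.var 2 = i
  var : ∀ v, v ≠ 2 → v ≠ 3 → m'.var v = m.var v
  mem : ∀ a, a ≠ 3 → a ≠ 4 → m'.mem a = m.mem a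
  closed : Closed k (envL m) (m'.mem 3)
  clauses : clausesOf k (envL m) (m'.mem 3) =
    run (firstViol θ k (envL m)) (adviceMode (2 ^ s) (digit s (m.mem 5))) i
      (clausesOf k (envL m) (m.mem 2))

theorem markGood_mem (k : ℕ) (m : Env) {x : ℕ} (hx : x < (envL m + 1) ^ k) :
    (markGood k m).mem 4 x ≠ 0 ↔ Good k (envL m) (m.mem 3) x := by
  classical
  rw [markGood, setArr_mem_self _ _ _ _ hx]
  simp

theorem ReplayInv.next {θ : ℕ → ℕ} {k s V : ℕ} {m m' : Env} {i : ℕ}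
    (h : ReplayInv θ k s V m i m') (hV : violBound k (envL m) ≤ V) (h1 : 1 ≤ V) (hi : i < V) :
    ReplayInv θ k s V m (i + 1) (replayStep θ k s m') := by
  classical
  have hL : envL m' = envL m := by simp only [envL, h.var 0 (by omega) (by omega)]
  have b1 : (markGood k m').Bdd V := bdd_setArr h.bdd fun x _ => by split <;> omega
  have hLg : envL (markGood k m') = envL m := hL
  have b2 : (findViol θ k (markGood k m')).Bdd V :=
    bdd_setVar b1 ((leastLt_le _ _).trans (by rw [hLg]; exact hV))
  have hLf : envL (findViol θ k (markGood k m')) = envL m := by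
    simpa [envL, findViol, Env.setVar] using hLg
  have b3 : (extend k s (findViol θ k (markGood k m'))).Bdd V :=
    bdd_setArr b2 fun x _ => by split <;> omega
  have e4 : ∀ a, a ≠ 3 → a ≠ 4 → (replayStep θ k s m').mem a = m'.mem a := by
    intro a h3 h4
    simp only [replayStep, Env.setVar, extend]
    rw [setArr_mem_of_ne _ _ _ h3]
    simp only [findViol, Env.setVar, markGood]
    rw [setArr_mem_of_ne _ _ _ h4]
  have hG : ∀ x < (envL m + 1) ^ k, (findViol θ k (markGood k m')).mem 4 x ≠ 0 ↔
      Good k (envL m) (m'.mem 3) x := by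
    intro x hx
    have := markGood_mem k m' (x := x) (by rw [hL]; exact hx)
    rw [hL] at this
    exact this
  have hnext := clausesOf_next (θ := θ) (s := s) (F' := (replayStep θ k s m').mem 3)
    (Y := m'.mem 5) i h.closed hG (fun x hx => by
      have e1 : (replayStep θ k s m').mem 3 x = if NextCode k (envL m) s (m'.mem 3)
          ((findViol θ k (markGood k m')).mem 4) (m'.mem 5) i
          (leastLt (violBound k (envL m)) (ViolCode θ k (envL m)
            ((findViol θ k (markGood k m')).mem 4))) x then 1 else 0 := by
        simp only [replayStep, Env.setVar, extend]
        rw [hLf, setArr_mem_self _ _ _ _ hx]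
        have f1 : (findViol θ k (markGood k m')).mem 3 = m'.mem 3 := by
          simp [findViol, Env.setVar, markGood, Env.setArr]
        have f2 : (findViol θ k (markGood k m')).mem 5 = m'.mem 5 := by
          simp [findViol, Env.setVar, markGood, Env.setArr]
        have f3 : (findViol θ k (markGood k m')).var 2 = i := by
          rw [← h.count]; simp [findViol, Env.setVar, markGood, Env.setArr]
        have f4 : (findViol θ k (markGood k m')).var 3 = leastLt (violBound k (envL m))
            (ViolCode θ k (envL m) ((findViol θ k (markGood k m')).mem 4)) := by
          rw [← hLg]; simp [findViol, Env.setVar]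
        rw [f1, f2, f3, f4]
      rw [e1]
      simp)
  refine ⟨bdd_setVar b3 ?_, ?_, ?_, ?_, hnext.2, ?_⟩
  · rw [h.count]; omega
  · simp [replayStep, Env.setVar, h.count]
  · intro v h2 h3
    rw [← h.var v h2 h3]
    simp [replayStep, Env.setVar, extend, Env.setArr, findViol, markGood, h2, h3]
  · intro a h3 h4
    rw [e4 a h3 h4, h.mem a h3 h4]
  · rw [hnext.1, run, h.clauses, h.mem 5 (by omega) (by omega)]

structure ReplayPost (θ : ℕ → ℕ) (k s V : ℕ) (m m' : Env) : Prop where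
  bdd : m'.Bdd V
  var : ∀ v, v ≠ 2 → v ≠ 3 → v ≠ 10 → m'.var v = m.var v
  mem : ∀ a, a ≠ 3 → a ≠ 4 → m'.mem a = m.mem a
  clauses : ∃ F, Closed k (envL m) F ∧ clausesOf k (envL m) F =
    run (firstViol θ k (envL m)) (adviceMode (2 ^ s) (digit s (m.mem 5))) (m.var 7)
      (clausesOf k (envL m) (m.mem 2)) ∧
    (∀ x < (envL m + 1) ^ k, m'.mem 4 x ≠ 0 ↔ Good k (envL m) F x)
  count : m'.var 10 =
    ((Finset.range ((envL m + 1) ^ k)).filter fun x => m'.mem 4 x ≠ 0).card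

/-- The number of codes is polynomial for fixed `k`, so each step takes polynomial time. The bound
`V` does not deteriorate in the loop: marks are 0 or 1, the violation is at most `violBound`, and
the step counter is at most the small variable 7. -/
theorem exists_replay (θ : ℕ → ℕ) (k s : ℕ) : ∃ (P : Program) (c : ℕ), ∀ (st : State) (V : ℕ),
    (∀ i, st.loc i = 0) → st.env.Bdd V → violBound k (envL st.env) ≤ V → 1 ≤ V →
    Closed k (envL st.env) (st.env.mem 2) →
    Runs P st ((V + 2) ^ c) fun st' => SmallFrame st st' ∧ ReplayPost θ k s V st.env st'.env := by
  classical
  obtain ⟨P₁, ⟨c₁, h₁⟩, -⟩ := exists_acts_setArr 3 (comp_codes (k := k) comp_envL)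
    (f := fun (m : Env) x => m.mem 2 x) (Comp.load 2 .snd)
  obtain ⟨P₂, ⟨c₂, h₂⟩, -⟩ := exists_acts_setVar 2 (f := fun _ : Env => 0) (Comp.const 0)
  obtain ⟨P₃, h₃⟩ := exists_acts_replayStep θ k s
  obtain ⟨c₃, h₃⟩ := h₃.loop_runs 2 7
  obtain ⟨P₄, ⟨c₄, h₄⟩, -⟩ := exists_acts_markGood k
  obtain ⟨P₅, ⟨c₅, h₅⟩, -⟩ := exists_acts_setVar 10
    (f := fun m : Env => ((Finset.range ((envL m + 1) ^ k)).filter fun x => m.mem 4 x ≠ 0).card)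
    (CompP.card (p := fun (m : Env) x => m.mem 4 x ≠ 0) (comp_codes comp_envL)
      (CompP.eq (Comp.load 4 .snd) (.const 0)).not)
  have hpow : ∀ c : ℕ, Expr.PolyBd fun V => (V + 2) ^ c := fun c => ⟨c, fun _ => le_rfl⟩
  obtain ⟨c, hc⟩ := (hpow c₁).add ((hpow c₂).add (((Expr.PolyBd.id.add (.const 1)).mul
    (hpow c₃)).add ((hpow c₄).add (hpow c₅))))
  refine ⟨.seq P₁ (.seq P₂ (.seq (.loop (.natLt (8 * 2) (8 * 7)) P₃) (.seq P₄ P₅))), c,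
    fun st V hl hb hV h1 hcl => ?_⟩
  set m := st.env with hm
  have hU : (envL m + 1) ^ k ≤ V := le_trans (by
    unfold violBound
    nlinarith [Nat.zero_le k, Nat.zero_le ((envL m + 1) ^ k), Nat.zero_le (k * (envL m + 1) ^ k),
      Nat.zero_le (k * (k * (envL m + 1) ^ k))]) hV
  set m₁ := m.setArr 3 ((envL m + 1) ^ k) fun x => m.mem 2 x with hm₁
  have hb₁ : m₁.Bdd V := bdd_setArr hb fun x _ => hb.2 _ _
  set m₂ := m₁.setVar 2 0 with hm₂
  have hb₂ : m₂.Bdd V := bdd_setVar hb₁ (Nat.zero_le _)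
  have hI0 : ReplayInv θ k s V m 0 m₂ := by
    have e : ∀ x < (envL m + 1) ^ k, m₂.mem 3 x = m.mem 2 x := fun x hx =>
      setArr_mem_self m 3 _ (fun x => m.mem 2 x) hx
    have h6 := clausesOf_eq (F := m₂.mem 3) (clausesOf_wf k (envL m) (m.mem 2)) fun x hx => by
      rw [e x hx]; exact hcl x hx
    refine ⟨hb₂, by simp [hm₂, Env.setVar], ?_, ?_, h6.2, h6.1⟩
    · intro v h2 _
      simp [hm₂, hm₁, Env.setVar, Env.setArr, h2]
    · intro a h3 _
      exact setArr_mem_of_ne _ _ _ h3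
  have hn : m.var 7 ≤ V := hb.1 7
  have hI : ∀ i ≤ m.var 7, ReplayInv θ k s V m i ((replayStep θ k s)^[i] m₂) := by
    intro i
    induction i with
    | zero => exact fun _ => hI0
    | succ i ih =>
      intro hi
      rw [Function.iterate_succ_apply']
      exact (ih (by omega)).next hV h1 (by omega)
  refine Runs.mono ?_ (hc V) fun _ h => h
  refine Runs.seq (h₁ st V hb hl) ?_ le_rfl
  rintro s₁ ⟨e₁, f₁⟩
  change s₁.env = m₁ at e₁
  refine Runs.seq (h₂ s₁ V (e₁ ▸ hb₁) (by rw [f₁.loc]; exact hl)) ?_ le_rfl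
  rintro s₂ ⟨e₂, f₂⟩
  replace e₂ : s₂.env = m₂ := by rw [e₂, e₁]
  have f₂' := f₁.trans f₂
  refine Runs.seq ((h₃ s₂ V (m.var 7) (by rw [f₂'.loc]; exact hl) ?_ ?_ ?_).mono
    (Nat.mul_le_mul_right _ (by omega)) fun _ h => h) ?_ le_rfl
  · rw [e₂]; exact fun i hi => (hI i hi).bdd
  · rw [e₂]
    intro i hi
    rw [(hI i hi.le).count, (hI i hi.le).var 7 (by omega) (by omega)]; exact hi
  · rw [e₂, (hI _ le_rfl).count, (hI _ le_rfl).var 7 (by omega) (by omega)]; exact lt_irrefl _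
  rintro s₃ ⟨e₃, f₃⟩
  rw [e₂] at e₃
  have f₃' := f₂'.trans f₃
  have hIn := hI _ le_rfl
  rw [← e₃] at hIn
  have hL : envL s₃.env = envL m := by
    simp only [envL, hIn.var 0 (by omega) (by omega)]
  refine Runs.seq (h₄ s₃ V hIn.bdd (by rw [f₃'.loc]; exact hl)) ?_ le_rfl
  rintro s₄ ⟨e₄, f₄⟩
  have f₄' := f₃'.trans f₄
  have hb₄ : s₄.env.Bdd V := by
    rw [e₄]; exact bdd_setArr hIn.bdd fun x _ => by split <;> omega
  refine (h₅ s₄ V hb₄ (by rw [f₄'.loc]; exact hl)).mono le_rfl ?_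
  rintro s₅ ⟨e₅, f₅⟩
  have hL₄ : envL s₄.env = envL m := by rw [e₄]; exact hL
  refine ⟨f₄'.trans f₅, ?_, ?_, ?_, ?_, ?_⟩
  · rw [e₅]
    refine bdd_setVar hb₄ ((Finset.card_filter_le _ _).trans ?_)
    rw [Finset.card_range, hL₄]; exact hU
  · intro v h2 h3 h10
    rw [e₅, e₄]
    simp only [Env.setVar, markGood, Env.setArr]
    rw [Function.update_of_ne h10, hIn.var v h2 h3]
  · intro a h3 h4
    rw [e₅, e₄]
    exact (setArr_mem_of_ne _ _ _ h4).trans (hIn.mem a h3 h4)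
  · refine ⟨s₃.env.mem 3, hIn.closed, hIn.clauses, fun x hx => ?_⟩
    rw [e₅, e₄]
    have := markGood_mem k s₃.env (x := x) (by rw [hL]; exact hx)
    rw [hL] at this
    exact this
  · rw [e₅]
    simp only [Env.setVar, Function.update_self, hL₄]

end Sparsify

/-! ### From the encoded formula to marked codes -/

namespace Sparsify

open RealRAM SAT

/-! ### Reading a formula

Small variables: `1` the number of clauses, `4` a clause, `6` its position. Small arrays: `0` the
encoding, `1` the positions of the clauses, `2` the codes of the clauses. -/

def litCode {N : ℕ} (l : Literal N) : ℕ := 2 * (l.1 : ℕ) + l.2.toNat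

def clauseSet {N : ℕ} (c : List (Literal N)) : Finset ℕ := (c.map litCode).toFinset

def clauseSets {N : ℕ} (φ : CNF N) : Clauses := (φ.map clauseSet).toFinset

theorem litCode_lt {N : ℕ} (l : Literal N) : litCode l < 2 * N := by
  have := l.1.2
  have h2 : l.2.toNat ≤ 1 := Bool.toNat_le _
  unfold litCode
  omega

theorem clauseSets_wf {N k L : ℕ} {φ : CNF N} (hφ : WidthLE k φ) (hL : 2 * N ≤ L) :
    WF k L (clauseSets φ) := by
  intro C hC
  simp only [clauseSets, List.mem_toFinset, List.mem_map] at hC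
  obtain ⟨c, hc, rfl⟩ := hC
  refine ⟨fun y hy => ?_, (List.toFinset_card_le _).trans (by simpa using hφ c hc)⟩
  simp only [clauseSet, List.mem_toFinset, List.mem_map] at hy
  obtain ⟨l, -, rfl⟩ := hy
  exact Finset.mem_range.2 ((litCode_lt l).trans_le hL)

/-- The truth of literals under an assignment. -/
def litTrue (β : ℕ → Bool) (y : ℕ) : Prop := y % 2 = (β (y / 2)).toNat

theorem litTrue_litCode {N : ℕ} (β : ℕ → Bool) (l : Literal N) :
    litTrue β (litCode l) ↔ β l.1 = l.2 := by
  have e1 : litCode l / 2 = l.1 := by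
    have h2 : l.2.toNat ≤ 1 := Bool.toNat_le _
    unfold litCode; omega
  have e2 : litCode l % 2 = l.2.toNat := by
    have h2 : l.2.toNat ≤ 1 := Bool.toNat_le _
    unfold litCode; omega
  rw [litTrue, e1, e2]
  cases β l.1 <;> cases l.2 <;> simp

theorem sat_clauseSets {N : ℕ} (β : ℕ → Bool) (φ : CNF N) :
    Sat (litTrue β) (clauseSets φ) ↔ ∀ c ∈ φ, ∃ l ∈ c, β l.1 = l.2 := by
  simp only [Sat, clauseSets, clauseSet, List.mem_toFinset, List.mem_map, forall_exists_index,
    and_imp, forall_apply_eq_imp_iff₂]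
  refine forall₂_congr fun c _ => ⟨?_, ?_⟩
  · rintro ⟨_, ⟨l, hl, rfl⟩, h⟩
    exact ⟨l, hl, (litTrue_litCode β l).1 h⟩
  · rintro ⟨l, hl, h⟩
    exact ⟨_, ⟨l, hl, rfl⟩, (litTrue_litCode β l).2 h⟩

/-- Assignments are defined on all of `ℕ`, so the number of variables can be raised without
affecting satisfiability. -/
theorem satisfiable_iff {N : ℕ} (φ : CNF N) :
    Satisfiable φ ↔ ∃ β : ℕ → Bool, Sat (litTrue β) (clauseSets φ) := by
  constructor
  · rintro ⟨σ, h⟩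
    refine ⟨fun v => if hv : v < N then σ ⟨v, hv⟩ else false, (sat_clauseSets _ φ).2 fun c hc => ?_⟩
    obtain ⟨l, hl, h⟩ := h c hc
    exact ⟨l, hl, by simpa using h⟩
  · rintro ⟨β, h⟩
    exact ⟨fun v => β v, (sat_clauseSets β φ).1 h⟩

def startPos {N : ℕ} (φ : CNF N) (j : ℕ) : ℕ := (encode (φ.take j)).length

theorem encode_append {N : ℕ} (φ ψ : CNF N) : encode (φ ++ ψ) = encode φ ++ encode ψ := by
  simp [encode]

theorem encode_eq {N : ℕ} (φ : CNF N) {j : ℕ} (hj : j < φ.length) :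
    encode φ = encode (φ.take j) ++ ((φ[j].length :: φ[j].map litCode) ++
      encode (φ.drop (j + 1))) := by
  have h : encode φ = encode (φ.take j) ++ encode (φ[j] :: φ.drop (j + 1)) := by
    rw [← encode_append, ← List.drop_eq_getElem_cons hj, List.take_append_drop]
  rw [h]
  rfl

/-- The clauses have different lengths, so their positions have to be found one after the other: the
cell at the start of a clause tells where the next one begins. -/
theorem getD_startPos {N : ℕ} (φ : CNF N) {j : ℕ} (hj : j < φ.length) :
    (encode φ).getD (startPos φ j) 0 = φ[j].length := by
  rw [encode_eq φ hj, startPos, List.getD_append_right _ _ _ _ le_rfl]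
  simp

theorem getD_literal {N : ℕ} (φ : CNF N) {j l : ℕ} (hj : j < φ.length) (hl : l < φ[j].length) :
    (encode φ).getD (startPos φ j + 1 + l) 0 = litCode φ[j][l] := by
  rw [encode_eq φ hj, startPos, List.getD_append_right _ _ _ _ (by omega),
    List.getD_append _ _ _ _ (by simp; omega)]
  rw [show (encode (φ.take j)).length + 1 + l - (encode (φ.take j)).length = l + 1 by omega,
    List.getD_cons_succ, List.getD_eq_getElem _ _ (by simpa using hl), List.getElem_map]

theorem startPos_succ {N : ℕ} (φ : CNF N) {j : ℕ} (hj : j < φ.length) :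
    startPos φ (j + 1) = startPos φ j + φ[j].length + 1 := by
  rw [startPos, startPos, List.take_succ_eq_append_getElem hj, encode_append]
  simp [encode]
  omega

theorem startPos_le {N : ℕ} (φ : CNF N) (j : ℕ) : startPos φ j ≤ (encode φ).length := by
  conv_rhs => rw [← List.take_append_drop j φ, encode_append]
  simp [startPos]

theorem length_le {N : ℕ} (φ : CNF N) : φ.length ≤ (encode φ).length := by
  induction φ with
  | nil => simp
  | cons c φ ih =>
    have : encode (c :: φ) = encode [c] ++ encode φ := encode_append [c] φ
    rw [this]
    simp [encode] at ih ⊢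
    omega

theorem mem_encode_le {N : ℕ} (φ : CNF N) {x : ℕ} (hx : x ∈ encode φ) :
    x ≤ 2 * N + (encode φ).length := by
  simp only [encode, List.mem_flatMap, List.mem_cons, List.mem_map] at hx
  obtain ⟨c, hc, rfl | ⟨l, -, rfl⟩⟩ := hx
  · obtain ⟨j, hj, rfl⟩ := List.getElem_of_mem hc
    have h1 := startPos_succ φ hj
    have h2 := startPos_le φ (j + 1)
    omega
  · have := litCode_lt l
    unfold litCode at this
    omega

theorem mem_clauseSets {N : ℕ} {φ : CNF N} {C : Finset ℕ} :
    C ∈ clauseSets φ ↔ ∃ j, ∃ h : j < φ.length, clauseSet φ[j] = C := by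
  simp only [clauseSets, List.mem_toFinset, List.mem_map]
  constructor
  · rintro ⟨c, hc, rfl⟩
    obtain ⟨j, hj, rfl⟩ := List.getElem_of_mem hc
    exact ⟨j, hj, rfl⟩
  · rintro ⟨j, hj, rfl⟩
    exact ⟨_, List.getElem_mem hj, rfl⟩

theorem mem_clauseSet {N : ℕ} (φ : CNF N) {j : ℕ} (hj : j < φ.length) {y : ℕ} :
    y ∈ clauseSet φ[j] ↔ ∃ l < (encode φ).getD (startPos φ j) 0,
      (encode φ).getD (startPos φ j + 1 + l) 0 = y := by
  rw [getD_startPos φ hj]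
  simp only [clauseSet, List.mem_toFinset, List.mem_map]
  constructor
  · rintro ⟨l, hl, rfl⟩
    obtain ⟨i, hi, rfl⟩ := List.getElem_of_mem hl
    exact ⟨i, hi, getD_literal φ hj hi⟩
  · rintro ⟨i, hi, rfl⟩
    exact ⟨_, List.getElem_mem hi, (getD_literal φ hj hi).symm⟩

/-- Record the position of a clause and go to the next one. -/
def parseStep (m : Env) : Env :=
  ((m.setArr 1 (m.var 1) fun x => if x = m.var 4 then m.var 6 else m.mem 1 x).setVar 6
    (m.var 6 + m.mem 0 (m.var 6) + 1)).setVar 4 (m.var 4 + 1)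

theorem exists_acts_parseStep : ∃ P : Program, P.Acts parseStep := by
  obtain ⟨P₁, h₁⟩ := exists_acts_setArr 1 (Comp.var 1)
    (f := fun (m : Env) x => if x = m.var 4 then m.var 6 else m.mem 1 x)
    (CompP.ite (CompP.eq Comp.snd (.var 4)) (.var 6) (.load 1 .snd))
  obtain ⟨P₂, h₂⟩ := exists_acts_setVar 6 (f := fun m : Env => m.var 6 + m.mem 0 (m.var 6) + 1)
    (((Comp.var 6).add (.load 0 (.var 6))).add (.const 1))
  obtain ⟨P₃, h₃⟩ := exists_acts_setVar 4 (f := fun m : Env => m.var 4 + 1)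
    ((Comp.var 4).add (.const 1))
  refine ⟨_, ((h₁.seq h₂).seq h₃).congr fun m => ?_⟩
  simp [parseStep, Env.setVar, Env.setArr, Ctx.env]

structure ParseInv {N : ℕ} (φ : CNF N) (i : ℕ) (m : Env) : Prop where
  var : ∀ v, v ≠ 4 → v ≠ 6 → m.var v = if v = 0 then N else if v = 1 then φ.length else 0
  clause : m.var 4 = i
  pos : m.var 6 = startPos φ i
  enc : ∀ x, m.mem 0 x = (encode φ).getD x 0
  start : ∀ j < i, m.mem 1 j = startPos φ j
  start_le : ∀ j, m.mem 1 j ≤ size φ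
  mem : ∀ a, a ≠ 0 → a ≠ 1 → ∀ x, m.mem a x = 0

theorem ParseInv.next {N : ℕ} {φ : CNF N} {i : ℕ} {m : Env} (h : ParseInv φ i m)
    (hi : i < φ.length) : ParseInv φ (i + 1) (parseStep m) := by
  have h1 : m.var 1 = φ.length := by rw [h.var 1 (by omega) (by omega)]; simp
  have hm1 : ∀ j, (parseStep m).mem 1 j = if j = i then startPos φ i else m.mem 1 j := by
    intro j
    simp only [parseStep, Env.setVar, Env.setArr, Function.update_self, h1, h.clause, h.pos]
    by_cases hj : j = i
    · simp [hj, hi]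
    · simp [hj]
  have hma : ∀ a, a ≠ 1 → (parseStep m).mem a = m.mem a := by
    intro a ha
    simp [parseStep, Env.setVar, Env.setArr, ha]
  refine ⟨fun v h4 h6 => ?_, ?_, ?_, fun x => ?_, fun j hj => ?_, fun j => ?_, fun a h0 h1 x => ?_⟩
  · rw [← h.var v h4 h6]
    simp [parseStep, Env.setVar, Env.setArr, h4, h6]
  · simp [parseStep, Env.setVar, h.clause]
  · rw [startPos_succ φ hi, ← getD_startPos φ hi, ← h.enc, ← h.pos]
    simp [parseStep, Env.setVar]
  · rw [hma 0 (by omega), h.enc]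
  · rw [hm1]
    split
    · next e => rw [e]
    · exact h.start j (by omega)
  · rw [hm1]
    split
    · exact (startPos_le _ _).trans (Nat.le_add_left _ _)
    · exact h.start_le j
  · rw [hma a h1, h.mem a h0 h1]

theorem ParseInv.bdd {N : ℕ} {φ : CNF N} {i : ℕ} {m : Env} (h : ParseInv φ i m)
    (hi : i ≤ φ.length) : m.Bdd (2 * size φ) := by
  have h0 : φ.length ≤ (encode φ).length := length_le φ
  refine ⟨fun v => ?_, fun a x => ?_⟩
  · by_cases h4 : v = 4
    · rw [h4, h.clause]; unfold size; omega
    · by_cases h6 : v = 6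
      · rw [h6, h.pos]
        have := startPos_le φ i
        unfold size; omega
      · rw [h.var v h4 h6]
        unfold size
        split_ifs <;> omega
  · by_cases ha : a = 0
    · rw [ha, h.enc]
      by_cases hx : x < (encode φ).length
      · rw [List.getD_eq_getElem _ _ hx]
        have := mem_encode_le φ (List.getElem_mem hx)
        unfold size; omega
      · rw [List.getD_eq_default _ _ (by omega)]; omega
    · by_cases ha1 : a = 1
      · rw [ha1]
        have := h.start_le x
        omega
      · rw [h.mem a ha ha1]; omega

theorem parseInv_zero {N : ℕ} (φ : CNF N) (s : State)
    (hs : s.natReg = Function.update (input φ).natReg 8 φ.length)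
    (hm : s.natMem = (input φ).natMem) : ParseInv φ 0 s.env := by
  refine ⟨fun v h4 h6 => ?_, ?_, ?_, fun x => ?_, by omega, fun j => ?_, fun a h0 h1 x => ?_⟩
  · simp only [State.env, hs, Function.update_apply, input]
    split_ifs <;> omega
  · simp [State.env, hs, input]
  · simp [State.env, hs, input, startPos, encode]
  · simp [State.env, hm, input]
  · simp [State.env, hm, input]
  · simp [State.env, hm, input, h0]

open Classical in
/-- Mark the codes of the clauses. -/
noncomputable def markClauses (k : ℕ) (m : Env) : Env :=
  m.setArr 2 ((envL m + 1) ^ k) fun x => if ∃ j < m.var 1, ∀ y < envL m,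
    y ∈ cset k (envL m) x ↔ ∃ l < m.mem 0 (m.mem 1 j), m.mem 0 (m.mem 1 j + 1 + l) = y
    then 1 else 0

theorem exists_acts_markClauses (k : ℕ) : ∃ P : Program, P.Acts (markClauses k) := by
  classical
  refine exists_acts_setArr 2 (comp_codes comp_envL) (f := fun (m : Env) x =>
    if ∃ j < m.var 1, ∀ y < envL m, y ∈ cset k (envL m) x ↔
      ∃ l < m.mem 0 (m.mem 1 j), m.mem 0 (m.mem 1 j + 1 + l) = y then 1 else 0) (CompP.ind ?_)
  refine CompP.ex (p := fun (q : Env × ℕ) j => ∀ y < envL q.1, y ∈ cset k (envL q.1) q.2 ↔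
      ∃ l < q.1.mem 0 (q.1.mem 1 j), q.1.mem 0 (q.1.mem 1 j + 1 + l) = y) (Comp.var 1) ?_
  refine CompP.all (p := fun (q : (Env × ℕ) × ℕ) y => y ∈ cset k (envL q.1.1) q.1.2 ↔
      ∃ l < q.1.1.mem 0 (q.1.1.mem 1 q.2), q.1.1.mem 0 (q.1.1.mem 1 q.2 + 1 + l) = y) comp_envL ?_
  refine (compP_mem comp_envL (Comp.snd.fst.fst) .snd).iff ?_
  exact CompP.ex (p := fun (q : ((Env × ℕ) × ℕ) × ℕ) l =>
      q.1.1.1.mem 0 (q.1.1.1.mem 1 q.1.2 + 1 + l) = q.2)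
    (Comp.load 0 (.load 1 (Comp.snd.fst))) (CompP.eq
      (.load 0 (((Comp.load 1 (Comp.snd.fst.fst)).add (.const 1)).add .snd)) (Comp.snd.fst))

/-- The constant `N₀` counts dummy variables, which ensure that the later parameters are large
enough for every formula. -/
structure ParsePost {N : ℕ} (k N₀ : ℕ) (φ : CNF N) (m : Env) : Prop where
  numVars : m.var 0 = N + N₀
  var : ∀ v, v ≠ 0 → v ≠ 1 → v ≠ 4 → v ≠ 6 → m.var v = 0
  closed : Closed k (envL m) (m.mem 2)
  clauses : clausesOf k (envL m) (m.mem 2) = clauseSets φ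

theorem exists_parse (k N₀ : ℕ) : ∃ (P : Program) (c : ℕ), ∀ (N : ℕ) (φ : CNF N), WidthLE k φ →
    Runs P (input φ) ((size φ + 2) ^ c) fun s => SmallFrame (input φ) s ∧
      s.env.Bdd ((size φ + 2) ^ c) ∧ ParsePost k N₀ φ s.env := by
  classical
  obtain ⟨P₁, h₁⟩ := exists_acts_parseStep
  obtain ⟨c₁, h₁⟩ := h₁.loop_runs 4 1
  obtain ⟨P₂, ⟨c₂, h₂⟩, ⟨d₂, g₂⟩⟩ := exists_acts_setVar 0 (f := fun m : Env => m.var 0 + N₀)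
    ((Comp.var 0).add (.const N₀))
  obtain ⟨P₃, ⟨c₃, h₃⟩, ⟨d₃, g₃⟩⟩ := exists_acts_markClauses k
  have hpow : ∀ c : ℕ, Expr.PolyBd fun V => (V + 2) ^ c := fun c => ⟨c, fun _ => le_rfl⟩
  have hid := (Expr.PolyBd.const 2).mul .id
  have hb₂ := (hpow d₂).comp hid
  have hb₃ := (hpow d₃).comp hb₂
  obtain ⟨c, hc⟩ := (Expr.PolyBd.id.add (.const 1)).add
    (((Expr.PolyBd.id.add (.const 1)).mul ((hpow c₁).comp hid)).add
    (((hpow c₂).comp hid).add (((hpow c₃).comp hb₂).add hb₃)))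
  -- Register 1 holds the number of clauses but belongs to the temporaries. Its content is moved to
  -- register 8, the small variable 1, which is still zero.
  refine ⟨.seq (.instr (.natOp .add 8 1 8)) (.seq (.loop (.natLt (8 * 4) (8 * 1)) P₁)
    (.seq P₂ P₃)), c, fun N φ hφ => ?_⟩
  have hlen : φ.length ≤ size φ := (length_le φ).trans (Nat.le_add_left _ _)
  set V := 2 * size φ with hV
  have hc' : size φ + 1 + ((size φ + 1) * (V + 2) ^ c₁ + ((V + 2) ^ c₂ +
    (((V + 2) ^ d₂ + 2) ^ c₃ + ((V + 2) ^ d₂ + 2) ^ d₃))) ≤ (size φ + 2) ^ c := hc (size φ)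
  refine Runs.mono (T := size φ + 1 + ((size φ + 1) * (V + 2) ^ c₁ + ((V + 2) ^ c₂ +
    ((V + 2) ^ d₂ + 2) ^ c₃))) ?_ (by omega) fun _ h => h
  refine Runs.seq (T₁ := size φ + 1) (M := fun s => SmallFrame (input φ) s ∧ ParseInv φ 0 s.env)
    (Runs.instr _ _ ?_ ⟨⟨?_, ?_, rfl, rfl⟩, parseInv_zero φ _ ?_ rfl⟩) ?_ le_rfl
  · have := size_le_self φ.length
    simp [Instr.cost, input]
    omega
  · intro x hx _
    simp only [Instr.apply]
    rw [Function.update_of_ne (by omega)]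
  · intro a _ _
    rfl
  · simp [Instr.apply, input, NatOp.eval]
  rintro s₁ ⟨f₁, e₁⟩
  have hI : ∀ i ≤ φ.length, ParseInv φ i (parseStep^[i] s₁.env) := by
    intro i
    induction i with
    | zero => exact fun _ => e₁
    | succ i ih =>
      intro hi
      rw [Function.iterate_succ_apply']
      exact (ih (by omega)).next (by omega)
  have hl : ∀ i, (input φ).loc i = 0 := by
    intro i
    simp only [State.loc, input]
    rw [if_neg (by omega), if_neg (by omega)]
  have hvar1 : ∀ i ≤ φ.length, (parseStep^[i] s₁.env).var 1 = φ.length := fun i hi => by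
    rw [(hI i hi).var 1 (by omega) (by omega)]; simp
  refine Runs.seq ((h₁ s₁ V φ.length (by rw [f₁.loc]; exact hl) (fun i hi => (hI i hi).bdd hi)
    (fun i hi => ?_) ?_).mono (Nat.mul_le_mul_right _ (by omega)) fun _ h => h) ?_ le_rfl
  · rw [(hI i hi.le).clause, hvar1 i hi.le]; exact hi
  · rw [(hI _ le_rfl).clause, hvar1 _ le_rfl]; exact lt_irrefl _
  rintro s₂ ⟨e₂, f₂⟩
  have f₂' := f₁.trans f₂
  have hI₂ : ParseInv φ φ.length s₂.env := by rw [e₂]; exact hI _ le_rfl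
  have hb₂ := hI₂.bdd le_rfl
  refine Runs.seq (h₂ s₂ V hb₂ (by rw [f₂'.loc]; exact hl)) ?_ le_rfl
  rintro s₃ ⟨e₃, f₃⟩
  have f₃' := f₂'.trans f₃
  have hb₃ : s₃.env.Bdd ((V + 2) ^ d₂) := by rw [e₃]; exact g₂ _ _ hb₂
  refine (h₃ s₃ _ hb₃ (by rw [f₃'.loc]; exact hl)).mono le_rfl ?_
  rintro s₄ ⟨e₄, f₄⟩
  have hb₄ : s₄.env.Bdd (((V + 2) ^ d₂ + 2) ^ d₃) := by rw [e₄]; exact g₃ _ _ hb₃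
  have v₃ : ∀ v, v ≠ 0 → s₃.env.var v = s₂.env.var v := fun v hv => by
    rw [e₃]; simp [Env.setVar, hv]
  have m₃ : s₃.env.mem = s₂.env.mem := by rw [e₃]; rfl
  have v₄ : s₄.env.var = s₃.env.var := by rw [e₄]; rfl
  have hL₄ : envL s₄.env = envL s₃.env := by simp only [envL, v₄]
  have n₃ : s₃.env.var 0 = N + N₀ := by
    rw [e₃]
    simp [Env.setVar, hI₂.var 0]
  have hwf := clauseSets_wf (L := envL s₃.env) hφ (by rw [envL, n₃]; omega)
  have hcl := clausesOf_eq (F := s₄.env.mem 2) hwf fun x hx => by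
    rw [e₄, markClauses, setArr_mem_self _ _ _ _ hx, m₃, v₃ 1 (by omega), hI₂.var 1 (by omega) (by omega), mem_clauseSets]
    simp only [ne_eq, ite_eq_right_iff, one_ne_zero, imp_false, not_not, if_true, if_false]
    have key : ∀ j, ∀ hj : j < φ.length, (∀ y < envL s₃.env, y ∈ cset k (envL s₃.env) x ↔
        ∃ l < s₂.env.mem 0 (s₂.env.mem 1 j), s₂.env.mem 0 (s₂.env.mem 1 j + 1 + l) = y) ↔
        clauseSet φ[j] = cset k (envL s₃.env) x := by
      intro j hj
      simp only [hI₂.enc, hI₂.start j hj, ← mem_clauseSet φ hj]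
      constructor
      · intro h
        ext y
        by_cases hy : y < envL s₃.env
        · exact (h y hy).symm
        · refine iff_of_false (fun hc => hy ?_) fun hc => hy (mem_cset.1 hc).1
          exact Finset.mem_range.1 ((hwf _ (mem_clauseSets.2 ⟨j, hj, rfl⟩)).1 hc)
      · rintro h y -
        rw [h]
    constructor
    · rintro ⟨j, hj, h⟩
      exact ⟨j, hj, (key j hj).1 h⟩
    · rintro ⟨j, hj, h⟩
      exact ⟨j, hj, (key j hj).2 h⟩
  refine ⟨f₃'.trans f₄, hb₄.mono ?_, ?_, fun v h0 h1 h4 h6 => ?_, ?_, ?_⟩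
  · omega
  · rw [v₄, n₃]
  · rw [v₄, v₃ v h0, hI₂.var v h4 h6, if_neg h0, if_neg h1]
  · rw [hL₄]; exact hcl.2
  · rw [hL₄]; exact hcl.1

end Sparsify

/-! ### The number of written cells bounds the running time from below -/

namespace RealRAM

/-- A computation writes at most one real cell per time unit. -/
theorem Exec.card_changed_le {P : Program} {s s' : State} {t : ℕ} (h : Exec P s t s') (a : ℕ) :
    ∀ S : Finset ℕ, (∀ x ∈ S, s'.realMem a x ≠ s.realMem a x) → S.card ≤ t := by
  classical
  have key : ∀ {s s₁ s₂ : State} {t₁ t₂ : ℕ},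
      (∀ S : Finset ℕ, (∀ x ∈ S, s₁.realMem a x ≠ s.realMem a x) → S.card ≤ t₁) →
      (∀ S : Finset ℕ, (∀ x ∈ S, s₂.realMem a x ≠ s₁.realMem a x) → S.card ≤ t₂) →
      ∀ S : Finset ℕ, (∀ x ∈ S, s₂.realMem a x ≠ s.realMem a x) → S.card ≤ t₁ + t₂ := by
    intro s s₁ s₂ t₁ t₂ h₁ h₂ S hS
    rw [← Finset.card_filter_add_card_filter_not (s := S) fun x => s₁.realMem a x ≠ s.realMem a x]
    refine Nat.add_le_add (h₁ _ fun x hx => (Finset.mem_filter.1 hx).2) (h₂ _ fun x hx => ?_)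
    obtain ⟨h3, h4⟩ := Finset.mem_filter.1 hx
    rw [not_not.1 h4]
    exact hS x h3
  induction h with
  | instr i s =>
    intro S hS
    have hcost : 1 ≤ i.cost s := by cases i <;> simp [Instr.cost] <;> omega
    refine le_trans ?_ hcost
    cases i with
    | realStore arr idx src =>
      refine (Finset.card_le_card (t := {s.natReg idx}) fun x hx => ?_).trans (by simp)
      have h1 := hS x hx
      simp only [Instr.apply, write_apply] at h1
      rw [Finset.mem_singleton]
      by_contra hne
      exact h1 (if_neg fun h => hne h.2)
    | _ =>
      rw [Finset.eq_empty_of_forall_notMem fun x hx => hS x hx rfl]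
      simp
  | seq _ _ ih₁ ih₂ => exact key ih₁ ih₂
  | branchTrue _ _ ih => exact fun S hS => (ih S hS).trans (Nat.le_add_left _ _)
  | branchFalse _ _ ih => exact fun S hS => (ih S hS).trans (Nat.le_add_left _ _)
  | loopTrue _ _ _ ih₁ ih₂ =>
    exact fun S hS => (key ih₁ ih₂ S hS).trans (by omega)
  | loopFalse _ =>
    intro S hS
    rw [Finset.eq_empty_of_forall_notMem fun x hx => hS x hx rfl]
    simp

end RealRAM

/-! ### Attention detects orthogonal pairs; growth of the parameters -/

namespace SlidingWindow

open RealRAM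

/-! ### Approximate computation -/

/-- Approximation with a multiplicative and an additive error. -/
def approx (μ ν : ℝ) : Accuracy := fun _ _ Y Y' => ∀ i j, |Y' i j - Y i j| ≤ μ * |Y i j| + ν

theorem ComputableInTime.mono {w dq dv : ℕ → ℕ} {A B : Accuracy} {T : ℕ → ℝ}
    (h : ComputableInTime w dq dv A T) (hAB : ∀ n m Y Y', A n m Y Y' → B n m Y Y') :
    ComputableInTime w dq dv B T := by
  obtain ⟨P, C, h⟩ := h
  refine ⟨P, C, h.mono fun n hn Q V => ?_⟩
  obtain ⟨t, s, h1, h2, h3⟩ := hn Q V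
  exact ⟨t, s, h1, hAB _ _ _ _ h2, h3⟩

theorem attention_apply {n d m : ℕ} (w : ℕ) (Q : Matrix (Fin n) (Fin d) ℝ)
    (V : Matrix (Fin n) (Fin m) ℝ) (i : Fin n) (j : Fin m) :
    attention w Q V i j = ∑ i', score w Q i i' * V i' j := rfl

theorem score_nonneg {n d : ℕ} (w : ℕ) (Q : Matrix (Fin n) (Fin d) ℝ) (i i' : Fin n) :
    0 ≤ score w Q i i' := by
  simp only [score, Matrix.of_apply]
  split
  · exact (Real.exp_pos _).le
  · exact le_rfl

/-- The output is written cell by cell. -/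
theorem card_output_le {n d m w : ℕ} {μ ν : ℝ} (hμ : μ < 1) {P : Program} {T : ℝ}
    (h : ∀ (Q : Matrix (Fin n) (Fin d) ℝ) (V : Matrix (Fin n) (Fin m) ℝ), ∃ t s,
      Exec P (input w Q V) t s ∧ approx μ ν n m (attention w Q V) (output n m s) ∧ (t : ℝ) ≤ T) :
    ((n * m : ℕ) : ℝ) ≤ T := by
  -- With zero queries all scores in the window are 1, so with constant values `l` every true entry
  -- is at least `l`, already by the diagonal term. An approximation 0 of such an entry would
  -- require `(1 - μ) l ≤ ν`. So no output cell can keep its initial content 0.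
  set l : ℝ := (|ν| + 1) / (1 - μ) with hl
  have h1μ : 0 < 1 - μ := by linarith
  have hlpos : 0 < l := by positivity
  obtain ⟨t, s, he, ha, ht⟩ := h 0 (Matrix.of fun _ _ => l)
  refine le_trans ?_ ht
  have hY : ∀ i j, l ≤ attention w (0 : Matrix (Fin n) (Fin d) ℝ)
      (Matrix.of fun (_ : Fin n) (_ : Fin m) => l) i j := by
    intro i j
    rw [attention_apply]
    have h1 : score w (0 : Matrix (Fin n) (Fin d) ℝ) i i * l = l := by
      have : (0 : ℝ) ≤ (w : ℝ) / 2 := by positivity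
      have h0 : (0 : Matrix (Fin n) (Fin d) ℝ) i ⬝ᵥ (0 : Matrix (Fin n) (Fin d) ℝ) i = 0 :=
        zero_dotProduct _
      simp [score, this, h0]
    calc l = score w (0 : Matrix (Fin n) (Fin d) ℝ) i i * l := h1.symm
      _ ≤ _ := Finset.single_le_sum (f := fun i' => score w (0 : Matrix (Fin n) (Fin d) ℝ) i i' *
          (Matrix.of fun (_ : Fin n) (_ : Fin m) => l) i' j)
          (fun i' _ => mul_nonneg (score_nonneg _ _ _ _) hlpos.le) (Finset.mem_univ i)
  have hne : ∀ i j, output n m s i j ≠ 0 := by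
    intro i j h0
    have h1 := ha i j
    have h2 := hY i j
    have h3 := le_abs_self ν
    set y := attention w (0 : Matrix (Fin n) (Fin d) ℝ)
      (Matrix.of fun (_ : Fin n) (_ : Fin m) => l) i j
    rw [h0, zero_sub, abs_neg, abs_of_pos (hlpos.trans_le h2)] at h1
    have h4 : (1 - μ) * l = |ν| + 1 := by rw [hl]; field_simp
    nlinarith
  have := he.card_changed_le 2 (Finset.range (n * m)) fun x hx => by
    rw [Finset.mem_range] at hx
    have hm : 0 < m := Nat.pos_of_ne_zero fun h => by simp [h] at hx
    have h1 := hne ⟨x / m, Nat.div_lt_of_lt_mul (by rwa [mul_comm])⟩ ⟨x % m, Nat.mod_lt _ hm⟩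
    simp only [output, Matrix.of_apply] at h1
    rw [mul_comm, Nat.div_add_mod] at h1
    simpa [input] using h1
  rw [Finset.card_range] at this
  exact_mod_cast this

/-! ### Orthogonal vectors -/

section

variable (n d m M : ℕ) (A : ℕ → Prop) (U : ℕ → ℕ → Prop)

open Classical in
/-- Query and key vectors: `0`-`1` vectors on the rows in `A`, multiplied by `-n` on the others. -/
noncomputable def queries : Matrix (Fin n) (Fin d) ℝ :=
  Matrix.of fun i j => if (j : ℕ) < M ∧ U i j then if A i then 1 else -(n : ℝ) else 0

-- Rows in `A` have value zero, so the scores inside `A`, which can be large, do not enter. One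
-- column suffices; the others are padding.
open Classical in
noncomputable def values : Matrix (Fin n) (Fin m) ℝ :=
  Matrix.of fun i j => if (j : ℕ) = 0 ∧ ¬ A i then (n : ℝ) else 0

variable {n d m M A U}

open Classical in
theorem queries_dotProduct {i i' : Fin n} (hi : A i) (hi' : ¬ A i') :
    queries n d M A U i ⬝ᵥ queries n d M A U i' =
      -(n : ℝ) *
        ((Finset.univ.filter fun j : Fin d => (j : ℕ) < M ∧ U i j ∧ U i' j).card : ℕ) := by
  rw [Finset.card_filter]
  push_cast
  rw [Finset.mul_sum, dotProduct]
  refine Finset.sum_congr rfl fun j _ => ?_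
  simp only [queries, Matrix.of_apply, hi, hi', if_true, if_false]
  by_cases h1 : (j : ℕ) < M <;> by_cases h2 : U i j <;> by_cases h3 : U i' j <;> simp [h1, h2, h3]

theorem values_nonneg (i : Fin n) (j : Fin m) : 0 ≤ values n m A i j := by
  simp only [values, Matrix.of_apply]
  split
  · positivity
  · exact le_rfl

theorem attention_nonneg (w : ℕ) (i : Fin n) (j : Fin m) :
    0 ≤ attention w (queries n d M A U) (values n m A) i j := by
  rw [attention_apply]
  exact Finset.sum_nonneg fun i' _ => mul_nonneg (score_nonneg _ _ _ _) (values_nonneg _ _)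

/-- An orthogonal pair in the window leads to a large entry. -/
theorem le_attention {w : ℕ} (i i' : Fin n) (j : Fin m) (hj : (j : ℕ) = 0) (hi : A i)
    (hi' : ¬ A i') (hw : |((i : ℕ) : ℝ) - ((i' : ℕ) : ℝ)| ≤ (w : ℝ) / 2)
    (h : ∀ j < M, ¬ (U i j ∧ U i' j)) :
    (n : ℝ) ≤ attention w (queries n d M A U) (values n m A) i j := by
  classical
  rw [attention_apply]
  have h1 : score w (queries n d M A U) i i' * values n m A i' j = n := by
    simp only [score, values, Matrix.of_apply]
    rw [if_pos hw, if_pos ⟨hj, hi'⟩, queries_dotProduct hi hi', Finset.filter_false_of_mem]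
    · simp
    · rintro j' - ⟨h2, h3⟩
      exact h _ h2 h3
  calc (n : ℝ) = score w (queries n d M A U) i i' * values n m A i' j := h1.symm
    _ ≤ _ := Finset.single_le_sum (f := fun i' => score w (queries n d M A U) i i' *
        values n m A i' j)
        (fun i' _ => mul_nonneg (score_nonneg _ _ _ _) (values_nonneg _ _)) (Finset.mem_univ i')

/-- Without orthogonal pairs the entries are small. -/
theorem attention_le {w : ℕ} (i : Fin n) (j : Fin m) (hi : A i) (hM : M ≤ d)
    (h : ∀ i' : Fin n, ¬ A i' → ∃ j < M, U i j ∧ U i' j) :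
    attention w (queries n d M A U) (values n m A) i j ≤ (n : ℝ) * (n * Real.exp (-n)) := by
  classical
  rw [attention_apply]
  have h1 : ∀ i' ∈ Finset.univ, score w (queries n d M A U) i i' * values n m A i' j ≤
      (n : ℝ) * Real.exp (-n) := by
    rintro i' -
    have hpos : 0 ≤ (n : ℝ) * Real.exp (-n) := by positivity
    by_cases hi' : A i'
    · simp only [values, Matrix.of_apply, hi', not_true, and_false, if_false, mul_zero]
      exact hpos
    · have h2 : score w (queries n d M A U) i i' ≤ Real.exp (-n) := by
        simp only [score, Matrix.of_apply]
        split
        · rw [queries_dotProduct hi hi', Real.exp_le_exp]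
          obtain ⟨j', hj', hU⟩ := h i' hi'
          have h3 : 1 ≤ (Finset.univ.filter
              fun j : Fin d => (j : ℕ) < M ∧ U i j ∧ U i' j).card :=
            Finset.card_pos.2 ⟨⟨j', by omega⟩, by simp [hj', hU]⟩
          have h4 : (1 : ℝ) ≤ (Finset.univ.filter
              fun j : Fin d => (j : ℕ) < M ∧ U i j ∧ U i' j).card := by exact_mod_cast h3
          nlinarith [(Nat.cast_nonneg n : (0 : ℝ) ≤ n)]
        · exact (Real.exp_pos _).le
      have h5 : values n m A i' j ≤ n := by
        simp only [values, Matrix.of_apply]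
        split
        · exact le_rfl
        · positivity
      calc score w (queries n d M A U) i i' * values n m A i' j
          ≤ Real.exp (-n) * n := mul_le_mul h2 h5 (values_nonneg _ _) (Real.exp_pos _).le
        _ = _ := mul_comm _ _
  refine (Finset.sum_le_card_nsmul _ _ _ h1).trans ?_
  simp

/-- From `1 + x + x^2 / 2 ≤ exp x`. -/
theorem sq_mul_exp_neg_le (x : ℝ) (hx : 0 ≤ x) : x * (x * Real.exp (-x)) ≤ 2 := by
  have h := Real.quadratic_le_exp_of_nonneg hx
  have h2 : Real.exp x * Real.exp (-x) = 1 := by rw [← Real.exp_add]; simp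
  have h3 := Real.exp_pos (-x)
  nlinarith

/-- The threshold `c` separates rows with and without orthogonal partners. -/
theorem lt_approx {w c : ℕ} {μ ν : ℝ} (hn : (c : ℝ) + ν < (1 - μ) * n)
    {Y' : Matrix (Fin n) (Fin m) ℝ} (hμ : μ < 1)
    (hY : approx μ ν n m (attention w (queries n d M A U) (values n m A)) Y')
    (i i' : Fin n) (j : Fin m) (hj : (j : ℕ) = 0) (hi : A i)
    (hi' : ¬ A i') (hw : |((i : ℕ) : ℝ) - ((i' : ℕ) : ℝ)| ≤ (w : ℝ) / 2)
    (h : ∀ j < M, ¬ (U i j ∧ U i' j)) : (c : ℝ) < Y' i j := by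
  have h1 := le_attention (d := d) i i' j hj hi hi' hw h
  have h2 := hY i j
  rw [abs_of_nonneg (attention_nonneg w i j)] at h2
  have h3 := (abs_le.1 h2).1
  nlinarith

/-- Without orthogonal partner the computed entry is at most `2 (1 + μ) + ν < 4 + ν`. The partner
that is found need not be in the window; any orthogonal pair will give a satisfying assignment. -/
theorem exists_of_lt_approx {w c : ℕ} {μ ν : ℝ} (hμ0 : 0 ≤ μ) (hμ : μ < 1)
    (hc : 4 + ν ≤ c) {Y' : Matrix (Fin n) (Fin m) ℝ}
    (hY : approx μ ν n m (attention w (queries n d M A U) (values n m A)) Y')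
    (i : Fin n) (j : Fin m) (hi : A i) (hM : M ≤ d) (hlt : (c : ℝ) < Y' i j) :
    ∃ i' : Fin n, ¬ A i' ∧ ∀ j < M, ¬ (U i j ∧ U i' j) := by
  by_contra hcon
  push Not at hcon
  have h1 := attention_le (w := w) i j hi hM hcon
  have h2 := hY i j
  have h0 := attention_nonneg (d := d) (M := M) (A := A) (U := U) w i j
  rw [abs_of_nonneg h0] at h2
  have h3 := (abs_le.1 h2).2
  have h4 := sq_mul_exp_neg_le n (Nat.cast_nonneg n)
  nlinarith

end

/-! ### Growth of the parameters -/

section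

variable {w dq dv : ℕ → ℕ} {C ε : ℝ}

/-- For `ε ≥ 1` the time bound would be at most a constant, while at least `n` cells are written. -/
theorem lt_one_of_output (hdv : ∀ᶠ n in atTop, 1 ≤ dv n)
    (h : ∀ᶠ n in atTop, ((n * dv n : ℕ) : ℝ) ≤ C * ((n : ℝ) * (w n : ℝ)) ^ (1 - ε)) : ε < 1 := by
  by_contra hcon
  push Not at hcon
  obtain ⟨n, hn, hd, hC, h1⟩ := (h.and (hdv.and ((tendsto_natCast_atTop_atTop.eventually
    (eventually_gt_atTop (|C|))).and (eventually_ge_atTop 1)))).exists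
  have h2 : ((n : ℝ) * (w n : ℝ)) ^ (1 - ε) ≤ 1 := by
    by_cases hw : w n = 0
    · rw [hw, Nat.cast_zero, mul_zero]
      by_cases he : 1 - ε = 0
      · rw [he, Real.rpow_zero]
      · rw [Real.zero_rpow he]; norm_num
    · refine Real.rpow_le_one_of_one_le_of_nonpos ?_ (by linarith)
      have : 1 ≤ n * w n := Nat.mul_pos h1 (Nat.pos_of_ne_zero hw)
      exact_mod_cast this
  have h3 : (n : ℝ) ≤ ((n * dv n : ℕ) : ℝ) := by exact_mod_cast Nat.le_mul_of_pos_right _ hd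
  have h4 : 0 ≤ ((n : ℝ) * (w n : ℝ)) ^ (1 - ε) := by positivity
  nlinarith [le_abs_self C, abs_nonneg C]

/-- Taking logarithms in `n ≤ D (n w)^(1-ε)` gives `ε log n ≤ log D + (1 - ε) log w`, and half of
the left side absorbs `log D`. Thus a program that is faster than the claimed bound forces `w` to be
at least a power of `n`. -/
theorem exists_log_le (hε : 0 < ε) (hdv : ∀ᶠ n in atTop, 1 ≤ dv n)
    (h : ∀ᶠ n in atTop, ((n * dv n : ℕ) : ℝ) ≤ C * ((n : ℝ) * (w n : ℝ)) ^ (1 - ε)) :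
    ∃ κ : ℝ, 0 < κ ∧ ∀ᶠ n : ℕ in atTop, κ * Real.log n ≤ Real.log (w n) := by
  have hε1 := lt_one_of_output hdv h
  set D := max C 1 with hD
  have hD1 : 1 ≤ D := le_max_right _ _
  refine ⟨ε / 2, by positivity, ?_⟩
  have hlog : Tendsto (fun n : ℕ => Real.log n) atTop atTop :=
    Real.tendsto_log_atTop.comp tendsto_natCast_atTop_atTop
  filter_upwards [h, hdv, hlog.eventually_ge_atTop (2 * Real.log D / ε), eventually_ge_atTop 1]
    with n hn hd hl h1
  have hn1 : (1 : ℝ) ≤ n := by exact_mod_cast h1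
  have h3 : (n : ℝ) ≤ D * ((n : ℝ) * (w n : ℝ)) ^ (1 - ε) := by
    calc (n : ℝ) ≤ ((n * dv n : ℕ) : ℝ) := by exact_mod_cast Nat.le_mul_of_pos_right _ hd
      _ ≤ C * ((n : ℝ) * (w n : ℝ)) ^ (1 - ε) := hn
      _ ≤ _ := mul_le_mul_of_nonneg_right (le_max_left _ _) (by positivity)
  have hw0 : w n ≠ 0 := by
    intro h0
    rw [h0, Nat.cast_zero, mul_zero, Real.zero_rpow (by linarith)] at h3
    linarith
  have hw1 : (1 : ℝ) ≤ w n := by exact_mod_cast Nat.pos_of_ne_zero hw0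
  have h4 := Real.log_le_log (by linarith) h3
  rw [Real.log_mul (by positivity) (by positivity), Real.log_rpow (by positivity),
    Real.log_mul (by positivity) (by positivity)] at h4
  have h5 : 2 * Real.log D ≤ Real.log n * ε := by rwa [div_le_iff₀ hε] at hl
  have h6 : 0 ≤ Real.log (w n) := Real.log_nonneg hw1
  nlinarith

/-- This turns `d_q = ω(log w)` into `d_q = ω(log n)`, which makes room for linearly many clauses in
`log n` variables. -/
theorem eventually_le_dim (hε : 0 < ε) (hdv : ∀ᶠ n in atTop, 1 ≤ dv n)
    (h : ∀ᶠ n in atTop, ((n * dv n : ℕ) : ℝ) ≤ C * ((n : ℝ) * (w n : ℝ)) ^ (1 - ε))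
    (hdq : (fun n => Real.log (w n : ℝ)) =o[atTop] fun n => (dq n : ℝ)) (K : ℝ) :
    ∀ᶠ n : ℕ in atTop, K * Real.log n ≤ dq n := by
  obtain ⟨κ, hκ, hw⟩ := exists_log_le hε hdv h
  have hK : 0 < κ / (|K| + 1) := by positivity
  filter_upwards [hw, hdq.def hK, eventually_ge_atTop 1] with n h1 h2 h3
  have hl : 0 ≤ Real.log n := Real.log_nonneg (by exact_mod_cast h3)
  rw [Real.norm_of_nonneg ((by positivity : 0 ≤ κ * Real.log n).trans h1),
    Real.norm_of_nonneg (Nat.cast_nonneg _)] at h2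
  have h4 := h1.trans h2
  rw [div_mul_eq_mul_div, le_div_iff₀ (by positivity)] at h4
  have h5 : κ * (Real.log n * (|K| + 1)) ≤ κ * dq n := by linarith
  have h6 := le_of_mul_le_mul_left h5 hκ
  nlinarith [le_abs_self K]

theorem eventually_le_window (hε : 0 < ε) (hdv : ∀ᶠ n in atTop, 1 ≤ dv n)
    (h : ∀ᶠ n in atTop, ((n * dv n : ℕ) : ℝ) ≤ C * ((n : ℝ) * (w n : ℝ)) ^ (1 - ε)) (W : ℕ) :
    ∀ᶠ n : ℕ in atTop, W ≤ w n := by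
  obtain ⟨κ, hκ, hw⟩ := exists_log_le hε hdv h
  have hlog : Tendsto (fun n : ℕ => Real.log n) atTop atTop :=
    Real.tendsto_log_atTop.comp tendsto_natCast_atTop_atTop
  filter_upwards [hw, hlog.eventually_gt_atTop (Real.log W / κ)] with n h1 h2
  rw [div_lt_iff₀ hκ] at h2
  by_contra hcon
  push Not at hcon
  have h3 : Real.log (w n) ≤ Real.log W := by
    by_cases h0 : w n = 0
    · rw [h0]; simp only [Nat.cast_zero, Real.log_zero]
      exact Real.log_natCast_nonneg W
    · exact Real.log_le_log (by exact_mod_cast Nat.pos_of_ne_zero h0) (by exact_mod_cast hcon.le)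
  linarith

end

end SlidingWindow

/-! ### Splitting the variables between two rows and the outer loop -/

namespace Sparsify

open RealRAM SAT

/-! ### Splitting the variables

Of `N` variables, those below `e` except `q` are given by the bits of a row of the first kind, those
between `e` and `e + q` by the last bits of a row of the second kind, and the others by the bits of
an outer loop. -/

/-- Variable `q` is an outer one because bit `q` of a row number is needed for the kind of the row.
-/
def outerVar (e q v : ℕ) : Prop := v = q ∨ e + q ≤ v

def outerIdx (e q v : ℕ) : ℕ := if v = q then 0 else v - (e + q) + 1

/-- No literal of `C` is made true by a row with bits `I` (of kind `0` or `1`), together with the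
outer bits `Y` in the former case. -/
def RowFalse (e q b : ℕ) (Y I : ℕ → ℕ) (kind : ℕ) (C : Finset ℕ) : Prop :=
  ∀ y ∈ C, (kind = 0 → (outerVar e q (y / 2) → Y (b + outerIdx e q (y / 2)) ≠ y % 2) ∧
      (y / 2 < e → y / 2 ≠ q → I (y / 2) ≠ y % 2)) ∧
    (kind ≠ 0 → e ≤ y / 2 → y / 2 < e + q → I (y / 2 - e) ≠ y % 2)

theorem RowFalse.congr {e q b : ℕ} (hq : q ≤ e) {Y I I' : ℕ → ℕ} (h : ∀ v < e, I v = I' v)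
    {kind : ℕ} {C : Finset ℕ} : RowFalse e q b Y I kind C ↔ RowFalse e q b Y I' kind C := by
  refine forall₂_congr fun y _ => and_congr (imp_congr_right fun _ => and_congr_right fun _ =>
    imp_congr_right fun hv => ?_) (imp_congr_right fun _ => imp_congr_right fun _ =>
    imp_congr_right fun hv => ?_)
  · rw [h _ hv]
  · rw [h _ (by omega)]

def bit (i v : ℕ) : ℕ := i / 2 ^ v % 2

open Classical in
/-- The clause with number `j` among those marked in `G` is false for the row with bits `I`. -/
def CoordFalse (k L e q b : ℕ) (G Y I : ℕ → ℕ) (kind j : ℕ) : Prop :=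
  ∃ x < (L + 1) ^ k, G x ≠ 0 ∧ ((Finset.range x).filter fun x' => G x' ≠ 0).card = j ∧
    RowFalse e q b Y I kind (cset k L x)

open Classical in
/-- The number of clauses marked in `G`. -/
noncomputable def numMarked (k L : ℕ) (G : ℕ → ℕ) : ℕ :=
  ((Finset.range ((L + 1) ^ k)).filter fun x => G x ≠ 0).card

open Classical in
theorem rank_inj {G : ℕ → ℕ} {x y : ℕ} (hx : G x ≠ 0)
    (hy : G y ≠ 0)
    (h : ((Finset.range x).filter fun x' => G x' ≠ 0).card =
      ((Finset.range y).filter fun x' => G x' ≠ 0).card) : x = y := by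
  have key : ∀ {x y : ℕ}, G x ≠ 0 → x < y → ((Finset.range x).filter fun x' => G x' ≠ 0).card <
      ((Finset.range y).filter fun x' => G x' ≠ 0).card := by
    intro x y hx hxy
    refine Finset.card_lt_card ⟨fun z hz => ?_, fun hsub => ?_⟩
    · simp only [Finset.mem_filter, Finset.mem_range] at hz ⊢
      exact ⟨by omega, hz.2⟩
    · have := hsub (Finset.mem_filter.2 ⟨Finset.mem_range.2 hxy, hx⟩)
      simp at this
  rcases lt_trichotomy x y with hlt | rfl | hlt
  · exact absurd h (key hx hlt).ne
  · rfl
  · exact absurd h (key hy hlt).ne'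

open Classical in
theorem rank_lt {k L : ℕ} {G : ℕ → ℕ} {x : ℕ}
    (hx : x < (L + 1) ^ k) (hG : G x ≠ 0) :
    ((Finset.range x).filter fun x' => G x' ≠ 0).card < numMarked k L G := by
  rw [numMarked]
  refine Finset.card_lt_card ⟨fun z hz => ?_, fun hsub => ?_⟩
  · simp only [Finset.mem_filter, Finset.mem_range] at hz ⊢
    exact ⟨by omega, hz.2⟩
  · have := hsub (Finset.mem_filter.2 ⟨Finset.mem_range.2 hx, hG⟩)
    simp at this

theorem numMarked_eq {k L : ℕ} {F G : ℕ → ℕ} (hF : Closed k L F)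
    (hG : ∀ x < (L + 1) ^ k, G x ≠ 0 ↔ Good k L F x) :
    numMarked k L G = (minimal (clausesOf k L F)).card := by
  classical
  have h := card_good hF fun _ => True
  simp only [and_true, Finset.filter_true] at h
  rw [← h, numMarked]
  congr 1
  ext x
  simp only [Finset.mem_filter, Finset.mem_range]
  exact and_congr_right fun hx => hG x hx

/-- Two rows of different kinds are orthogonal iff they make all clauses true. -/
theorem coordFalse_iff {k L e q b : ℕ} {F G Y I I' : ℕ → ℕ} (hF : Closed k L F)
    (hG : ∀ x < (L + 1) ^ k, G x ≠ 0 ↔ Good k L F x) (κ κ' : ℕ) :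
    (∀ j < numMarked k L G, ¬ (CoordFalse k L e q b G Y I κ j ∧
      CoordFalse k L e q b G Y I' κ' j)) ↔
    ∀ C ∈ minimal (clausesOf k L F), ¬ (RowFalse e q b Y I κ C ∧ RowFalse e q b Y I' κ' C) := by
  classical
  constructor
  · rintro h C hC ⟨h1, h2⟩
    obtain ⟨x, hx, hg, rfl⟩ := exists_good hF hC
    have hGx := (hG x hx).2 hg
    exact h _ (rank_lt hx hGx) ⟨⟨x, hx, hGx, rfl, h1⟩, ⟨x, hx, hGx, rfl, h2⟩⟩
  · rintro h j hj ⟨⟨x, hx, hGx, h1, h2⟩, ⟨x', hx', hGx', h1', h2'⟩⟩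
    -- Coordinates number the marked codes by their rank, so both rows fail on the same clause.
    obtain rfl : x = x' := rank_inj hGx hGx' (h1.trans h1'.symm)
    exact h _ (((hG x hx).1 hGx).mem_minimal hx) ⟨h2, h2'⟩

/-- The clauses at the end of a run. -/
noncomputable def finalClauses {N : ℕ} (α k s T L : ℕ) (φ : CNF N) (Y : ℕ → ℕ) : Clauses :=
  run (firstViol (theta α) k L) (adviceMode (2 ^ s) (digit s Y)) (T * 2 ^ s) (clauseSets φ)

/-- Clauses that contain another clause are redundant; only the minimal ones become coordinates. -/
theorem sat_of_minimal {σ : ℕ → Prop} {S : Clauses} (h : Sat σ (minimal S)) : Sat σ S := by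
  intro C hC
  obtain ⟨C', hC', hsub⟩ : ∃ C' ∈ minimal S, C' ⊆ C := by
    obtain ⟨C', h1, h2⟩ := (S.filter fun E => E ⊆ C).exists_min_image Finset.card
      ⟨C, by simp [hC]⟩
    rw [Finset.mem_filter] at h1
    refine ⟨C', mem_minimal.2 ⟨h1.1, fun E hE hE' => ?_⟩, h1.2⟩
    exact Finset.eq_of_subset_of_card_le hE' (h2 E (Finset.mem_filter.2 ⟨hE, hE'.trans h1.2⟩))
  obtain ⟨y, hy, hσ⟩ := h C' hC'
  exact ⟨y, hsub hy, hσ⟩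

/-- Two rows of different kinds that make all clauses true give a satisfying assignment. -/
theorem satisfiable_of_rows {N α k s T L e q b : ℕ} {φ : CNF N} {Y I I' : ℕ → ℕ} {κ' : ℕ}
    (hκ' : κ' ≠ 0) (hqe : q < e)
    (h : ∀ C ∈ minimal (finalClauses α k s T L φ Y),
      ¬ (RowFalse e q b Y I 0 C ∧ RowFalse e q b Y I' κ' C)) : Satisfiable φ := by
  classical
  -- The assignment is put together from three sources: the outer bits, the row of the first kind,
  -- and the low bits of the row of the second kind.
  set val : ℕ → ℕ := fun v => if outerVar e q v then Y (b + outerIdx e q v) else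
    if v < e then I v else I' (v - e) with hval
  refine (satisfiable_iff φ).2 ⟨fun v => val v == 1, fun C hC => ?_⟩
  refine sat_of_minimal (S := finalClauses α k s T L φ Y) (fun C hC => ?_) C
    (subset_run _ _ _ hC)
  by_contra hcon
  push Not at hcon
  have hne : ∀ y ∈ C, val (y / 2) ≠ y % 2 := by
    intro y hy hv
    refine hcon y hy ?_
    simp only [litTrue, hv]
    rcases Nat.mod_two_eq_zero_or_one y with h | h <;> simp [h]
  refine h C hC ⟨fun y hy => ⟨fun _ => ⟨fun ho => ?_, fun h1 h2 => ?_⟩, fun h0 => absurd rfl h0⟩,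
    fun y hy => ⟨fun h0 => absurd h0 hκ', fun _ h1 h2 => ?_⟩⟩
  · have := hne y hy
    simp only [hval] at this
    rwa [if_pos ho] at this
  · have := hne y hy
    have ho : ¬ outerVar e q (y / 2) := by unfold outerVar; omega
    simp only [hval] at this
    rwa [if_neg ho, if_pos h1] at this
  · have := hne y hy
    have ho : ¬ outerVar e q (y / 2) := by unfold outerVar; omega
    simp only [hval] at this
    rwa [if_neg ho, if_neg (by omega)] at this

theorem exists_bits : ∀ (len : ℕ) (f : ℕ → ℕ), (∀ t, f t < 2) →
    ∃ r < 2 ^ len, ∀ t < len, bit r t = f t := by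
  intro len
  induction len with
  | zero => exact fun f _ => ⟨0, by simp, by simp⟩
  | succ len ih =>
    intro f hf
    obtain ⟨r, hr, h⟩ := ih (fun t => f (t + 1)) fun t => hf _
    have h0 := hf 0
    refine ⟨f 0 + 2 * r, by rw [pow_succ]; omega, fun t ht => ?_⟩
    cases t with
    | zero => simp only [bit, pow_zero, Nat.div_one]; omega
    | succ t =>
      have h1 : (f 0 + 2 * r) / 2 = r := by omega
      rw [bit, pow_succ', ← Nat.div_div_eq_div_mul, h1]
      exact h t (by omega)

theorem sum_bits (x s : ℕ) : ∑ l ∈ Finset.range s, bit x l * 2 ^ l = x % 2 ^ s := by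
  induction s with
  | zero => simp [Nat.mod_one]
  | succ s ih => rw [Finset.sum_range_succ, ih, Nat.mod_pow_succ, bit, mul_comm (2 ^ s)]

theorem bit_lt_two (i v : ℕ) : bit i v < 2 := Nat.mod_lt _ (by omega)

theorem bit_add {a x q v : ℕ} (hv : v < q) : bit (a * 2 ^ q + x) v = bit x v := by
  have e : a * 2 ^ q + x = 2 ^ v * (2 * (a * 2 ^ (q - v - 1))) + x := by
    have : 2 ^ q = 2 ^ v * (2 * 2 ^ (q - v - 1)) := by
      rw [← pow_succ', ← pow_add]; congr 1; omega
    rw [this]; ring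
  rw [bit, bit, e, Nat.mul_add_div (by positivity), Nat.mul_add_mod]

/-- Some choice of the outer bits and of two rows close to each other makes all clauses true. -/
theorem exists_rows {N Nφ α k s T L e q w d : ℕ} {φ : CNF Nφ} (hφ : WidthLE k φ)
    (hN : Nφ ≤ N) (hL : L = 2 * N) (hs : 1 ≤ s) (hqe : q < e) (hqw : 4 * 2 ^ q ≤ w)
    (hd : 1 + L * sparseBound α k ≤ d)
    (hT : ∀ h p, h + p ≤ (thresh α k).2 * L → p * α ≤ k * L →
      p * (2 ^ s - 1) + h < T * (2 ^ s - 1))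
    (hsat : Satisfiable φ) :
    ∃ r < 2 ^ (T * s + (N - (e + q) + 1)), ∀ Y : ℕ → ℕ,
      (∀ t < T * s + (N - (e + q) + 1), Y t = bit r t) →
      (minimal (finalClauses α k s T L φ Y)).card ≤ d ∧
      ∃ i < 2 ^ e, ∃ i' < 2 ^ e, bit i q = 0 ∧ bit i' q = 1 ∧
        |(i : ℝ) - (i' : ℝ)| ≤ (w : ℝ) / 2 ∧
        ∀ C ∈ minimal (finalClauses α k s T L φ Y),
          ¬ (RowFalse e q (T * s) Y (bit i) 0 C ∧ RowFalse e q (T * s) Y (bit i') 1 C) := by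
  classical
  obtain ⟨β, hβ⟩ := (satisfiable_iff φ).1 hsat
  have hβ2 : ∀ v, (β v).toNat < 2 := fun v => by cases β v <;> simp
  have hθ := one_le_theta α
  obtain ⟨z, hz, hwf, hsatS, hnone⟩ := exists_advice (ch := firstViol (theta α) k L)
    (fun S c H hS h => firstViol_choice hθ S c H hS h)
    (Nat.le_self_pow (by omega : s ≠ 0) 2) (clauseSets_wf (L := L) hφ (by omega)) hβ hT
  -- The guess consists of the binary digits of the advice, `s` bits for each of the `T` chunks,
  -- followed by the values of the outer variables, beginning with variable `q`.
  obtain ⟨r, hr, hbits⟩ := exists_bits (T * s + (N - (e + q) + 1)) (fun t =>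
    if t < T * s then bit (z (t / s)) (t % s) else
      (β (if t - T * s = 0 then q else t - T * s - 1 + (e + q))).toNat) (fun t => by
      split_ifs
      · exact bit_lt_two _ _
      · exact hβ2 _
      · exact hβ2 _)
  -- Only these first bits of `Y` matter; the program does not control its array beyond them.
  refine ⟨r, hr, fun Y hY => ?_⟩
  have hdig : ∀ t < T, digit s Y t = z t := by
    intro t ht
    have : ∀ l ∈ Finset.range s, Y (t * s + l) * 2 ^ l = bit (z t) l * 2 ^ l := by
      intro l hl
      rw [Finset.mem_range] at hl
      have h1 : t * s + l < T * s := by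
        calc t * s + l < (t + 1) * s := by rw [add_mul]; omega
          _ ≤ T * s := Nat.mul_le_mul_right _ ht
      rw [hY _ (by omega), hbits _ (by omega), if_pos h1, mul_comm t,
        Nat.mul_add_div (by omega), Nat.mul_add_mod, Nat.div_eq_of_lt hl, Nat.mod_eq_of_lt hl,
        add_zero]
    rw [digit, Finset.sum_congr rfl this, sum_bits, Nat.mod_eq_of_lt (hz t)]
  have hfin : finalClauses α k s T L φ Y =
      run (firstViol (theta α) k L) (adviceMode (2 ^ s) z) (T * 2 ^ s) (clauseSets φ) := by
    refine run_congr (fun τ hτ => ?_) _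
    rw [adviceMode, adviceMode, hdig _ ((Nat.div_lt_iff_lt_mul (by positivity)).2 hτ)]
  rw [← hfin] at hwf hsatS hnone
  have hno := firstViol_none hθ hwf hnone
  refine ⟨(card_minimal_le hwf hno).trans hd, ?_⟩
  obtain ⟨i, hi, hib⟩ := exists_bits e (fun v => if v = q then 0 else (β v).toNat) (fun v => by
    split_ifs
    · omega
    · exact hβ2 v)
  obtain ⟨x, hx, hxb⟩ := exists_bits q (fun v => (β (e + v)).toNat) fun v => hβ2 _
  have hiq : bit i q = 0 := by rw [hib q hqe, if_pos rfl]
  -- Bit `q` of `i` is zero, so `i` lies in the block number `a` of length `2 ^ q` with `a` even.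
  -- The next block has odd number and contains a row for each pattern `x` of the low `q` bits. Two
  -- such blocks together have length `2 * 2 ^ q ≤ w / 2`, so the partner is in the window.
  set a := i / 2 ^ q with ha
  have hpq : 0 < 2 ^ q := by positivity
  have haq : a % 2 = 0 := hiq
  have h2e : 2 ^ e = 2 * 2 ^ (e - q - 1) * 2 ^ q := by
    rw [← pow_succ', ← pow_add]; congr 1; omega
  have ha_lt : a < 2 * 2 ^ (e - q - 1) := by
    rw [ha, Nat.div_lt_iff_lt_mul hpq, ← h2e]; exact hi
  have hlow : a * 2 ^ q ≤ i := Nat.div_mul_le_self _ _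
  have hhigh : i < (a + 1) * 2 ^ q := by
    have := Nat.lt_div_mul_add (a := i) hpq
    rw [add_mul, one_mul]; exact this
  have ei : (a + 1) * 2 ^ q = a * 2 ^ q + 2 ^ q := by ring
  refine ⟨i, hi, (a + 1) * 2 ^ q + x, ?_, hiq, ?_, ?_, ?_⟩
  · calc (a + 1) * 2 ^ q + x < (a + 1) * 2 ^ q + 2 ^ q := by omega
      _ = (a + 2) * 2 ^ q := by ring
      _ ≤ 2 * 2 ^ (e - q - 1) * 2 ^ q := Nat.mul_le_mul_right _ (by omega)
      _ = 2 ^ e := h2e.symm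
  · rw [bit, mul_comm, Nat.mul_add_div hpq, Nat.div_eq_of_lt hx]; omega
  · have h1 : ((i : ℕ) : ℝ) ≤ (((a + 1) * 2 ^ q + x : ℕ) : ℝ) := by exact_mod_cast (by omega)
    have h2 : (2 : ℝ) * (((a + 1) * 2 ^ q + x : ℕ) : ℝ) ≤ 2 * (i : ℝ) + w := by
      exact_mod_cast (by omega)
    rw [abs_le]
    constructor <;> linarith
  · rintro C hC ⟨h1, h2⟩
    obtain ⟨hCS, -⟩ := mem_minimal.1 hC
    obtain ⟨y, hy, hlit⟩ := hsatS C hCS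
    have hyL := Finset.mem_range.1 ((hwf C hCS).1 hy)
    unfold litTrue at hlit
    obtain ⟨hA1, hA2⟩ := (h1 y hy).1 rfl
    have hB := (h2 y hy).2 (by omega)
    by_cases ho : outerVar e q (y / 2)
    · refine hA1 ho ?_
      have hidx : outerIdx e q (y / 2) < N - (e + q) + 1 := by
        unfold outerIdx outerVar at *
        split_ifs <;> omega
      rw [hY _ (by omega), hbits _ (by omega), if_neg (by omega), hlit, Nat.add_sub_cancel_left]
      unfold outerIdx outerVar at *
      by_cases hvq : y / 2 = q
      · simp [hvq]
      · rw [if_neg hvq, if_neg (by omega)]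
        congr 2; omega
    · by_cases hve : y / 2 < e
      · refine hA2 hve (fun h => ho (Or.inl h)) ?_
        rw [hib _ hve, if_neg (fun h => ho (Or.inl h)), hlit]
      · have hveq : y / 2 < e + q := by
          unfold outerVar at ho; omega
        refine hB (by omega) hveq ?_
        rw [bit_add (by omega), hxb _ (by omega), hlit]
        congr 2; omega

end Sparsify

/-! ### Powers of two, bits and logarithms of large numbers on the machine -/

namespace RealRAM

/-! ### Subroutines for large numbers

The registers `3`, `11`, `35`, `43`, … hold large numbers; `67`, `75`, `83`, `107` are scratch
registers, and `91`, `99`, `115` hold the constants `1`, `2`, `0`. -/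

noncomputable def listCost : List Instr → State → ℕ
  | [], _ => 0
  | i :: l, s => i.cost s + listCost l (i.apply s)

theorem Runs.block {l : List Instr} (hl : l ≠ []) {s : State} {T : ℕ} {Q : State → Prop}
    (hT : listCost l s ≤ T) (hQ : Q (l.foldl (fun s i => i.apply s) s)) :
    Runs (block l) s T Q := by
  refine Runs.mono ?_ hT fun _ h => h
  clear hT
  induction l generalizing s with
  | nil => exact absurd rfl hl
  | cons i l ih =>
    cases l with
    | nil => exact Runs.instr i s (by simp [listCost]) hQ
    | cons j l => exact Runs.cons le_rfl (ih (by simp) hQ)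

/-- `s'` differs from `s` only in small variables and arrays, temporaries and scratch registers. -/
structure WorkFrame (s s' : State) : Prop where
  natReg : ∀ x, x % 8 ≠ 0 → x % 8 ≠ 1 → x ≠ 67 → x ≠ 75 → x ≠ 83 → x ≠ 107 →
    s'.natReg x = s.natReg x
  natMem : ∀ a, a % 8 ≠ 0 → a % 8 ≠ 1 → s'.natMem a = s.natMem a
  realReg : s'.realReg = s.realReg
  realMem : s'.realMem = s.realMem

theorem WorkFrame.trans {s s' s'' : State} (h : WorkFrame s s') (h' : WorkFrame s' s'') :
    WorkFrame s s'' :=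
  ⟨fun x h0 h1 h2 h3 h4 h5 => (h'.natReg x h0 h1 h2 h3 h4 h5).trans (h.natReg x h0 h1 h2 h3 h4 h5),
    fun x hx hx' => (h'.natMem x hx hx').trans (h.natMem x hx hx'),
    h'.realReg.trans h.realReg, h'.realMem.trans h.realMem⟩

theorem SmallFrame.workFrame {s s' : State} (h : SmallFrame s s') : WorkFrame s s' :=
  ⟨fun x h0 h1 _ _ _ _ => h.natReg x h0 h1, h.natMem, h.realReg, h.realMem⟩

theorem WorkFrame.loc {s s' : State} (h : WorkFrame s s') : s'.loc = s.loc := by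
  funext i
  exact h.natReg _ (by omega) (by omega) (by omega) (by omega) (by omega) (by omega)

theorem size_le_of_le_two_pow {x V : ℕ} (h : x ≤ 2 ^ V) : x.size ≤ V + 1 := by
  rw [Nat.size_le, pow_succ]
  have : 0 < 2 ^ V := by positivity
  omega

/-- `dst := 2 ^ v`. -/
def pow2Prog (dst v : ℕ) : Program :=
  .seq (block [.natConst 83 0, .natConst dst 1])
    (.loop (.natLt 83 (8 * v)) (block [.natOp .add dst dst dst, .natOp .add 83 83 91]))

theorem pow2Prog_runs {dst v V : ℕ} (h8 : dst % 8 = 3) (h83 : dst ≠ 83) (h91 : dst ≠ 91)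
    {s : State} (hs : s.natReg 91 = 1) (hV : s.env.var v ≤ V) :
    Runs (pow2Prog dst v) s (20 * (V + 1) ^ 2) fun s' =>
      s' = { s with natReg :=
        Function.update (Function.update s.natReg 83 (s.env.var v)) dst (2 ^ s.env.var v) } := by
  set N := s.env.var v with hN
  have hNr : s.natReg (8 * v) = N := rfl
  set I : ℕ → State → Prop := fun i s' => s' = { s with
    natReg := Function.update (Function.update s.natReg 83 i) dst (2 ^ i) }
  have hz : ∀ i ≤ N, i.size ≤ V := fun i hi => (size_le_self i).trans (hi.trans hV)
  have z1 : Nat.size 1 = 1 := Nat.size_one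
  have z0 : Nat.size 0 = 0 := Nat.size_zero
  have e1 : ∀ i, Function.update (Function.update s.natReg 83 i) dst (2 ^ i) 83 = i := fun i => by
    rw [Function.update_of_ne h83.symm, Function.update_self]
  have e2 : ∀ i, Function.update (Function.update s.natReg 83 i) dst (2 ^ i) (8 * v) = N :=
    fun i => by rw [Function.update_of_ne (by omega), Function.update_of_ne (by omega), hNr]
  refine Runs.seq (T₁ := 3) (T₂ := N * (2 * V + 1 + (3 * V + 5)) + (2 * V + 1)) (M := I 0)
    (Runs.block (by simp) ?_ ?_) (fun s' h => Runs.loop I (c := 2 * V + 1) (T := 3 * V + 5)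
      ?_ ?_ ?_ h le_rfl) ?_
  · simp [listCost, Instr.cost]
  · simp [I, Instr.apply]
  · rintro i _ hi rfl
    simp only [Test.cost]
    rw [e1, e2]
    have := hz i hi
    have := hz N le_rfl
    omega
  · rintro i _ hi rfl
    constructor
    · simp only [Test.holds]
      rwa [e1, e2]
    · refine Runs.block (by simp) ?_ ?_
      · have := hz i hi.le
        simp [listCost, Instr.cost, Instr.apply, Nat.size_pow, h83.symm, h91.symm, hs, z1,
          NatOp.eval]
        omega
      · simp only [I, List.foldl, Instr.apply]
        congr 1
        funext x
        by_cases hx : x = dst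
        · subst hx
          simp [h83, NatOp.eval, pow_succ, mul_two]
        · by_cases hx' : x = 83
          · subst hx'
            simp [NatOp.eval, h83.symm, h91.symm, hs]
          · simp [hx, hx']
  · rintro _ rfl
    simp only [Test.holds]
    rw [e1, e2]
    omega
  · nlinarith

/-- Store the bits of the register `src` in the first `v` cells of the small array `a`. -/
def unpackProg (src a v : ℕ) : Program :=
  .seq (block [.natConst 83 0, .natOp .add 67 src 115])
    (.loop (.natLt 83 (8 * v)) (block [.natOp .div 75 67 99, .natOp .mul 107 75 99,
      .natOp .sub 107 67 107, .natStore (8 * a) 83 107, .natOp .add 67 75 115,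
      .natOp .add 83 83 91]))

theorem unpackProg_runs {src a v V : ℕ} {s : State} (h1 : s.natReg 91 = 1) (h2 : s.natReg 99 = 2)
    (h0 : s.natReg 115 = 0) (hsrc' : src ≠ 83) (hx : s.natReg src ≤ 2 ^ V)
    (hV : s.env.var v ≤ V) :
    Runs (unpackProg src a v) s (60 * (V + 1) ^ 2) fun s' => WorkFrame s s' ∧
      s'.env = s.env.setArr a (s.env.var v) fun t => s.natReg src / 2 ^ t % 2 := by
  set N := s.env.var v with hN
  have hNr : s.natReg (8 * v) = N := rfl
  set X := s.natReg src with hX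
  set I : ℕ → State → Prop := fun i s' =>
    (∀ x, x ≠ 67 → x ≠ 75 → x ≠ 83 → x ≠ 107 → s'.natReg x = s.natReg x) ∧
    s'.natReg 67 = X / 2 ^ i ∧ s'.natReg 83 = i ∧
    s'.natMem = Function.update s.natMem (8 * a)
      (fun t => if t < i then X / 2 ^ t % 2 else s.natMem (8 * a) t) ∧
    s'.realReg = s.realReg ∧ s'.realMem = s.realMem with hI
  have hz : ∀ i ≤ N, i.size ≤ V := fun i hi => (size_le_self i).trans (hi.trans hV)
  have hzX : ∀ y ≤ X, y.size ≤ V + 1 := fun y hy => size_le_of_le_two_pow (hy.trans hx)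
  have z2 : Nat.size 2 = 2 := by decide
  refine Runs.seq (T₁ := V + 3) (T₂ := N * (2 * V + 1 + (10 * V + 30)) + (2 * V + 1)) (M := I 0)
    (Runs.block (by simp) ?_ ?_) (fun s' h => (Runs.loop I (c := 2 * V + 1) (T := 10 * V + 30)
      ?_ ?_ ?_ h le_rfl).mono le_rfl ?_) ?_
  · have := hzX X le_rfl
    simp [listCost, Instr.cost, Instr.apply, hsrc', h0, ← hX]
    omega
  · refine ⟨fun x h67 _ h83 _ => ?_, ?_, ?_, ?_, rfl, rfl⟩
    · simp [Instr.apply, h67, h83]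
    · simp [Instr.apply, NatOp.eval, hsrc', h0, hX]
    · simp [Instr.apply]
    · simp [Instr.apply]
  · rintro i s' hi ⟨g1, -, g3, -⟩
    simp only [Test.cost]
    rw [g3, g1 _ (by omega) (by omega) (by omega) (by omega), hNr]
    have := hz i hi
    have := hz N le_rfl
    omega
  · rintro i s' hi ⟨g1, g2, g3, g4, g5, g6⟩
    have k1 : s'.natReg 91 = 1 := (g1 91 (by omega) (by omega) (by omega) (by omega)).trans h1
    have k2 : s'.natReg 99 = 2 := (g1 99 (by omega) (by omega) (by omega) (by omega)).trans h2
    have k0 : s'.natReg 115 = 0 := (g1 115 (by omega) (by omega) (by omega) (by omega)).trans h0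
    have hdd : X / 2 ^ i / 2 = X / 2 ^ (i + 1) := by rw [Nat.div_div_eq_div_mul, pow_succ]
    have hb : X / 2 ^ i - X / 2 ^ (i + 1) * 2 = X / 2 ^ i % 2 := by
      rw [← hdd]; omega
    constructor
    · simp only [Test.holds]
      rwa [g3, g1 _ (by omega) (by omega) (by omega) (by omega), hNr]
    · refine Runs.block (by simp) ?_ ?_
      · have q1 := hz i hi.le
        have q2 := hzX (X / 2 ^ i) (Nat.div_le_self _ _)
        have q3 := hzX (X / 2 ^ (i + 1)) (Nat.div_le_self _ _)
        have q4 := hzX (X / 2 ^ (i + 1) * 2) (by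
          rw [← hdd]; exact (Nat.div_mul_le_self _ _).trans (Nat.div_le_self _ _))
        have q5 : (X / 2 ^ i % 2).size ≤ 2 := (size_le_self _).trans (by omega)
        simp [listCost, Instr.cost, Instr.apply, NatOp.eval, g2, g3, k0, k1, k2, z2, hdd, hb]
        omega
      · simp only [List.foldl, Instr.apply, NatOp.eval]
        refine ⟨fun x h67 h75 h83 h107 => ?_, ?_, ?_, ?_, g5, g6⟩
        · simp [h67, h75, h83, h107, g1 x h67 h75 h83 h107]
        · simp [g2, k0, k2, hdd]
        · simp [g3, k1]
        · funext b t
          simp only [write_apply, g4, Function.update_apply]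
          by_cases hb' : b = 8 * a
          · subst hb'
            by_cases ht : t = i
            · simp [ht, g2, g3, k2, hdd, hb]
            · have : t < i + 1 ↔ t < i := by omega
              simp [ht, this, g3]
          · simp [hb']
  · rintro s' ⟨g1, -, g3, -⟩
    simp only [Test.holds]
    rw [g3, g1 _ (by omega) (by omega) (by omega) (by omega), hNr]
    omega
  · rintro s' ⟨g1, -, -, g4, g5, g6⟩
    refine ⟨⟨fun x _ _ h67 h75 h83 h107 => g1 x h67 h75 h83 h107, fun b hb _ => ?_, g5, g6⟩, ?_⟩
    · rw [g4, Function.update_of_ne (by omega)]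
    · simp only [State.env, Env.setArr, g4]
      congr 1
      · funext u
        exact g1 _ (by omega) (by omega) (by omega) (by omega)
      · funext b
        by_cases hb : b = a
        · subst hb; simp
        · rw [Function.update_of_ne hb, Function.update_of_ne (by omega)]
  · have : N * (2 * V + 1 + (10 * V + 30)) ≤ V * (12 * V + 31) :=
      Nat.mul_le_mul hV (by omega)
    nlinarith

/-- The small variable `8` is set to the logarithm of a quarter of the register `43`. -/
def logProg : Program :=
  .seq (block [.natConst 107 4, .natOp .div 67 43 107, .natConst 64 0])
    (.loop (.natLt 91 67) (block [.natOp .div 67 67 99, .natOp .add 64 64 91]))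

theorem logProg_runs {V : ℕ} {s : State} (h1 : s.natReg 91 = 1) (h2 : s.natReg 99 = 2)
    (hx : s.natReg 43 ≤ 2 ^ V) :
    Runs logProg s (60 * (V + 1) ^ 2) fun s' => WorkFrame s s' ∧
      s'.env = s.env.setVar 8 (Nat.log 2 (s.natReg 43 / 4)) := by
  set w := s.natReg 43 with hw
  set y := w / 4 with hy
  set N := Nat.log 2 y with hN
  have hyw : y ≤ w := Nat.div_le_self _ _
  have hNV : N ≤ V := by
    have := Nat.log_mono_right (b := 2) (hyw.trans hx)
    rwa [Nat.log_pow (by omega)] at this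
  set I : ℕ → State → Prop := fun i s' =>
    (∀ x, x ≠ 67 → x ≠ 107 → x ≠ 64 → s'.natReg x = s.natReg x) ∧
    s'.natReg 67 = y / 2 ^ i ∧ s'.natReg 64 = i ∧
    s'.natMem = s.natMem ∧ s'.realReg = s.realReg ∧ s'.realMem = s.realMem with hI
  have hz : ∀ i ≤ N, i.size ≤ V := fun i hi => (size_le_self i).trans (hi.trans hNV)
  have hzy : ∀ u ≤ w, u.size ≤ V + 1 := fun u hu => size_le_of_le_two_pow (hu.trans hx)
  have z1 : Nat.size 1 = 1 := Nat.size_one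
  have z2 : Nat.size 2 = 2 := by decide
  have z4 : Nat.size 4 = 3 := by decide
  refine Runs.seq (T₁ := V + 20) (T₂ := N * (V + 3 + (3 * V + 20)) + (V + 3)) (M := I 0)
    (Runs.block (by simp) ?_ ?_) (fun s' h => (Runs.loop I (c := V + 3) (T := 3 * V + 20)
      ?_ ?_ ?_ h le_rfl).mono le_rfl ?_) ?_
  · have := hzy w le_rfl
    simp [listCost, Instr.cost, Instr.apply, ← hw, z4]
    omega
  · refine ⟨fun x h67 h107 h64 => ?_, ?_, ?_, rfl, rfl, rfl⟩
    · simp [Instr.apply, h67, h107, h64]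
    · simp [Instr.apply, NatOp.eval, ← hw, hy]
    · simp [Instr.apply]
  · rintro i s' hi ⟨g1, g2, -⟩
    simp only [Test.cost]
    rw [g2, g1 _ (by omega) (by omega) (by omega), h1]
    have := hzy (y / 2 ^ i) ((Nat.div_le_self _ _).trans hyw)
    omega
  · rintro i s' hi ⟨g1, g2, g3, g4, g5, g6⟩
    have k1 : s'.natReg 91 = 1 := (g1 91 (by omega) (by omega) (by omega)).trans h1
    have k2 : s'.natReg 99 = 2 := (g1 99 (by omega) (by omega) (by omega)).trans h2
    have hdd : y / 2 ^ i / 2 = y / 2 ^ (i + 1) := by rw [Nat.div_div_eq_div_mul, pow_succ]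
    constructor
    · simp only [Test.holds, g2, k1]
      have hy0 : y ≠ 0 := by
        intro h0
        rw [hN, h0] at hi
        simp at hi
      have : 2 ^ (i + 1) ≤ y := (Nat.pow_le_pow_right (by omega) hi).trans (Nat.pow_log_le_self 2 hy0)
      rw [pow_succ] at this
      exact (Nat.le_div_iff_mul_le (by positivity)).2 (by rw [mul_comm]; exact this)
    · refine Runs.block (by simp) ?_ ?_
      · have q1 := hz i hi.le
        have q2 := hzy (y / 2 ^ i) ((Nat.div_le_self _ _).trans hyw)
        simp [listCost, Instr.cost, Instr.apply, g2, g3, k1, k2, z2, z1]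
        omega
      · simp only [List.foldl, Instr.apply, NatOp.eval]
        refine ⟨fun x h67 h107 h64 => ?_, ?_, ?_, g4, g5, g6⟩
        · simp [h67, h64, g1 x h67 h107 h64]
        · simp [g2, k2, hdd]
        · simp [g3, k1]
  · rintro s' ⟨g1, g2, -⟩
    simp only [Test.holds]
    rw [g2, g1 _ (by omega) (by omega) (by omega), h1]
    have := Nat.lt_pow_succ_log_self (b := 2) (by omega) y
    rw [not_lt, ← Nat.lt_succ_iff, Nat.div_lt_iff_lt_mul (by positivity)]
    rw [pow_succ] at this
    rw [mul_comm]; exact this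
  · rintro s' ⟨g1, -, g3, g4, g5, g6⟩
    refine ⟨⟨fun x h0 _ h67 _ _ h107 => g1 x h67 h107 (by omega), fun b _ _ => by rw [g4], g5, g6⟩,
      ?_⟩
    simp only [State.env, Env.setVar, g4]
    congr 1
    funext u
    by_cases hu : u = 8
    · subst hu; simpa using g3
    · rw [Function.update_of_ne hu]
      exact g1 _ (by omega) (by omega) (by omega)
  · have : N * (V + 3 + (3 * V + 20)) ≤ V * (4 * V + 23) :=
      Nat.mul_le_mul hNV (by omega)
    nlinarith

/-- Clear the registers below `K` of the relocated program. -/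
def resetProg : ℕ → Program
  | 0 => .instr (.natConst 67 0)
  | K + 1 => .seq (resetProg K) (block [.natConst (8 * K + 4) 0, .realCast (8 * K + 4) 115])

/-- Unlike array cells, the registers of the attention program are shared by all calls and have to
be cleared; only those below the bound of the program can have been written. -/
theorem resetProg_runs (K : ℕ) {s : State} (h0 : s.natReg 115 = 0) :
    Runs (resetProg K) s (2 * K + 1) fun s' =>
      (∀ x, s'.natReg x = if x = 67 ∨ x % 8 = 4 ∧ x < 8 * K then 0 else s.natReg x) ∧
      (∀ x, s'.realReg x = if x % 8 = 4 ∧ x < 8 * K then 0 else s.realReg x) ∧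
      s'.natMem = s.natMem ∧ s'.realMem = s.realMem := by
  induction K with
  | zero =>
    refine Runs.instr _ _ (by simp [Instr.cost]) ⟨fun x => ?_, fun x => ?_, rfl, rfl⟩
    · simp [Instr.apply, Function.update_apply]
    · simp [Instr.apply]
  | succ K ih =>
    refine Runs.seq ih (T₂ := 2) ?_ (by omega)
    rintro s' ⟨g1, g2, g3, g4⟩
    have k0 : s'.natReg 115 = 0 := by rw [g1]; simp [h0]
    have k0' : (Function.update s'.natReg (8 * K + 4) 0) 115 = 0 := by
      rw [Function.update_of_ne (by omega), k0]
    refine Runs.block (by simp) ?_ ⟨fun x => ?_, fun x => ?_, g3, g4⟩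
    · simp [listCost, Instr.cost, Instr.apply, k0']
    · simp only [List.foldl, Instr.apply, Function.update_apply, g1]
      split_ifs <;> first | rfl | omega
    · simp only [List.foldl, Instr.apply, k0', Function.update_apply, g2]
      split_ifs <;> first | omega | simp

end RealRAM

/-! ### Writing the query and value matrices of one round -/

namespace Sparsify

open RealRAM

/-! ### Building the queries and values

Small variables: `5` the number of bits of a row, `8` the position of the kind of a row, `9` the
offset of the outer bits, `10` the number of coordinates, `11` a coordinate, `13` whether the clause
is false, `14` the kind of the row. Small array `6`: the bits of the row. -/

/-- The numbers and reals that are fixed in the main loop. -/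
structure Static (R n w d m c₀ K : ℕ) (s : State) : Prop where
  modulus : s.natReg 3 = R
  rows : s.natReg 35 = n
  window : s.natReg 43 = w
  dim : s.natReg 51 = d
  cols : s.natReg 59 = m
  one : s.natReg 91 = 1
  two : s.natReg 99 = 2
  zero : s.natReg 115 = 0
  real_one : s.realReg 2 = 1
  real_neg : s.realReg 10 = -(n : ℝ)
  real_rows : s.realReg 18 = n
  real_threshold : s.realReg 26 = c₀
  loc : ∀ i, s.loc i = 0
  -- Beyond the bound `K` the registers of the attention program are never written, so they are zero
  -- at each call.
  natHigh : ∀ x, x % 8 = 4 → 8 * K ≤ x → s.natReg x = 0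
  realHigh : ∀ x, x % 8 = 4 → 8 * K ≤ x → s.realReg x = 0

/-- Only real cells and registers of minor importance change. -/
structure RowFrame (s s' : State) : Prop where
  natReg : ∀ x, x % 8 ≠ 0 → x % 8 ≠ 1 → x ≠ 67 → x ≠ 75 → x ≠ 83 → x ≠ 107 → x ≠ 27 → x ≠ 123 →
    s'.natReg x = s.natReg x
  natMem : ∀ a, a % 8 ≠ 0 → a % 8 ≠ 1 → s'.natMem a = s.natMem a
  realReg : ∀ x, x ≠ 34 → s'.realReg x = s.realReg x

theorem RowFrame.trans {s s' s'' : State} (h : RowFrame s s') (h' : RowFrame s' s'') :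
    RowFrame s s'' :=
  ⟨fun x h0 h1 h2 h3 h4 h5 h6 h7 => (h'.natReg x h0 h1 h2 h3 h4 h5 h6 h7).trans
    (h.natReg x h0 h1 h2 h3 h4 h5 h6 h7),
    fun x hx hx' => (h'.natMem x hx hx').trans (h.natMem x hx hx'),
    fun x hx => (h'.realReg x hx).trans (h.realReg x hx)⟩

theorem RowFrame.refl (s : State) : RowFrame s s :=
  ⟨fun _ _ _ _ _ _ _ _ _ => rfl, fun _ _ _ => rfl, fun _ _ => rfl⟩

theorem RowFrame.of_work {s s' : State} (h : WorkFrame s s') : RowFrame s s' :=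
  ⟨fun x h0 h1 h2 h3 h4 h5 _ _ => h.natReg x h0 h1 h2 h3 h4 h5, h.natMem,
    fun _ _ => by rw [h.realReg]⟩

section

variable {R n w d m c₀ K : ℕ} {s s' : State}

theorem Static.of_rowFrame (h : Static R n w d m c₀ K s) (hf : RowFrame s s') :
    Static R n w d m c₀ K s' := by
  have e : ∀ x, x % 8 ≠ 0 → x % 8 ≠ 1 → x ≠ 67 → x ≠ 75 → x ≠ 83 → x ≠ 107 → x ≠ 27 → x ≠ 123 →
    s'.natReg x = s.natReg x := hf.natReg
  refine ⟨?_, ?_, ?_, ?_, ?_, ?_, ?_, ?_, ?_, ?_, ?_, ?_, fun i => ?_, fun x hx hK => ?_,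
    fun x hx hK => ?_⟩
  · rw [e 3 (by omega) (by omega) (by omega) (by omega) (by omega) (by omega) (by omega) (by omega),
      h.modulus]
  · rw [e 35 (by omega) (by omega) (by omega) (by omega) (by omega) (by omega) (by omega)
      (by omega), h.rows]
  · rw [e 43 (by omega) (by omega) (by omega) (by omega) (by omega) (by omega) (by omega)
      (by omega), h.window]
  · rw [e 51 (by omega) (by omega) (by omega) (by omega) (by omega) (by omega) (by omega)
      (by omega), h.dim]
  · rw [e 59 (by omega) (by omega) (by omega) (by omega) (by omega) (by omega) (by omega)
      (by omega), h.cols]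
  · rw [e 91 (by omega) (by omega) (by omega) (by omega) (by omega) (by omega) (by omega)
      (by omega), h.one]
  · rw [e 99 (by omega) (by omega) (by omega) (by omega) (by omega) (by omega) (by omega)
      (by omega), h.two]
  · rw [e 115 (by omega) (by omega) (by omega) (by omega) (by omega) (by omega) (by omega)
      (by omega), h.zero]
  · rw [hf.realReg _ (by omega), h.real_one]
  · rw [hf.realReg _ (by omega), h.real_neg]
  · rw [hf.realReg _ (by omega), h.real_rows]
  · rw [hf.realReg _ (by omega), h.real_threshold]
  · exact (e _ (by omega) (by omega) (by omega) (by omega) (by omega) (by omega) (by omega)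
      (by omega)).trans (h.loc i)
  · rw [e x (by omega) (by omega) (by omega) (by omega) (by omega) (by omega) (by omega) (by omega),
      h.natHigh x hx hK]
  · rw [hf.realReg x (by omega), h.realHigh x hx hK]

end

open Classical in
noncomputable def markCoord (k : ℕ) (m : Env) : Env :=
  m.setVar 13 (if CoordFalse k (envL m) (m.var 5) (m.var 8) (m.var 9) (m.mem 4) (m.mem 5) (m.mem 6)
    (m.var 14) (m.var 11) then 1 else 0)

theorem exists_acts_markCoord (k : ℕ) : ∃ P : Program, P.Acts (markCoord k) := by
  classical
  refine exists_acts_setVar 13 (f := fun m : Env => if CoordFalse k (envL m) (m.var 5) (m.var 8)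
    (m.var 9) (m.mem 4) (m.mem 5) (m.mem 6) (m.var 14) (m.var 11) then 1 else 0) (CompP.ind ?_)
  refine CompP.ex (p := fun (m : Env) x => m.mem 4 x ≠ 0 ∧
    ((Finset.range x).filter fun x' => m.mem 4 x' ≠ 0).card = m.var 11 ∧
    RowFalse (m.var 5) (m.var 8) (m.var 9) (m.mem 5) (m.mem 6) (m.var 14) (cset k (envL m) x))
    (comp_codes comp_envL) ?_
  refine (CompP.eq (.load 4 .snd) (.const 0)).not.and ((CompP.eq ?_ (.var 11)).and ?_)
  · exact CompP.card (p := fun (q : Env × ℕ) x' => q.1.mem 4 x' ≠ 0) .snd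
      (CompP.eq (.load 4 .snd) (.const 0)).not
  · have hv : Comp fun q : (Env × ℕ) × ℕ => q.2 / 2 := Comp.snd.div (.const 2)
    have hb : Comp fun q : (Env × ℕ) × ℕ => q.2 % 2 := Comp.snd.mod (.const 2)
    have hk : CompP fun q : (Env × ℕ) × ℕ => q.1.1.var 14 = 0 := CompP.eq (.var 14) (.const 0)
    have he : Comp fun q : (Env × ℕ) × ℕ => q.1.1.var 5 := Comp.var 5
    have hq : Comp fun q : (Env × ℕ) × ℕ => q.1.1.var 8 := Comp.var 8
    refine (CompP.all (f := fun q : Env × ℕ => envL q.1)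
      (p := fun (q : Env × ℕ) y => y ∈ cset k (envL q.1) q.2 →
      (q.1.var 14 = 0 → ((y / 2 = q.1.var 8 ∨ q.1.var 5 + q.1.var 8 ≤ y / 2) →
        q.1.mem 5 (q.1.var 9 + (if y / 2 = q.1.var 8 then 0 else
          y / 2 - (q.1.var 5 + q.1.var 8) + 1)) ≠ y % 2) ∧
        (y / 2 < q.1.var 5 → y / 2 ≠ q.1.var 8 → q.1.mem 6 (y / 2) ≠ y % 2)) ∧
      (q.1.var 14 ≠ 0 → q.1.var 5 ≤ y / 2 → y / 2 < q.1.var 5 + q.1.var 8 →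
        q.1.mem 6 (y / 2 - q.1.var 5) ≠ y % 2)) comp_envL ?_).congr fun q => ?_
    · refine (compP_mem comp_envL (Comp.snd.fst) .snd).imp ((hk.imp (CompP.and ?_ ?_)).and
        (hk.not.imp ((CompP.le he hv).imp ((CompP.lt hv (he.add hq)).imp ?_))))
      · exact ((CompP.eq hv hq).or (CompP.le (he.add hq) hv)).imp (CompP.eq (Comp.load 5
          ((Comp.var 9).add (CompP.ite (CompP.eq hv hq) (.const 0)
            ((hv.sub (he.add hq)).add (.const 1))))) hb).not
      · exact (CompP.lt hv he).imp ((CompP.eq hv hq).not.imp (CompP.eq (Comp.load 6 hv) hb).not)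
      · exact (CompP.eq (Comp.load 6 (hv.sub he)) hb).not
    · exact ⟨fun h y hy => h y (mem_cset.1 hy).1 hy, fun h y _ hy => h y hy⟩

/-- The fixed data of one round of the main loop. -/
structure Round where
  (R n w d m c₀ K V r₀ k : ℕ)

section

variable (p : Round) (s₀ : State)

def Round.coord (i j : ℕ) : Prop :=
  CoordFalse p.k (envL s₀.env) (s₀.env.var 5) (s₀.env.var 8) (s₀.env.var 9) (s₀.env.mem 4)
    (s₀.env.mem 5) (bit i) (bit i (s₀.env.var 8)) j

open Classical in
noncomputable def Round.query (i j : ℕ) : ℝ :=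
  if j < s₀.env.var 10 ∧ p.coord s₀ i j then
    if bit i (s₀.env.var 8) = 0 then 1 else -(p.n : ℝ) else 0

noncomputable def Round.value (i j : ℕ) : ℝ :=
  if j = 0 ∧ ¬ bit i (s₀.env.var 8) = 0 then (p.n : ℝ) else 0

/-- The state at the beginning of a round. -/
structure Round.Start : Prop where
  static : Static p.R p.n p.w p.d p.m p.c₀ p.K s₀
  round : s₀.natReg 11 = p.r₀
  round_lt : p.r₀ < p.R
  bdd : s₀.env.Bdd p.V
  kind_lt : s₀.env.var 8 < s₀.env.var 5
  count_le : s₀.env.var 10 ≤ p.d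
  hR : p.R ≤ 2 ^ p.V
  hn : p.n ≤ 2 ^ p.V
  hw : p.w ≤ 2 ^ p.V
  hd : p.d ≤ 2 ^ p.V
  hm : p.m ≤ 2 ^ p.V
  hm0 : 1 ≤ p.m
  hV : 1 ≤ p.V
  cells₀ : ∀ x, s₀.realMem 4 (x * p.R + p.r₀) = 0
  cells₁ : ∀ x, s₀.realMem 12 (x * p.R + p.r₀) = 0

/-- What holds during the construction. -/
structure Round.Common (s : State) : Prop where
  frame : RowFrame s₀ s
  bdd : s.env.Bdd p.V
  var : ∀ v, v ≠ 11 → v ≠ 13 → v ≠ 14 → s.env.var v = s₀.env.var v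
  mem : ∀ a, a ≠ 6 → s.env.mem a = s₀.env.mem a
  other : ∀ a x, ((a ≠ 4 ∧ a ≠ 12) ∨ x % p.R ≠ p.r₀) → s.realMem a x = s₀.realMem a x

structure Round.Row (i : ℕ) (s : State) : Prop extends p.Common s₀ s where
  row : s.natReg 27 = i
  queries : ∀ x, s.realMem 4 (x * p.R + p.r₀) =
    if x < i * p.d then p.query s₀ (x / p.d) (x % p.d) else 0
  values : ∀ x, s.realMem 12 (x * p.R + p.r₀) =
    if x < i * p.m then p.value s₀ (x / p.m) (x % p.m) else 0

structure Round.Col (i j : ℕ) (s : State) : Prop extends p.Common s₀ s where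
  row : s.natReg 27 = i
  base : s.natReg 123 = i * p.d
  col : s.env.var 11 = j
  kind : s.env.var 14 = bit i (s₀.env.var 8)
  bits : ∀ v < s₀.env.var 5, s.env.mem 6 v = bit i v
  queries : ∀ x, s.realMem 4 (x * p.R + p.r₀) =
    if x < i * p.d + j then p.query s₀ (x / p.d) (x % p.d) else 0
  values : ∀ x, s.realMem 12 (x * p.R + p.r₀) =
    if x < i * p.m then p.value s₀ (x / p.m) (x % p.m) else 0

end

end Sparsify

namespace Sparsify

open RealRAM

/-- The cell `x` of the array `arr`, as seen by the relocated program, is set; `x` is the result of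
the operation `o`. -/
def storeAt (o : NatOp) (a b arr src : ℕ) : Program :=
  block [.natOp o 67 a b, .natOp .mul 67 67 3, .natOp .add 67 67 11, .realStore arr 67 src]

theorem storeAt_runs {o : NatOp} {a b arr src S : ℕ} {s : State}
    (ha : (s.natReg a).size ≤ S) (hb : (s.natReg b).size ≤ S)
    (ho : (o.eval (s.natReg a) (s.natReg b)).size ≤ S) (hR : (s.natReg 3).size ≤ S)
    (hr : s.natReg 11 < s.natReg 3) {Q : State → Prop}
    (hQ : Q { s with
      natReg := Function.update s.natReg 67
        (o.eval (s.natReg a) (s.natReg b) * s.natReg 3 + s.natReg 11)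
      realMem := write s.realMem arr
        (o.eval (s.natReg a) (s.natReg b) * s.natReg 3 + s.natReg 11) (s.realReg src) }) :
    Runs (storeAt o a b arr src) s (9 * S + 4) Q := by
  refine Runs.block (by simp) ?_ ?_
  · have em : ∀ x y, NatOp.eval .mul x y = x * y := fun _ _ => rfl
    have ea : ∀ x y, NatOp.eval .add x y = x + y := fun _ _ => rfl
    set X := o.eval (s.natReg a) (s.natReg b) with hX
    have h1 := size_mul_add_le (x := X) hr
    have h2 := size_mul_le X (s.natReg 3)
    have h3 : (s.natReg 11).size ≤ S := (Nat.size_le_size hr.le).trans hR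
    simp [listCost, Instr.cost, Instr.apply, em, ea, ← hX] at h1 h2 ⊢
    omega
  · convert hQ using 1
    simp [Instr.apply, NatOp.eval]

theorem write_cell {mem : ℕ → ℕ → ℝ} {a R r₀ X : ℕ} (hr : r₀ < R) (v : ℝ) (x : ℕ) :
    write mem a (X * R + r₀) v a (x * R + r₀) = if x = X then v else mem a (x * R + r₀) := by
  rw [write_apply]
  have : x * R + r₀ = X * R + r₀ ↔ x = X := by
    constructor
    · intro h
      have h' : x * R = X * R := by omega
      exact Nat.eq_of_mul_eq_mul_right (by omega) h'
    · rintro rfl; rfl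
  simp only [this, true_and]

theorem write_other {mem : ℕ → ℕ → ℝ} {a b R r₀ X y : ℕ} (hr : r₀ < R) (v : ℝ)
    (h : b ≠ a ∨ y % R ≠ r₀) : write mem a (X * R + r₀) v b y = mem b y := by
  rw [write_apply, if_neg]
  rintro ⟨rfl, rfl⟩
  refine h.elim (fun h => h rfl) fun h => h ?_
  rw [mul_comm, Nat.mul_add_mod, Nat.mod_eq_of_lt hr]

section

variable {p : Round} {s₀ s s' : State}

theorem Round.Common.static (h : p.Common s₀ s) (h0 : p.Start s₀) :
    Static p.R p.n p.w p.d p.m p.c₀ p.K s := h0.static.of_rowFrame h.frame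

theorem Round.Common.round (h : p.Common s₀ s) (h0 : p.Start s₀) : s.natReg 11 = p.r₀ := by
  rw [h.frame.natReg 11 (by omega) (by omega) (by omega) (by omega) (by omega) (by omega)
    (by omega) (by omega), h0.round]

theorem Round.Common.of_work (h : p.Common s₀ s) (hf : WorkFrame s s') (hb : s'.env.Bdd p.V)
    (hv : ∀ v, v ≠ 11 → v ≠ 13 → v ≠ 14 → s'.env.var v = s.env.var v)
    (hm : ∀ a, a ≠ 6 → s'.env.mem a = s.env.mem a) : p.Common s₀ s' :=
  ⟨h.frame.trans (.of_work hf), hb, fun v h1 h2 h3 => (hv v h1 h2 h3).trans (h.var v h1 h2 h3),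
    fun a ha => (hm a ha).trans (h.mem a ha), fun a x hx => by rw [hf.realMem, h.other a x hx]⟩

/-- After the entry in column `j` has been stored. -/
structure Round.Stored (p : Round) (s₀ : State) (i j : ℕ) (s : State) : Prop
    extends p.Common s₀ s where
  row : s.natReg 27 = i
  base : s.natReg 123 = i * p.d
  col : s.env.var 11 = j
  kind : s.env.var 14 = bit i (s₀.env.var 8)
  bits : ∀ v < s₀.env.var 5, s.env.mem 6 v = bit i v
  queries : ∀ x, s.realMem 4 (x * p.R + p.r₀) =
    if x < i * p.d + (j + 1) then p.query s₀ (x / p.d) (x % p.d) else 0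
  values : ∀ x, s.realMem 12 (x * p.R + p.r₀) =
    if x < i * p.m then p.value s₀ (x / p.m) (x % p.m) else 0

theorem div_mod_of_lt {i j d : ℕ} (h : j < d) : (i * d + j) / d = i ∧ (i * d + j) % d = j := by
  constructor
  · rw [mul_comm, Nat.mul_add_div (by omega), Nat.div_eq_of_lt h, add_zero]
  · rw [mul_comm, Nat.mul_add_mod, Nat.mod_eq_of_lt h]

theorem Round.Col.stored {i j : ℕ} (h0 : p.Start s₀) (h : p.Col s₀ i j s)
    (hj : j < s₀.env.var 10) (y : ℝ) (hy : p.query s₀ i j = y) :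
    p.Stored s₀ i j { s with
      natReg := Function.update s.natReg 67 ((i * p.d + j) * p.R + p.r₀)
      realMem := write s.realMem 4 ((i * p.d + j) * p.R + p.r₀) y } := by
  have hjd : j < p.d := hj.trans_le h0.count_le
  have henv : ({ s with
      natReg := Function.update s.natReg 67 ((i * p.d + j) * p.R + p.r₀)
      realMem := write s.realMem 4 ((i * p.d + j) * p.R + p.r₀) y } : State).env = s.env := by
    simp only [State.env]
    congr 1
    funext v
    rw [Function.update_of_ne (by omega)]
  refine ⟨⟨h.frame.trans ⟨fun x _ _ h67 _ _ _ _ _ => Function.update_of_ne h67 _ _, fun _ _ _ => rfl,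
    fun _ _ => rfl⟩, ?_, ?_, ?_, fun a x hx => ?_⟩, ?_, ?_, ?_, ?_, ?_, fun x => ?_, fun x => ?_⟩
  · rw [henv]; exact h.bdd
  · rw [henv]; exact h.var
  · rw [henv]; exact h.mem
  · rw [← h.other a x hx]
    exact write_other (mem := s.realMem) (X := i * p.d + j) h0.round_lt _ (hx.imp_left fun h => h.1)
  · simpa using h.row
  · simpa using h.base
  · rw [henv]; exact h.col
  · rw [henv]; exact h.kind
  · rw [henv]; exact h.bits
  · refine (write_cell (a := 4) h0.round_lt y x).trans ?_
    rw [h.queries]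
    obtain ⟨e1, e2⟩ := div_mod_of_lt (i := i) hjd
    by_cases hx : x = i * p.d + j
    · rw [if_pos hx, if_pos (by omega), hx, e1, e2, hy]
    · rw [if_neg hx]
      have : x < i * p.d + j ↔ x < i * p.d + (j + 1) := by omega
      simp only [this]
  · rw [← h.values x]
    exact write_other (mem := s.realMem) (a := 4) (b := 12) (X := i * p.d + j) h0.round_lt y (Or.inl (by omega))

theorem Round.Col.skip {i j : ℕ} (h0 : p.Start s₀) (h : p.Col s₀ i j s)
    (hj : j < s₀.env.var 10) (hy : p.query s₀ i j = 0) (z : ℕ) :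
    p.Stored s₀ i j { s with natReg := Function.update s.natReg 107 z } := by
  have hjd : j < p.d := hj.trans_le h0.count_le
  have henv : ({ s with natReg := Function.update s.natReg 107 z } : State).env = s.env := by
    simp only [State.env]
    congr 1
    funext v
    rw [Function.update_of_ne (by omega)]
  refine ⟨⟨h.frame.trans ⟨fun x _ _ _ _ _ h107 _ _ => Function.update_of_ne h107 _ _,
    fun _ _ _ => rfl, fun _ _ => rfl⟩, ?_, ?_, ?_, h.other⟩, ?_, ?_, ?_, ?_, ?_, fun x => ?_,
    h.values⟩
  · rw [henv]; exact h.bdd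
  · rw [henv]; exact h.var
  · rw [henv]; exact h.mem
  · simpa using h.row
  · simpa using h.base
  · rw [henv]; exact h.col
  · rw [henv]; exact h.kind
  · rw [henv]; exact h.bits
  · refine (h.queries x).trans ?_
    obtain ⟨e1, e2⟩ := div_mod_of_lt (i := i) hjd
    by_cases hx : x = i * p.d + j
    · rw [if_neg (by omega), if_pos (by omega), hx, e1, e2, hy]
    · have : x < i * p.d + j ↔ x < i * p.d + (j + 1) := by omega
      simp only [this]

theorem Round.Col.mark {i j : ℕ} (h0 : p.Start s₀) (h : p.Col s₀ i j s)
    (he : s'.env = markCoord p.k s.env) (hf : SmallFrame s s') :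
    p.Col s₀ i j s' ∧ (s'.env.var 13 = 1 ∧ p.coord s₀ i j ∨
      s'.env.var 13 = 0 ∧ ¬ p.coord s₀ i j) := by
  classical
  have hw := hf.workFrame
  have hv : ∀ v, v ≠ 13 → s'.env.var v = s.env.var v := fun v hv => by
    rw [he]; simp [markCoord, Env.setVar, hv]
  have hm : s'.env.mem = s.env.mem := by rw [he]; rfl
  have hcoord : CoordFalse p.k (envL s.env) (s.env.var 5) (s.env.var 8) (s.env.var 9)
      (s.env.mem 4) (s.env.mem 5) (s.env.mem 6) (s.env.var 14) (s.env.var 11) ↔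
      p.coord s₀ i j := by
    unfold Round.coord CoordFalse
    simp only [envL]
    rw [h.var 0 (by omega) (by omega) (by omega), h.var 5 (by omega) (by omega) (by omega),
      h.var 8 (by omega) (by omega) (by omega), h.var 9 (by omega) (by omega) (by omega),
      h.mem 4 (by omega), h.mem 5 (by omega), h.kind, h.col]
    simp only [RowFalse.congr h0.kind_lt.le h.bits]
  refine ⟨⟨h.toCommon.of_work hw ?_ (fun v _ h13 _ => hv v h13) fun a _ => by rw [hm], ?_, ?_, ?_,
    ?_, ?_, ?_, ?_⟩, ?_⟩
  · rw [he]
    refine bdd_setVar h.bdd ?_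
    have := h0.hV
    split <;> omega
  · rw [hf.natReg _ (by omega) (by omega), h.row]
  · rw [hf.natReg _ (by omega) (by omega), h.base]
  · rw [hv _ (by omega), h.col]
  · rw [hv _ (by omega), h.kind]
  · rw [hm]; exact h.bits
  · rw [hf.realMem]; exact h.queries
  · rw [hf.realMem]; exact h.values
  · rw [he]
    simp only [markCoord, Env.setVar, Function.update_self, hcoord]
    by_cases hc : p.coord s₀ i j <;> simp [hc]

theorem Round.Stored.next {i j : ℕ} (h : p.Stored s₀ i j s) (h0 : p.Start s₀)
    (hj : j < s₀.env.var 10) :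
    p.Col s₀ i (j + 1) { s with natReg := Function.update s.natReg 88 (j + 1) } := by
  set s' : State := { s with natReg := Function.update s.natReg 88 (j + 1) } with hs'
  have henv : s'.env = s.env.setVar 11 (j + 1) := by
    simp only [State.env, Env.setVar, hs']
    congr 1
    funext v
    by_cases hv : v = 11
    · subst hv; simp
    · rw [Function.update_of_ne (by omega), Function.update_of_ne hv]
  have hv : ∀ v, v ≠ 11 → s'.env.var v = s.env.var v := fun v hv => by
    rw [henv]; simp [Env.setVar, hv]
  have hm : s'.env.mem = s.env.mem := by rw [henv]; rfl
  have hw : WorkFrame s s' := ⟨fun x hx _ _ _ _ _ => Function.update_of_ne (by omega) _ _,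
    fun _ _ _ => rfl, rfl, rfl⟩
  refine ⟨h.toCommon.of_work hw ?_ (fun v h11 _ _ => hv v h11) fun a _ => by rw [hm], ?_, ?_, ?_,
    ?_, ?_, h.queries, h.values⟩
  · rw [henv]
    exact bdd_setVar h.bdd (le_trans hj (h0.bdd.1 10))
  · simpa [hs'] using h.row
  · simpa [hs'] using h.base
  · rw [henv]; simp [Env.setVar]
  · rw [hv _ (by omega), h.kind]
  · rw [hm]; exact h.bits

/-- A substitute for the empty program; register 107 is scratch. -/
def skipProg : Program := .instr (.natConst 107 0)

/-- Only nonzero entries are stored, since the cells of the round are still zero. The kind of the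
row selects the real register 2, which holds 1, or 10, which holds `-n`. -/
def colProg (Pc : Program) : Program :=
  .seq Pc (.seq (.branch (.natLt 115 (8 * 13)) (.branch (.natLt 115 (8 * 14))
    (storeAt .add 123 (8 * 11) 4 10) (storeAt .add 123 (8 * 11) 4 2)) skipProg)
    (.instr (.natOp .add (8 * 11) (8 * 11) 91)))

theorem Round.size_R (h0 : p.Start s₀) : p.R.size ≤ p.V + 1 := size_le_of_le_two_pow h0.hR

theorem colProg_runs {Pc : Program} {c : ℕ} (hPc : ∀ (s : State) (V : ℕ), s.env.Bdd V →
    (∀ i, s.loc i = 0) → Runs Pc s ((V + 2) ^ c) fun s' =>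
      s'.env = markCoord p.k s.env ∧ SmallFrame s s')
    {i j : ℕ} (h0 : p.Start s₀) (h : p.Col s₀ i j s) (hi : i < p.n) (hj : j < s₀.env.var 10) :
    Runs (colProg Pc) s ((p.V + 2) ^ c + (21 * p.V + 30)) (p.Col s₀ i (j + 1)) := by
  have hjd : j < p.d := hj.trans_le h0.count_le
  have hjV : j ≤ p.V := hj.le.trans (h0.bdd.1 10)
  refine Runs.seq (hPc s p.V h.bdd (h.toCommon.static h0).loc) (T₂ := 21 * p.V + 30) ?_ le_rfl
  rintro s₁ ⟨he, hf⟩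
  obtain ⟨h₁, hc⟩ := h.mark h0 he hf
  have hst := h₁.toCommon.static h0
  have hr := h₁.toCommon.round h0
  refine Runs.seq (T₁ := 20 * p.V + 27) (T₂ := p.V + 3) (M := p.Stored s₀ i j) ?_ ?_ (by omega)
  · have hij : i * p.d + j < p.n * p.d := by
      calc i * p.d + j < (i + 1) * p.d := by rw [add_mul]; omega
        _ ≤ _ := Nat.mul_le_mul_right _ hi
    have hnd : p.n * p.d ≤ 2 ^ (2 * p.V) := by
      rw [two_mul, pow_add]; exact Nat.mul_le_mul h0.hn h0.hd
    have z1 : (i * p.d + j).size ≤ 2 * p.V + 2 :=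
      (size_le_of_le_two_pow (hij.le.trans hnd)).trans (by omega)
    have z2 : (i * p.d).size ≤ 2 * p.V + 2 := (Nat.size_le_size (by omega)).trans z1
    have z3 : j.size ≤ 2 * p.V + 2 := (size_le_self j).trans (by omega)
    have z4 : p.R.size ≤ 2 * p.V + 2 := (Round.size_R h0).trans (by omega)
    have hcol : s₁.natReg (8 * 11) = j := h₁.col
    have hstore : ∀ src, s₁.realReg src = p.query s₀ i j →
        Runs (storeAt .add 123 (8 * 11) 4 src) s₁ (9 * (2 * p.V + 2) + 4) (p.Stored s₀ i j) := by
      intro src hsrc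
      refine storeAt_runs (by rw [h₁.base]; exact z2) (by rw [hcol]; exact z3)
        (by rw [h₁.base, hcol]; exact z1) (by rw [hst.modulus]; exact z4)
        (by rw [hst.modulus, hr]; exact h0.round_lt) ?_
      rw [h₁.base, hcol, hst.modulus, hr]
      exact h₁.stored h0 hj _ hsrc.symm
    have c13 : (Test.natLt 115 (8 * 13)).cost s₁ ≤ 2 := by
      have e : s₁.natReg (8 * 13) = s₁.env.var 13 := rfl
      simp only [Test.cost, hst.zero, e]
      rcases hc with ⟨hc, -⟩ | ⟨hc, -⟩ <;> rw [hc] <;> simp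
    have hkind : s₁.natReg (8 * 14) = bit i (s₀.env.var 8) := h₁.kind
    have hb2 := bit_lt_two i (s₀.env.var 8)
    have c14 : (Test.natLt 115 (8 * 14)).cost s₁ ≤ 3 := by
      simp only [Test.cost, hst.zero, hkind]
      have := size_le_self (bit i (s₀.env.var 8))
      simp only [Nat.size_zero]
      omega
    rcases hc with ⟨hc, hcoord⟩ | ⟨hc, hcoord⟩
    · refine (Runs.branchTrue (by simp only [Test.holds, hst.zero]; exact (show s₁.natReg (8 * 13) = 1 from hc) ▸ Nat.one_pos) c13
        (T := 3 + (9 * (2 * p.V + 2) + 4)) ?_).mono (by omega) fun _ h => h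
      by_cases hk : bit i (s₀.env.var 8) = 0
      · refine Runs.branchFalse (by simp only [Test.holds, hst.zero, hkind, hk]; omega) c14
          (hstore 2 ?_)
        rw [hst.real_one, Round.query, if_pos ⟨hj, hcoord⟩, if_pos hk]
      · refine Runs.branchTrue (by simp only [Test.holds, hst.zero, hkind]; omega) c14
          (hstore 10 ?_)
        rw [hst.real_neg, Round.query, if_pos ⟨hj, hcoord⟩, if_neg hk]
    · refine (Runs.branchFalse (by
          simp only [Test.holds, hst.zero]; exact (show s₁.natReg (8 * 13) = 0 from hc) ▸ lt_irrefl _)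
        c13 (T := 1) ?_).mono (by omega) fun _ h => h
      refine Runs.instr _ _ (by simp [Instr.cost]) ?_
      exact h₁.skip h0 hj (by rw [Round.query, if_neg fun h => hcoord h.2]) 0
  · intro s₂ h₂
    have hst₂ := h₂.toCommon.static h0
    have hcol : s₂.natReg (8 * 11) = j := h₂.col
    refine Runs.instr _ _ ?_ ?_
    · simp only [Instr.cost, hcol, hst₂.one, Nat.size_one]
      have := size_le_self j
      omega
    · have := h₂.next h0 hj
      simp only [Instr.apply, hcol, hst₂.one, NatOp.eval]
      exact this

end

end Sparsify

namespace Sparsify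

open RealRAM

section

variable {p : Round} {s₀ s s' : State}

theorem exists_eq_add_of_lt {i d x : ℕ} (h1 : i * d ≤ x) (h2 : x < (i + 1) * d) :
    ∃ t < d, x = i * d + t := ⟨x - i * d, by rw [add_mul] at h2; omega, by omega⟩

theorem Round.query_eq_zero {i j : ℕ} (h : s₀.env.var 10 ≤ j) : p.query s₀ i j = 0 := by
  rw [Round.query, if_neg]
  rintro ⟨h', -⟩
  omega

/-- After row `i` has been completed. -/
structure Round.Done (p : Round) (s₀ : State) (i : ℕ) (s : State) : Prop
    extends p.Common s₀ s where
  row : s.natReg 27 = i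
  queries : ∀ x, s.realMem 4 (x * p.R + p.r₀) =
    if x < (i + 1) * p.d then p.query s₀ (x / p.d) (x % p.d) else 0
  values : ∀ x, s.realMem 12 (x * p.R + p.r₀) =
    if x < (i + 1) * p.m then p.value s₀ (x / p.m) (x % p.m) else 0

theorem Round.Col.queries_done {i : ℕ} (h : p.Col s₀ i (s₀.env.var 10) s) (h0 : p.Start s₀)
    (x : ℕ) : s.realMem 4 (x * p.R + p.r₀) =
      if x < (i + 1) * p.d then p.query s₀ (x / p.d) (x % p.d) else 0 := by
  have hM := h0.count_le
  have e : (i + 1) * p.d = i * p.d + p.d := by ring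
  rw [h.queries]
  by_cases h1 : x < i * p.d + s₀.env.var 10
  · rw [if_pos h1, if_pos (by omega)]
  · rw [if_neg h1]
    split
    · next h2 =>
      obtain ⟨t, ht, rfl⟩ := exists_eq_add_of_lt (by omega) h2
      rw [(div_mod_of_lt ht).1, (div_mod_of_lt ht).2, Round.query_eq_zero (by omega)]
    · rfl

/-- A row changes at most its cell in column 0; the other columns are zero in the matrix as well as
in the fresh memory. -/
theorem Round.values_succ {i : ℕ} (h0 : p.Start s₀) {f g : ℕ → ℝ}
    (hf : ∀ x, f x = if x < i * p.m then p.value s₀ (x / p.m) (x % p.m) else 0)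
    (hg : ∀ x, g x = if x = i * p.m then p.value s₀ i 0 else f x) (x : ℕ) :
    g x = if x < (i + 1) * p.m then p.value s₀ (x / p.m) (x % p.m) else 0 := by
  have hm := h0.hm0
  have e : (i + 1) * p.m = i * p.m + p.m := by ring
  rw [hg]
  by_cases hx : x = i * p.m
  · obtain ⟨e1, e2⟩ := div_mod_of_lt (i := i) (j := 0) (d := p.m) (by omega)
    rw [add_zero] at e1 e2
    rw [if_pos hx, if_pos (by omega), hx, e1, e2]
  · rw [if_neg hx, hf]
    by_cases h1 : x < i * p.m
    · rw [if_pos h1, if_pos (by omega)]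
    · rw [if_neg h1]
      split
      · next h2 =>
        obtain ⟨t, ht, rfl⟩ := exists_eq_add_of_lt (by omega) h2
        rw [(div_mod_of_lt ht).1, (div_mod_of_lt ht).2, Round.value, if_neg]
        rintro ⟨h3, -⟩
        omega
      · rfl

theorem Round.Col.done_store {i : ℕ} (h : p.Col s₀ i (s₀.env.var 10) s) (h0 : p.Start s₀)
    (hk : ¬ bit i (s₀.env.var 8) = 0) :
    p.Done s₀ i { s with
      natReg := Function.update s.natReg 67 (i * p.m * p.R + p.r₀)
      realMem := write s.realMem 12 (i * p.m * p.R + p.r₀) p.n } := by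
  set s' : State := { s with
      natReg := Function.update s.natReg 67 (i * p.m * p.R + p.r₀)
      realMem := write s.realMem 12 (i * p.m * p.R + p.r₀) p.n } with hs'
  have henv : s'.env = s.env := by
    simp only [State.env, hs']
    congr 1
    funext v
    rw [Function.update_of_ne (by omega)]
  refine ⟨⟨h.frame.trans ⟨fun x _ _ h67 _ _ _ _ _ => Function.update_of_ne h67 _ _, fun _ _ _ => rfl,
    fun _ _ => rfl⟩, ?_, ?_, ?_, fun a x hx => ?_⟩, ?_, fun x => ?_, ?_⟩
  · rw [henv]; exact h.bdd
  · rw [henv]; exact h.var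
  · rw [henv]; exact h.mem
  · rw [← h.other a x hx]
    exact write_other (mem := s.realMem) (X := i * p.m) h0.round_lt _ (hx.imp_left fun h => h.2)
  · simpa [hs'] using h.row
  · rw [← h.queries_done h0 x]
    exact write_other (mem := s.realMem) (a := 12) (b := 4) (X := i * p.m) h0.round_lt (p.n : ℝ)
      (Or.inl (by omega))
  · refine Round.values_succ h0 h.values fun x => ?_
    refine (write_cell (mem := s.realMem) (a := 12) (X := i * p.m) h0.round_lt (p.n : ℝ) x).trans ?_
    have hv : p.value s₀ i 0 = p.n := by rw [Round.value, if_pos ⟨rfl, hk⟩]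
    rw [hv]

theorem Round.Col.done_skip {i : ℕ} (h : p.Col s₀ i (s₀.env.var 10) s) (h0 : p.Start s₀)
    (hk : bit i (s₀.env.var 8) = 0) (z : ℕ) :
    p.Done s₀ i { s with natReg := Function.update s.natReg 107 z } := by
  set s' : State := { s with natReg := Function.update s.natReg 107 z } with hs'
  have henv : s'.env = s.env := by
    simp only [State.env, hs']
    congr 1
    funext v
    rw [Function.update_of_ne (by omega)]
  refine ⟨⟨h.frame.trans ⟨fun x _ _ _ _ _ h107 _ _ => Function.update_of_ne h107 _ _,
    fun _ _ _ => rfl, fun _ _ => rfl⟩, ?_, ?_, ?_, h.other⟩, ?_, h.queries_done h0, ?_⟩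
  · rw [henv]; exact h.bdd
  · rw [henv]; exact h.var
  · rw [henv]; exact h.mem
  · simpa [hs'] using h.row
  · refine Round.values_succ h0 h.values fun x => ?_
    split
    · next hx =>
      refine (h.values x).trans ?_
      rw [if_neg (by omega), Round.value, if_neg fun h => h.2 hk]
    · rfl

theorem Round.Done.next {i : ℕ} (h : p.Done s₀ i s) :
    p.Row s₀ (i + 1) { s with natReg := Function.update s.natReg 27 (i + 1) } := by
  set s' : State := { s with natReg := Function.update s.natReg 27 (i + 1) } with hs'
  have henv : s'.env = s.env := by
    simp only [State.env, hs']
    congr 1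
    funext v
    rw [Function.update_of_ne (by omega)]
  refine ⟨⟨h.frame.trans ⟨fun x _ _ _ _ _ _ h27 _ => Function.update_of_ne h27 _ _,
    fun _ _ _ => rfl, fun _ _ => rfl⟩, ?_, ?_, ?_, h.other⟩, ?_, h.queries, h.values⟩
  · rw [henv]; exact h.bdd
  · rw [henv]; exact h.var
  · rw [henv]; exact h.mem
  · simp [hs']

theorem Round.Row.enter {i : ℕ} (h : p.Row s₀ i s) (h0 : p.Start s₀) (hf : WorkFrame s s')
    (he : s'.env = (s.env.setArr 6 (s.env.var 5) fun t => i / 2 ^ t % 2).setVar 14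
      (bit i (s₀.env.var 8))) :
    p.Col s₀ i 0 { s' with
      natReg := Function.update (Function.update s'.natReg 88 0) 123 (i * p.d) } := by
  have hv : ∀ v, v ≠ 14 → s'.env.var v = s.env.var v := fun v hv => by
    rw [he]; simp [Env.setVar, Env.setArr, hv]
  have hm : ∀ a, a ≠ 6 → s'.env.mem a = s.env.mem a := fun a ha => by
    rw [he]; simp [Env.setVar, Env.setArr, ha]
  have hV := h0.hV
  have hb : s'.env.Bdd p.V := by
    rw [he]
    refine bdd_setVar (bdd_setArr h.bdd fun x _ => ?_) ?_
    · have := bit_lt_two i x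
      unfold bit at this
      omega
    · have := bit_lt_two i (s₀.env.var 8)
      omega
  have hc : p.Common s₀ s' := h.toCommon.of_work hf hb (fun v _ _ h14 => hv v h14) hm
  set s'' : State := { s' with
      natReg := Function.update (Function.update s'.natReg 88 0) 123 (i * p.d) } with hs''
  have henv : s''.env = s'.env.setVar 11 0 := by
    simp only [State.env, Env.setVar, hs'']
    congr 1
    funext v
    rw [Function.update_of_ne (by omega)]
    by_cases hv : v = 11
    · subst hv; simp
    · rw [Function.update_of_ne (by omega), Function.update_of_ne hv]
  refine ⟨⟨hc.frame.trans ⟨fun x hx _ _ _ _ _ _ h123 => ?_, fun _ _ _ => rfl, fun _ _ => rfl⟩, ?_,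
    fun v h11 h13 h14 => ?_, ?_, hc.other⟩, ?_, ?_, ?_, ?_, fun v hv' => ?_, ?_, ?_⟩
  · exact (Function.update_of_ne h123 _ _).trans (Function.update_of_ne (by omega) _ _)
  · rw [henv]; exact bdd_setVar hb (Nat.zero_le _)
  · rw [henv, ← hc.var v h11 h13 h14]; simp [Env.setVar, h11]
  · rw [henv]; exact hc.mem
  · have : s'.natReg 27 = s.natReg 27 := hf.natReg 27 (by omega) (by omega) (by omega) (by omega)
      (by omega) (by omega)
    rw [h.row] at this
    simpa [hs''] using this
  · simp [hs'']
  · rw [henv]; simp [Env.setVar]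
  · rw [henv, he]; simp [Env.setVar]
  · rw [henv, he]
    have h5 := h.var 5 (by omega) (by omega) (by omega)
    simp [Env.setVar, Env.setArr, h5, hv', bit]
  · intro x
    rw [add_zero, ← h.queries x, ← hf.realMem]
  · intro x
    rw [← h.values x, ← hf.realMem]

/-- The inner loop runs over the coordinates in use, not over all `d` columns; the remaining cells
are zero anyway. The cost of a row is therefore polynomial in `V`, although `d` itself may be
exponential in `V`. -/
def rowProg (Pk Pc : Program) : Program :=
  .seq (unpackProg 27 6 5) (.seq Pk (.seq (block [.natConst (8 * 11) 0, .natOp .mul 123 27 51])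
    (.seq (.loop (.natLt (8 * 11) (8 * 10)) (colProg Pc)) (.seq
      (.branch (.natLt 115 (8 * 14)) (storeAt .mul 27 59 12 18) skipProg)
      (.instr (.natOp .add 27 27 91))))))

theorem rowProg_runs {Pk Pc : Program} {c : ℕ} (hPk : ∀ (s : State) (V : ℕ), s.env.Bdd V →
    (∀ i, s.loc i = 0) → Runs Pk s ((V + 2) ^ c) fun s' =>
      s'.env = s.env.setVar 14 (s.env.mem 6 (s.env.var 8)) ∧ SmallFrame s s')
    (hPc : ∀ (s : State) (V : ℕ), s.env.Bdd V →
    (∀ i, s.loc i = 0) → Runs Pc s ((V + 2) ^ c) fun s' =>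
      s'.env = markCoord p.k s.env ∧ SmallFrame s s')
    {i : ℕ} (h0 : p.Start s₀) (h : p.Row s₀ i s) (hi : i < p.n) :
    Runs (rowProg Pk Pc) s (60 * (p.V + 1) ^ 2 + (p.V + 2) ^ c + (2 * p.V + 10) +
      (p.V * (2 * p.V + 1 + ((p.V + 2) ^ c + (21 * p.V + 30))) + (2 * p.V + 1)) +
      (20 * p.V + 30) + (p.V + 5)) (p.Row s₀ (i + 1)) := by
  have hin : i ≤ 2 ^ p.V := hi.le.trans h0.hn
  have hst := h.toCommon.static h0
  have zi : i.size ≤ p.V + 1 := size_le_of_le_two_pow hin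
  have zd : p.d.size ≤ p.V + 1 := size_le_of_le_two_pow h0.hd
  have zm : p.m.size ≤ p.V + 1 := size_le_of_le_two_pow h0.hm
  have hq := h0.kind_lt
  have e5 : s.env.var 5 = s₀.env.var 5 := h.var 5 (by omega) (by omega) (by omega)
  have e8 : s.env.var 8 = s₀.env.var 8 := h.var 8 (by omega) (by omega) (by omega)
  refine Runs.seq (T₁ := 60 * (p.V + 1) ^ 2) (T₂ := (p.V + 2) ^ c + ((2 * p.V + 10) +
      ((p.V * (2 * p.V + 1 + ((p.V + 2) ^ c + (21 * p.V + 30))) + (2 * p.V + 1)) +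
      ((20 * p.V + 30) + (p.V + 5)))))
    (unpackProg_runs (V := p.V) hst.one hst.two hst.zero (by omega)
      (by rw [h.row]; exact hin) (h.bdd.1 5)) ?_ (by omega)
  rintro s₁ ⟨f₁, he₁⟩
  rw [h.row] at he₁
  have hb₁ : s₁.env.Bdd p.V := by
    rw [he₁]
    refine bdd_setArr h.bdd fun x _ => ?_
    have := h0.hV
    have := bit_lt_two i x
    unfold bit at this
    omega
  refine Runs.seq (hPk s₁ p.V hb₁ (by rw [f₁.loc]; exact hst.loc)) (T₂ := (2 * p.V + 10) +
      ((p.V * (2 * p.V + 1 + ((p.V + 2) ^ c + (21 * p.V + 30))) + (2 * p.V + 1)) +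
      ((20 * p.V + 30) + (p.V + 5)))) ?_ le_rfl
  rintro s₂ ⟨he₂, f₂⟩
  have f₂' := f₁.trans f₂.workFrame
  have hkind : s₁.env.mem 6 (s₁.env.var 8) = bit i (s₀.env.var 8) := by
    rw [he₁]
    simp [Env.setArr, e5, e8, hq, bit]
  rw [hkind, he₁] at he₂
  have hcol := h.enter h0 f₂' he₂
  have r27 : s₂.natReg 27 = i := (f₂'.natReg 27 (by omega) (by omega) (by omega) (by omega)
      (by omega) (by omega)).trans h.row
  have r51 : s₂.natReg 51 = p.d := (f₂'.natReg 51 (by omega) (by omega) (by omega) (by omega)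
      (by omega) (by omega)).trans hst.dim
  refine Runs.seq (M := p.Col s₀ i 0) (T₁ := 2 * p.V + 10) (T₂ :=
      ((p.V * (2 * p.V + 1 + ((p.V + 2) ^ c + (21 * p.V + 30))) + (2 * p.V + 1)) +
      ((20 * p.V + 30) + (p.V + 5)))) (Runs.block (by simp) ?_ ?_) ?_ le_rfl
  · simp [listCost, Instr.cost, Instr.apply, r27, r51]
    omega
  · simp only [List.foldl, Instr.apply, NatOp.eval]
    rw [Function.update_of_ne (by omega), Function.update_of_ne (by omega), r27, r51]
    exact hcol
  intro s₃ h₃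
  have hMV : s₀.env.var 10 ≤ p.V := h0.bdd.1 10
  have hcmp : ∀ {j : ℕ} {s : State}, p.Col s₀ i j s → s.natReg (8 * 11) = j ∧
      s.natReg (8 * 10) = s₀.env.var 10 := fun h =>
    ⟨h.col, h.var 10 (by omega) (by omega) (by omega)⟩
  refine Runs.seq (T₁ := p.V * (2 * p.V + 1 + ((p.V + 2) ^ c + (21 * p.V + 30))) + (2 * p.V + 1))
    (T₂ := (20 * p.V + 30) + (p.V + 5)) (Runs.loop (p.Col s₀ i) (n := s₀.env.var 10)
      (c := 2 * p.V + 1) (T := (p.V + 2) ^ c + (21 * p.V + 30)) ?_ ?_ ?_ h₃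
      (Nat.add_le_add_right (Nat.mul_le_mul_right _ hMV) _)) ?_ le_rfl
  · intro j s hj h
    simp only [Test.cost, (hcmp h).1, (hcmp h).2]
    have := size_le_self j
    have := size_le_self (s₀.env.var 10)
    omega
  · intro j s hj h
    refine ⟨?_, colProg_runs hPc h0 h hi hj⟩
    simp only [Test.holds, (hcmp h).1, (hcmp h).2]
    exact hj
  · intro s h
    simp only [Test.holds, (hcmp h).1, (hcmp h).2]
    exact lt_irrefl _
  intro s₄ h₄
  have hst₄ := h₄.toCommon.static h0
  have hr₄ := h₄.toCommon.round h0
  have hk₄ : s₄.natReg (8 * 14) = bit i (s₀.env.var 8) := h₄.kind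
  have hb2 := bit_lt_two i (s₀.env.var 8)
  have c14 : (Test.natLt 115 (8 * 14)).cost s₄ ≤ 3 := by
    simp only [Test.cost, hst₄.zero, hk₄]
    have := size_le_self (bit i (s₀.env.var 8))
    simp only [Nat.size_zero]
    omega
  refine Runs.seq (M := p.Done s₀ i) (T₁ := 20 * p.V + 30) (T₂ := p.V + 5) ?_ ?_ le_rfl
  · by_cases hk : bit i (s₀.env.var 8) = 0
    · refine (Runs.branchFalse (by simp only [Test.holds, hst₄.zero, hk₄, hk]; omega) c14
        (T := 1) ?_).mono (by omega) fun _ h => h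
      exact Runs.instr _ _ (by simp [Instr.cost]) (h₄.done_skip h0 hk 0)
    · refine (Runs.branchTrue (by simp only [Test.holds, hst₄.zero, hk₄]; omega) c14
        (T := 9 * (2 * p.V + 2) + 4) ?_).mono (by omega) fun _ h => h
      refine storeAt_runs (by rw [h₄.row]; omega) (by rw [hst₄.cols]; omega) ?_
        (by rw [hst₄.modulus]; exact (Round.size_R h0).trans (by omega))
        (by rw [hst₄.modulus, hr₄]; exact h0.round_lt) ?_
      · rw [h₄.row, hst₄.cols]
        exact (size_mul_le _ _).trans (by omega)
      · rw [h₄.row, hst₄.cols, hst₄.modulus, hr₄, hst₄.real_rows]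
        exact h₄.done_store h0 hk
  intro s₅ h₅
  have hst₅ := h₅.toCommon.static h0
  refine Runs.instr _ _ ?_ ?_
  · simp only [Instr.cost, h₅.row, hst₅.one, Nat.size_one]
    omega
  · simp only [Instr.apply, h₅.row, hst₅.one, NatOp.eval]
    exact h₅.next

def buildProg (Pk Pc : Program) : Program :=
  .seq (.instr (.natConst 27 0)) (.loop (.natLt 27 35) (rowProg Pk Pc))

theorem exists_build (k : ℕ) : ∃ (P : Program) (c : ℕ), ∀ (p : Round) (s₀ : State), p.k = k →
    p.Start s₀ → Runs P s₀ ((p.n + 1) * (p.V + 2) ^ c) (p.Row s₀ p.n) := by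
  obtain ⟨Pk, ⟨c₁, h₁⟩, -⟩ := exists_acts_setVar 14 (f := fun m : Env => m.mem 6 (m.var 8))
    (Comp.load 6 (.var 8))
  obtain ⟨Pc, ⟨c₂, h₂⟩, -⟩ := exists_acts_markCoord k
  have hpow : ∀ c : ℕ, Expr.PolyBd fun V => (V + 2) ^ c := fun c => ⟨c, fun _ => le_rfl⟩
  set c := max c₁ c₂ with hc
  have hle : ∀ {V c' : ℕ}, c' ≤ c → (V + 2) ^ c' ≤ (V + 2) ^ c := fun h =>
    Nat.pow_le_pow_right (by omega) h
  have hl : Expr.PolyBd fun V => 60 * (V + 1) ^ 2 + (V + 2) ^ c + (2 * V + 10) +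
      (V * (2 * V + 1 + ((V + 2) ^ c + (21 * V + 30))) + (2 * V + 1)) +
      (20 * V + 30) + (V + 5) + (2 * V + 5) := by
    have lin : ∀ a b : ℕ, Expr.PolyBd fun V => a * V + b := fun a b =>
      ((Expr.PolyBd.const a).mul .id).add (.const b)
    have h1 : Expr.PolyBd fun V => 60 * (V + 1) ^ 2 :=
      ((Expr.PolyBd.const 60).mul ((Expr.PolyBd.id.add (.const 1)).mul
        (Expr.PolyBd.id.add (.const 1)))).mono fun V => by rw [pow_two]
    exact (((((h1.add (hpow c)).add (lin 2 10)).add ((Expr.PolyBd.id.mul ((lin 2 1).add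
      ((hpow c).add (lin 21 30)))).add (lin 2 1))).add (lin 20 30)).add
      (Expr.PolyBd.id.add (.const 5))).add (lin 2 5)
  obtain ⟨C, hC⟩ := hl
  refine ⟨buildProg Pk Pc, C, fun p s₀ hk h0 => ?_⟩
  subst hk
  have hCV := hC p.V
  set X := 60 * (p.V + 1) ^ 2 + (p.V + 2) ^ c + (2 * p.V + 10) +
      (p.V * (2 * p.V + 1 + ((p.V + 2) ^ c + (21 * p.V + 30))) + (2 * p.V + 1)) +
      (20 * p.V + 30) + (p.V + 5) with hX
  replace hCV : X + (2 * p.V + 5) ≤ (p.V + 2) ^ C := hCV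
  have hz : ∀ i ≤ p.n, i.size ≤ p.V + 1 := fun i hi => size_le_of_le_two_pow (hi.trans h0.hn)
  refine Runs.seq (M := p.Row s₀ 0) (T₁ := 1) (T₂ := p.n * (2 * p.V + 3 + X) + (2 * p.V + 3))
    (Runs.instr _ _ (by simp [Instr.cost]) ?_) (fun s h => Runs.loop (p.Row s₀)
      (c := 2 * p.V + 3) (T := X) ?_ ?_ ?_ h le_rfl) ?_
  · refine ⟨⟨⟨fun x _ _ _ _ _ _ h27 _ => Function.update_of_ne h27 _ _, fun _ _ _ => rfl,
      fun _ _ => rfl⟩, ?_, fun v _ _ _ => ?_, fun _ _ => rfl, fun _ _ _ => rfl⟩, ?_, ?_, ?_⟩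
    · refine ⟨fun v => ?_, h0.bdd.2⟩
      have : (Instr.apply (.natConst 27 0) s₀).env.var v = s₀.env.var v :=
        Function.update_of_ne (by omega) _ _
      rw [this]; exact h0.bdd.1 v
    · exact Function.update_of_ne (by omega) _ _
    · simp [Instr.apply]
    · intro x
      rw [zero_mul, if_neg (by omega)]
      exact h0.cells₀ x
    · intro x
      rw [zero_mul, if_neg (by omega)]
      exact h0.cells₁ x
  · intro i s hi h
    simp only [Test.cost, h.row, (h.toCommon.static h0).rows]
    have := hz i hi
    have := hz p.n le_rfl
    omega
  · intro i s hi h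
    refine ⟨by simp only [Test.holds, h.row, (h.toCommon.static h0).rows]; exact hi, ?_⟩
    exact rowProg_runs (c := c) (fun s V hs hl => (h₁ s V hs hl).mono (hle (le_max_left _ _))
      fun _ h => h) (fun s V hs hl => (h₂ s V hs hl).mono (hle (le_max_right _ _)) fun _ h => h)
      h0 h hi
  · intro s h
    simp only [Test.holds, h.row, (h.toCommon.static h0).rows]
    exact lt_irrefl _
  · calc 1 + (p.n * (2 * p.V + 3 + X) + (2 * p.V + 3)) ≤
        (p.n + 1) * (X + (2 * p.V + 5)) := by nlinarith
      _ ≤ _ := Nat.mul_le_mul_left _ hCV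

end

end Sparsify

/-! ### Calling the attention program and scanning its output -/

namespace Sparsify

open RealRAM

/-- What may change in a round of the main loop. -/
structure RoundFrame (K R r₀ : ℕ) (s s' : State) : Prop where
  natReg : ∀ x, x % 8 ≠ 0 → x % 8 ≠ 1 → x ≠ 19 → x ≠ 67 → x ≠ 75 → x ≠ 83 → x ≠ 107 → x ≠ 27 →
    x ≠ 123 → (x % 8 = 4 → 8 * K ≤ x) → s'.natReg x = s.natReg x
  natMem : ∀ a x, a % 8 ≠ 0 → a % 8 ≠ 1 → (a % 8 = 4 → x % R ≠ r₀) → s'.natMem a x = s.natMem a x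
  realReg : ∀ x, x ≠ 34 → (x % 8 = 4 → 8 * K ≤ x) → s'.realReg x = s.realReg x
  realMem : ∀ a x, (a % 8 = 4 → x % R ≠ r₀) → s'.realMem a x = s.realMem a x

section

variable {K R r₀ n w d m c₀ : ℕ} {s s' s'' : State}

theorem RoundFrame.trans (h : RoundFrame K R r₀ s s') (h' : RoundFrame K R r₀ s' s'') :
    RoundFrame K R r₀ s s'' :=
  ⟨fun x h0 h1 h2 h3 h4 h5 h6 h7 h8 h9 => (h'.natReg x h0 h1 h2 h3 h4 h5 h6 h7 h8 h9).trans
      (h.natReg x h0 h1 h2 h3 h4 h5 h6 h7 h8 h9),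
    fun a x h0 h1 h2 => (h'.natMem a x h0 h1 h2).trans (h.natMem a x h0 h1 h2),
    fun x h0 h1 => (h'.realReg x h0 h1).trans (h.realReg x h0 h1),
    fun a x h0 => (h'.realMem a x h0).trans (h.realMem a x h0)⟩

theorem RoundFrame.of_reloc (h : RelocFrame 4 K R r₀ s s') : RoundFrame K R r₀ s s' :=
  ⟨fun x _ _ h19 _ _ _ _ _ _ h9 => h.natReg x h19 h9, fun a x _ _ hx => h.natMem a x hx,
    fun x _ hx => h.realReg x hx, h.realMem⟩

theorem RoundFrame.of_work (h : WorkFrame s s') : RoundFrame K R r₀ s s' :=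
  ⟨fun x h0 h1 _ h3 h4 h5 h6 _ _ _ => h.natReg x h0 h1 h3 h4 h5 h6,
    fun a x h0 h1 _ => by rw [h.natMem a h0 h1], fun x _ _ => by rw [h.realReg],
    fun a x _ => by rw [h.realMem]⟩

theorem RoundFrame.of_rowFrame (h : RowFrame s s')
    (hm : ∀ a x, (a % 8 = 4 → x % R ≠ r₀) → s'.realMem a x = s.realMem a x) :
    RoundFrame K R r₀ s s' :=
  ⟨fun x h0 h1 _ h3 h4 h5 h6 h7 h8 _ => h.natReg x h0 h1 h3 h4 h5 h6 h7 h8,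
    fun a x h0 h1 _ => by rw [h.natMem a h0 h1], fun x h34 _ => h.realReg x h34, hm⟩

theorem Static.of_roundFrame (h : Static R n w d m c₀ K s) (hf : RoundFrame K R r₀ s s') :
    Static R n w d m c₀ K s' := by
  have e : ∀ x, (x = 3 ∨ x = 35 ∨ x = 43 ∨ x = 51 ∨ x = 59 ∨ x = 91 ∨ x = 99 ∨ x = 115 ∨
      x % 8 = 2 ∨ x % 8 = 4 ∧ 8 * K ≤ x) → s'.natReg x = s.natReg x := fun x hx =>
    hf.natReg x (by omega) (by omega) (by omega) (by omega) (by omega) (by omega) (by omega)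
      (by omega) (by omega) (by omega)
  have er : ∀ x, (x = 2 ∨ x = 10 ∨ x = 18 ∨ x = 26 ∨ x % 8 = 4 ∧ 8 * K ≤ x) →
      s'.realReg x = s.realReg x := fun x hx => hf.realReg x (by omega) (by omega)
  exact ⟨(e 3 (by omega)).trans h.modulus, (e 35 (by omega)).trans h.rows,
    (e 43 (by omega)).trans h.window, (e 51 (by omega)).trans h.dim,
    (e 59 (by omega)).trans h.cols, (e 91 (by omega)).trans h.one, (e 99 (by omega)).trans h.two,
    (e 115 (by omega)).trans h.zero, (er 2 (by omega)).trans h.real_one,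
    (er 10 (by omega)).trans h.real_neg, (er 18 (by omega)).trans h.real_rows,
    (er 26 (by omega)).trans h.real_threshold, fun i => (e _ (by omega)).trans (h.loc i),
    fun x hx hK => (e x (by omega)).trans (h.natHigh x hx hK),
    fun x hx hK => (er x (by omega)).trans (h.realHigh x hx hK)⟩

end

/-! ### Running the attention program -/

section

variable {p : Round} {s₀ s s' : State}

/-- The matrices built in a round. -/
noncomputable def Round.Q (p : Round) (s₀ : State) : Matrix (Fin p.n) (Fin p.d) ℝ :=
  SlidingWindow.queries p.n p.d (s₀.env.var 10) (fun i => bit i (s₀.env.var 8) = 0) (p.coord s₀)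

noncomputable def Round.Vals (p : Round) (s₀ : State) : Matrix (Fin p.n) (Fin p.m) ℝ :=
  SlidingWindow.values p.n p.m fun i => bit i (s₀.env.var 8) = 0

/-- The memory that the attention program will use is empty. -/
structure Round.Fresh (p : Round) (s₀ : State) : Prop where
  nat : ∀ a x, a % 8 = 4 → s₀.natMem a (x * p.R + p.r₀) = 0
  real : ∀ a x, a % 8 = 4 → s₀.realMem a (x * p.R + p.r₀) = 0

theorem lt_mul_iff_div_mod (x n d : ℕ) : x < n * d ↔ x / d < n ∧ x % d < d := by
  rcases Nat.eq_zero_or_pos d with rfl | hd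
  · simp
  · rw [Nat.div_lt_iff_lt_mul hd]
    exact ⟨fun h => ⟨h, Nat.mod_lt _ hd⟩, fun h => h.1⟩

/-- The targets 4, 12, 20, 28 are the registers 0 to 3 of the relocated program, where it expects
`n`, `w`, `d`, `m`. -/
def launchProg (K : ℕ) : Program :=
  .seq (resetProg K) (block [.natOp .add 4 35 115, .natOp .add 12 43 115, .natOp .add 20 51 115,
    .natOp .add 28 59 115])

/-- Registers are cleared, the arrays of residue `r₀` were empty before the matrices were written,
so the relocated program sees precisely an initial state and `Exec.reloc` applies. -/
theorem launchProg_runs (h0 : p.Start s₀) (hfr : p.Fresh s₀) (hK : 4 ≤ p.K)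
    (h : p.Row s₀ p.n s) :
    Runs (launchProg p.K) s (2 * p.K + 1 + (4 * p.V + 8)) fun s' =>
      RoundFrame p.K p.R p.r₀ s s' ∧ s'.env = s.env ∧
      view 4 p.R p.r₀ s' = SlidingWindow.input p.w (p.Q s₀) (p.Vals s₀) := by
  have hst := h.toCommon.static h0
  refine Runs.seq (resetProg_runs p.K hst.zero) (T₂ := 4 * p.V + 8) ?_ le_rfl
  rintro s₁ ⟨g1, g2, g3, g4⟩
  have e : ∀ x, x % 8 = 3 → x ≠ 67 → s₁.natReg x = s.natReg x := fun x h3 h67 => by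
    rw [g1, if_neg (by omega)]
  have e35 := (e 35 (by omega) (by omega)).trans hst.rows
  have e43 := (e 43 (by omega) (by omega)).trans hst.window
  have e51 := (e 51 (by omega) (by omega)).trans hst.dim
  have e59 := (e 59 (by omega) (by omega)).trans hst.cols
  have e115 := (e 115 (by omega) (by omega)).trans hst.zero
  have z1 := size_le_of_le_two_pow h0.hn
  have z2 := size_le_of_le_two_pow h0.hw
  have z3 := size_le_of_le_two_pow h0.hd
  have z4 := size_le_of_le_two_pow h0.hm
  refine Runs.block (by simp) ?_ ?_
  · simp [listCost, Instr.cost, Instr.apply, e35, e43, e51, e59, e115]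
    omega
  have hreg : ∀ x, (List.foldl (fun s i => Instr.apply i s) s₁ [.natOp .add 4 35 115,
      .natOp .add 12 43 115, .natOp .add 20 51 115, .natOp .add 28 59 115]).natReg x =
      if x = 4 then p.n else if x = 12 then p.w else if x = 20 then p.d else if x = 28 then p.m
      else s₁.natReg x := by
    intro x
    simp [Instr.apply, NatOp.eval, e35, e43, e51, e59, e115, Function.update_apply]
    split_ifs <;> first | rfl | omega
  set s₂ := List.foldl (fun s i => Instr.apply i s) s₁ [.natOp .add 4 35 115,
      .natOp .add 12 43 115, .natOp .add 20 51 115, .natOp .add 28 59 115] with hs₂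
  have m1 : s₂.natMem = s.natMem := g3
  have m2 : s₂.realMem = s.realMem := g4
  have m3 : s₂.realReg = s₁.realReg := rfl
  have fresh : ∀ a x, a % 8 = 4 → s.natMem a (x * p.R + p.r₀) = 0 := fun a x ha => by
    rw [h.frame.natMem a (by omega) (by omega), hfr.nat a x ha]
  refine ⟨⟨fun x h0 h1 _ h67 _ _ _ _ _ h4 => ?_, fun a x _ _ _ => by rw [m1], fun x _ h4 => ?_,
    fun a x _ => by rw [m2]⟩, ?_, ?_⟩
  · rw [hreg, g1]
    split_ifs <;> first | rfl | omega
  · rw [m3, g2, if_neg (by omega)]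
  · simp only [State.env, m1]
    congr 1
    funext v
    rw [hreg, g1]
    split_ifs <;> first | rfl | omega
  · refine State.ext ?_ ?_ ?_ ?_
    · funext r
      simp only [view, SlidingWindow.input]
      rw [hreg, g1]
      have : r < p.K ∨ s.natReg (8 * r + 4) = 0 := by
        by_cases hr : r < p.K
        · exact Or.inl hr
        · exact Or.inr (hst.natHigh _ (by omega) (by omega))
      split_ifs <;> omega
    · funext a x
      simp only [view, SlidingWindow.input, State.blank, m1]
      exact fresh _ x (by omega)
    · funext r
      simp only [view, SlidingWindow.input, State.blank, m3]
      rw [g2]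
      split_ifs with hr
      · rfl
      · exact hst.realHigh _ (by omega) (by omega)
    · funext a x
      simp only [view, SlidingWindow.input, m2]
      by_cases ha0 : a = 0
      · subst ha0
        rw [if_pos rfl]
        refine (h.queries x).trans ?_
        by_cases hx : x / p.d < p.n ∧ x % p.d < p.d
        · rw [if_pos ((lt_mul_iff_div_mod _ _ _).2 hx), dif_pos hx]
          simp only [Round.Q, Round.query, SlidingWindow.queries, Matrix.of_apply]
          congr
        · rw [if_neg fun h => hx ((lt_mul_iff_div_mod _ _ _).1 h), dif_neg hx]
      · rw [if_neg ha0]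
        by_cases ha1 : a = 1
        · subst ha1
          rw [if_pos rfl]
          refine (h.values x).trans ?_
          by_cases hx : x / p.m < p.n ∧ x % p.m < p.m
          · rw [if_pos ((lt_mul_iff_div_mod _ _ _).2 hx), dif_pos hx]
            simp only [Round.Vals, Round.value, SlidingWindow.values, Matrix.of_apply]
            congr
          · rw [if_neg fun h => hx ((lt_mul_iff_div_mod _ _ _).1 h), dif_neg hx]
        · rw [if_neg ha1, h.other _ _ (Or.inl ⟨by omega, by omega⟩)]
          exact hfr.real _ x (by omega)

/-! ### Reading the output -/

/-- Array 20 is array 2 of the relocated program, its output. For rows of the first kind the entry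
in column 0 is compared with the threshold in the real register 26; a success is recorded in the
small variable 12. -/
def scanRow (Pk : Program) : Program :=
  .seq (unpackProg 27 6 5) (.seq Pk (.seq (.branch (.natLt 115 (8 * 14)) skipProg
    (.seq (block [.natOp .mul 67 27 59, .natOp .mul 67 67 3, .natOp .add 67 67 11,
      .realLoad 34 20 67]) (.branch (.realLt 26 34) (.instr (.natConst (8 * 12) 1)) skipProg)))
    (.instr (.natOp .add 27 27 91))))

/-- The entry of the output for row `i` indicates an orthogonal pair. -/
def Round.hit (p : Round) (q : ℕ) (s : State) (i : ℕ) : Prop :=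
  bit i q = 0 ∧ (p.c₀ : ℝ) < s.realMem 20 (i * p.m * p.R + p.r₀)

open Classical in
structure Round.Scan (p : Round) (s : State) (i : ℕ) (s' : State) : Prop where
  frame : RowFrame s s'
  realMem : s'.realMem = s.realMem
  bdd : s'.env.Bdd p.V
  var : ∀ v, v ≠ 12 → v ≠ 14 → s'.env.var v = s.env.var v
  mem : ∀ a, a ≠ 6 → s'.env.mem a = s.env.mem a
  row : s'.natReg 27 = i
  answer : s'.env.var 12 = if ∃ i' < i, p.hit (s.env.var 8) s i' then 1 else s.env.var 12

/-- What is needed for the scan. -/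
structure Round.ScanStart (p : Round) (s : State) : Prop where
  static : Static p.R p.n p.w p.d p.m p.c₀ p.K s
  round : s.natReg 11 = p.r₀
  round_lt : p.r₀ < p.R
  bdd : s.env.Bdd p.V
  kind_lt : s.env.var 8 < s.env.var 5
  hR : p.R ≤ 2 ^ p.V
  hn : p.n ≤ 2 ^ p.V
  hm : p.m ≤ 2 ^ p.V
  hV : 1 ≤ p.V

theorem scanRow_runs {Pk : Program} {c : ℕ} (hPk : ∀ (s : State) (V : ℕ), s.env.Bdd V →
    (∀ i, s.loc i = 0) → Runs Pk s ((V + 2) ^ c) fun s' =>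
      s'.env = s.env.setVar 14 (s.env.mem 6 (s.env.var 8)) ∧ SmallFrame s s')
    {i : ℕ} (h0 : p.ScanStart s) (h : p.Scan s i s') (hi : i < p.n) :
    Runs (scanRow Pk) s' (60 * (p.V + 1) ^ 2 + (p.V + 2) ^ c + (19 * p.V + 40))
      (p.Scan s (i + 1)) := by
  classical
  have hin : i ≤ 2 ^ p.V := hi.le.trans h0.hn
  have hst := h0.static.of_rowFrame h.frame
  have zi : i.size ≤ p.V + 1 := size_le_of_le_two_pow hin
  have zm : p.m.size ≤ p.V + 1 := size_le_of_le_two_pow h0.hm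
  have zR : p.R.size ≤ p.V + 1 := size_le_of_le_two_pow h0.hR
  have hq := h0.kind_lt
  have e5 : s'.env.var 5 = s.env.var 5 := h.var 5 (by omega) (by omega)
  have e8 : s'.env.var 8 = s.env.var 8 := h.var 8 (by omega) (by omega)
  refine Runs.seq (T₁ := 60 * (p.V + 1) ^ 2) (T₂ := (p.V + 2) ^ c + (19 * p.V + 40))
    (unpackProg_runs (V := p.V) hst.one hst.two hst.zero (by omega)
      (by rw [h.row]; exact hin) (h.bdd.1 5)) ?_ (by omega)
  rintro s₁ ⟨f₁, he₁⟩
  rw [h.row] at he₁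
  have hV := h0.hV
  have hb₁ : s₁.env.Bdd p.V := by
    rw [he₁]
    refine bdd_setArr h.bdd fun x _ => ?_
    have := bit_lt_two i x
    unfold bit at this
    omega
  refine Runs.seq (hPk s₁ p.V hb₁ (by rw [f₁.loc]; exact hst.loc)) (T₂ := 19 * p.V + 40) ?_ le_rfl
  rintro s₂ ⟨he₂, f₂⟩
  have f₂' := f₁.trans f₂.workFrame
  have hkind : s₁.env.mem 6 (s₁.env.var 8) = bit i (s.env.var 8) := by
    rw [he₁]
    simp [Env.setArr, e5, e8, hq, bit]
  rw [hkind] at he₂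
  have hb2 := bit_lt_two i (s.env.var 8)
  have hb₂ : s₂.env.Bdd p.V := by rw [he₂]; exact bdd_setVar hb₁ (by omega)
  have v₂ : ∀ v, v ≠ 14 → s₂.env.var v = s'.env.var v := fun v hv => by
    rw [he₂, he₁]; simp [Env.setVar, Env.setArr, hv]
  have m₂ : ∀ a, a ≠ 6 → s₂.env.mem a = s'.env.mem a := fun a ha => by
    rw [he₂, he₁]; simp [Env.setVar, Env.setArr, ha]
  have hf₂ := h.frame.trans (.of_work f₂')
  have hst₂ := h0.static.of_rowFrame hf₂
  have r27 : s₂.natReg 27 = i := (f₂'.natReg 27 (by omega) (by omega) (by omega) (by omega)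
      (by omega) (by omega)).trans h.row
  have r11 : s₂.natReg 11 = p.r₀ := (hf₂.natReg 11 (by omega) (by omega) (by omega) (by omega)
      (by omega) (by omega) (by omega) (by omega)).trans h0.round
  have rm₂ : s₂.realMem = s.realMem := f₂'.realMem.trans h.realMem
  have hk₂ : s₂.natReg (8 * 14) = bit i (s.env.var 8) := by
    change s₂.env.var 14 = _
    rw [he₂]; simp [Env.setVar]
  have c14 : (Test.natLt 115 (8 * 14)).cost s₂ ≤ 3 := by
    simp only [Test.cost, hst₂.zero, hk₂]
    have := size_le_self (bit i (s.env.var 8))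
    simp only [Nat.size_zero]
    omega
  have hrange : (∃ i' < i + 1, p.hit (s.env.var 8) s i') ↔
      (∃ i' < i, p.hit (s.env.var 8) s i') ∨ p.hit (s.env.var 8) s i := by
    constructor
    · rintro ⟨i', h1, h2⟩
      by_cases hii : i' = i
      · exact Or.inr (hii ▸ h2)
      · exact Or.inl ⟨i', by omega, h2⟩
    · rintro (⟨i', h1, h2⟩ | h2)
      · exact ⟨i', by omega, h2⟩
      · exact ⟨i, by omega, h2⟩
  -- the state before the row counter is increased
  refine Runs.seq (T₁ := 18 * p.V + 32) (T₂ := p.V + 5) (M := fun s₃ => RowFrame s₂ s₃ ∧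
    s₃.realMem = s₂.realMem ∧ s₃.natReg 27 = i ∧ (∀ v, v ≠ 12 → s₃.env.var v = s₂.env.var v) ∧
    s₃.env.mem = s₂.env.mem ∧ s₃.env.var 12 = if p.hit (s.env.var 8) s i then 1
      else s₂.env.var 12) ?_ ?_ (by omega)
  · have hskip : ∀ s₃ : State, ¬ p.hit (s.env.var 8) s i → RowFrame s₂ s₃ →
        s₃.realMem = s₂.realMem → s₃.natReg 27 = i → s₃.env = s₂.env → Runs skipProg s₃ 1
        fun s₃ => RowFrame s₂ s₃ ∧
          s₃.realMem = s₂.realMem ∧ s₃.natReg 27 = i ∧ (∀ v, v ≠ 12 → s₃.env.var v = s₂.env.var v) ∧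
          s₃.env.mem = s₂.env.mem ∧ s₃.env.var 12 = if p.hit (s.env.var 8) s i then 1
            else s₂.env.var 12 := by
      intro s₃ hh hf hr h27 he
      refine Runs.instr _ _ (by simp [Instr.cost]) ?_
      have henv : (Instr.apply (.natConst 107 0) s₃).env = s₂.env := by
        rw [← he]
        simp only [State.env, Instr.apply]
        congr 1
        funext v
        rw [Function.update_of_ne (by omega)]
      refine ⟨hf.trans ⟨fun x _ _ _ _ _ h107 _ _ => Function.update_of_ne h107 _ _,
        fun _ _ _ => rfl, fun _ _ => rfl⟩, hr, ?_, fun v _ => by rw [henv], by rw [henv], ?_⟩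
      · simpa [Instr.apply] using h27
      · rw [henv, if_neg hh]
    by_cases hk : bit i (s.env.var 8) = 0
    · refine (Runs.branchFalse (by simp only [Test.holds, hst₂.zero, hk₂, hk]; omega) c14
        (T := 16 * p.V + 20 + 4) ?_).mono (by omega) fun _ h => h
      set s₃ : State := { s₂ with
        natReg := Function.update s₂.natReg 67 (i * p.m * p.R + p.r₀)
        realReg := Function.update s₂.realReg 34 (s.realMem 20 (i * p.m * p.R + p.r₀)) } with hs₃
      have henv : s₃.env = s₂.env := by
        simp only [State.env, hs₃]
        congr 1
        funext v
        rw [Function.update_of_ne (by omega)]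
      have hf₃ : RowFrame s₂ s₃ := ⟨fun x _ _ h67 _ _ _ _ _ => Function.update_of_ne h67 _ _,
        fun _ _ _ => rfl, fun x hx => Function.update_of_ne hx _ _⟩
      have h27 : s₃.natReg 27 = i := by simpa [hs₃] using r27
      have hr26 : s₃.realReg 26 = p.c₀ := (hf₃.realReg 26 (by omega)).trans hst₂.real_threshold
      have hr34 : s₃.realReg 34 = s.realMem 20 (i * p.m * p.R + p.r₀) := by simp [hs₃]
      refine Runs.seq (T₁ := 16 * p.V + 20) (T₂ := 4) (M := fun s => s = s₃)
        (Runs.block (by simp) ?_ ?_) ?_ (by omega)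
      · have q1 := size_mul_le i p.m
        have q2 := size_mul_le (i * p.m) p.R
        have q3 := size_mul_add_le (x := i * p.m) h0.round_lt
        have q4 : p.r₀.size ≤ p.R.size := Nat.size_le_size h0.round_lt.le
        simp [listCost, Instr.cost, Instr.apply, NatOp.eval, r27, r11, hst₂.cols, hst₂.modulus]
        omega
      · simp [Instr.apply, NatOp.eval, r27, r11, hst₂.cols, hst₂.modulus, rm₂, hs₃]
      · rintro _ rfl
        have c26 : (Test.realLt 26 34).cost s₃ ≤ 1 := le_rfl
        by_cases hlt : (p.c₀ : ℝ) < s.realMem 20 (i * p.m * p.R + p.r₀)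
        · refine (Runs.branchTrue (by simp only [Test.holds, hr26, hr34]; exact hlt) c26
            (T := 2) (Runs.instr _ _ (by simp [Instr.cost]) ?_)).mono (by omega) fun _ h => h
          have henv' : (Instr.apply (.natConst (8 * 12) 1) s₃).env = s₂.env.setVar 12 1 := by
            rw [← henv]
            simp only [State.env, Instr.apply, Env.setVar]
            congr 1
            funext v
            by_cases hv : v = 12
            · subst hv; simp
            · rw [Function.update_of_ne (by omega), Function.update_of_ne hv]
          refine ⟨hf₃.trans ⟨fun x hx _ _ _ _ _ _ _ => Function.update_of_ne (by omega) _ _,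
            fun _ _ _ => rfl, fun _ _ => rfl⟩, rfl, ?_, fun v hv => ?_, ?_, ?_⟩
          · simpa [Instr.apply] using h27
          · rw [henv']; simp [Env.setVar, hv]
          · rw [henv']; rfl
          · rw [henv', if_pos ⟨hk, hlt⟩]; simp [Env.setVar]
        · exact (Runs.branchFalse (by simp only [Test.holds, hr26, hr34]; exact hlt) c26
            (hskip s₃ (fun h => hlt h.2) hf₃ rfl h27 henv)).mono (by omega) fun _ h => h
    · exact (Runs.branchTrue (by simp only [Test.holds, hst₂.zero, hk₂]; omega) c14
        (hskip s₂ (fun h => hk h.1) (.refl _) rfl r27 rfl)).mono (by omega) fun _ h => h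
  rintro s₃ ⟨hf₃, rm₃, r27₃, v₃, m₃, ans₃⟩
  have hf₃' := hf₂.trans hf₃
  have hst₃ := h0.static.of_rowFrame hf₃'
  have hb₃ : s₃.env.Bdd p.V := by
    refine ⟨fun v => ?_, fun a x => by rw [m₃]; exact hb₂.2 a x⟩
    by_cases hv : v = 12
    · rw [hv, ans₃]
      have := hb₂.1 12
      split <;> omega
    · rw [v₃ v hv]; exact hb₂.1 v
  refine Runs.instr _ _ ?_ ?_
  · simp only [Instr.cost, r27₃, hst₃.one, Nat.size_one]
    omega
  · have henv : (Instr.apply (.natOp .add 27 27 91) s₃).env = s₃.env := by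
      simp only [State.env, Instr.apply]
      congr 1
      funext v
      rw [Function.update_of_ne (by omega)]
    refine ⟨hf₃'.trans ⟨fun x _ _ _ _ _ _ h27 _ => Function.update_of_ne h27 _ _,
        fun _ _ _ => rfl, fun _ _ => rfl⟩, rm₃.trans rm₂, ?_, fun v h12 h14 => ?_, fun a ha => ?_,
        ?_, ?_⟩
    · rw [henv]; exact hb₃
    · rw [henv, v₃ v h12, v₂ v h14, h.var v h12 h14]
    · rw [henv, m₃, m₂ a ha, h.mem a ha]
    · simp [Instr.apply, NatOp.eval, r27₃, hst₃.one]
    · rw [henv, ans₃, v₂ 12 (by omega), h.answer]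
      simp only [hrange]
      by_cases h1 : p.hit (s.env.var 8) s i <;>
        by_cases h2 : ∃ i' < i, p.hit (s.env.var 8) s i' <;> simp [h1, h2]

theorem exists_scan : ∃ (P : Program) (c : ℕ), ∀ (p : Round) (s : State), p.ScanStart s →
    Runs P s ((p.n + 1) * (p.V + 2) ^ c) (p.Scan s p.n) := by
  classical
  obtain ⟨Pk, ⟨c, h₁⟩, -⟩ := exists_acts_setVar 14 (f := fun m : Env => m.mem 6 (m.var 8))
    (Comp.load 6 (.var 8))
  have hpow : ∀ c : ℕ, Expr.PolyBd fun V => (V + 2) ^ c := fun c => ⟨c, fun _ => le_rfl⟩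
  have hl : Expr.PolyBd fun V => 60 * (V + 1) ^ 2 + (V + 2) ^ c + (19 * V + 40) +
      (2 * V + 5) := by
    have lin : ∀ a b : ℕ, Expr.PolyBd fun V => a * V + b := fun a b =>
      ((Expr.PolyBd.const a).mul .id).add (.const b)
    have h1 : Expr.PolyBd fun V => 60 * (V + 1) ^ 2 :=
      ((Expr.PolyBd.const 60).mul ((Expr.PolyBd.id.add (.const 1)).mul
        (Expr.PolyBd.id.add (.const 1)))).mono fun V => by rw [pow_two]
    exact ((h1.add (hpow c)).add (lin 19 40)).add (lin 2 5)
  obtain ⟨C, hC⟩ := hl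
  refine ⟨.seq (.instr (.natConst 27 0)) (.loop (.natLt 27 35) (scanRow Pk)), C,
    fun p s h0 => ?_⟩
  have hCV := hC p.V
  set X := 60 * (p.V + 1) ^ 2 + (p.V + 2) ^ c + (19 * p.V + 40) with hX
  replace hCV : X + (2 * p.V + 5) ≤ (p.V + 2) ^ C := hCV
  have hz : ∀ i ≤ p.n, i.size ≤ p.V + 1 := fun i hi => size_le_of_le_two_pow (hi.trans h0.hn)
  refine Runs.seq (M := p.Scan s 0) (T₁ := 1) (T₂ := p.n * (2 * p.V + 3 + X) + (2 * p.V + 3))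
    (Runs.instr _ _ (by simp [Instr.cost]) ?_) (fun s₁ h => Runs.loop (p.Scan s)
      (c := 2 * p.V + 3) (T := X) ?_ ?_ ?_ h le_rfl) ?_
  · have henv : (Instr.apply (.natConst 27 0) s).env = s.env := by
      simp only [State.env, Instr.apply]
      congr 1
      funext v
      rw [Function.update_of_ne (by omega)]
    refine ⟨⟨fun x _ _ _ _ _ _ h27 _ => Function.update_of_ne h27 _ _, fun _ _ _ => rfl,
      fun _ _ => rfl⟩, rfl, ?_, fun v _ _ => by rw [henv], fun _ _ => by rw [henv], ?_, ?_⟩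
    · rw [henv]; exact h0.bdd
    · simp [Instr.apply]
    · rw [henv]; simp
  · intro i s₁ hi h
    simp only [Test.cost, h.row, (h0.static.of_rowFrame h.frame).rows]
    have := hz i hi
    have := hz p.n le_rfl
    omega
  · intro i s₁ hi h
    refine ⟨by simp only [Test.holds, h.row, (h0.static.of_rowFrame h.frame).rows]; exact hi, ?_⟩
    exact scanRow_runs h₁ h0 h hi
  · intro s₁ h
    simp only [Test.holds, h.row, (h0.static.of_rowFrame h.frame).rows]
    exact lt_irrefl _
  · calc 1 + (p.n * (2 * p.V + 3 + X) + (2 * p.V + 3)) ≤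
        (p.n + 1) * (X + (2 * p.V + 5)) := by nlinarith
      _ ≤ _ := Nat.mul_le_mul_left _ hCV

end

end Sparsify

/-! ### One round of the search: soundness and completeness -/

namespace Sparsify

open RealRAM SAT

/-! ### A round of the main loop -/

/-- The fixed data of the main loop. -/
structure Search extends Round where
  (α s T N e q len : ℕ)

def Search.at (p : Search) (r : ℕ) : Search := { p with r₀ := r }

structure Search.Valid (p : Search) : Prop where
  kind_lt : p.q < p.e
  modulus : p.R = 2 ^ p.len
  rows : p.n = 2 ^ p.e
  viol : violBound p.k (2 * p.N) ≤ p.V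
  hR : p.R ≤ 2 ^ p.V
  hn : p.n ≤ 2 ^ p.V
  hw : p.w ≤ 2 ^ p.V
  hd : p.d ≤ 2 ^ p.V
  hm : p.m ≤ 2 ^ p.V
  hm0 : 1 ≤ p.m
  hV : 1 ≤ p.V

section

variable {Nφ : ℕ} (p : Search) (φ : CNF Nφ) {st st' st'' s₀ s : State}

/-- The state at the beginning of a round. -/
structure Search.Base (st : State) : Prop where
  static : Static p.R p.n p.w p.d p.m p.c₀ p.K st
  round : st.natReg 11 = p.r₀
  bdd : st.env.Bdd p.V
  numVars : st.env.var 0 = p.N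
  rowBits : st.env.var 5 = p.e
  steps : st.env.var 7 = p.T * 2 ^ p.s
  kind : st.env.var 8 = p.q
  offset : st.env.var 9 = p.T * p.s
  length : st.env.var 15 = p.len
  closed : Closed p.k (2 * p.N) (st.env.mem 2)
  clauses : clausesOf p.k (2 * p.N) (st.env.mem 2) = clauseSets φ
  -- Residues below `r₀` have been used up by earlier rounds.
  natFresh : ∀ a x, a % 8 = 4 → p.r₀ ≤ x % p.R → st.natMem a x = 0
  realFresh : ∀ a x, a % 8 = 4 → p.r₀ ≤ x % p.R → st.realMem a x = 0

/-- What a round does not change. -/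
structure Search.Kept (st st' : State) : Prop where
  frame : RoundFrame p.K p.R p.r₀ st st'
  bdd : st'.env.Bdd p.V
  var : ∀ v, v ≠ 2 → v ≠ 3 → v ≠ 10 → v ≠ 11 → v ≠ 12 → v ≠ 13 → v ≠ 14 →
    st'.env.var v = st.env.var v
  mem : ∀ a, a ≠ 3 → a ≠ 4 → a ≠ 5 → a ≠ 6 → st'.env.mem a = st.env.mem a

/-- The advice `r` leads to a pair of rows that make all clauses true. -/
def Search.Hit (r : ℕ) : Prop := ∀ Y : ℕ → ℕ, (∀ t < p.len, Y t = bit r t) →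
  (minimal (finalClauses p.α p.k p.s p.T (2 * p.N) φ Y)).card ≤ p.d ∧
  ∃ i < p.n, ∃ i' < p.n, bit i p.q = 0 ∧ bit i' p.q = 1 ∧ |(i : ℝ) - (i' : ℝ)| ≤ (p.w : ℝ) / 2 ∧
    ∀ C ∈ minimal (finalClauses p.α p.k p.s p.T (2 * p.N) φ Y),
      ¬ (RowFalse p.e p.q (p.T * p.s) Y (bit i) 0 C ∧
        RowFalse p.e p.q (p.T * p.s) Y (bit i') 1 C)

/-- The state after the advice has been replayed. -/
structure Search.Ready (st : State) : Prop where
  base : ∃ st₀, p.Base φ st₀ ∧ p.Kept st₀ st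
  cells : ∀ a x, a % 8 = 4 → st.natMem a (x * p.R + p.r₀) = 0 ∧ st.realMem a (x * p.R + p.r₀) = 0
  bits : ∀ t < p.len, st.env.mem 5 t = bit p.r₀ t
  clauses : ∃ F, Closed p.k (2 * p.N) F ∧ clausesOf p.k (2 * p.N) F =
      finalClauses p.α p.k p.s p.T (2 * p.N) φ (st.env.mem 5) ∧
    ∀ x < (2 * p.N + 1) ^ p.k, st.env.mem 4 x ≠ 0 ↔ Good p.k (2 * p.N) F x
  count : st.env.var 10 = numMarked p.k (2 * p.N) (st.env.mem 4)

variable {p φ}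

theorem Search.Kept.trans (h : p.Kept st st') (h' : p.Kept st' st'') : p.Kept st st'' :=
  ⟨h.frame.trans h'.frame, h'.bdd, fun v h1 h2 h3 h4 h5 h6 h7 =>
    (h'.var v h1 h2 h3 h4 h5 h6 h7).trans (h.var v h1 h2 h3 h4 h5 h6 h7),
    fun a h1 h2 h3 h4 => (h'.mem a h1 h2 h3 h4).trans (h.mem a h1 h2 h3 h4)⟩

theorem Search.Kept.of_env (hf : RoundFrame p.K p.R p.r₀ st st') (hb : st.env.Bdd p.V)
    (he : st'.env = st.env) : p.Kept st st' :=
  ⟨hf, he ▸ hb, fun _ _ _ _ _ _ _ _ => by rw [he], fun _ _ _ _ _ => by rw [he]⟩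

theorem Search.Ready.var (h : p.Ready φ st) : st.env.var 0 = p.N ∧ st.env.var 5 = p.e ∧
    st.env.var 8 = p.q ∧ st.env.var 9 = p.T * p.s := by
  obtain ⟨st₀, hb, hk⟩ := h.base
  have e := hk.var
  exact ⟨(e 0 (by omega) (by omega) (by omega) (by omega) (by omega) (by omega)
      (by omega)).trans hb.numVars, (e 5 (by omega) (by omega) (by omega) (by omega) (by omega)
      (by omega) (by omega)).trans hb.rowBits, (e 8 (by omega) (by omega) (by omega) (by omega)
      (by omega) (by omega) (by omega)).trans hb.kind, (e 9 (by omega) (by omega) (by omega)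
      (by omega) (by omega) (by omega) (by omega)).trans hb.offset⟩

theorem RoundFrame.round {K R r₀ : ℕ} (h : RoundFrame K R r₀ st st') :
    st'.natReg 11 = st.natReg 11 :=
  h.natReg 11 (by omega) (by omega) (by omega) (by omega) (by omega) (by omega) (by omega)
    (by omega) (by omega) (by omega)

theorem RelocFrame.env {K R r₀ : ℕ} (h : RelocFrame 4 K R r₀ st st') : st'.env = st.env := by
  simp only [State.env]
  congr 1
  · funext v
    exact h.natReg _ (by omega) (by omega)
  · funext a x
    exact h.natMem _ _ (by omega)

theorem Search.Ready.static (h : p.Ready φ st) :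
    Static p.R p.n p.w p.d p.m p.c₀ p.K st ∧ st.natReg 11 = p.r₀ ∧ st.env.Bdd p.V := by
  obtain ⟨st₀, hb, hk⟩ := h.base
  exact ⟨hb.static.of_roundFrame hk.frame, hk.frame.round.trans hb.round, hk.bdd⟩

theorem Search.Ready.start (h : p.Ready φ st) (hv : p.Valid) (hr : p.r₀ < p.R)
    (hc : st.env.var 10 ≤ p.d) : p.toRound.Start st ∧ p.toRound.Fresh st := by
  obtain ⟨h1, h2, h3⟩ := h.static
  obtain ⟨-, v5, v8, -⟩ := h.var
  refine ⟨⟨h1, h2, hr, h3, ?_, hc, hv.hR, hv.hn, hv.hw, hv.hd, hv.hm, hv.hm0, hv.hV,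
    fun x => (h.cells 4 x rfl).2, fun x => (h.cells 12 x rfl).2⟩,
    fun a x ha => (h.cells a x ha).1, fun a x ha => (h.cells a x ha).2⟩
  rw [v5, v8]; exact hv.kind_lt

/-- The kind that enters the coordinates is bit `q` of the row number, so orthogonality of two rows
is joint satisfaction of the final clauses under the guessed outer bits. -/
theorem Search.Ready.orthogonal_iff (h : p.Ready φ st) (i i' : ℕ) :
    (∀ j < st.env.var 10, ¬ (p.toRound.coord st i j ∧ p.toRound.coord st i' j)) ↔
    ∀ C ∈ minimal (finalClauses p.α p.k p.s p.T (2 * p.N) φ (st.env.mem 5)),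
      ¬ (RowFalse p.e p.q (p.T * p.s) (st.env.mem 5) (bit i) (bit i p.q) C ∧
        RowFalse p.e p.q (p.T * p.s) (st.env.mem 5) (bit i') (bit i' p.q) C) := by
  obtain ⟨v0, v5, v8, v9⟩ := h.var
  obtain ⟨F, hF, hcl, hG⟩ := h.clauses
  rw [h.count, ← hcl, ← coordFalse_iff hF hG]
  simp only [Round.coord, envL, v0, v5, v8, v9]

variable {μ ν : ℝ}

/-- A large entry of the output shows that the formula is satisfiable. -/
theorem Search.Ready.satisfiable (h : p.Ready φ st) (hv : p.Valid) (hμ0 : 0 ≤ μ) (hμ : μ < 1)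
    (hc₀ : 4 + ν ≤ p.c₀) (hc : st.env.var 10 ≤ p.d) {Y' : Matrix (Fin p.n) (Fin p.m) ℝ}
    (hY : SlidingWindow.approx μ ν p.n p.m (SlidingWindow.attention p.w (p.toRound.Q st)
      (p.toRound.Vals st)) Y') {i : Fin p.n} {j : Fin p.m} (hi : bit i p.q = 0)
    (hlt : (p.c₀ : ℝ) < Y' i j) : Satisfiable φ := by
  have v8 := h.var.2.2.1
  obtain ⟨i', hi', ho⟩ := SlidingWindow.exists_of_lt_approx hμ0 hμ hc₀ hY i j
    (show bit i (st.env.var 8) = 0 by rw [v8]; exact hi) hc hlt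
  have ho' := (h.orthogonal_iff i i').1 ho
  rw [hi] at ho'
  rw [v8] at hi'
  exact satisfiable_of_rows hi' hv.kind_lt ho'

/-- Here the window matters: the good pair of rows must be close to each other to produce a large
entry. -/
theorem Search.Ready.complete (h : p.Ready φ st) (hv : p.Valid) (hμ : μ < 1)
    (hn : (p.c₀ : ℝ) + ν < (1 - μ) * p.n) {Y' : Matrix (Fin p.n) (Fin p.m) ℝ}
    (hY : SlidingWindow.approx μ ν p.n p.m (SlidingWindow.attention p.w (p.toRound.Q st)
      (p.toRound.Vals st)) Y') (hh : p.Hit φ p.r₀) :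
    st.env.var 10 ≤ p.d ∧ ∃ i : Fin p.n, bit i p.q = 0 ∧ (p.c₀ : ℝ) < Y' i ⟨0, hv.hm0⟩ := by
  have v8 := h.var.2.2.1
  obtain ⟨h1, i, hi, i', hi', hb, hb', hw, ho⟩ := hh _ h.bits
  obtain ⟨F, hF, hcl, hG⟩ := h.clauses
  refine ⟨by rw [h.count, numMarked_eq hF hG, hcl]; exact h1, ⟨i, hi⟩, hb, ?_⟩
  refine SlidingWindow.lt_approx hn hμ hY ⟨i, hi⟩ ⟨i', hi'⟩ ⟨0, hv.hm0⟩ rfl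
    (show bit i (st.env.var 8) = 0 by rw [v8]; exact hb)
    (show ¬ bit i' (st.env.var 8) = 0 by rw [v8, hb']; omega) hw ?_
  refine (h.orthogonal_iff i i').2 ?_
  rw [hb, hb']
  exact ho

theorem Search.Ready.count_le_of_hit (h : p.Ready φ st) (hh : p.Hit φ p.r₀) :
    st.env.var 10 ≤ p.d := by
  obtain ⟨F, hF, hcl, hG⟩ := h.clauses
  rw [h.count, numMarked_eq hF hG, hcl]
  exact (hh _ h.bits).1

/-- The effect of a round. -/
structure Search.Outcome (p : Search) (φ : CNF Nφ) (st st' : State) : Prop where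
  sound : st'.env.var 12 = 1 → st.env.var 12 = 1 ∨ Satisfiable φ
  keep : st.env.var 12 = 1 → st'.env.var 12 = 1
  complete : p.Hit φ p.r₀ → st'.env.var 12 = 1

def prepareProg (Pr : Program) : Program := .seq (unpackProg 11 5 15) Pr

theorem prepareProg_runs {Pr : Program} {c : ℕ} (hPr : ∀ (st : State) (V : ℕ),
      (∀ i, st.loc i = 0) → st.env.Bdd V → violBound p.k (envL st.env) ≤ V → 1 ≤ V →
      Closed p.k (envL st.env) (st.env.mem 2) → Runs Pr st ((V + 2) ^ c) fun st' =>
        SmallFrame st st' ∧ ReplayPost (theta p.α) p.k p.s V st.env st'.env)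
    (hv : p.Valid) (hr : p.r₀ < p.R) (h : p.Base φ st) :
    Runs (prepareProg Pr) st (60 * (p.V + 1) ^ 2 + (p.V + 2) ^ c) fun st' =>
      p.Ready φ st' ∧ p.Kept st st' ∧ st'.env.var 12 = st.env.var 12 := by
  have hst := h.static
  have hV := hv.hV
  refine Runs.seq (unpackProg_runs (V := p.V) hst.one hst.two hst.zero (by omega)
    (by rw [h.round]; exact hr.le.trans hv.hR) (h.bdd.1 15)) ?_ le_rfl
  rintro s₁ ⟨f₁, he₁⟩
  rw [h.round, h.length] at he₁
  have var₁ : ∀ v, s₁.env.var v = st.env.var v := fun v => by rw [he₁]; rfl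
  have mem₁ : ∀ a, a ≠ 5 → s₁.env.mem a = st.env.mem a := fun a ha => by
    rw [he₁]; simp [Env.setArr, ha]
  have hL : envL s₁.env = 2 * p.N := by rw [envL, var₁, h.numVars]
  have hb₁ : s₁.env.Bdd p.V := by
    rw [he₁]
    refine bdd_setArr h.bdd fun x _ => ?_
    omega
  refine (hPr s₁ p.V (by rw [f₁.loc]; exact hst.loc) hb₁ (by rw [hL]; exact hv.viol) hV
    (by rw [hL, mem₁ 2 (by omega)]; exact h.closed)).mono le_rfl ?_
  rintro s₂ ⟨f₂, hp⟩
  have hk : p.Kept st s₂ := ⟨.of_work (f₁.trans f₂.workFrame), hp.bdd,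
    fun v h2 h3 h10 _ _ _ _ => (hp.var v h2 h3 h10).trans (var₁ v),
    fun a h3 h4 h5 _ => (hp.mem a h3 h4).trans (mem₁ a h5)⟩
  refine ⟨⟨⟨st, h, hk⟩, fun a x ha => ?_, fun t ht => ?_, ?_, ?_⟩, hk,
    (hp.var 12 (by omega) (by omega) (by omega)).trans (var₁ 12)⟩
  · have hx : p.r₀ ≤ (x * p.R + p.r₀) % p.R := by
      rw [mul_comm, Nat.mul_add_mod, Nat.mod_eq_of_lt hr]
    rw [f₂.natMem a (by omega) (by omega), f₁.natMem a (by omega) (by omega), f₂.realMem,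
      f₁.realMem]
    exact ⟨h.natFresh a _ ha hx, h.realFresh a _ ha hx⟩
  · rw [hp.mem 5 (by omega) (by omega), he₁, setArr_mem_self _ _ _ _ ht]
    rfl
  · obtain ⟨F, hF, hcl, hG⟩ := hp.clauses
    rw [hL] at hF hcl hG
    refine ⟨F, hF, ?_, hG⟩
    rw [hcl, hp.mem 5 (by omega) (by omega), mem₁ 2 (by omega), h.clauses, var₁, h.steps]
    rfl
  · rw [hp.count, hL]
    rfl

def attendProg (Pb Patt Ps : Program) (K : ℕ) : Program :=
  .seq Pb (.seq (launchProg K) (.seq (reloc 4 Patt) Ps))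

theorem attendProg_runs {Pb Patt Ps : Program} {c c' τ : ℕ}
    (hPb : ∀ s₀, p.toRound.Start s₀ → Runs Pb s₀ ((p.n + 1) * (p.V + 2) ^ c)
      (p.toRound.Row s₀ p.n))
    (hPs : ∀ s₀, p.toRound.ScanStart s₀ → Runs Ps s₀ ((p.n + 1) * (p.V + 2) ^ c')
      (p.toRound.Scan s₀ p.n))
    (hv : p.Valid) (hr : p.r₀ < p.R) (hK : Patt.bound ≤ p.K) (hK4 : 4 ≤ p.K)
    (hμ0 : 0 ≤ μ) (hμ : μ < 1) (hc₀ : 4 + ν ≤ p.c₀) (hn : (p.c₀ : ℝ) + ν < (1 - μ) * p.n)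
    (hatt : ∀ (Q : Matrix (Fin p.n) (Fin p.d) ℝ) (V : Matrix (Fin p.n) (Fin p.m) ℝ),
      ∃ t u, Exec Patt (SlidingWindow.input p.w Q V) t u ∧ SlidingWindow.approx μ ν p.n p.m
        (SlidingWindow.attention p.w Q V) (SlidingWindow.output p.n p.m u) ∧ t ≤ τ)
    (h : p.Ready φ st) (hc : st.env.var 10 ≤ p.d) :
    Runs (attendProg Pb Patt Ps p.K) st ((p.n + 1) * (p.V + 2) ^ c +
      (2 * p.K + 1 + (4 * p.V + 8) + (τ * (8 * (p.V + 2)) + (p.n + 1) * (p.V + 2) ^ c')))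
      fun st' => p.Kept st st' ∧ p.Outcome φ st st' := by
  classical
  obtain ⟨h0, hfr⟩ := h.start hv hr hc
  have v8 := h.var.2.2.1
  refine Runs.seq (hPb st h0) ?_ le_rfl
  intro s₁ h₁
  have k₁ : p.Kept st s₁ := ⟨.of_rowFrame h₁.frame fun a x hx => h₁.other a x (by omega), h₁.bdd,
    fun v _ _ _ h11 _ h13 h14 => h₁.var v h11 h13 h14, fun a _ _ _ h6 => h₁.mem a h6⟩
  refine Runs.seq (launchProg_runs h0 hfr hK4 h₁) ?_ le_rfl
  rintro s₂ ⟨f₂, e₂, hview⟩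
  have k₂ := k₁.trans (.of_env f₂ h₁.bdd e₂)
  have st₂ := h.static.1.of_roundFrame k₂.frame
  have r₂ := k₂.frame.round.trans h.static.2.1
  obtain ⟨t, u, hex, hap, ht⟩ := hatt (p.toRound.Q st) (p.toRound.Vals st)
  have hz : p.R.size ≤ p.V + 1 := size_le_of_le_two_pow hv.hR
  refine Runs.seq ((hex.reloc (j := 4) (K := p.K) (by omega) (by omega) hr hK s₂ hview st₂.modulus
    r₂).mono (Nat.mul_le_mul ht (by omega)) fun _ h => h) ?_ le_rfl
  rintro s₃ ⟨hview₃, f₃⟩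
  have e₃ := RelocFrame.env f₃
  have k₃ := k₂.trans (.of_env (.of_reloc f₃) k₂.bdd e₃)
  have st₃ := h.static.1.of_roundFrame k₃.frame
  have w₃ : ∀ v, v ≠ 11 → v ≠ 13 → v ≠ 14 → s₃.env.var v = st.env.var v := fun v h1 h2 h3 => by
    rw [e₃, e₂, h₁.var v h1 h2 h3]
  have w8 := (w₃ 8 (by omega) (by omega) (by omega)).trans v8
  refine (hPs s₃ ⟨st₃, k₃.frame.round.trans h.static.2.1, hr, k₃.bdd, ?_, hv.hR, hv.hn, hv.hm,
    hv.hV⟩).mono le_rfl fun s₄ h₄ => ⟨?_, ?_⟩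
  · rw [w8, w₃ 5 (by omega) (by omega) (by omega), h.var.2.1]
    exact hv.kind_lt
  · exact k₃.trans ⟨.of_rowFrame h₄.frame fun a x _ => by rw [h₄.realMem], h₄.bdd,
      fun v _ _ _ _ h12 _ h14 => h₄.var v h12 h14, fun a _ _ _ h6 => h₄.mem a h6⟩
  · have hout : ∀ i : Fin p.n, SlidingWindow.output p.n p.m u i ⟨0, hv.hm0⟩ =
        s₃.realMem 20 (i * p.m * p.R + p.r₀) := fun i => by rw [← hview₃]; rfl
    have ans := h₄.answer
    rw [w8, w₃ 12 (by omega) (by omega) (by omega)] at ans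
    refine ⟨fun h1 => ?_, fun h1 => ?_, fun hh => ?_⟩
    · rw [ans] at h1
      split at h1
      · next hhit =>
        obtain ⟨i, hi, hb, hlt⟩ := hhit
        exact Or.inr (h.satisfiable hv hμ0 hμ hc₀ hc hap (i := ⟨i, hi⟩) hb
          (by rw [hout]; exact hlt))
      · exact Or.inl h1
    · rw [ans]
      split
      · rfl
      · exact h1
    · obtain ⟨-, i, hb, hlt⟩ := h.complete hv hμ hn hap hh
      rw [ans, if_pos ⟨i, i.2, hb, by rw [← hout]; exact hlt⟩]

/-- A guess that leaves more minimal clauses than there are coordinates is discarded: register 51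
holds `d`, the small variable 10 the number of clauses. This loses nothing, since a correct guess
has at most `d` of them. -/
def roundProg (Pr Pb Patt Ps : Program) (K : ℕ) : Program :=
  .seq (prepareProg Pr) (.seq (.branch (.natLt 51 (8 * 10)) skipProg (attendProg Pb Patt Ps K))
    (.instr (.natOp .add 11 11 91)))

/-- In the arrays of class 4 a round writes only cells of residue `r₀`, so all larger residues are
still empty for the following rounds. -/
theorem Search.Kept.next (h : p.Kept st st') (hb : p.Base φ st) :
    (p.at (p.r₀ + 1)).Base φ (Instr.apply (.natOp .add 11 11 91) st') ∧
      (Instr.apply (.natOp .add 11 11 91) st').env = st'.env := by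
  have hst := hb.static.of_roundFrame h.frame
  set s := Instr.apply (.natOp .add 11 11 91) st' with hs
  have hreg : ∀ x, x ≠ 11 → s.natReg x = st'.natReg x := fun x hx => Function.update_of_ne hx _ _
  have henv : s.env = st'.env := by
    simp only [State.env]
    congr 1
    funext v
    exact hreg _ (by omega)
  have e := h.var
  refine ⟨⟨?_, ?_, ?_, ?_, ?_, ?_, ?_, ?_, ?_, ?_, ?_, fun a x ha hx => ?_, fun a x ha hx => ?_⟩,
    henv⟩
  · exact ⟨(hreg 3 (by omega)).trans hst.modulus, (hreg 35 (by omega)).trans hst.rows,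
      (hreg 43 (by omega)).trans hst.window, (hreg 51 (by omega)).trans hst.dim,
      (hreg 59 (by omega)).trans hst.cols, (hreg 91 (by omega)).trans hst.one,
      (hreg 99 (by omega)).trans hst.two, (hreg 115 (by omega)).trans hst.zero, hst.real_one,
      hst.real_neg, hst.real_rows, hst.real_threshold, fun i => (hreg _ (by omega)).trans (hst.loc i),
      fun x hx hK => (hreg x (by omega)).trans (hst.natHigh x hx hK), hst.realHigh⟩
  · have h1 : st'.natReg 11 = p.r₀ := h.frame.round.trans hb.round
    simp [hs, Instr.apply, NatOp.eval, h1, hst.one, Search.at]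
  · rw [henv]; exact h.bdd
  · rw [henv, e 0 (by omega) (by omega) (by omega) (by omega) (by omega) (by omega) (by omega)]
    exact hb.numVars
  · rw [henv, e 5 (by omega) (by omega) (by omega) (by omega) (by omega) (by omega) (by omega)]
    exact hb.rowBits
  · rw [henv, e 7 (by omega) (by omega) (by omega) (by omega) (by omega) (by omega) (by omega)]
    exact hb.steps
  · rw [henv, e 8 (by omega) (by omega) (by omega) (by omega) (by omega) (by omega) (by omega)]
    exact hb.kind
  · rw [henv, e 9 (by omega) (by omega) (by omega) (by omega) (by omega) (by omega) (by omega)]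
    exact hb.offset
  · rw [henv, e 15 (by omega) (by omega) (by omega) (by omega) (by omega) (by omega) (by omega)]
    exact hb.length
  · rw [henv, h.mem 2 (by omega) (by omega) (by omega) (by omega)]
    exact hb.closed
  · rw [henv, h.mem 2 (by omega) (by omega) (by omega) (by omega)]
    exact hb.clauses
  · change p.r₀ + 1 ≤ x % p.R at hx
    exact (h.frame.natMem a x (by omega) (by omega) fun _ => by omega).trans
      (hb.natFresh a x ha (by omega))
  · change p.r₀ + 1 ≤ x % p.R at hx
    exact (h.frame.realMem a x fun _ => by omega).trans (hb.realFresh a x ha (by omega))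

end

theorem exists_round (Patt : Program) (α s k K : ℕ) (hK : Patt.bound ≤ K) (hK4 : 4 ≤ K) :
    ∃ (P : Program) (C : ℕ), ∀ (p : Search) {Nφ : ℕ} (φ : CNF Nφ) (st : State) (μ ν : ℝ) (τ : ℕ),
      p.α = α → p.s = s → p.k = k → p.K = K → p.Valid → p.r₀ < p.R → 0 ≤ μ → μ < 1 →
      4 + ν ≤ p.c₀ → (p.c₀ : ℝ) + ν < (1 - μ) * p.n →
      (∀ (Q : Matrix (Fin p.n) (Fin p.d) ℝ) (V : Matrix (Fin p.n) (Fin p.m) ℝ),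
        ∃ t u, Exec Patt (SlidingWindow.input p.w Q V) t u ∧ SlidingWindow.approx μ ν p.n p.m
          (SlidingWindow.attention p.w Q V) (SlidingWindow.output p.n p.m u) ∧ t ≤ τ) →
      p.Base φ st → Runs P st ((p.n + τ + 1) * (p.V + 2) ^ C) fun st' =>
        (p.at (p.r₀ + 1)).Base φ st' ∧ p.Outcome φ st st' := by
  obtain ⟨Pr, c₁, hPr⟩ := exists_replay (theta α) k s
  obtain ⟨Pb, c₂, hPb⟩ := exists_build k
  obtain ⟨Ps, c₃, hPs⟩ := exists_scan
  have hpow : ∀ c : ℕ, Expr.PolyBd fun V => (V + 2) ^ c := fun c => ⟨c, fun _ => le_rfl⟩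
  have lin : ∀ a b : ℕ, Expr.PolyBd fun V => a * V + b := fun a b =>
    ((Expr.PolyBd.const a).mul .id).add (.const b)
  have hl : Expr.PolyBd fun V => 60 * (V + 1) ^ 2 + (V + 2) ^ c₁ + ((V + 2) ^ c₂ + (V + 2) ^ c₃) +
      (16 * V + (2 * K + 40)) := by
    have h1 : Expr.PolyBd fun V => 60 * (V + 1) ^ 2 :=
      ((Expr.PolyBd.const 60).mul ((Expr.PolyBd.id.add (.const 1)).mul
        (Expr.PolyBd.id.add (.const 1)))).mono fun V => by rw [pow_two]
    exact ((h1.add (hpow c₁)).add ((hpow c₂).add (hpow c₃))).add (lin 16 (2 * K + 40))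
  obtain ⟨C, hC⟩ := hl
  refine ⟨roundProg Pr Pb Patt Ps K, C, ?_⟩
  rintro p Nφ φ st μ ν τ rfl rfl rfl rfl hv hr hμ0 hμ hc₀ hn hatt hb
  have hCV := hC p.V
  set A := 60 * (p.V + 1) ^ 2 + (p.V + 2) ^ c₁ with hA
  set B := (p.V + 2) ^ c₂ with hB
  set D := (p.V + 2) ^ c₃ with hD
  replace hCV : A + (B + D) + (16 * p.V + (2 * p.K + 40)) ≤ (p.V + 2) ^ C := hCV
  set X := (p.n + 1) * B + (2 * p.K + 1 + (4 * p.V + 8) + (τ * (8 * (p.V + 2)) + (p.n + 1) * D))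
    with hX
  refine Runs.seq (prepareProg_runs hPr hv hr hb) (T₂ := 2 * p.V + 2 + (X + 1) + (p.V + 4)) ?_ ?_
  · rintro s₁ ⟨h₁, k₁, a₁⟩
    have hst := h₁.static
    have hcost : (Test.natLt 51 (8 * 10)).cost s₁ ≤ 2 * p.V + 2 := by
      have z1 : p.d.size ≤ p.V + 1 := size_le_of_le_two_pow hv.hd
      have z2 : (s₁.env.var 10).size ≤ p.V := (size_le_self _).trans (hst.2.2.1 10)
      simp only [Test.cost, hst.1.dim]
      change 1 + p.d.size + (s₁.env.var 10).size ≤ _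
      omega
    refine Runs.seq (M := fun s₂ => p.Kept st s₂ ∧ p.Outcome φ st s₂)
      (T₁ := 2 * p.V + 2 + (X + 1)) (T₂ := p.V + 4) ?_ ?_ le_rfl
    · by_cases hc : s₁.env.var 10 ≤ p.d
      · refine (Runs.branchFalse ?_ hcost ((attendProg_runs (hPb p.toRound · rfl)
          (hPs p.toRound) hv hr hK hK4 hμ0 hμ hc₀ hn hatt h₁ hc).mono (Nat.le_succ _)
          fun s₂ h₂ => ⟨k₁.trans h₂.1, ?_⟩))
        · simp only [Test.holds, hst.1.dim, not_lt]
          exact hc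
        · exact ⟨fun h => by rw [← a₁]; exact h₂.2.sound h,
            fun h => h₂.2.keep (a₁.trans h), h₂.2.complete⟩
      · refine (Runs.branchTrue ?_ hcost (Runs.instr _ _ (by simp [Instr.cost]) ?_))
        · simp only [Test.holds, hst.1.dim]
          exact not_le.1 hc
        · have henv : (Instr.apply (.natConst 107 0) s₁).env = s₁.env := by
            simp only [State.env, Instr.apply]
            congr 1
            funext v
            rw [Function.update_of_ne (by omega)]
          refine ⟨k₁.trans (.of_env ⟨fun x _ _ _ _ _ _ h107 _ _ _ => Function.update_of_ne h107 _ _,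
            fun _ _ _ _ _ => rfl, fun _ _ _ => rfl, fun _ _ _ => rfl⟩ k₁.bdd henv), ?_⟩
          refine ⟨fun h => Or.inl ?_, fun h => ?_, fun h => absurd (h₁.count_le_of_hit h) hc⟩
          · rwa [henv, a₁] at h
          · rwa [henv, a₁]
    · rintro s₂ ⟨k₂, o₂⟩
      obtain ⟨hb', he⟩ := k₂.next hb
      refine Runs.instr _ _ ?_ ⟨hb', ?_⟩
      · have h1 : s₂.natReg 11 = p.r₀ := k₂.frame.round.trans hb.round
        simp only [Instr.cost, h1, (hb.static.of_roundFrame k₂.frame).one, Nat.size_one]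
        have : p.r₀.size ≤ p.V + 1 := size_le_of_le_two_pow (hr.le.trans hv.hR)
        omega
      · exact ⟨fun h => o₂.sound (he ▸ h), fun h => he ▸ o₂.keep h, fun h => he ▸ o₂.complete h⟩
  · calc A + (2 * p.V + 2 + (X + 1) + (p.V + 4)) ≤
        (p.n + τ + 1) * (A + (B + D) + (16 * p.V + (2 * p.K + 40))) := by
          have h1 : τ * (8 * (p.V + 2)) ≤ τ * (16 * p.V + (2 * p.K + 40)) :=
            Nat.mul_le_mul_left _ (by omega)
          have h2 : (p.n + τ + 1) * (A + (B + D) + (16 * p.V + (2 * p.K + 40))) =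
            (p.n + 1) * B + (p.n + 1) * D + A + (16 * p.V + (2 * p.K + 40)) +
              τ * (16 * p.V + (2 * p.K + 40)) + τ * (B + D) + (p.n + τ) * A +
              p.n * (16 * p.V + (2 * p.K + 40)) := by ring
          rw [h2, hX]
          omega
      _ ≤ _ := Nat.mul_le_mul_left _ hCV

end Sparsify

/-! ### Initialization: the parameters are computed from the formula -/

namespace Sparsify

open RealRAM SAT

/-! ### Initialization -/

/-- The registers and arrays of the classes `2`, `4` and `j`, …, `7` modulo `8` are zero. -/
structure Clean (j : ℕ) (st : State) : Prop where
  natReg : ∀ x, x % 8 = 2 ∨ x % 8 = 4 ∨ j ≤ x % 8 → st.natReg x = 0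
  natMem : ∀ a x, a % 8 = 2 ∨ a % 8 = 4 ∨ j ≤ a % 8 → st.natMem a x = 0
  realReg : ∀ x, x % 8 = 2 ∨ x % 8 = 4 ∨ j ≤ x % 8 → st.realReg x = 0
  realMem : ∀ a x, a % 8 = 2 ∨ a % 8 = 4 ∨ j ≤ a % 8 → st.realMem a x = 0

/-- The state during the initialization; the list `l` holds registers and their contents. -/
structure Setup (j : ℕ) (m : Env) (l : List (ℕ × ℕ)) (st : State) : Prop where
  clean : Clean j st
  env : st.env = m
  regs : ∀ q ∈ l, st.natReg q.1 = q.2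

section

variable {j : ℕ} {m m' : Env} {l l' : List (ℕ × ℕ)} {st st' : State}

theorem Setup.sub (h : Setup j m l st) (hl : ∀ q ∈ l', q ∈ l) : Setup j m l' st :=
  ⟨h.clean, h.env, fun q hq => h.regs q (hl q hq)⟩

theorem Setup.of_work (hj : 4 ≤ j) (h : Setup j m l st) (f : WorkFrame st st')
    (he : st'.env = m') (hl : ∀ q ∈ l, q.1 % 8 = 3 ∧ q.1 ≠ 67 ∧ q.1 ≠ 75 ∧ q.1 ≠ 83 ∧ q.1 ≠ 107) :
    Setup j m' l st' := by
  refine ⟨⟨fun x hx => ?_, fun a x hx => ?_, fun x hx => ?_, fun a x hx => ?_⟩, he, fun q hq => ?_⟩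
  · rw [f.natReg x (by omega) (by omega) (by omega) (by omega) (by omega) (by omega)]
    exact h.clean.natReg x hx
  · rw [f.natMem a (by omega) (by omega)]
    exact h.clean.natMem a x hx
  · rw [f.realReg]
    exact h.clean.realReg x hx
  · rw [f.realMem]
    exact h.clean.realMem a x hx
  · obtain ⟨h1, h2, h3, h4, h5⟩ := hl q hq
    rw [f.natReg _ (by omega) (by omega) h2 h3 h4 h5]
    exact h.regs q hq

theorem Setup.update (hj : 4 ≤ j) (h : Setup j m l st) {dst x : ℕ} (hd : dst % 8 = 3)
    (hl : ∀ q ∈ l, q.1 ≠ dst) :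
    Setup j m ((dst, x) :: l) { st with natReg := Function.update st.natReg dst x } := by
  refine ⟨⟨fun y hy => ?_, h.clean.natMem, h.clean.realReg, h.clean.realMem⟩, ?_, fun q hq => ?_⟩
  · exact (Function.update_of_ne (by omega) _ _).trans (h.clean.natReg y hy)
  · rw [← h.env]
    simp only [State.env]
    congr 1
    funext v
    rw [Function.update_of_ne (by omega)]
  · rcases List.mem_cons.1 hq with rfl | hq
    · exact Function.update_self _ _ _
    · exact (Function.update_of_ne (hl q hq) _ _).trans (h.regs q hq)

theorem Setup.pow2 (hj : 4 ≤ j) (h : Setup j m l st) {dst v V : ℕ} (hd : dst % 8 = 3)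
    (h83 : dst ≠ 83) (h91 : dst ≠ 91) (h1 : (91, 1) ∈ l) (hV : m.var v ≤ V)
    (hl : ∀ q ∈ l', q ∈ l ∧ q.1 ≠ dst ∧ q.1 ≠ 83) :
    Runs (pow2Prog dst v) st (20 * (V + 1) ^ 2) (Setup j m ((dst, 2 ^ m.var v) :: l')) := by
  refine (pow2Prog_runs hd h83 h91 (h.regs _ h1) (by rw [h.env]; exact hV)).mono le_rfl ?_
  rintro _ rfl
  have h2 := (h.sub fun q hq => (hl q hq).1).update hj (dst := 83) (x := st.env.var v) (by omega)
    fun q hq => (hl q hq).2.2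
  have h3 := (h2.sub (l' := l') fun q hq => List.mem_cons_of_mem _ hq).update hj (dst := dst)
    (x := 2 ^ st.env.var v) hd fun q hq => (hl q hq).2.1
  rwa [h.env] at h3 ⊢

/-- Run the program `P` on the content of the register `35`; the result is left in `dst`. -/
def evalProg (j dst : ℕ) (P : Program) : Program :=
  .seq (.instr (.natOp .add j 35 115)) (.seq (reloc j P) (.instr (.natOp .add dst j 115)))

/-- Every parameter program gets a class `j` of registers and arrays of its own, so it starts from
clean memory without any clearing; afterwards only the classes from `j + 1` on are known to be
clean. -/
theorem Setup.eval (hj : 4 < j) (hj8 : j < 8) (h : Setup j m l st) {dst n x t V : ℕ}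
    (hd : dst % 8 = 3)
    (hl : ∀ q ∈ l, q.1 % 8 = 3 ∧ q.1 ≠ dst ∧ q.1 ≠ 19)
    (hmem : (35, n) ∈ l ∧ (115, 0) ∈ l ∧ (3, 1) ∈ l ∧ (11, 0) ∈ l) (hn : n ≤ 2 ^ V) (hx : x ≤ 2 ^ V)
    {P : Program} {u : State}
    (hP : Exec P { State.blank with natReg := fun r => if r = 0 then n else 0 } t u)
    (hu : u.natReg 0 = x) :
    Runs (evalProg j dst P) st (16 * t + (2 * V + 4)) (Setup (j + 1) m ((dst, x) :: l)) := by
  obtain ⟨m35, m115, m3, m11⟩ := hmem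
  have zn := size_le_of_le_two_pow hn
  have zx := size_le_of_le_two_pow hx
  have e35 : st.natReg 35 = n := h.regs _ m35
  have e115 : st.natReg 115 = 0 := h.regs _ m115
  set s₁ : State := { st with natReg := Function.update st.natReg j n } with hs₁
  have c1 : ∀ x, x ≠ j → s₁.natReg x = st.natReg x := fun x hx => Function.update_of_ne hx _ _
  refine Runs.seq (T₁ := V + 2) (T₂ := 16 * t + (V + 2)) (M := fun s => s = s₁)
    (Runs.instr _ _ ?_ ?_) ?_ (by omega)
  · simp only [Instr.cost, e35, e115, Nat.size_zero]
    omega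
  · simp [Instr.apply, NatOp.eval, e35, e115, hs₁]
  rintro _ rfl
  have hview : view j 1 0 s₁ =
      { State.blank with natReg := fun r => if r = 0 then n else 0 } := by
    refine State.ext ?_ ?_ ?_ ?_
    · funext r
      simp only [view]
      by_cases hr : r = 0
      · simp [hr, hs₁]
      · rw [if_neg hr, c1 _ (by omega)]
        exact h.clean.natReg _ (by omega)
    · funext a x
      exact h.clean.natMem _ _ (by omega)
    · funext r
      exact h.clean.realReg _ (by omega)
    · funext a x
      exact h.clean.realMem _ _ (by omega)
  -- During the initialization the registers 3 and 11 hold 1 and 0, so the relocation leaves cell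
  -- indices unchanged, and its overhead is the constant `8 * (1 + 1) = 16`.
  refine Runs.seq ((hP.reloc (j := j) (R := 1) (r₀ := 0) hj8 (by omega) (by omega) le_rfl s₁ hview
    ((c1 3 (by omega)).trans (h.regs _ m3)) ((c1 11 (by omega)).trans (h.regs _ m11))).mono
    (T' := 16 * t) (by rw [Nat.size_one]; omega) fun _ h => h) ?_ le_rfl
  rintro s₂ ⟨hv, f⟩
  have hreg : ∀ x, x % 8 ≠ j → x ≠ 19 → s₂.natReg x = st.natReg x := fun x hx h19 =>
    (f.natReg x h19 fun h => absurd h hx).trans (c1 x (by rintro rfl; omega))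
  have hj0 : s₂.natReg j = x := by
    rw [← hu, ← hv]
    simp [view]
  have h115' : s₂.natReg 115 = 0 := (hreg 115 (by omega) (by omega)).trans e115
  have hset : Setup (j + 1) m l s₂ := by
    refine ⟨⟨fun x hx => ?_, fun a x hx => ?_, fun x hx => ?_, fun a x hx => ?_⟩, ?_, fun q hq => ?_⟩
    · rw [hreg x (by omega) (by omega)]
      exact h.clean.natReg x (by omega)
    · rw [f.natMem a x (by omega)]
      exact h.clean.natMem a x (by omega)
    · rw [f.realReg x (by omega)]
      exact h.clean.realReg x (by omega)
    · rw [f.realMem a x (by omega)]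
      exact h.clean.realMem a x (by omega)
    · rw [← h.env]
      simp only [State.env]
      congr 1
      · funext v
        exact hreg _ (by omega) (by omega)
      · funext a x
        exact f.natMem _ _ (by omega)
    · obtain ⟨h1, -, h3⟩ := hl q hq
      rw [hreg _ (by omega) h3]
      exact h.regs q hq
  refine Runs.instr _ _ ?_ ?_
  · simp only [Instr.cost, hj0, h115', Nat.size_zero]
    omega
  · have := hset.update (by omega) (x := x) hd fun q hq => (hl q hq).2.1
    simpa [Instr.apply, NatOp.eval, hj0, h115'] using this

end

/-- The constants that the loop needs. -/
def constProg (c₀ : ℕ) : Program :=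
  -- Programs have no real constants, so all reals are cast from naturals; `-n` is obtained as `0 -
  -- n`, because the real register 34 is still zero.
  block [.natConst 107 c₀, .natConst 11 0, .realCast 2 91, .realCast 18 35, .realOp .sub 10 34 18,
    .realCast 26 107]

theorem Setup.consts {m : Env} {l : List (ℕ × ℕ)} {st : State} (h : Setup 8 m l st)
    {n c₀ V : ℕ} (hl : ∀ q ∈ l, q.1 ≠ 107 ∧ q.1 ≠ 11) (hmem : (35, n) ∈ l ∧ (91, 1) ∈ l)
    (hn : n ≤ 2 ^ V) :
    Runs (constProg c₀) st (V + 2 * c₀ + 10) fun st' => st'.env = m ∧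
      (∀ q ∈ (11, 0) :: l, st'.natReg q.1 = q.2) ∧
      (st'.realReg 2 = 1 ∧ st'.realReg 10 = -(n : ℝ) ∧ st'.realReg 18 = n ∧ st'.realReg 26 = c₀) ∧
      (∀ x, x % 8 = 2 ∨ x % 8 = 4 → st'.natReg x = 0) ∧ (∀ x, x % 8 = 4 → st'.realReg x = 0) ∧
      ∀ a x, a % 8 = 4 → st'.natMem a x = 0 ∧ st'.realMem a x = 0 := by
  have e35 : st.natReg 35 = n := h.regs _ hmem.1
  have e91 : st.natReg 91 = 1 := h.regs _ hmem.2
  have e34 : st.realReg 34 = 0 := h.clean.realReg 34 (by omega)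
  have zn := size_le_of_le_two_pow hn
  have zc := size_le_self c₀
  refine Runs.block (by simp) ?_ ⟨?_, fun q hq => ?_, ?_, fun x hx => ?_, fun x hx => ?_,
    fun a x hx => ?_⟩
  · simp [listCost, Instr.cost, Instr.apply, e35, e91]
    omega
  · rw [← h.env]
    simp only [State.env, List.foldl, Instr.apply]
    congr 1
    funext v
    rw [Function.update_of_ne (by omega), Function.update_of_ne (by omega)]
  · simp only [List.foldl, Instr.apply]
    rcases List.mem_cons.1 hq with rfl | hq
    · simp
    · rw [Function.update_of_ne (hl q hq).2, Function.update_of_ne (hl q hq).1]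
      exact h.regs q hq
  · simp [Instr.apply, RealOp.eval, e34, e35, e91]
  · simp only [List.foldl, Instr.apply]
    rw [Function.update_of_ne (by omega), Function.update_of_ne (by omega)]
    exact h.clean.natReg x (by omega)
  · simp only [List.foldl, Instr.apply]
    rw [Function.update_of_ne (by omega), Function.update_of_ne (by omega),
      Function.update_of_ne (by omega), Function.update_of_ne (by omega)]
    exact h.clean.realReg x (by omega)
  · exact ⟨h.clean.natMem a x (by omega), h.clean.realMem a x (by omega)⟩

/-- The parameters of the search that belong to a formula with `p.N` variables. -/
structure Search.Fits (p : Search) (a τ₀ : ℕ) : Prop extends p.Valid where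
  rowBits : p.e = p.N / a
  steps : p.T = p.N / τ₀ + 1
  kind : p.q = Nat.log 2 (p.w / 4)
  length : p.len = p.T * p.s + (p.N - (p.e + p.q) + 1)
  round : p.r₀ = 0
  steps_le : p.T * 2 ^ p.s ≤ p.V
  offset_le : p.T * p.s ≤ p.V
  length_le : p.len ≤ p.V

/-- The order is forced: `n = 2 ^ e` is needed for `w`, `d`, `m`, then `w` for `q`, then `q` for the
number of guessed bits. Register 3 receives the modulus only after the relocated evaluations, which
need it to be 1. -/
def initProg (Pp P₅ P₇ P₉ P₁₅ Pw Pq Pv : Program) (c₀ : ℕ) : Program :=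
  .seq Pp (.seq P₅ (.seq P₇ (.seq P₉ (.seq (block [.natConst 91 1, .natConst 99 2, .natConst 115 0,
    .natConst 3 1, .natConst 11 0]) (.seq (pow2Prog 35 5) (.seq (evalProg 5 43 Pw)
    (.seq (evalProg 6 51 Pq) (.seq (evalProg 7 59 Pv) (.seq logProg (.seq P₁₅ (.seq (pow2Prog 3 15)
    (constProg c₀))))))))))))

theorem exists_init (k N₀ a τ₀ s c₀ : ℕ) (Pw Pq Pv : Program) : ∃ (P : Program) (C c : ℕ),
    ∀ (p : Search) (Nφ : ℕ) (φ : CNF Nφ) (tw tq tv : ℕ) (uw uq uv : State), WidthLE k φ → p.k = k →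
      p.s = s → p.c₀ = c₀ → p.N = Nφ + N₀ → (size φ + 2) ^ c ≤ p.V → p.Fits a τ₀ →
      Exec Pw { State.blank with natReg := fun r => if r = 0 then p.n else 0 } tw uw →
      Exec Pq { State.blank with natReg := fun r => if r = 0 then p.n else 0 } tq uq →
      Exec Pv { State.blank with natReg := fun r => if r = 0 then p.n else 0 } tv uv →
      uw.natReg 0 = p.w → uq.natReg 0 = p.d → uv.natReg 0 = p.m →
      Runs P (input φ) ((p.V + 2) ^ C + 16 * (tw + tq + tv)) fun st =>
        p.Base φ st ∧ st.env.var 12 = 0 := by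
  obtain ⟨Pp, c, hPp⟩ := exists_parse k N₀
  obtain ⟨P₅, ⟨c₅, h₅⟩, -⟩ := exists_acts_setVar 5 (f := fun m : Env => m.var 0 / a)
    ((Comp.var 0).div (.const a))
  obtain ⟨P₇, ⟨c₇, h₇⟩, -⟩ := exists_acts_setVar 7 (f := fun m : Env => (m.var 0 / τ₀ + 1) * 2 ^ s)
    ((((Comp.var 0).div (.const τ₀)).add (.const 1)).mul (.const _))
  obtain ⟨P₉, ⟨c₉, h₉⟩, -⟩ := exists_acts_setVar 9 (f := fun m : Env => (m.var 0 / τ₀ + 1) * s)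
    ((((Comp.var 0).div (.const τ₀)).add (.const 1)).mul (.const _))
  obtain ⟨P₁₅, ⟨c₁₅, h₁₅⟩, -⟩ := exists_acts_setVar 15
    (f := fun m : Env => m.var 9 + (m.var 0 - (m.var 5 + m.var 8) + 1))
    ((Comp.var 9).add (((Comp.var 0).sub ((Comp.var 5).add (.var 8))).add (.const 1)))
  have hpow : ∀ c : ℕ, Expr.PolyBd fun V => (V + 2) ^ c := fun c => ⟨c, fun _ => le_rfl⟩
  have lin : ∀ a b : ℕ, Expr.PolyBd fun V => a * V + b := fun a b =>
    ((Expr.PolyBd.const a).mul .id).add (.const b)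
  have h1 : Expr.PolyBd fun V => (V + 1) ^ 2 :=
    ((Expr.PolyBd.id.add (.const 1)).mul (Expr.PolyBd.id.add (.const 1))).mono fun V => by
      rw [pow_two]
  obtain ⟨C, hC⟩ := ((((hpow c₅).add (hpow c₇)).add ((hpow c₉).add (hpow c₁₅))).add
    ((Expr.PolyBd.const 100).mul h1)).add (lin 8 (2 * c₀ + 50))
  refine ⟨initProg Pp P₅ P₇ P₉ P₁₅ Pw Pq Pv c₀, C, c, ?_⟩
  rintro p Nφ φ tw tq tv uw uq uv hφ rfl rfl rfl hN hcV hp hw hq hv hw0 hq0 hv0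
  have hCV := hC p.V
  simp only at hCV
  refine (Runs.seq (hPp Nφ φ hφ) (T₂ := (p.V + 2) ^ c₅ + ((p.V + 2) ^ c₇ + ((p.V + 2) ^ c₉ +
    (20 + (20 * (p.V + 1) ^ 2 + ((16 * tw + (2 * p.V + 4)) + ((16 * tq + (2 * p.V + 4)) +
    ((16 * tv + (2 * p.V + 4)) + (60 * (p.V + 1) ^ 2 + ((p.V + 2) ^ c₁₅ + (20 * (p.V + 1) ^ 2 +
    (p.V + 2 * p.c₀ + 10)))))))))))) ?_ le_rfl).mono (by omega) fun _ h => h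
  rintro s₁ ⟨f₁, b₁, pp⟩
  have hv0' : s₁.env.var 0 = p.N := by rw [pp.numVars, hN]
  have L : envL s₁.env = 2 * p.N := by rw [envL, hv0']
  have hbV := b₁.mono hcV
  have i₁ : Setup 5 s₁.env [] s₁ := by
    refine ⟨⟨fun x hx => ?_, fun a x hx => ?_, fun x hx => ?_, fun a x hx => ?_⟩, rfl, by simp⟩
    · rw [f₁.natReg x (by omega) (by omega)]
      simp only [input]
      rw [if_neg (by omega), if_neg (by omega)]
    · rw [f₁.natMem a (by omega) (by omega)]
      simp only [input]
      rw [if_neg (by omega)]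
    · rw [f₁.realReg]
      rfl
    · rw [f₁.realMem]
      rfl
  have loc : ∀ {j m l st}, Setup j m l st → ∀ i, st.loc i = 0 := fun h i =>
    h.clean.natReg _ (by omega)
  have step : ∀ {j : ℕ} {m : Env} {l : List (ℕ × ℕ)} {st : State} {P : Program} {c' : ℕ}
      (F : Env → Env), (∀ (s : State) (V : ℕ), s.env.Bdd V → (∀ i, s.loc i = 0) →
        Runs P s ((V + 2) ^ c') fun s' => s'.env = F s.env ∧ SmallFrame s s') → 4 ≤ j →
      Setup j m l st → m.Bdd p.V →
      (∀ q ∈ l, q.1 % 8 = 3 ∧ q.1 ≠ 67 ∧ q.1 ≠ 75 ∧ q.1 ≠ 83 ∧ q.1 ≠ 107) →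
      Runs P st ((p.V + 2) ^ c') (Setup j (F m) l) := fun F hP hj h hb hl =>
    (hP _ p.V (h.env ▸ hb) (loc h)).mono le_rfl fun _ h' =>
      h.of_work hj h'.2.workFrame (h'.1.trans (by rw [h.env])) hl
  refine Runs.seq (step (fun m => m.setVar 5 (m.var 0 / a)) h₅ (by omega) i₁ hbV (by simp)) ?_ le_rfl
  intro s₂ i₂
  have heN : p.e ≤ p.V := by
    rw [hp.rowBits, ← hv0']; exact (Nat.div_le_self _ _).trans (hbV.1 0)
  rw [hv0', ← hp.rowBits] at i₂
  have hb₂ := bdd_setVar (v := 5) hbV heN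
  refine Runs.seq (step (fun m => m.setVar 7 ((m.var 0 / τ₀ + 1) * 2 ^ p.s)) h₇ (by omega) i₂ hb₂ (by simp)) ?_ le_rfl
  intro s₃ i₃
  have e0 : (s₁.env.setVar 5 p.e).var 0 = p.N := hv0'
  rw [e0, ← hp.steps] at i₃
  have hb₃ := bdd_setVar (v := 7) hb₂ hp.steps_le
  refine Runs.seq (step (fun m => m.setVar 9 ((m.var 0 / τ₀ + 1) * p.s)) h₉ (by omega) i₃ hb₃ (by simp)) ?_ le_rfl
  intro s₄ i₄
  have e0 : ((s₁.env.setVar 5 p.e).setVar 7 (p.T * 2 ^ p.s)).var 0 = p.N := hv0'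
  rw [e0, ← hp.steps] at i₄
  have hb₄ := bdd_setVar (v := 9) hb₃ hp.offset_le
  set m₄ := ((s₁.env.setVar 5 p.e).setVar 7 (p.T * 2 ^ p.s)).setVar 9 (p.T * p.s) with hm₄
  have hm5 : m₄.var 5 = p.e := by simp [hm₄, Env.setVar]
  refine Runs.seq (M := Setup 5 m₄ [(11, 0), (3, 1), (115, 0), (99, 2), (91, 1)])
    (Runs.block (by simp) ?_ ?_) ?_ le_rfl
  · have z2 : Nat.size 2 = 2 := by decide
    simp [listCost, Instr.cost, z2]
  · exact ((((i₄.update (by omega) (dst := 91) (x := 1) (by omega) (by simp)).update (by omega)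
      (dst := 99) (x := 2) (by omega) (by simp)).update (by omega) (dst := 115) (x := 0) (by omega)
      (by simp)).update (by omega) (dst := 3) (x := 1) (by omega) (by simp)).update (by omega)
      (dst := 11) (x := 0) (by omega) (by simp)
  intro s₅ i₅
  refine Runs.seq (i₅.pow2 (l' := [(11, 0), (3, 1), (115, 0), (99, 2), (91, 1)]) (by omega)
    (dst := 35) (v := 5) (V := p.V) (by omega) (by omega) (by omega) (by simp)
    (by rw [hm5]; exact heN) (by simp)) ?_ le_rfl
  intro s₆ i₆
  rw [hm5, ← hp.rows] at i₆
  refine Runs.seq (i₆.eval (by omega) (by omega) (dst := 43) (V := p.V) (by omega) (by simp)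
    (by simp) hp.hn hp.hw hw hw0) ?_ le_rfl
  intro s₇ i₇
  refine Runs.seq (i₇.eval (by omega) (by omega) (dst := 51) (V := p.V) (by omega) (by simp)
    (by simp) hp.hn hp.hd hq hq0) ?_ le_rfl
  intro s₈ i₈
  refine Runs.seq (i₈.eval (by omega) (by omega) (dst := 59) (V := p.V) (by omega) (by simp)
    (by simp) hp.hn hp.hm hv hv0) ?_ le_rfl
  intro s₉ i₉
  have r43 : s₉.natReg 43 = p.w := i₉.regs (43, p.w) (by simp)
  have hqV : p.q ≤ p.V := hp.kind_lt.le.trans heN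
  refine Runs.seq (logProg_runs (V := p.V) (i₉.regs (91, 1) (by simp)) (i₉.regs (99, 2) (by simp))
    (by rw [r43]; exact hp.hw)) ?_ le_rfl
  rintro s₁₀ ⟨f₁₀, e₁₀⟩
  rw [r43, ← hp.kind, i₉.env] at e₁₀
  have i₁₀ := i₉.of_work (by omega) f₁₀ e₁₀ (by simp)
  have hb₁₀ := bdd_setVar (v := 8) hb₄ hqV
  refine Runs.seq (step (fun m => m.setVar 15 (m.var 9 + (m.var 0 - (m.var 5 + m.var 8) + 1)))
    h₁₅ (by omega) i₁₀ hb₁₀ (by simp)) ?_ le_rfl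
  intro s₁₁ i₁₁
  have elen : (m₄.setVar 8 p.q).var 9 + ((m₄.setVar 8 p.q).var 0 - ((m₄.setVar 8 p.q).var 5 +
      (m₄.setVar 8 p.q).var 8) + 1) = p.len := by
    rw [hp.length]
    simp [hm₄, Env.setVar, hv0']
  rw [elen] at i₁₁
  set m := (m₄.setVar 8 p.q).setVar 15 p.len with hm
  have hbm : m.Bdd p.V := bdd_setVar hb₁₀ hp.length_le
  have hm15 : m.var 15 = p.len := by simp [hm, Env.setVar]
  refine Runs.seq (i₁₁.pow2 (l' := [(59, p.m), (51, p.d), (43, p.w), (35, p.n), (115, 0), (99, 2),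
    (91, 1)]) (by omega) (dst := 3) (v := 15) (V := p.V) (by omega) (by omega) (by omega) (by simp)
    (by rw [hm15]; exact hp.length_le) (by simp)) ?_ le_rfl
  intro s₁₂ i₁₂
  rw [hm15, ← hp.modulus] at i₁₂
  refine (i₁₂.consts (n := p.n) (c₀ := p.c₀) (V := p.V) (by simp) (by simp) hp.hn).mono le_rfl ?_
  rintro st ⟨henv, hreg, ⟨r1, r2, r3, r4⟩, hn0, hr0, hmem⟩
  refine ⟨⟨?_, ?_, henv ▸ hbm, ?_, ?_, ?_, ?_, ?_, ?_, ?_, ?_, fun a x ha _ => (hmem a x ha).1,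
    fun a x ha _ => (hmem a x ha).2⟩, ?_⟩
  · exact ⟨hreg (3, p.R) (by simp), hreg (35, p.n) (by simp), hreg (43, p.w) (by simp),
      hreg (51, p.d) (by simp), hreg (59, p.m) (by simp), hreg (91, 1) (by simp),
      hreg (99, 2) (by simp), hreg (115, 0) (by simp), r1, r2, r3, r4,
      fun i => hn0 _ (by omega), fun x hx _ => hn0 x (Or.inr hx), fun x hx _ => hr0 x hx⟩
  · rw [hp.round]; exact hreg (11, 0) (by simp)
  · rw [henv]; simp [hm, hm₄, Env.setVar, hv0']
  · rw [henv]; simp [hm, hm₄, Env.setVar]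
  · rw [henv]; simp [hm, hm₄, Env.setVar]
  · rw [henv]; simp [hm, hm₄, Env.setVar]
  · rw [henv]; simp [hm, hm₄, Env.setVar]
  · rw [henv]; simp [hm, hm₄, Env.setVar]
  · rw [henv, ← L]; exact pp.closed
  · rw [henv, ← L]; exact pp.clauses
  · rw [henv]
    have := pp.var 12 (by omega) (by omega) (by omega) (by omega)
    simpa [hm, hm₄, Env.setVar] using this

end Sparsify

/-! ### The search over all guesses, and the choice of the sparsification parameters -/

namespace Sparsify

open RealRAM SAT

/-! ### The main loop -/

theorem Search.at_eq_self {p : Search} {r : ℕ} (h : p.r₀ = r) : p.at r = p := by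
  subst h
  rfl

/-- The counter of the loop is register 11, which at the same time is the residue used by the
relocation and the number whose bits are the guess; the loop ends when it reaches the modulus in
register 3. -/
theorem exists_search (Patt Pw Pq Pv : Program) (k N₀ a τ₀ s c₀ α : ℕ) :
    ∃ (P : Program) (C c : ℕ), ∀ (p : Search) (Nφ : ℕ) (φ : CNF Nφ) (tw tq tv : ℕ)
      (uw uq uv : State) (μ ν : ℝ) (τ : ℕ), WidthLE k φ → p.α = α → p.k = k → p.s = s →
      p.c₀ = c₀ → p.K = max Patt.bound 4 → p.N = Nφ + N₀ → (size φ + 2) ^ c ≤ p.V → p.Fits a τ₀ →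
      Exec Pw { State.blank with natReg := fun r => if r = 0 then p.n else 0 } tw uw →
      Exec Pq { State.blank with natReg := fun r => if r = 0 then p.n else 0 } tq uq →
      Exec Pv { State.blank with natReg := fun r => if r = 0 then p.n else 0 } tv uv →
      uw.natReg 0 = p.w → uq.natReg 0 = p.d → uv.natReg 0 = p.m →
      0 ≤ μ → μ < 1 → 4 + ν ≤ p.c₀ → (p.c₀ : ℝ) + ν < (1 - μ) * p.n →
      (∀ (Q : Matrix (Fin p.n) (Fin p.d) ℝ) (V : Matrix (Fin p.n) (Fin p.m) ℝ),
        ∃ t u, Exec Patt (SlidingWindow.input p.w Q V) t u ∧ SlidingWindow.approx μ ν p.n p.m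
          (SlidingWindow.attention p.w Q V) (SlidingWindow.output p.n p.m u) ∧ t ≤ τ) →
      (Satisfiable φ → ∃ r < p.R, p.Hit φ r) →
      Runs P (input φ) (p.R * (p.n + τ + 1) * (p.V + 2) ^ C + 16 * (tw + tq + tv)) fun st =>
        st.natReg 0 = 1 ↔ Satisfiable φ := by
  obtain ⟨Pi, C₁, c, hPi⟩ := exists_init k N₀ a τ₀ s c₀ Pw Pq Pv
  obtain ⟨Pr, C₂, hPr⟩ := exists_round Patt α s k (max Patt.bound 4) (le_max_left _ _)
    (le_max_right _ _)
  have hpow : ∀ c : ℕ, Expr.PolyBd fun V => (V + 2) ^ c := fun c => ⟨c, fun _ => le_rfl⟩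
  have lin : ∀ a b : ℕ, Expr.PolyBd fun V => a * V + b := fun a b =>
    ((Expr.PolyBd.const a).mul .id).add (.const b)
  obtain ⟨C, hC⟩ := ((hpow C₁).add (hpow C₂)).add (lin 5 12)
  refine ⟨.seq Pi (.seq (.loop (.natLt 11 3) Pr) (.instr (.natOp .add 0 96 115))), C, c, ?_⟩
  rintro p Nφ φ tw tq tv uw uq uv μ ν τ hφ rfl rfl rfl rfl hK hN hcV hp hw hq hv hw0 hq0 hv0
    hμ0 hμ hc₀ hn hatt hsat
  have hCV := hC p.V
  simp only at hCV
  have hV := hp.toValid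
  have hR1 : 1 ≤ p.R := by rw [hV.modulus]; exact Nat.one_le_two_pow
  set X := (p.n + τ + 1) * (p.V + 2) ^ C₂ with hX
  refine (Runs.seq (hPi p Nφ φ tw tq tv uw uq uv hφ rfl rfl rfl hN hcV hp hw hq hv hw0 hq0 hv0)
    (T₂ := p.R * (2 * p.V + 3 + X) + (2 * p.V + 3) + (p.V + 2)) ?_ le_rfl).mono ?_ fun _ h => h
  · rintro st ⟨hb, h12⟩
    set I : ℕ → State → Prop := fun r st' => (p.at r).Base φ st' ∧
      (st'.env.var 12 = 1 → Satisfiable φ) ∧ ∀ r' < r, p.Hit φ r' → st'.env.var 12 = 1 with hI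
    refine Runs.seq (T₁ := p.R * (2 * p.V + 3 + X) + (2 * p.V + 3)) (T₂ := p.V + 2) (M := I p.R)
      (Runs.loop I (c := 2 * p.V + 3) (T := X) ?_ ?_ ?_ ⟨?_, ?_, ?_⟩ le_rfl) ?_ le_rfl
    · rintro r st' hr ⟨hb', -⟩
      simp only [Test.cost, hb'.round, hb'.static.modulus]
      have h1 : r.size ≤ p.V + 1 := size_le_of_le_two_pow (hr.trans hV.hR)
      have h2 : p.R.size ≤ p.V + 1 := size_le_of_le_two_pow hV.hR
      simp only [Search.at]
      omega
    · rintro r st' hr ⟨hb', hs, hh⟩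
      refine ⟨by simp only [Test.holds, hb'.round, hb'.static.modulus]; exact hr, ?_⟩
      have hV' : (p.at r).Valid := ⟨hV.kind_lt, hV.modulus, hV.rows, hV.viol, hV.hR, hV.hn, hV.hw,
        hV.hd, hV.hm, hV.hm0, hV.hV⟩
      refine (hPr (p.at r) φ st' μ ν τ rfl rfl rfl hK hV' hr hμ0 hμ hc₀ hn hatt hb').mono le_rfl ?_
      rintro st'' ⟨hb'', ho⟩
      refine ⟨hb'', fun h => (ho.sound h).elim hs id, fun r' hr' hhit => ?_⟩
      rcases Nat.lt_succ_iff_lt_or_eq.1 hr' with h | rfl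
      · exact ho.keep (hh r' h hhit)
      · exact ho.complete hhit
    · rintro st' ⟨hb', -⟩
      simp only [Test.holds, hb'.round, hb'.static.modulus]
      exact lt_irrefl _
    · rwa [Search.at_eq_self hp.round]
    · rw [h12]; intro h; omega
    · intro r' hr'; omega
    · rintro st' ⟨hb', hs, hh⟩
      have e96 : st'.natReg 96 = st'.env.var 12 := rfl
      refine Runs.instr _ _ ?_ ?_
      · simp only [Instr.cost, hb'.static.zero, e96, Nat.size_zero]
        have := (size_le_self (st'.env.var 12)).trans (hb'.bdd.1 12)
        simp only [Search.at] at this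
        omega
      · simp only [Instr.apply, NatOp.eval, hb'.static.zero, e96, Function.update_self, add_zero]
        refine ⟨hs, fun h => ?_⟩
        obtain ⟨r, hr, hhit⟩ := hsat h
        exact hh r hr hhit
  · have h1 : p.R * (p.n + τ + 1) * ((p.V + 2) ^ C₁ + (p.V + 2) ^ C₂ + (5 * p.V + 12)) ≤
        p.R * (p.n + τ + 1) * (p.V + 2) ^ C := Nat.mul_le_mul_left _ hCV
    have h2 : p.R * X + p.R * ((p.V + 2) ^ C₁ + (5 * p.V + 12)) ≤
        p.R * (p.n + τ + 1) * ((p.V + 2) ^ C₁ + (p.V + 2) ^ C₂ + (5 * p.V + 12)) := by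
      have : p.R * (p.n + τ + 1) * ((p.V + 2) ^ C₁ + (p.V + 2) ^ C₂ + (5 * p.V + 12)) =
          p.R * X + p.R * ((p.V + 2) ^ C₁ + (5 * p.V + 12)) +
            p.R * (p.n + τ) * ((p.V + 2) ^ C₁ + (5 * p.V + 12)) := by rw [hX]; ring
      omega
    have h3 : (p.V + 2) ^ C₁ + (3 * p.V + 9) ≤ p.R * ((p.V + 2) ^ C₁ + (3 * p.V + 9)) :=
      Nat.le_mul_of_pos_left _ hR1
    have h4 : p.R * ((p.V + 2) ^ C₁ + (5 * p.V + 12)) =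
      p.R * ((p.V + 2) ^ C₁ + (3 * p.V + 9)) + p.R * (2 * p.V + 3) := by ring
    have h5 : p.R * (2 * p.V + 3 + X) = p.R * (2 * p.V + 3) + p.R * X := by ring
    omega

/-! ### The choice of the parameters -/

theorem eventually_mul_pow_le (A G : ℕ) : ∀ᶠ j : ℕ in atTop, A * j ^ G + 1 ≤ 2 ^ j := by
  have h := tendsto_pow_const_div_const_pow_of_one_lt G (r := (2 : ℝ)) (by norm_num)
  have hpos : (0 : ℝ) < 1 / (A + 1) := by positivity
  filter_upwards [h.eventually (gt_mem_nhds hpos), eventually_ge_atTop 1] with j hj h1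
  rw [div_lt_div_iff₀ (by positivity) (by positivity), one_mul] at hj
  have h2 : j ^ G * (A + 1) < 2 ^ j := by exact_mod_cast hj
  have h3 : 1 ≤ j ^ G := Nat.one_le_pow _ _ h1
  nlinarith

/-- Take `τ₀ = m s` with `m ≥ 1 / η`, so that the advice costs `s ≤ η τ₀` bits per `τ₀` variables.
With `α = 4 (k + 1) τ₀` there are at most `N / (2 τ₀)` petal steps. The number of heart steps is at
most `2 B N` with `B` polynomial in `s`, so for large `s` it is at most `(2 ^ s - 1) N / (2 τ₀)`.
Together the potential is at most `(2 ^ s - 1) N / τ₀`. -/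
theorem exists_params (k : ℕ) {η : ℝ} (hη : 0 < η) : ∃ α τ₀ s : ℕ, 1 ≤ τ₀ ∧ 1 ≤ s ∧
    (s : ℝ) ≤ η * τ₀ ∧ ∀ N h p, h + p ≤ (thresh α k).2 * (2 * N) → p * α ≤ k * (2 * N) →
      p * (2 ^ s - 1) + h < (N / τ₀ + 1) * (2 ^ s - 1) := by
  obtain ⟨c, g, hcg⟩ := thresh_le k
  obtain ⟨M, hM⟩ := exists_nat_ge (1 / η)
  set m := M + 1 with hm
  obtain ⟨s, hs, hs1⟩ := ((eventually_mul_pow_le (4 * (c * (4 * (k + 1) * m) ^ g) * m)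
    (g + 1)).and (eventually_ge_atTop 1)).exists
  have hτ : 1 ≤ m * s := Nat.mul_pos (by omega) hs1
  refine ⟨4 * (k + 1) * (m * s), m * s, s, hτ, hs1, ?_, fun N h p h1 h2 => ?_⟩
  · have h1 : 1 ≤ η * m := by
      rw [div_le_iff₀ hη] at hM
      push_cast [hm]
      nlinarith
    push_cast
    nlinarith [(Nat.cast_nonneg s : (0 : ℝ) ≤ s)]
  · set τ := m * s with hτ'
    set B := (thresh (4 * (k + 1) * τ) k).2 with hB
    have hBle : 4 * B * τ + 1 ≤ 2 ^ s := by
      refine le_trans ?_ hs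
      have hα : 1 ≤ 4 * (k + 1) * τ := by nlinarith
      have := (hcg _ hα).2
      calc 4 * B * τ + 1 ≤ 4 * (c * (4 * (k + 1) * τ) ^ g) * τ + 1 := by gcongr
        _ = _ := by
          have e : 4 * (k + 1) * τ = 4 * (k + 1) * m * s := by rw [hτ']; ring
          rw [e, mul_pow _ s, hτ']
          ring
    set D := 2 ^ s - 1 with hD
    have hD1 : 1 ≤ D := by
      have : 2 ^ 1 ≤ 2 ^ s := Nat.pow_le_pow_right (by omega) hs1
      omega
    have hT : N < (N / τ + 1) * τ := by
      have := Nat.lt_div_mul_add (a := N) (b := τ) hτ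
      rw [add_mul, one_mul]; exact this
    have hp : p * (2 * τ) ≤ N := by
      have h3 : (k + 1) * (p * (4 * τ)) ≤ (k + 1) * (2 * N) := by nlinarith
      have h4 := Nat.le_of_mul_le_mul_left h3 (by omega)
      have h5 : p * (4 * τ) = 2 * (p * (2 * τ)) := by ring
      omega
    have hh : h * (2 * τ) ≤ D * N := by
      have h3 : h ≤ B * (2 * N) := by omega
      have h4 : 4 * B * τ ≤ D := by omega
      calc h * (2 * τ) ≤ B * (2 * N) * (2 * τ) := Nat.mul_le_mul_right _ h3
        _ = 4 * B * τ * N := by ring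
        _ ≤ D * N := Nat.mul_le_mul_right _ h4
    refine Nat.lt_of_mul_lt_mul_right (a := 2 * τ) ?_
    calc (p * D + h) * (2 * τ) = p * (2 * τ) * D + h * (2 * τ) := by ring
      _ ≤ N * D + D * N := Nat.add_le_add (Nat.mul_le_mul_right _ hp) hh
      _ = 2 * D * N := by ring
      _ < 2 * D * ((N / τ + 1) * τ) := by
        exact Nat.mul_lt_mul_of_pos_left hT (by omega)
      _ = _ := by ring

end Sparsify

/-! ### The running time and the contradiction to SETH -/

namespace Sparsify

open RealRAM SAT

/-- The factor 4 leaves room for two adjacent blocks of length `2 ^ q` within half a window, and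
only a factor of at most 8 is lost. -/
theorem log_div_four {w e q : ℕ} (hw : 8 ≤ w) (hwe : w ≤ 2 ^ e) (hq : q = Nat.log 2 (w / 4)) :
    4 * 2 ^ q ≤ w ∧ w ≤ 8 * 2 ^ q ∧ q < e := by
  have h1 : 2 ^ q ≤ w / 4 := by rw [hq]; exact Nat.pow_log_le_self 2 (by omega)
  have h2 : w / 4 < 2 ^ (q + 1) := by rw [hq]; exact Nat.lt_pow_succ_log_self (by omega) _
  rw [pow_succ] at h2
  refine ⟨by omega, by omega, ?_⟩
  by_contra hcon
  have h3 : 2 ^ e ≤ 2 ^ q := Nat.pow_le_pow_right (by omega) (not_lt.1 hcon)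
  have h4 : 0 < 2 ^ e := by positivity
  omega

/-- Without the saving, the rounds and the pairs of rows in one round make up about `2 ^ N`. The
factor `2 ^ (-ε e)` gains `ε N / a` in the exponent, and the advice gives back at most half of it,
up to `s`. The constant 5 collects 1 for the variable `q`, 3 for `w ≤ 8 * 2 ^ q`, and 1 for rounding
`N / a` down to `e`. -/
theorem search_time_le {ε D X : ℝ} {a N e q w τ₀ s T : ℕ} (hε : 0 < ε) (hε1 : ε < 1) (ha : 1 ≤ a)
    (he : e = N / a) (heq : e + q ≤ N) (hw : 1 ≤ w) (hwq : w ≤ 8 * 2 ^ q) (hτ : 1 ≤ τ₀)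
    (hT : T = N / τ₀ + 1) (hs : (s : ℝ) ≤ ε / (2 * a) * τ₀) (hD : 0 ≤ D)
    (hX : X ≤ D * (((2 ^ e : ℕ) : ℝ) * w) ^ (1 - ε)) :
    (2 : ℝ) ^ (T * s + (N - (e + q) + 1)) * X ≤
      D * 2 ^ (s + 5) * (2 : ℝ) ^ ((1 - ε / (2 * a)) * (N : ℝ)) := by
  have h2 : (0 : ℝ) < 2 := by norm_num
  have ha' : (1 : ℝ) ≤ a := by exact_mod_cast ha
  have hτ' : (1 : ℝ) ≤ τ₀ := by exact_mod_cast hτ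
  have hw1 : (1 : ℝ) ≤ w := by exact_mod_cast hw
  have hn : (0 : ℝ) < 2 ^ e := by positivity
  have h3 : (((2 ^ e : ℕ) : ℝ) * w) ^ (1 - ε) ≤ (2 : ℝ) ^ ((e : ℝ) + q + 3 - e * ε) := by
    push_cast
    have h4 : ((2 : ℝ) ^ e * w) ^ (1 - ε) = (2 : ℝ) ^ e * w * ((2 : ℝ) ^ e * w) ^ (-ε) := by
      rw [sub_eq_add_neg, Real.rpow_add (by positivity), Real.rpow_one]
    have h5 : ((2 : ℝ) ^ e * w) ^ (-ε) ≤ ((2 : ℝ) ^ e) ^ (-ε) :=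
      Real.rpow_le_rpow_of_nonpos hn (by nlinarith) (by linarith)
    have h6 : ((2 : ℝ) ^ e) ^ (-ε) = (2 : ℝ) ^ (-((e : ℝ) * ε)) := by
      rw [← Real.rpow_natCast, ← Real.rpow_mul h2.le]; ring_nf
    have h7 : (2 : ℝ) ^ e * w ≤ (2 : ℝ) ^ ((e : ℝ) + q + 3) := by
      have : (w : ℝ) ≤ 8 * 2 ^ q := by exact_mod_cast hwq
      calc (2 : ℝ) ^ e * w ≤ 2 ^ e * (8 * 2 ^ q) := by gcongr
        _ = 2 ^ (e + q + 3) := by rw [pow_add, pow_add]; ring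
        _ = _ := by rw [← Real.rpow_natCast]; push_cast; rfl
    rw [h4, sub_eq_add_neg, Real.rpow_add h2]
    rw [h6] at h5
    gcongr
  have h4 : (2 : ℝ) ^ (T * s + (N - (e + q) + 1)) =
      (2 : ℝ) ^ ((T : ℝ) * s + (N - (e + q) + 1)) := by
    rw [← Real.rpow_natCast]
    push_cast [heq]
    rfl
  have h5 : (T : ℝ) * s ≤ ε / (2 * a) * N + s := by
    have h6 : (T : ℝ) ≤ N / τ₀ + 1 := by
      rw [hT]; push_cast; gcongr; exact Nat.cast_div_le
    calc (T : ℝ) * s ≤ (N / τ₀ + 1) * s := by gcongr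
      _ = N / τ₀ * s + s := by ring
      _ ≤ N / τ₀ * (ε / (2 * a) * τ₀) + s := by gcongr
      _ = _ := by field_simp
  have h6 : (N : ℝ) / a ≤ e + 1 := by
    rw [div_le_iff₀ (by linarith)]
    have : N < (N / a + 1) * a := by
      have := Nat.lt_div_mul_add (a := N) (b := a) ha
      rw [add_mul, one_mul]; exact this
    rw [← he] at this
    exact_mod_cast this.le
  have h7 : (N : ℝ) / a * ε ≤ e * ε + 1 := by nlinarith
  have h8 : (N : ℝ) / a * ε = 2 * (ε / (2 * a) * N) := by field_simp
  calc (2 : ℝ) ^ (T * s + (N - (e + q) + 1)) * X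
      ≤ (2 : ℝ) ^ ((T : ℝ) * s + (N - (e + q) + 1)) *
        (D * (2 : ℝ) ^ ((e : ℝ) + q + 3 - e * ε)) := by
        rw [h4]
        gcongr
        exact hX.trans (by gcongr)
    _ = D * (2 : ℝ) ^ ((T : ℝ) * s + (N - (e + q) + 1) + ((e : ℝ) + q + 3 - e * ε)) := by
        rw [Real.rpow_add h2 ((T : ℝ) * s + (N - (e + q) + 1))]; ring
    _ ≤ D * (2 : ℝ) ^ (((s + 5 : ℕ) : ℝ) + (1 - ε / (2 * a)) * (N : ℝ)) := by
        refine mul_le_mul_of_nonneg_left (Real.rpow_le_rpow_of_exponent_le (by norm_num) ?_) hD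
        push_cast
        nlinarith
    _ = _ := by rw [Real.rpow_add h2, Real.rpow_natCast]; ring

/-- Since `a ≥ 2 b`, the power `n ^ b = 2 ^ (e b)` is at most `2 ^ (N / 2)`; this is why the number
of row bits is only a fraction of `N` that depends on the parameter programs. -/
theorem init_time_le {A b a e N t : ℕ} (ha : a = 2 * b + 2) (he : e = N / a)
    (ht : t ≤ A * (2 ^ e + 1) ^ b) : (t : ℝ) ≤ A * 2 ^ b * (2 : ℝ) ^ ((1 / 2 : ℝ) * N) := by
  have h1 : 2 * (e * b) ≤ N := by
    have := Nat.div_mul_le_self N a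
    rw [← he, ha] at this
    nlinarith
  have h2 : t ≤ A * (2 ^ b * 2 ^ (e * b)) := by
    refine ht.trans (Nat.mul_le_mul_left _ ?_)
    rw [pow_mul, ← mul_pow]
    refine Nat.pow_le_pow_left ?_ _
    have : 0 < 2 ^ e := by positivity
    omega
  have h3 : (2 : ℝ) ^ (e * b) ≤ (2 : ℝ) ^ ((1 / 2 : ℝ) * N) := by
    rw [← Real.rpow_natCast]
    refine Real.rpow_le_rpow_of_exponent_le (by norm_num) ?_
    have : (2 : ℝ) * (e * b : ℕ) ≤ N := by exact_mod_cast h1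
    linarith
  calc (t : ℝ) ≤ A * (2 ^ b * 2 ^ (e * b)) := by exact_mod_cast h2
    _ = A * 2 ^ b * 2 ^ (e * b) := by ring
    _ ≤ _ := by gcongr

/-- The requirements on `n` for the reduction. -/
structure Large (w dq dv : ℕ → ℕ) (Patt : Program) (μ ν ε C : ℝ) (c₀ K n : ℕ) : Prop where
  window_le : w n ≤ n
  cols_pos : 1 ≤ dv n
  window : 8 ≤ w n
  dim_le : dq n ≤ w n
  le_dim : K * Real.log n ≤ Real.log 2 * dq n
  gap : (c₀ : ℝ) + ν < (1 - μ) * n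
  attention : ∀ (Q : Matrix (Fin n) (Fin (dq n)) ℝ) (V : Matrix (Fin n) (Fin (dv n)) ℝ),
    ∃ t u, Exec Patt (SlidingWindow.input (w n) Q V) t u ∧ SlidingWindow.approx μ ν n (dv n)
      (SlidingWindow.attention (w n) Q V) (SlidingWindow.output n (dv n) u) ∧
      (t : ℝ) ≤ C * ((n : ℝ) * w n) ^ (1 - ε)
  output : ((n * dv n : ℕ) : ℝ) ≤ C * ((n : ℝ) * w n) ^ (1 - ε)

section

variable {w dq dv : ℕ → ℕ} {μ ν ε C : ℝ}

theorem eventually_large {Patt : Program} (hε : 0 < ε) (hμ : μ < 1)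
    (hwn : ∀ᶠ n in atTop, w n ≤ n) (hdv_pos : ∀ᶠ n in atTop, 1 ≤ dv n)
    (hdq_log : (fun n => Real.log (w n : ℝ)) =o[atTop] fun n => (dq n : ℝ))
    (hw_dq : (fun n => (dq n : ℝ)) =o[atTop] fun n => (w n : ℝ))
    (h : ∀ᶠ n in atTop, ∀ (Q : Matrix (Fin n) (Fin (dq n)) ℝ) (V : Matrix (Fin n) (Fin (dv n)) ℝ),
      ∃ t u, Exec Patt (SlidingWindow.input (w n) Q V) t u ∧ SlidingWindow.approx μ ν n (dv n)
        (SlidingWindow.attention (w n) Q V) (SlidingWindow.output n (dv n) u) ∧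
        (t : ℝ) ≤ C * ((n : ℝ) * w n) ^ (1 - ε)) (c₀ K : ℕ) :
    ∀ᶠ n in atTop, Large w dq dv Patt μ ν ε C c₀ K n := by
  have hout : ∀ᶠ n in atTop, ((n * dv n : ℕ) : ℝ) ≤ C * ((n : ℝ) * (w n : ℝ)) ^ (1 - ε) :=
    h.mono fun n hn => SlidingWindow.card_output_le hμ hn
  have hgap : ∀ᶠ n : ℕ in atTop, (c₀ : ℝ) + ν < (1 - μ) * n :=
    (tendsto_natCast_atTop_atTop.const_mul_atTop (by linarith : 0 < 1 - μ)).eventually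
      (eventually_gt_atTop _)
  have hlog2 : 0 < Real.log 2 := Real.log_pos (by norm_num)
  filter_upwards [hwn, hdv_pos, SlidingWindow.eventually_le_window hε hdv_pos hout 8,
    hw_dq.def one_pos, SlidingWindow.eventually_le_dim hε hdv_pos hout hdq_log (K / Real.log 2),
    hgap, h, hout] with n h1 h2 h3 h4 h5 h6 h7 h8
  refine ⟨h1, h2, h3, ?_, ?_, h6, h7, h8⟩
  · simpa using h4
  · rw [div_mul_eq_mul_div, div_le_iff₀ hlog2] at h5
    linarith

/-- The output bound also yields `d_v ≤ C w`, so that `d_v`, like the other parameters, has a bit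
length polynomial in the size of the formula. -/
theorem Large.one_le_rpow {Patt : Program} {c₀ K n : ℕ} (h : Large w dq dv Patt μ ν ε C c₀ K n)
    (hε : 0 < ε) (hε1 : ε < 1) : 1 ≤ ((n : ℝ) * w n) ^ (1 - ε) ∧ 0 ≤ C ∧
      (n : ℝ) ≤ C * ((n : ℝ) * w n) ^ (1 - ε) ∧ (dv n : ℝ) ≤ C * w n := by
  have hw := h.window
  have hwn := h.window_le
  have hd := h.cols_pos
  have hn1 : (1 : ℝ) ≤ n := by exact_mod_cast (by omega : 1 ≤ n)
  have hw1 : (1 : ℝ) ≤ w n := by exact_mod_cast (by omega : 1 ≤ w n)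
  have hd1 : (1 : ℝ) ≤ dv n := by exact_mod_cast hd
  have hnw : (1 : ℝ) ≤ (n : ℝ) * w n := by nlinarith
  have ho := h.output
  push_cast at ho
  have h1 : 1 ≤ ((n : ℝ) * w n) ^ (1 - ε) := Real.one_le_rpow hnw (by linarith)
  have hC : 0 ≤ C := by
    by_contra hcon
    nlinarith
  have hn2 : (n : ℝ) ≤ n * dv n := by nlinarith
  refine ⟨h1, hC, hn2.trans ho, ?_⟩
  have h2 : ((n : ℝ) * w n) ^ (1 - ε) ≤ (n : ℝ) * w n := by
    calc ((n : ℝ) * w n) ^ (1 - ε) ≤ ((n : ℝ) * w n) ^ (1 : ℝ) :=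
          Real.rpow_le_rpow_of_exponent_le hnw (by linarith)
      _ = _ := Real.rpow_one _
  have h3 : (n : ℝ) * dv n ≤ n * (C * w n) := by
    calc (n : ℝ) * dv n ≤ C * ((n : ℝ) * w n) := ho.trans (by gcongr)
      _ = _ := by ring
  exact le_of_mul_le_mul_left h3 (by linarith)

/-- An upper bound for all numbers and logarithms of numbers that occur. -/
def sizeBound (c k N₀ s Z x : ℕ) : ℕ :=
  (x + 2) ^ c + (k + 1) * ((k + 1) * (2 * (x + N₀) + 1) ^ k) + (x + N₀ + 1) * (2 ^ s + s + 1) + Z + 2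

theorem polyBd_sizeBound (c k N₀ s Z : ℕ) : Expr.PolyBd (sizeBound c k N₀ s Z) := by
  have hpow : ∀ c : ℕ, Expr.PolyBd fun V => (V + 2) ^ c := fun c => ⟨c, fun _ => le_rfl⟩
  have hx : Expr.PolyBd fun x => x + N₀ := Expr.PolyBd.id.add (.const N₀)
  have hk : Expr.PolyBd fun x => (2 * (x + N₀) + 1) ^ k :=
    ((hpow k).comp ((Expr.PolyBd.const 2).mul hx)).mono fun x => Nat.pow_le_pow_left (by omega) _
  exact (((((hpow c).add ((Expr.PolyBd.const (k + 1)).mul ((Expr.PolyBd.const (k + 1)).mul hk))).add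
    ((hx.add (.const 1)).mul (.const (2 ^ s + s + 1)))).add (.const Z)).add (.const 2))

theorem le_sizeBound {c k N₀ s Z x N T : ℕ} (hN : N ≤ x + N₀) (hT : T ≤ N + 1) :
    (x + 2) ^ c ≤ sizeBound c k N₀ s Z x ∧ violBound k (2 * N) ≤ sizeBound c k N₀ s Z x ∧
    T * 2 ^ s ≤ sizeBound c k N₀ s Z x ∧ T * s + (N + 1) ≤ sizeBound c k N₀ s Z x ∧
    Z + N ≤ sizeBound c k N₀ s Z x ∧ 1 ≤ sizeBound c k N₀ s Z x := by
  have h1 : violBound k (2 * N) ≤ (k + 1) * ((k + 1) * (2 * (x + N₀) + 1) ^ k) := by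
    unfold violBound
    gcongr
  have h2 : T * (2 ^ s + s) ≤ (x + N₀ + 1) * (2 ^ s + s) := Nat.mul_le_mul_right _ (by omega)
  have h3 : (x + N₀ + 1) * (2 ^ s + s + 1) = (x + N₀ + 1) * (2 ^ s + s) + (x + N₀ + 1) := by ring
  rw [mul_add] at h2
  unfold sizeBound
  refine ⟨?_, ?_, ?_, ?_, ?_, ?_⟩ <;> omega

/-- From `N < (e + 1) a ≤ 2 e a` the number `1 + 2 N B` of clauses is at most `(1 + 4 a B) e`, a
constant times the binary logarithm of `n = 2 ^ e`. -/
theorem le_dim_of_log {a e N B d : ℕ} (he : 1 ≤ e) (hN : N < (e + 1) * a)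
    (h : (1 + 4 * (a : ℝ) * B) * Real.log (2 ^ e) ≤ Real.log 2 * d) : 1 + 2 * N * B ≤ d := by
  have hlog2 : 0 < Real.log 2 := Real.log_pos (by norm_num)
  rw [Real.log_pow] at h
  have h2 : (1 + 4 * (a : ℝ) * B) * e ≤ d := le_of_mul_le_mul_left (by linarith) hlog2
  have h3 : (1 + 4 * a * B) * e ≤ d := by exact_mod_cast h2
  have h5 : (e + 1) * a ≤ 2 * e * a := Nat.mul_le_mul_right _ (by omega)
  have h4 : 2 * N * B ≤ 2 * (2 * e * a) * B := Nat.mul_le_mul_right _ (by omega)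
  calc 1 + 2 * N * B ≤ e + 2 * (2 * e * a) * B := by omega
    _ = (1 + 4 * a * B) * e := by ring
    _ ≤ d := h3

/-- The saving depends on `ε` and on the exponent `b` of the parameter programs, but not on `k`, as
the contradiction to SETH requires. The minimum with `1 / 2` accounts for the initialization. -/
theorem solvableInTime {Patt Pw Pq Pv : Program} (hε : 0 < ε) (hε1 : ε < 1) (hμ0 : 0 ≤ μ)
    (hμ : μ < 1) {A b : ℕ}
    (hP : ∀ n, ∃ tw tq tv uw uq uv,
      Exec Pw { State.blank with natReg := fun r => if r = 0 then n else 0 } tw uw ∧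
      Exec Pq { State.blank with natReg := fun r => if r = 0 then n else 0 } tq uq ∧
      Exec Pv { State.blank with natReg := fun r => if r = 0 then n else 0 } tv uv ∧
      uw.natReg 0 = w n ∧ uq.natReg 0 = dq n ∧ uv.natReg 0 = dv n ∧
      tw + tq + tv ≤ A * (n + 1) ^ b)
    (hlarge : ∀ c₀ K : ℕ, ∀ᶠ n in atTop, Large w dq dv Patt μ ν ε C c₀ K n) (k : ℕ) :
    SolvableInTime k (min (ε / (2 * (2 * b + 2 : ℕ))) (1 / 2)) := by
  set a := 2 * b + 2 with ha
  set ε' : ℝ := min (ε / (2 * (a : ℕ))) (1 / 2) with hε'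
  have ha0 : (0 : ℝ) < a := by rw [ha]; positivity
  obtain ⟨α, τ₀, s, hτ₀, hs1, hs, hadv⟩ := exists_params k (η := ε / (2 * a)) (by positivity)
  obtain ⟨c₀, hc₀⟩ := exists_nat_ge (4 + ν)
  obtain ⟨e₀, he₀⟩ := eventually_atTop.1 (hlarge c₀ (1 + 4 * a * sparseBound α k))
  obtain ⟨Z, hZ⟩ := exists_nat_ge C
  -- So many dummy variables give `e > e₀` for every formula, hence `n = 2 ^ e` is beyond the point
  -- from which `Large` holds.
  set N₀ := a * (e₀ + 1) with hN₀
  obtain ⟨P, Cp, c, hPr⟩ := exists_search Patt Pw Pq Pv k N₀ a τ₀ s c₀ α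
  obtain ⟨E, hE⟩ := Expr.PolyBd.comp (f := fun V => (V + 2) ^ Cp) ⟨Cp, fun _ => le_rfl⟩
    (polyBd_sizeBound c k N₀ s Z)
  -- The factor `2 * C + 1` comes from `n + τ + 1 ≤ (2 * C + 1) (n w)^(1-ε)`, the factor `2 ^ E`
  -- from passing from `size φ + 2` to `size φ + 1`, and `2 ^ N₀` from the dummy variables.
  refine ⟨P, ((2 * C + 1) * 2 ^ (s + 5) * 2 ^ E + 16 * (A * 2 ^ b)) * 2 ^ N₀, E, fun Nφ φ hφ => ?_⟩
  set N := Nφ + N₀ with hN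
  set e := N / a with he
  set n := 2 ^ e with hn
  have hapos : 0 < a := by omega
  have hee : e₀ + 1 ≤ e := by
    rw [he, Nat.le_div_iff_mul_le hapos, mul_comm]
    omega
  have haN : e * a ≤ N := Nat.div_mul_le_self N a
  have h2e : e * 2 ≤ e * a := Nat.mul_le_mul_left _ (by omega)
  have hNe : N < (e + 1) * a := by
    have := Nat.lt_div_mul_add (a := N) (b := a) hapos
    rw [add_mul, one_mul]; exact this
  have hen : e < n := Nat.lt_two_pow_self
  have hl := he₀ n (by omega)
  obtain ⟨hrp, hC, hnC, hdvC⟩ := hl.one_le_rpow hε hε1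
  have hwn := hl.window_le
  set q := Nat.log 2 (w n / 4) with hq
  obtain ⟨hqw, hwq, hqe⟩ := log_div_four hl.window hwn hq
  set T := N / τ₀ + 1 with hT
  set len := T * s + (N - (e + q) + 1) with hlen
  set V := sizeBound c k N₀ s Z (size φ) with hV
  have hNs : N ≤ size φ + N₀ := by simp only [hN, size]; omega
  obtain ⟨v1, v2, v3, v4, v5, v6⟩ := le_sizeBound (c := c) (k := k) (s := s) (Z := Z) hNs
    (T := T) (by rw [hT]; exact Nat.succ_le_succ (Nat.div_le_self _ _))
  rw [← hV] at v1 v2 v3 v4 v5 v6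
  have hlenV : len ≤ V := by omega
  have hnV : n ≤ 2 ^ V := Nat.pow_le_pow_right (by omega) (by omega)
  have hdvV : dv n ≤ 2 ^ V := by
    have h1 : (dv n : ℝ) ≤ 2 ^ (Z + e) := by
      have h2 : (Z : ℝ) ≤ 2 ^ Z := by exact_mod_cast Nat.lt_two_pow_self.le
      have h3 : (w n : ℝ) ≤ 2 ^ e := by exact_mod_cast hwn
      calc (dv n : ℝ) ≤ C * w n := hdvC
        _ ≤ 2 ^ Z * 2 ^ e := by gcongr; exact hZ.trans h2
        _ = _ := (pow_add _ _ _).symm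
    have h2 : dv n ≤ 2 ^ (Z + e) := by exact_mod_cast h1
    exact h2.trans (Nat.pow_le_pow_right (by omega) (by omega))
  set τ := ⌊C * ((n : ℝ) * w n) ^ (1 - ε)⌋₊ with hτ
  have hτC : (τ : ℝ) ≤ C * ((n : ℝ) * w n) ^ (1 - ε) := Nat.floor_le (by positivity)
  obtain ⟨tw, tq, tv, uw, uq, uv, x1, x2, x3, y1, y2, y3, ht⟩ := hP n
  set p : Search := {
    R := 2 ^ len, n := n, w := w n, d := dq n, m := dv n, c₀ := c₀, K := max Patt.bound 4, V := V
    r₀ := 0, k := k, α := α, s := s, T := T, N := N, e := e, q := q, len := len } with hp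
  have hfit : p.Fits a τ₀ := ⟨⟨hqe, rfl, rfl, v2, Nat.pow_le_pow_right (by omega) hlenV, hnV,
    hwn.trans hnV, (hl.dim_le.trans hwn).trans hnV, hdvV, hl.cols_pos, v6⟩, rfl, rfl, rfl, rfl, rfl,
    v3, show T * s ≤ V by omega, hlenV⟩
  have hdim : 1 + 2 * N * sparseBound α k ≤ dq n := by
    have h1 := hl.le_dim
    rw [hn] at h1
    push_cast at h1
    exact le_dim_of_log (by omega) hNe h1
  obtain ⟨t, st, hex, htle, hans⟩ := hPr p Nφ φ tw tq tv uw uq uv μ ν τ hφ rfl rfl rfl rfl rfl rfl v1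
    hfit x1 x2 x3 y1 y2 y3 hμ0 hμ hc₀ hl.gap
    (fun Q V => by
      obtain ⟨t, u, h1, h2, h3⟩ := hl.attention Q V
      exact ⟨t, u, h1, h2, Nat.le_floor h3⟩)
    (fun hsat => by
      obtain ⟨r, hr, h⟩ := exists_rows (N := N) (L := 2 * N) (T := T) (e := e) (q := q) (w := w n)
        (d := dq n) hφ (by omega) rfl hs1 hqe hqw hdim (hadv N) hsat
      exact ⟨r, hr, h⟩)
  refine ⟨t, st, hex, hans, ?_⟩
  have hX : ((n + τ + 1 : ℕ) : ℝ) ≤ (2 * C + 1) * ((n : ℝ) * w n) ^ (1 - ε) := by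
    push_cast
    linarith
  have hmain := search_time_le hε hε1 hapos he (by omega) (by linarith [hl.window]) hwq hτ₀ hT hs
    (by linarith : 0 ≤ 2 * C + 1) hX
  have hinit := init_time_le (t := tw + tq + tv) ha he ht
  have hexp : ∀ δ : ℝ, ε' ≤ δ → 0 ≤ δ →
      (2 : ℝ) ^ ((1 - δ) * (N : ℝ)) ≤ 2 ^ N₀ * 2 ^ ((1 - ε') * (Nφ : ℝ)) := by
    intro δ hδ hδ0
    rw [← Real.rpow_natCast, ← Real.rpow_add (by norm_num)]
    refine Real.rpow_le_rpow_of_exponent_le (by norm_num) ?_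
    rw [hN]
    push_cast
    nlinarith [(Nat.cast_nonneg Nφ : (0 : ℝ) ≤ Nφ), (Nat.cast_nonneg N₀ : (0 : ℝ) ≤ N₀)]
  have hmain' := hexp (ε / (2 * a)) (min_le_left _ _) (by positivity)
  have hinit' := hexp (1 / 2) (min_le_right _ _) (by norm_num)
  rw [show (1 - 1 / 2 : ℝ) = 1 / 2 by norm_num] at hinit'
  have hx1 : (1 : ℝ) ≤ (size φ + 1 : ℝ) ^ E := one_le_pow₀ (by linarith [(Nat.cast_nonneg
    (size φ) : (0 : ℝ) ≤ size φ)])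
  have hpoly : (((V + 2) ^ Cp : ℕ) : ℝ) ≤ 2 ^ E * (size φ + 1 : ℝ) ^ E := by
    have h1 : (V + 2) ^ Cp ≤ (2 * (size φ + 1)) ^ E :=
      (hE (size φ)).trans (Nat.pow_le_pow_left (by omega) _)
    rw [mul_pow] at h1
    exact_mod_cast h1
  have htle' : (t : ℝ) ≤ (2 : ℝ) ^ len * ((n + τ + 1 : ℕ) : ℝ) * (((V + 2) ^ Cp : ℕ) : ℝ) +
      16 * ((tw + tq + tv : ℕ) : ℝ) := by exact_mod_cast htle
  set Y := (2 : ℝ) ^ ((1 - ε') * (Nφ : ℝ)) with hY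
  have hY0 : 0 < Y := by positivity
  calc (t : ℝ) ≤ (2 : ℝ) ^ len * ((n + τ + 1 : ℕ) : ℝ) * (((V + 2) ^ Cp : ℕ) : ℝ) +
      16 * ((tw + tq + tv : ℕ) : ℝ) := htle'
    _ ≤ (2 * C + 1) * 2 ^ (s + 5) * (2 ^ N₀ * Y) * (2 ^ E * (size φ + 1 : ℝ) ^ E) +
        16 * (A * 2 ^ b * (2 ^ N₀ * Y)) * (size φ + 1 : ℝ) ^ E := by
      refine add_le_add (mul_le_mul (hmain.trans ?_) hpoly (by positivity) (by positivity)) ?_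
      · exact mul_le_mul_of_nonneg_left hmain' (by positivity)
      · refine le_trans ?_ (le_mul_of_one_le_right (by positivity) hx1)
        refine mul_le_mul_of_nonneg_left (hinit.trans ?_) (by norm_num)
        exact mul_le_mul_of_nonneg_left hinit' (by positivity)
    _ = _ := by ring

theorem not_computableInTime (hSETH : SETH) (hw : PolyTimeComputable w)
    (hdq : PolyTimeComputable dq) (hdv : PolyTimeComputable dv)
    (hwn : ∀ᶠ n in atTop, w n ≤ n) (hdv_pos : ∀ᶠ n in atTop, 1 ≤ dv n)
    (hdq_log : (fun n => Real.log (w n : ℝ)) =o[atTop] fun n => (dq n : ℝ))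
    (hw_dq : (fun n => (dq n : ℝ)) =o[atTop] fun n => (w n : ℝ)) (hε : 0 < ε) (hμ0 : 0 ≤ μ)
    (hμ : μ < 1) :
    ¬ SlidingWindow.ComputableInTime w dq dv (SlidingWindow.approx μ ν)
      (fun n => ((n : ℝ) * (w n : ℝ)) ^ (1 - ε)) := by
  rintro ⟨Patt, C, h⟩
  have hε1 := SlidingWindow.lt_one_of_output hdv_pos
    (h.mono fun n hn => SlidingWindow.card_output_le hμ hn)
  obtain ⟨Pw, Aw, bw, hw⟩ := hw
  obtain ⟨Pq, Aq, bq, hq⟩ := hdq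
  obtain ⟨Pv, Av, bv, hv⟩ := hdv
  obtain ⟨k, hk⟩ := hSETH (min (ε / (2 * (2 * (bw + bq + bv) + 2 : ℕ))) (1 / 2)) (by positivity)
  refine hk (solvableInTime (Patt := Patt) (Pw := Pw) (Pq := Pq) (Pv := Pv) (A := Aw + Aq + Av)
    (w := w) (dq := dq) (dv := dv) (C := C) (μ := μ) (ν := ν) hε hε1 hμ0 hμ (fun n => ?_)
    (eventually_large hε hμ hwn hdv_pos hdq_log hw_dq h) k)
  obtain ⟨tw, uw, x1, y1, z1⟩ := hw n
  obtain ⟨tq, uq, x2, y2, z2⟩ := hq n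
  obtain ⟨tv, uv, x3, y3, z3⟩ := hv n
  refine ⟨tw, tq, tv, uw, uq, uv, x1, x2, x3, y1, y2, y3, ?_⟩
  have hle : ∀ {c}, c ≤ bw + bq + bv → (n + 1) ^ c ≤ (n + 1) ^ (bw + bq + bv) := fun h =>
    Nat.pow_le_pow_right (by omega) h
  calc tw + tq + tv ≤ Aw * (n + 1) ^ (bw + bq + bv) + Aq * (n + 1) ^ (bw + bq + bv) +
      Av * (n + 1) ^ (bw + bq + bv) :=
        Nat.add_le_add (Nat.add_le_add (z1.trans (Nat.mul_le_mul_left _ (hle (by omega))))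
          (z2.trans (Nat.mul_le_mul_left _ (hle (by omega)))))
          (z3.trans (Nat.mul_le_mul_left _ (hle (by omega))))
    _ = _ := by ring

end

end Sparsify

theorem mainTheorem3 (hSETH : SETH) (w dq dv : ℕ → ℕ)
    (hw : RealRAM.PolyTimeComputable w) (hdq : RealRAM.PolyTimeComputable dq)
    (hdv : RealRAM.PolyTimeComputable dv)
    (hwn : ∀ᶠ n in atTop, w n ≤ n) (hdv_pos : ∀ᶠ n in atTop, 1 ≤ dv n)
    (hdq_log : (fun n => Real.log (w n : ℝ)) =o[atTop] fun n => (dq n : ℝ))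
    (hw_dq : (fun n => (dq n : ℝ)) =o[atTop] fun n => (w n : ℝ))
    (ε : ℝ) (hε : 0 < ε) :
    ¬ SlidingWindow.ComputableInTime w dq dv SlidingWindow.exact
        (fun n => ((n : ℝ) * (w n : ℝ)) ^ (1 - ε)) ∧
    (∀ μ : ℝ, 0 ≤ μ → μ < 1 →
      ¬ SlidingWindow.ComputableInTime w dq dv (SlidingWindow.multiplicative μ)
        (fun n => ((n : ℝ) * (w n : ℝ)) ^ (1 - ε))) ∧
    (∀ μ : ℝ, 0 ≤ μ →
      ¬ SlidingWindow.ComputableInTime w dq dv (SlidingWindow.additive μ)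
        (fun n => ((n : ℝ) * (w n : ℝ)) ^ (1 - ε))) := by
  -- The three guarantees imply `approx` with the errors `(0, 0)`, `(μ, 0)` and `(0, ν)`.
  refine ⟨fun h => ?_, fun μ hμ0 hμ h => ?_, fun ν _ h => ?_⟩
  · refine Sparsify.not_computableInTime (μ := 0) (ν := 0) hSETH hw hdq hdv hwn hdv_pos hdq_log
      hw_dq hε le_rfl zero_lt_one (h.mono fun n m Y Y' hY i j => ?_)
    rw [show Y' = Y from hY]
    simp
  · refine Sparsify.not_computableInTime (μ := μ) (ν := 0) hSETH hw hdq hdv hwn hdv_pos hdq_log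
      hw_dq hε hμ0 hμ (h.mono fun n m Y Y' hY i j => ?_)
    rw [add_zero]
    exact hY i j
  · refine Sparsify.not_computableInTime (μ := 0) (ν := ν) hSETH hw hdq hdv hwn hdv_pos hdq_log
      hw_dq hε le_rfl zero_lt_one (h.mono fun n m Y Y' hY i j => ?_)
    rw [zero_mul, zero_add]
    exact hY i j
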